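/- **Setting.** For each sample size $n\ge1$ let $y=X\beta+\epsilon$, where $X=(x_{ij})$ is a fixed $n\times p$ matrix with thin singular value decomposition $X=P\Lambda Q^T$ ($P^TP=Q^TQ=QQ^T=I_p$, $\Lambda=\mathrm{diag}(\lambda_1,\dots,\lambda_p)$), $\beta\in\mathbf R^p$, $M=(m_{ij})$ is a fixed $p_1\times p$ matrix and $\gamma=M\beta$. All these objects, the ridge parameter $\rho_n\in\mathbf R$, the threshold $b_n$ and the bandwidth $k_n$ may depend on $n$. The errors are $\epsilon_i=g_i(\dots,e_{i-1},e_i)$, $i=1,\dots,n$, with measurable $g_i$ and independent (not necessarily identically distributed) real random variables $e_i$, $i\in\mathbf Z$; let $(e_i^\dagger)_{i\in\mathbf Z}$ be independent, independent of $(e_i)$, with $e_i^\dagger\sim e_i$; let $\epsilon_{i,j}$ be $\epsilon_i$ with $e_{i-j}$ replaced by $e^\dagger_{i-j}$, $\|Z\|_m=(\mathbf E|Z|^m)^{1/m}$, $\delta_{i,j,m}=\|\epsilon_i-\epsilon_{i,j}\|_m$, and $\Sigma=(\mathbf E\epsilon_i\epsilon_j)_{i,j}$. Put $$w_j=\frac{\lambda_j}{\lambda_j^2+\rho_n}+\frac{\rho_n\lambda_j}{(\lambda_j^2+\rho_n)^2},\quad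 \mathcal N=\{k:|\beta_k|>b_n\},\quad c_{ij}=\sum_{k\in\mathcal N}m_{ik}q_{kj},\quad \tau_i=\Big(\frac1n+\sum_j c_{ij}^2w_j^2\Big)^{1/2},$$ $\mathcal M=\{i:\sum_jc_{ij}^2>0\}$, and, for a Gaussian vector $\xi\sim N(0,\Sigma)$, $$H(x)=\mathrm{Prob}\Big(\max_{i\in\mathcal M}\frac1{\tau_i}\Big|\sum_{j=1}^p\sum_{l=1}^n c_{ij}w_jp_{lj}\xi_l\Big|\le x\Big).$$ **Estimators.** $\tilde\beta^\star=(X^TX+\rho_nI_p)^{-1}X^Ty$, $\tilde\beta=\tilde\beta^\star+\rho_nQ(\Lambda^2+\rho_nI_p)^{-1}Q^T\tilde\beta^\star$, $\hat{\mathcal N}=\{k:|\tilde\beta_k|>b_n\}$, $\hat\beta_k=\tilde\beta_k\mathbf 1_{k\in\hat{\mathcal N}}$, $\hat\gamma=M\hat\beta$, $\hat\epsilon=y-X\hat\beta$, and $\hat\tau_i$ is $\tau_i$ with $\mathcal N$ replaced by $\hat{\mathcal N}$. **Bootstrap.** Let $\varepsilon^*=(\varepsilon^*_1,\dots,\varepsilon^*_n)$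 be Gaussian with mean $0$ and covariance matrix $(K((i-j)/k_n))_{i,j}$, independent of $y$; let $y^*=X\hat\beta+\epsilon^*$ with $\epsilon^*_i=\hat\epsilon_i\varepsilon^*_i$, and let $\hat\gamma^*,\hat\tau^*_i$ be computed from $y^*$ as $\hat\gamma,\hat\tau_i$ are from $y$. Write $\mathrm{Prob}^*(\cdot)=\mathrm{Prob}(\cdot\mid y)$ and, for $0<\alpha<1$, $$c^*_{1-\alpha}=\inf\Big\{x\in\mathbf R:\mathrm{Prob}^*\Big(\max_{i}\frac{|\hat\gamma^*_i-\hat\gamma_i|}{\hat\tau^*_i}\le x\Big)\ge1-\alpha\Big\}.$$ **Assumptions** (constants do not depend on $n$; $O$, $o$ refer to $n\to\infty$). 1. $\mathrm{rank}\,X=p\le n$; there are $C_\lambda,c_\lambda>0$ and $0<\eta\le\frac12$ with $C_\lambda n^{1/2}\ge\lambda_1\ge\dots\ge\lambda_p\ge c_\lambda n^\eta$ for all $n$; $\max_{i,j}|x_{ij}|=O(1)$; $p_1=O(1)$. 2. $\mathbf E\epsilon_i=0$; there are $m>3/\eta$ and $\alpha_\epsilon>1$ with $\sup_{k\ge0}(k+1)^{\alpha_\epsilon}\sum_{j\ge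 k}\max_{i\le n}\delta_{i,j,m}=O(1)$ and $\max_{i\le n}\|\epsilon_i\|_m=O(1)$; for some $c_\Sigma>0$ all eigenvalues of $\Sigma$ exceed $c_\Sigma$ for all $n$. 3. $\|\beta\|_2=O(n^{\alpha_\beta})$ with $0\le\alpha_\beta<3\eta$, and $|\mathcal N|=o(n^{\eta-1/m})$. 4. $\rho_n=O(n^{2\eta-\delta})$ with $\frac{\eta+\alpha_\beta}2<\delta<2\eta$; $b_n=C_bn^{-\nu_b}$ with $C_b>0$, $0<\nu_b<\eta-\frac3m$; for some $0<c_b<1$ and all $n$, $|\beta_i|\le c_bb_n$ for $i\notin\mathcal N$ and $|\beta_i|\ge b_n/c_b$ for $i\in\mathcal N$. 5. $\mathcal M\ne\emptyset$; there are $0<c_{\mathcal M}\le C_{\mathcal M}<\infty$ with $c_{\mathcal M}\le\sum_{k\in\mathcal N}m_{ik}^2\le C_{\mathcal M}$ for all $i\in\mathcal M$ and all $n$; $\max_{i\le p_1}|\sum_{j\notin\mathcal N}m_{ij}\beta_j|=o(n^{-1/2})$ and $\max_{i\le n}|\sum_{j\notin\mathcal N}x_{ij}\beta_j|=o(n^{(1/m-\eta)/2})$.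 6. $(c_{ij})_{i\in\mathcal M,\,j\le p}$ has rank $|\mathcal M|$, and $\max_{i\in\mathcal M,\,l\le n}\frac1{\tau_i}|\sum_jc_{ij}p_{lj}w_j|=o(n^{-1/4}\log^{-\zeta}n)$ with $\zeta=\max\big(\frac92,\frac{3\alpha_\epsilon}{2\alpha_\epsilon-2}\big)$. 7. $K:\mathbf R\to[0,\infty)$ is symmetric, continuously differentiable, integrable, nonincreasing on $[0,\infty)$, with $K(0)=1$; its Fourier transform $\mathcal FK(x)=\int K(t)e^{-2\pi itx}\,dt$ is nonnegative and integrable; $k_n\to\infty$, $k_n=o(n^{2\eta-2\nu_b-4/m})$ and $k_n=O(n^{\eta/2-3/(2m)})$. **Theorem.** Under Assumptions 1–7, as $n\to\infty$, $$\sup_{x\in\mathbf R}\Big|\mathrm{Prob}^*\Big(\max_{i\le p_1}\frac{|\hat\gamma^*_i-\hat\gamma_i|}{\hat\tau^*_i}\le x\Big)-H(x)\Big|\to0\quad\text{in probability},$$ and for every $0<\alpha<1$ $$\mathrm{Prob}\Big(\max_{i\le p_1}\frac{|\hat\gamma_i-\gamma_i|}{\hat\tau_i}\le c^*_{1-\alpha}\Big)\to1-\alpha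 .$$ Equivalently, the test of the null hypothesis $M\beta=z$ that rejects when $\max_i|\hat\gamma_i-z_i|/\hat\tau_i>c^*_{1-\alpha}$ has, under the null hypothesis (for all $n$), rejection probability tending to $\alpha$. -/

import Mathlib

open MeasureTheory ProbabilityTheory Filter Asymptotics Topology
open scoped ENNReal Matrix

namespace RidgeBootstrap

noncomputable section

/-- The nonrandom data of the linear model at sample size `n`: a fixed design matrix `X` with a thin
singular value decomposition `X = P Λ Qᵀ`, `Λ = diag lam`, the matrix `M` of linear combinations,
the parameter `β`, the ridge parameter `ρ` and the threshold `b`. -/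
structure Setting (n : ℕ) where
  p : ℕ
  p₁ : ℕ
  X : Matrix (Fin n) (Fin p) ℝ
  P : Matrix (Fin n) (Fin p) ℝ
  lam : Fin p → ℝ
  Q : Matrix (Fin p) (Fin p) ℝ
  X_eq : X = P * Matrix.diagonal lam * Qᵀ
  P_orthonormal : Pᵀ * P = 1
  Q_orthonormal : Qᵀ * Q = 1
  Q_orthonormal_rows : Q * Qᵀ = 1
  M : Matrix (Fin p₁) (Fin p) ℝ
  β : Fin p → ℝ
  ρ : ℝ
  b : ℝ

namespace Setting

variable {n : ℕ} (S : Setting n)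

/-- `γ = M β`. -/
def γ : Fin S.p₁ → ℝ := S.M *ᵥ S.β

/-- The indices whose coordinate exceeds the threshold in absolute value. -/
def active (v : Fin S.p → ℝ) : Finset (Fin S.p) := {i | S.b < |v i|}

/-- `𝒩_b`. -/
def N : Finset (Fin S.p) := S.active S.β

/-- `λ_j / (λ_j² + ρ) + ρ λ_j / (λ_j² + ρ)²`. -/
def weight (j : Fin S.p) : ℝ :=
  S.lam j / (S.lam j ^ 2 + S.ρ) + S.ρ * S.lam j / (S.lam j ^ 2 + S.ρ) ^ 2

/-- `∑_{k ∈ A} m_{ik} q_{kj}`; it is `c_{ij}` for `A = 𝒩_b`. -/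
def coef (A : Finset (Fin S.p)) (i : Fin S.p₁) (j : Fin S.p) : ℝ :=
  ∑ k ∈ A, S.M i k * S.Q k j

/-- The normalizing constant computed from the index set `A`; it is `τ_i` for `A = 𝒩_b`. -/
def scale (A : Finset (Fin S.p)) (i : Fin S.p₁) : ℝ :=
  √(1 / (n : ℝ) + ∑ j, S.coef A i j ^ 2 * S.weight j ^ 2)

/-- `c_{ij}`. -/
def c (i : Fin S.p₁) (j : Fin S.p) : ℝ := S.coef S.N i j

/-- `τ_i`. -/
def τ (i : Fin S.p₁) : ℝ := S.scale S.N i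

/-- The set `ℳ` of rows with `∑_j c_{ij}² > 0`. -/
def Mset : Set (Fin S.p₁) := {i | 0 < ∑ j, S.c i j ^ 2}

/-- `c* = max_{i ∈ ℳ, l} (1 / τ_i) |∑_j c_{ij} p_{lj} (weight j)|`. -/
def cStar : ℝ :=
  ⨆ q : S.Mset × Fin n, 1 / S.τ q.1 * |∑ j, S.c q.1 j * S.P q.2 j * S.weight j|

/-- The Gaussian distribution function
`H(x) = Prob (max_{i ∈ ℳ} (1 / τ_i) |∑_j ∑_l c_{ij} (weight j) p_{lj} ξ_l| ≤ x)`, `ξ ∼ N(0, V)`. -/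
def H (V : Matrix (Fin n) (Fin n) ℝ) (x : ℝ) : ℝ :=
  (multivariateGaussian 0 V).real
    {ξ : EuclideanSpace ℝ (Fin n) |
      (⨆ i : S.Mset, 1 / S.τ i * |∑ j, ∑ l, S.c i j * S.weight j * S.P l j * ξ l|) ≤ x}

/-- The ridge regression estimator `(XᵀX + ρ I)⁻¹ Xᵀ y`. -/
def ridge (y : Fin n → ℝ) : Fin S.p → ℝ :=
  (S.Xᵀ * S.X + S.ρ • (1 : Matrix (Fin S.p) (Fin S.p) ℝ))⁻¹ *ᵥ (S.Xᵀ *ᵥ y)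

/-- The de-biased ridge estimator `β~ = β~⋆ + ρ Q (Λ² + ρ I)⁻¹ Qᵀ β~⋆`. -/
def debiased (y : Fin n → ℝ) : Fin S.p → ℝ :=
  S.ridge y + S.ρ •
    ((S.Q * (Matrix.diagonal S.lam ^ 2 + S.ρ • (1 : Matrix (Fin S.p) (Fin S.p) ℝ))⁻¹ * S.Qᵀ) *ᵥ
      S.ridge y)

/-- The selected index set of the data `y`. -/
def NHat (y : Fin n → ℝ) : Finset (Fin S.p) := S.active (S.debiased y)

/-- The de-biased and thresholded ridge estimator of `β`. -/
def βHat (y : Fin n → ℝ) (i : Fin S.p) : ℝ :=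
  if i ∈ S.NHat y then S.debiased y i else 0

/-- The estimator of `γ`. -/
def γHat (y : Fin n → ℝ) : Fin S.p₁ → ℝ := S.M *ᵥ S.βHat y

/-- The estimated normalizing constant. -/
def τHat (y : Fin n → ℝ) (i : Fin S.p₁) : ℝ := S.scale (S.NHat y) i

/-- `max_i |γHat_i - g_i| / τHat_i`, computed from the data `y`. -/
def maxStat (y : Fin n → ℝ) (g : Fin S.p₁ → ℝ) : ℝ :=
  ⨆ i, |S.γHat y i - g i| / S.τHat y i

/-- The estimated errors `y - X βHat`. -/
def residual (y : Fin n → ℝ) : Fin n → ℝ := y - S.X *ᵥ S.βHat y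

/-- The bootstrap sample `y* = X βHat + ε*`, `ε*_i = (residual)_i w_i`, from multipliers `w`. -/
def bootSample (y : Fin n → ℝ) (w : EuclideanSpace ℝ (Fin n)) : Fin n → ℝ :=
  S.X *ᵥ S.βHat y + fun i => S.residual y i * w i

/-- The bootstrap statistic `max_i |γHat*_i - γHat_i| / τHat*_i`: the starred estimators are the
estimators above computed from the bootstrap sample. -/
def bootStat (y : Fin n → ℝ) (w : EuclideanSpace ℝ (Fin n)) : ℝ :=
  S.maxStat (S.bootSample y w) (S.γHat y)

end Setting

/-- A (nonstationary) causal error process `ε_i = g_i(…, e_{i-1}, e_i)`, `i = 1, …, n`, driven by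
independent innovations `e_i`, `i ∈ ℤ`, together with an independent copy `eDag` of them.
The argument of `g` lists the past of `e` backwards in time. -/
structure ErrorProcess (n : ℕ) {Ω : Type*} [MeasurableSpace Ω] (P : Measure Ω) where
  e : ℤ → Ω → ℝ
  eDag : ℤ → Ω → ℝ
  g : Fin n → (ℕ → ℝ) → ℝ
  measurable_e : ∀ i, Measurable (e i)
  measurable_eDag : ∀ i, Measurable (eDag i)
  measurable_g : ∀ i, Measurable (g i)
  indep : iIndepFun (Sum.elim e eDag) P
  identDistrib : ∀ i, IdentDistrib (eDag i) (e i) P P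

namespace ErrorProcess

variable {n : ℕ} {Ω : Type*} [MeasurableSpace Ω] {P : Measure Ω} (E : ErrorProcess n P)

/-- The error `ε_i`; the element `i : Fin n` stands for the time `i + 1`. -/
def ε (i : Fin n) (ω : Ω) : ℝ :=
  E.g i fun k => E.e ((i.val : ℤ) + 1 - k) ω

/-- `ε_{i,j}`: the error in which the innovation at lag `j` is replaced by its copy. -/
def εCoupled (i : Fin n) (j : ℕ) (ω : Ω) : ℝ :=
  E.g i fun k => if k = j then E.eDag ((i.val : ℤ) + 1 - k) ω else E.e ((i.val : ℤ) + 1 - k) ω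

/-- The physical dependence measure `δ_{i,j,m} = ‖ε_i - ε_{i,j}‖_m`. -/
def dep (m : ℝ) (i : Fin n) (j : ℕ) : ℝ≥0∞ :=
  eLpNorm (fun ω => E.ε i ω - E.εCoupled i j ω) (ENNReal.ofReal m) P

/-- The covariance matrix `(𝐄 ε_i ε_j)_{i,j}` of the (centred) errors. -/
def cov : Matrix (Fin n) (Fin n) ℝ := Matrix.of fun i j => ∫ ω, E.ε i ω * E.ε j ω ∂P

/-- The observations `y = X β + ε`. -/
def y (S : Setting n) (ω : Ω) : Fin n → ℝ := S.X *ᵥ S.β + fun i => E.ε i ω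

end ErrorProcess

/-- The covariance matrix `(K((i - j) / k))_{i,j}` of the bootstrap multipliers. -/
def kernelMatrix (n : ℕ) (K : ℝ → ℝ) (k : ℝ) : Matrix (Fin n) (Fin n) ℝ :=
  Matrix.of fun i j => K (((i.val : ℝ) - (j.val : ℝ)) / k)

/-- The Fourier transform `𝓕K(x) = ∫ K(t) exp(-2πitx) dt`. -/
def fourierK (K : ℝ → ℝ) (x : ℝ) : ℂ :=
  ∫ t : ℝ, (K t : ℂ) * Complex.exp (-2 * (Real.pi : ℂ) * Complex.I * (t : ℂ) * (x : ℂ))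

section Bootstrap

variable {n : ℕ} {Ω : Type*} [MeasurableSpace Ω] (P : Measure Ω) [IsProbabilityMeasure P]

/-- `Prob* (max_i |γHat*_i - γHat_i| / τHat*_i ≤ x) = Prob (… ≤ x | Y)` at the outcome `ω`, where
`Y` is the vector of observations and `W` the vector of bootstrap multipliers. The conditional
probability is taken from a regular conditional distribution. -/
def bootCDF (S : Setting n) (Y : Ω → Fin n → ℝ) (W : Ω → EuclideanSpace ℝ (Fin n))
    (ω : Ω) (x : ℝ) : ℝ :=
  (condDistrib (fun ω' => S.bootStat (Y ω') (W ω')) Y P (Y ω)).real (Set.Iic x)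

/-- The conditional quantile `c*_{1-α}`. -/
def bootQuantile (S : Setting n) (Y : Ω → Fin n → ℝ) (W : Ω → EuclideanSpace ℝ (Fin n))
    (α : ℝ) (ω : Ω) : ℝ :=
  sInf {x : ℝ | 1 - α ≤ bootCDF P S Y W ω x}

end Bootstrap

/-- Design: full rank, singular values between `c_λ n^η` and `C_λ n^{1/2}`, bounded entries,
boundedly many linear combinations. -/
structure Assumption1 (S : ∀ n, Setting n) (η : ℝ) : Prop where
  η_pos : 0 < η
  η_le : η ≤ 1 / 2
  p_le : ∀ n ≥ 1, (S n).p ≤ n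
  rank_eq : ∀ n ≥ 1, (S n).X.rank = (S n).p
  antitone_lam : ∀ n ≥ 1, Antitone (S n).lam
  lam_upper : ∃ C : ℝ, 0 < C ∧ ∀ n ≥ 1, ∀ j, (S n).lam j ≤ C * (n : ℝ) ^ (1 / 2 : ℝ)
  lam_lower : ∃ c : ℝ, 0 < c ∧ ∀ n : ℕ, n ≥ 1 → ∀ j, c * (n : ℝ) ^ η ≤ (S n).lam j
  X_bound : ∃ C : ℝ, ∀ n ≥ 1, ∀ i j, |(S n).X i j| ≤ C
  p₁_bound : ∃ C : ℕ, ∀ n ≥ 1, (S n).p₁ ≤ C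

/-- Errors: centred, short-range dependent, with bounded `m`-th moments and a covariance matrix
whose eigenvalues are bounded away from zero. -/
structure Assumption2 {Ω : ℕ → Type*} [∀ n, MeasurableSpace (Ω n)] {P : ∀ n, Measure (Ω n)}
    (E : ∀ n, ErrorProcess n (P n)) (η m αε : ℝ) : Prop where
  m_gt : 3 / η < m
  αε_gt : 1 < αε
  mean_zero : ∀ n ≥ 1, ∀ i, ∫ ω, (E n).ε i ω ∂(P n) = 0
  dep_bound : ∃ C : ℝ, ∀ n ≥ 1, ∀ k : ℕ,
    ENNReal.ofReal (((k : ℝ) + 1) ^ αε) * ∑' j : ℕ, ⨆ i, (E n).dep m i (k + j) ≤ ENNReal.ofReal C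
  moment_bound : ∃ C : ℝ, ∀ n ≥ 1, ∀ i,
    eLpNorm ((E n).ε i) (ENNReal.ofReal m) (P n) ≤ ENNReal.ofReal C
  cov_lower : ∃ c : ℝ, 0 < c ∧ ∀ n ≥ 1, ∀ μ ∈ spectrum ℝ (E n).cov, c < μ

/-- Size and sparsity of the parameter vector. -/
structure Assumption3 (S : ∀ n, Setting n) (η m αβ : ℝ) : Prop where
  αβ_nonneg : 0 ≤ αβ
  αβ_lt : αβ < 3 * η
  β_norm : (fun n => √(∑ i, (S n).β i ^ 2)) =O[atTop] fun n : ℕ => (n : ℝ) ^ αβ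
  N_card : (fun n => ((S n).N.card : ℝ)) =o[atTop] fun n : ℕ => (n : ℝ) ^ (η - 1 / m)

/-- Ridge parameter, threshold, and separation of the coordinates of `β` by the threshold. -/
structure Assumption4 (S : ∀ n, Setting n) (η m αβ δ νb : ℝ) : Prop where
  δ_gt : (η + αβ) / 2 < δ
  δ_lt : δ < 2 * η
  ρ_order : (fun n => (S n).ρ) =O[atTop] fun n : ℕ => (n : ℝ) ^ (2 * η - δ)
  νb_pos : 0 < νb
  νb_lt : νb < η - 3 / m
  b_eq : ∃ Cb : ℝ, 0 < Cb ∧ ∀ n ≥ 1, (S n).b = Cb * (n : ℝ) ^ (-νb)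
  separation : ∃ cb : ℝ, 0 < cb ∧ cb < 1 ∧ ∀ n ≥ 1,
    (∀ i ∉ (S n).N, |(S n).β i| ≤ cb * (S n).b) ∧ (∀ i ∈ (S n).N, (S n).b / cb ≤ |(S n).β i|)

/-- Nondegeneracy of the linear combinations, and smallness of the weak coordinates of `β`. -/
structure Assumption5 (S : ∀ n, Setting n) (η m : ℝ) : Prop where
  Mset_nonempty : ∀ n ≥ 1, (S n).Mset.Nonempty
  row_bounds : ∃ cM CM : ℝ, 0 < cM ∧ cM ≤ CM ∧ ∀ n ≥ 1, ∀ i ∈ (S n).Mset,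
    cM ≤ ∑ k ∈ (S n).N, (S n).M i k ^ 2 ∧ ∑ k ∈ (S n).N, (S n).M i k ^ 2 ≤ CM
  weak_M : (fun n => ⨆ i, |∑ j ∈ (S n).Nᶜ, (S n).M i j * (S n).β j|)
    =o[atTop] fun n : ℕ => 1 / √(n : ℝ)
  weak_X : (fun n => ⨆ i, |∑ j ∈ (S n).Nᶜ, (S n).X i j * (S n).β j|)
    =o[atTop] fun n : ℕ => (n : ℝ) ^ ((1 / m - η) / 2)

/-- Full rank of `(c_{ij})_{i ∈ ℳ, j}` and the negligibility of single errors. -/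
structure Assumption6 (S : ∀ n, Setting n) (αε : ℝ) : Prop where
  rank_eq : ∀ n ≥ 1,
    (Matrix.of fun (i : (S n).Mset) (j : Fin (S n).p) => (S n).c i j).rank = (S n).Mset.ncard
  cStar_order : (fun n => (S n).cStar) =o[atTop] fun n : ℕ =>
    (n : ℝ) ^ (-(1 / 4) : ℝ) * Real.log n ^ (-(max (9 / 2) (3 * αε / (2 * αε - 2))))

/-- Kernel and bandwidth of the dependent wild bootstrap. -/
structure Assumption7 (K : ℝ → ℝ) (k : ℕ → ℝ) (η m νb : ℝ) : Prop where
  nonneg : ∀ x, 0 ≤ K x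
  symm : ∀ x, K (-x) = K x
  contDiff : ContDiff ℝ 1 K
  at_zero : K 0 = 1
  integrable : Integrable K
  antitoneOn : AntitoneOn K (Set.Ici 0)
  fourier_nonneg : ∀ x, (fourierK K x).im = 0 ∧ 0 ≤ (fourierK K x).re
  fourier_integrable : Integrable (fourierK K)
  k_tendsto : Tendsto k atTop atTop
  k_littleO : k =o[atTop] fun n : ℕ => (n : ℝ) ^ (2 * η - 2 * νb - 4 / m)
  k_bigO : k =O[atTop] fun n : ℕ => (n : ℝ) ^ (η / 2 - 3 / (2 * m))

end

end RidgeBootstrap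

namespace RidgeBootstrap

set_option linter.unusedSectionVars false

/-! ### Averaging out single coordinates of a product measure -/

/-! Outside events of small probability, the statistic and its bootstrap version are both maxima of
absolute values of boundedly many standardised linear forms. The theorem therefore reduces to a
normal approximation for linear forms in weakly dependent errors, and to the consistency of one
kernel-weighted covariance estimator.

Algebra. In singular coordinates the de-biased ridge estimator equals the parameter, minus a bias
with the second-order factors ρ²/(λ²+ρ)², plus `noiseMat` applied to the errors
(`Setting.debiased_eq`). The strong and weak coordinates lie at a distance proportional to b from
the threshold, so the correct set is selected as soon as noise and bias are small fractions of b. On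
that event the studentised deviation is a linear form in the errors with coefficients `load`, up to
two remainders: the neglected weak coordinates and the ridge bias, both o(1) relative to τ
(`Setting.Regular.abs_studentized_sub_le`). The bootstrap repeats this with `βHat` as true parameter
and residuals times multipliers as errors, since `βHat` inherits the separation
(`Setting.Separated.bootStat_sandwich`).

Errors. The errors are functions of independent coordinates. Integrating coordinates out one by one
gives martingale differences, each dominated by the effect of a single coordinate, which the
physical dependence measure controls. This yields moment bounds of even order for linear forms
(`lpNorm_sub_integral_sq_le`), a variance bound for quadratic forms (`lpNorm_quadratic_sq_le`) and
an approximate Stein identity (`abs_integral_mul_sub_le`). Applied to cosine and sine, the identity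
is a differential equation for the characteristic function of a linear form, whose solution is
Gaussian up to an error proportional to the largest coefficient (`abs_integral_cos_sin_sub_le`).
That coefficient is at most `cStar`, which tends to zero. Truncation and finite-dimensional
approximation carry the bounds over to the actual errors (`ErrorProcess.noiseBounds`).

Gaussian comparison. The number of linear combinations is bounded, so the linear forms can be
listed, with repetitions, in a fixed dimension D. Compactness of the set of bounded covariance
matrices and the continuity theorem then give closeness uniformly over centred cubes. Only a lower
bound on the variances is needed: it makes the measure of a cube Lipschitz in its half-width, which
absorbs the remainders above.

Bootstrap. Given the data, the bootstrap linear forms are exactly Gaussian, and their covariance is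
the kernel-weighted estimator built from the residuals. Its entries converge in L¹ to those of the
true covariance (`NoiseBounds.integral_abs_weighted_cov_sub_le`). Hence the bootstrap distribution
function and that of the statistic are both uniformly close to H. Since H is continuous, the
bootstrap quantile lies between two nearby quantiles of H with high probability, which gives the
coverage (`abs_coverage_sub_le`). -/

/-- Bounded measurable functions of the innovations. -/
def BM (F : (ℕ → ℝ) → ℝ) : Prop := Measurable F ∧ ∃ C, ∀ x, |F x| ≤ C

namespace BM

variable {F G : (ℕ → ℝ) → ℝ}

lemma const (c : ℝ) : BM fun _ => c := ⟨measurable_const, |c|, fun _ => le_rfl⟩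

lemma add (hF : BM F) (hG : BM G) : BM fun x => F x + G x := by
  obtain ⟨hF, C, hC⟩ := hF
  obtain ⟨hG, D, hD⟩ := hG
  exact ⟨hF.add hG, C + D, fun x => (abs_add_le _ _).trans (add_le_add (hC x) (hD x))⟩

lemma mul (hF : BM F) (hG : BM G) : BM fun x => F x * G x := by
  obtain ⟨hF, C, hC⟩ := hF
  obtain ⟨hG, D, hD⟩ := hG
  refine ⟨hF.mul hG, C * D, fun x => ?_⟩
  rw [abs_mul]
  exact mul_le_mul (hC x) (hD x) (abs_nonneg _) ((abs_nonneg _).trans (hC x))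

lemma const_mul (c : ℝ) (hF : BM F) : BM fun x => c * F x := (BM.const c).mul hF

lemma sub (hF : BM F) (hG : BM G) : BM fun x => F x - G x := by
  simpa [sub_eq_add_neg] using hF.add (hG.const_mul (-1))

lemma pow (hF : BM F) (q : ℕ) : BM fun x => F x ^ q := by
  induction q with
  | zero => simpa using BM.const 1
  | succ q ih => simpa [pow_succ] using ih.mul hF

lemma abs (hF : BM F) : BM fun x => |F x| := by
  obtain ⟨hF, C, hC⟩ := hF
  exact ⟨hF.abs, C, fun x => by simpa using hC x⟩

lemma sum {ι : Type*} {s : Finset ι} {F : ι → (ℕ → ℝ) → ℝ} (h : ∀ i ∈ s, BM (F i)) :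
    BM fun x => ∑ i ∈ s, F i x := by
  classical
  induction s using Finset.induction_on with
  | empty => simpa using BM.const 0
  | insert a s ha ih =>
    simp only [Finset.sum_insert ha]
    exact (h a (by simp)).add (ih fun i hi => h i (by simp [hi]))

lemma bounded_comp {f : ℝ → ℝ} (hf : Measurable f) {C : ℝ} (hC : ∀ x, |f x| ≤ C) (hF : Measurable F) :
    BM fun x => f (F x) := ⟨hf.comp hF, C, fun _ => hC _⟩

variable {μ : Measure (ℕ → ℝ)} [IsProbabilityMeasure μ]

lemma integrable (hF : BM F) : Integrable F μ := by
  obtain ⟨hF, C, hC⟩ := hF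
  exact Integrable.of_bound hF.aestronglyMeasurable C (ae_of_all _ hC)

lemma memLp (hF : BM F) (q : ℝ≥0∞) : MemLp F q μ := by
  obtain ⟨hF, C, hC⟩ := hF
  exact MemLp.of_bound hF.aestronglyMeasurable C (ae_of_all _ hC)

lemma integrable_update (hF : BM F) (ν : Measure ℝ) [IsProbabilityMeasure ν] (x : ℕ → ℝ) (k : ℕ) :
    Integrable (fun y => F (Function.update x k y)) ν := by
  obtain ⟨hF, C, hC⟩ := hF
  exact Integrable.of_bound (hF.comp (measurable_update x)).aestronglyMeasurable C
    (ae_of_all _ fun y => hC _)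

end BM

lemma measurable_update_uncurry (k : ℕ) :
    Measurable fun p : (ℕ → ℝ) × ℝ => Function.update p.1 k p.2 := by
  refine measurable_pi_iff.2 fun i => ?_
  by_cases h : i = k
  · subst h; simpa using measurable_snd
  · simp only [Function.update_of_ne h]
    exact (measurable_pi_apply i).comp measurable_fst

/-- `F` does not depend on the coordinate `k`. -/
def Free (k : ℕ) (F : (ℕ → ℝ) → ℝ) : Prop := ∀ x y, F (Function.update x k y) = F x

variable (ρ : ℕ → Measure ℝ) [∀ k, IsProbabilityMeasure (ρ k)]

/-- Integrate the coordinate `k` out. -/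
noncomputable def avg (k : ℕ) (F : (ℕ → ℝ) → ℝ) (x : ℕ → ℝ) : ℝ :=
  ∫ y, F (Function.update x k y) ∂ρ k

/-- Resampling one coordinate independently preserves a product measure. This makes `avg` a
conditional expectation given the other coordinates, defined at every point and without any
σ-algebra. -/
lemma map_update_infinitePi (k : ℕ) :
    ((Measure.infinitePi ρ).prod (ρ k)).map (fun p => Function.update p.1 k p.2)
      = Measure.infinitePi ρ := by
  refine Measure.eq_infinitePi ρ fun s t ht => ?_
  classical
  rw [Measure.map_apply (measurable_update_uncurry k)
    (MeasurableSet.pi (Set.to_countable _) fun i _ => ht i)]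
  have : (fun p : (ℕ → ℝ) × ℝ => Function.update p.1 k p.2) ⁻¹' (Set.pi s t)
      = (Set.pi (s.erase k : Finset ℕ) t) ×ˢ (if k ∈ s then t k else Set.univ) := by
    ext ⟨x, y⟩
    simp only [Set.mem_preimage, Set.mem_pi, Finset.mem_coe, Set.mem_prod, Finset.mem_erase]
    constructor
    · intro h
      refine ⟨fun i hi => by simpa [Function.update_of_ne hi.1] using h i hi.2, ?_⟩
      split_ifs with hk
      · simpa using h k hk
      · trivial
    · rintro ⟨h1, h2⟩ i hi
      by_cases hik : i = k
      · subst hik; simpa [hi] using h2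
      · simpa [Function.update_of_ne hik] using h1 i ⟨hik, hi⟩
  rw [this, Measure.prod_prod, Measure.infinitePi_pi _ (fun i _ => ht i)]
  by_cases hk : k ∈ s
  · rw [if_pos hk, Finset.prod_erase_mul _ _ hk]
  · rw [if_neg hk, Finset.erase_eq_of_notMem hk]; simp

section avg
variable {ρ} {F G : (ℕ → ℝ) → ℝ} {k j : ℕ}

lemma BM.avg (hF : BM F) : BM (avg ρ k F) := by
  refine ⟨?_, ?_⟩
  · exact (StronglyMeasurable.integral_prod_right
      (f := fun x y => F (Function.update x k y))
      (hF.1.comp (measurable_update_uncurry k)).stronglyMeasurable).measurable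
  · obtain ⟨hF, C, hC⟩ := hF
    refine ⟨C, fun x => ?_⟩
    refine (norm_integral_le_of_norm_le_const (μ := ρ k) (f := fun y => F (Function.update x k y))
      (C := C) (ae_of_all _ fun y => hC _)).trans ?_
    simp

lemma avg_sub (hF : BM F) (hG : BM G) :
    avg ρ k (fun x => F x - G x) = fun x => avg ρ k F x - avg ρ k G x := by
  ext x
  exact integral_sub (hF.integrable_update _ x k) (hG.integrable_update _ x k)

lemma avg_const_mul (c : ℝ) : avg ρ k (fun x => c * F x) = fun x => c * avg ρ k F x := by
  ext x
  exact integral_const_mul c _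

lemma avg_sum {ι : Type*} {s : Finset ι} {F : ι → (ℕ → ℝ) → ℝ} (h : ∀ i ∈ s, BM (F i)) :
    avg ρ k (fun x => ∑ i ∈ s, F i x) = fun x => ∑ i ∈ s, avg ρ k (F i) x := by
  ext x
  exact integral_finsetSum s fun i hi => (h i hi).integrable_update _ x k

lemma free_avg : Free k (avg ρ k F) := fun x y => by simp [avg]

lemma avg_of_free (hF : Free k F) : avg ρ k F = F := by
  ext x; simp [avg, hF x]

lemma avg_mul_of_free (hG : Free k G) : avg ρ k (fun x => G x * F x) = fun x => G x * avg ρ k F x := by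
  ext x
  simp only [avg, hG x]
  exact integral_const_mul _ _

lemma Free.avg (hF : Free j F) : Free j (avg ρ k F) := by
  by_cases h : j = k
  · subst h; exact free_avg
  · intro x y
    simp only [RidgeBootstrap.avg]
    congr 1
    ext z
    rw [Function.update_comm h, hF]

lemma avg_comm (hF : BM F) : avg ρ k (avg ρ j F) = avg ρ j (avg ρ k F) := by
  by_cases h : j = k
  · rw [h]
  · ext x
    simp only [avg]
    rw [integral_integral_swap]
    · congr 1; ext y; congr 1; ext z; rw [Function.update_comm h]
    · obtain ⟨hF, C, hC⟩ := hF
      refine Integrable.of_bound (C := C) ?_ (ae_of_all _ fun p => hC _)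
      refine (hF.comp ?_).aestronglyMeasurable
      have h1 : Measurable fun p : ℝ × ℝ => (Function.update x k p.1, p.2) :=
        ((measurable_update x).comp measurable_fst).prodMk measurable_snd
      exact (measurable_update_uncurry j).comp h1

lemma integral_avg (hF : BM F) :
    ∫ x, avg ρ k F x ∂Measure.infinitePi ρ = ∫ x, F x ∂Measure.infinitePi ρ := by
  conv_rhs => rw [← map_update_infinitePi ρ k]
  rw [integral_map (measurable_update_uncurry k).aemeasurable hF.1.aestronglyMeasurable,
    integral_prod]
  · rfl
  · obtain ⟨hF, C, hC⟩ := hF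
    exact Integrable.of_bound (C := C) (hF.comp (measurable_update_uncurry k)).aestronglyMeasurable
      (ae_of_all _ fun p => hC _)

/-- Orthogonality of martingale differences: averaging over the coordinate k first, the factor G
comes out of the average and F averages to zero. -/
lemma integral_mul_avg_eq_zero (hF : BM F) (hG : BM G) (hGk : Free k G) (h0 : avg ρ k F = fun _ => 0) :
    ∫ x, G x * F x ∂Measure.infinitePi ρ = 0 := by
  rw [← integral_avg (k := k) (hG.mul hF), avg_mul_of_free hGk, h0]
  simp

end avg

section norms
variable {μ : Measure (ℕ → ℝ)} [IsProbabilityMeasure μ] {F G : (ℕ → ℝ) → ℝ} {q : ℕ}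

lemma lpNorm_pow_eq_integral (hq : q ≠ 0) (hF : BM F) : lpNorm F q μ ^ q = ∫ x, |F x| ^ q ∂μ := by
  rw [lpNorm_eq_integral_norm_rpow_toReal (by simpa using hq) (by simp) hF.1.aestronglyMeasurable]
  simp only [ENNReal.toReal_natCast, Real.rpow_natCast, Real.norm_eq_abs]
  exact Real.rpow_inv_natCast_pow (integral_nonneg fun _ => by positivity) hq

lemma lpNorm_le_of_integral_le (hq : q ≠ 0) (hF : BM F) {a : ℝ} (ha : 0 ≤ a)
    (h : ∫ x, |F x| ^ q ∂μ ≤ a ^ q) : lpNorm F q μ ≤ a := by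
  rw [← lpNorm_pow_eq_integral hq hF] at h
  exact le_of_pow_le_pow_left₀ hq ha h

lemma lpNorm_add_le_of_bm (hq : 1 ≤ q) (hF : BM F) :
    lpNorm (fun x => F x + G x) q μ ≤ lpNorm F q μ + lpNorm G q μ :=
  lpNorm_add_le (hF.memLp _) (by exact_mod_cast hq)

lemma lpNorm_sub_le_of_bm (hq : 1 ≤ q) (hF : BM F) :
    lpNorm (fun x => F x - G x) q μ ≤ lpNorm F q μ + lpNorm G q μ :=
  lpNorm_sub_le (hF.memLp _) (by exact_mod_cast hq)

lemma lpNorm_const_mul' (c : ℝ) : lpNorm (fun x => c * F x) q μ = |c| * lpNorm F q μ := by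
  have := lpNorm_const_smul (p := (q : ℝ≥0∞)) c F μ
  simpa [Pi.smul_def] using this

lemma lpNorm_sum_le_of_bm (hq : 1 ≤ q) {ι : Type*} {s : Finset ι} {F : ι → (ℕ → ℝ) → ℝ}
    (h : ∀ i ∈ s, BM (F i)) :
    lpNorm (fun x => ∑ i ∈ s, F i x) q μ ≤ ∑ i ∈ s, lpNorm (F i) q μ := by
  classical
  induction s using Finset.induction_on with
  | empty => simp
  | insert a s ha ih =>
    simp only [Finset.sum_insert ha]
    exact (lpNorm_add_le_of_bm hq (h a (by simp))).trans
      (by gcongr; exact ih fun i hi => h i (by simp [hi]))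

lemma abs_integral_mul_le (hF : BM F) (hG : BM G) :
    |∫ x, F x * G x ∂μ| ≤ lpNorm F 2 μ * lpNorm G 2 μ := by
  have h := integral_mul_norm_le_Lp_mul_Lq (μ := μ) (f := F) (g := G) Real.HolderConjugate.two_two
    (hF.memLp _) (hG.memLp _)
  refine (norm_integral_le_integral_norm (fun x => F x * G x)).trans ?_
  simp only [norm_mul]
  refine h.trans (le_of_eq ?_)
  rw [lpNorm_eq_integral_norm_rpow_toReal (by simp) (by simp) hF.1.aestronglyMeasurable,
    lpNorm_eq_integral_norm_rpow_toReal (by simp) (by simp) hG.1.aestronglyMeasurable]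
  simp

lemma lpNorm_two_mul_le (hF : BM F) (hG : BM G) :
    lpNorm (fun x => F x * G x) 2 μ ≤ lpNorm F 4 μ * lpNorm G 4 μ := by
  have e : ∀ H, BM H → lpNorm (fun x => H x ^ 2) 2 μ = lpNorm H 4 μ ^ 2 := by
    intro H hH
    have h1 := lpNorm_pow_eq_integral (μ := μ) (q := 2) two_ne_zero (hH.pow 2)
    have h2 := lpNorm_pow_eq_integral (μ := μ) (q := 4) four_ne_zero hH
    have : lpNorm (fun x => H x ^ 2) 2 μ ^ 2 = (lpNorm H 4 μ ^ 2) ^ 2 := by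
      rw [← pow_mul]; norm_num at h1 h2 ⊢
      rw [h1, h2]; congr 1; ext x; rw [← pow_mul, show 4 = 2 * 2 by norm_num, pow_mul, pow_mul, sq_abs]
    exact (pow_left_inj₀ lpNorm_nonneg (by positivity) two_ne_zero).1 this
  refine lpNorm_le_of_integral_le (q := 2) two_ne_zero (hF.mul hG)
    (mul_nonneg lpNorm_nonneg lpNorm_nonneg) ?_
  have := (le_abs_self _).trans (abs_integral_mul_le (μ := μ) (hF.pow 2) (hG.pow 2))
  rw [e F hF, e G hG] at this
  rw [mul_pow]
  refine le_trans (le_of_eq ?_) this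
  congr 1; ext x; rw [sq_abs]; ring

lemma lpNorm_mono_exp {p q : ℕ} (hpq : p ≤ q) (hF : BM F) : lpNorm F p μ ≤ lpNorm F q μ := by
  rw [← toReal_eLpNorm hF.1.aestronglyMeasurable, ← toReal_eLpNorm hF.1.aestronglyMeasurable]
  exact ENNReal.toReal_mono (hF.memLp _).eLpNorm_ne_top
    (eLpNorm_le_eLpNorm_of_exponent_le (by exact_mod_cast hpq) hF.1.aestronglyMeasurable)

/-- Jensen's inequality in the single coordinate k, then integration over the others. -/
lemma lpNorm_avg_le (hq : 1 ≤ q) (hF : BM F) (k : ℕ) :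
    lpNorm (avg ρ k F) q (Measure.infinitePi ρ) ≤ lpNorm F q (Measure.infinitePi ρ) := by
  have hq0 : q ≠ 0 := by lia
  refine lpNorm_le_of_integral_le hq0 hF.avg lpNorm_nonneg ?_
  rw [lpNorm_pow_eq_integral hq0 hF, ← integral_avg (k := k) (hF.abs.pow q)]
  refine integral_mono (hF.avg.abs.pow q).integrable (hF.abs.pow q).avg.integrable fun x => ?_
  have h1 : |avg ρ k F x| ≤ ∫ y, |F (Function.update x k y)| ∂ρ k :=
    norm_integral_le_integral_norm (fun y => F (Function.update x k y))
  refine (pow_le_pow_left₀ (abs_nonneg _) h1 q).trans ?_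
  exact (convexOn_pow q).map_integral_le (continuous_pow q).continuousOn isClosed_Ici
    (ae_of_all _ fun y => Set.mem_Ici.2 (abs_nonneg _)) (hF.abs.integrable_update _ x k)
    ((hF.abs.pow q).integrable_update _ x k)

end norms

/-- The effect of the coordinate `k`. -/
noncomputable def res (k : ℕ) (F : (ℕ → ℝ) → ℝ) (x : ℕ → ℝ) : ℝ := F x - avg ρ k F x

/-- Integrate the first `t` coordinates out. -/
noncomputable def pre : ℕ → ((ℕ → ℝ) → ℝ) → (ℕ → ℝ) → ℝ
  | 0, F => F
  | t + 1, F => avg ρ t (pre t F)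

/-- The martingale differences. -/
noncomputable def mdiff (k : ℕ) (F : (ℕ → ℝ) → ℝ) (x : ℕ → ℝ) : ℝ := pre ρ k F x - pre ρ (k + 1) F x

variable {ρ} {F G : (ℕ → ℝ) → ℝ} {q : ℕ}

lemma BM.res (hF : BM F) (k : ℕ) : BM (res ρ k F) := hF.sub hF.avg

lemma BM.pre (hF : BM F) (t : ℕ) : BM (pre ρ t F) := by
  induction t with
  | zero => exact hF
  | succ t ih => exact ih.avg

lemma BM.mdiff (hF : BM F) (t : ℕ) : BM (mdiff ρ t F) := (hF.pre t).sub (hF.pre (t + 1))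

lemma avg_res (hF : BM F) (k : ℕ) : avg ρ k (res ρ k F) = fun _ => 0 := by
  unfold res
  rw [avg_sub hF hF.avg, avg_of_free (free_avg (F := F))]
  simp

lemma avg_pre_comm (hF : BM F) (k t : ℕ) : avg ρ k (pre ρ t F) = pre ρ t (avg ρ k F) := by
  induction t with
  | zero => rfl
  | succ t ih => simp only [pre]; rw [avg_comm (hF.pre t), ih]

lemma pre_sub (hF : BM F) (hG : BM G) (t : ℕ) :
    pre ρ t (fun x => F x - G x) = fun x => pre ρ t F x - pre ρ t G x := by
  induction t with
  | zero => rfl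
  | succ t ih => simp only [pre]; rw [ih, avg_sub (hF.pre t) (hG.pre t)]

/-- Averages over different coordinates commute, so the effect of the coordinate k may be taken
before the first k coordinates are integrated out. As `pre` contracts every norm, the martingale
difference is dominated by `res`, which a coupling controls. The innovations will be listed
backwards in time, so `pre` is then the conditional expectation given the past. -/
lemma mdiff_eq_pre_res (hF : BM F) (k : ℕ) : mdiff ρ k F = pre ρ k (res ρ k F) := by
  unfold res
  rw [pre_sub hF hF.avg, ← avg_pre_comm hF]
  rfl

lemma mdiff_eq_res_pre (k : ℕ) : mdiff ρ k F = res ρ k (pre ρ k F) := rfl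

lemma avg_mdiff (hF : BM F) (k : ℕ) : avg ρ k (mdiff ρ k F) = fun _ => 0 := by
  rw [mdiff_eq_res_pre]
  exact avg_res (hF.pre k) k

lemma free_pre {k t : ℕ} (h : k < t) : Free k (pre ρ t F) := by
  induction t with
  | zero => lia
  | succ t ih =>
    by_cases hk : k = t
    · subst hk; exact free_avg
    · exact (ih (by lia)).avg

lemma lpNorm_pre_le (hq : 1 ≤ q) (hF : BM F) (t : ℕ) :
    lpNorm (pre ρ t F) q (Measure.infinitePi ρ) ≤ lpNorm F q (Measure.infinitePi ρ) := by
  induction t with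
  | zero => exact le_rfl
  | succ t ih => exact (lpNorm_avg_le ρ hq (hF.pre t) t).trans ih

lemma lpNorm_mdiff_le (hq : 1 ≤ q) (hF : BM F) (k : ℕ) :
    lpNorm (mdiff ρ k F) q (Measure.infinitePi ρ) ≤ lpNorm (res ρ k F) q (Measure.infinitePi ρ) := by
  rw [mdiff_eq_pre_res hF]
  exact lpNorm_pre_le hq (hF.res k) k

lemma lpNorm_res_le (hq : 1 ≤ q) (hF : BM F) (k : ℕ) :
    lpNorm (res ρ k F) q (Measure.infinitePi ρ) ≤ 2 * lpNorm F q (Measure.infinitePi ρ) := by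
  have := lpNorm_sub_le_of_bm (μ := Measure.infinitePi ρ) hq hF (G := avg ρ k F)
  have h2 := lpNorm_avg_le ρ hq hF k
  unfold res
  linarith

/-- A function free of the coordinate k is invisible to `res`, so any such G may be subtracted
first. It serves for products, where a product of averages is a more convenient G than the average
of the product. -/
lemma lpNorm_res_le_of_free (hq : 1 ≤ q) (hF : BM F) (hG : BM G) {k : ℕ} (hk : Free k G) :
    lpNorm (res ρ k F) q (Measure.infinitePi ρ)
      ≤ 2 * lpNorm (fun x => F x - G x) q (Measure.infinitePi ρ) := by
  have : res ρ k F = res ρ k (fun x => F x - G x) := by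
    ext x
    simp only [res, avg_sub hF hG, avg_of_free hk]
    ring
  rw [this]
  exact lpNorm_res_le hq (hF.sub hG) k

lemma integral_pre (hF : BM F) (t : ℕ) :
    ∫ x, pre ρ t F x ∂Measure.infinitePi ρ = ∫ x, F x ∂Measure.infinitePi ρ := by
  induction t with
  | zero => rfl
  | succ t ih => simp only [pre]; rw [integral_avg (hF.pre t), ih]

/-- `F` depends on the first `N` coordinates only. -/
def Upto (N : ℕ) (F : (ℕ → ℝ) → ℝ) : Prop := DependsOn F (Set.Iio N)

lemma Upto.free {N k : ℕ} (h : Upto N F) (hk : N ≤ k) : Free k F := fun x y => by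
  refine h fun i hi => ?_
  rw [Function.update_of_ne]
  have : i < N := hi
  lia

lemma Upto.avg {N : ℕ} (h : Upto N F) (k : ℕ) : Upto N (avg ρ k F) := by
  intro x y hxy
  simp only [RidgeBootstrap.avg]
  congr 1
  ext z
  refine h fun i hi => ?_
  by_cases hik : i = k
  · subst hik; simp
  · simp [Function.update_of_ne hik, hxy i hi]

lemma Upto.pre {N : ℕ} (h : Upto N F) (k : ℕ) : Upto N (pre ρ k F) := by
  induction k with
  | zero => exact h
  | succ k ih => exact ih.avg k

/-- The coordinates of x are exchanged for those of y one at a time, and no exchange changes the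
value. -/
lemma update_all_eq {N : ℕ} (hfree : ∀ k < N, Free k F) (hup : Upto N F) (x y : ℕ → ℝ) :
    F x = F y := by
  have key : ∀ t ≤ N, F (fun i => if i < t then y i else x i) = F x := by
    intro t ht
    induction t with
    | zero => simp
    | succ t ih =>
      rw [← ih (by lia), ← hfree t (by lia) (fun i => if i < t then y i else x i) (y t)]
      congr 1
      ext i
      by_cases hit : i = t
      · subst hit; simp
      · have : i < t + 1 ↔ i < t := by lia
        simp [Function.update_of_ne hit, this]
  rw [← key N le_rfl]
  refine hup fun i hi => ?_
  have : i < N := hi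
  simp [this]

lemma pre_eq_integral (hF : BM F) {N : ℕ} (h : Upto N F) (x : ℕ → ℝ) :
    pre ρ N F x = ∫ x, F x ∂Measure.infinitePi ρ := by
  rw [← integral_pre hF N]
  have : pre ρ N F = fun _ => pre ρ N F x := by
    ext y
    exact update_all_eq (fun k hk => free_pre hk) (h.pre N) y x
  rw [this]; simp

lemma sum_mdiff (hF : BM F) {N : ℕ} (h : Upto N F) (x : ℕ → ℝ) :
    ∑ k ∈ Finset.range N, mdiff ρ k F x = F x - ∫ x, F x ∂Measure.infinitePi ρ := by
  rw [← pre_eq_integral hF h x]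
  unfold mdiff
  rw [Finset.sum_range_sub']
  rfl

/-- The covariance in terms of martingale differences. -/
lemma integral_sub_mul_eq_sum (hF : BM F) (hG : BM G) {N : ℕ} (h : Upto N F)
    (G' : ℕ → (ℕ → ℝ) → ℝ) (hG' : ∀ k, BM (G' k)) (hfree : ∀ k, Free k (G' k)) :
    ∫ x, (F x - ∫ x, F x ∂Measure.infinitePi ρ) * G x ∂Measure.infinitePi ρ
      = ∑ k ∈ Finset.range N, ∫ x, mdiff ρ k F x * (G x - G' k x) ∂Measure.infinitePi ρ := by
  simp_rw [← sum_mdiff hF h, Finset.sum_mul]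
  rw [integral_finsetSum _ fun k _ => ((hF.mdiff k).mul hG).integrable]
  refine Finset.sum_congr rfl fun k _ => ?_
  simp_rw [mul_sub]
  rw [integral_sub ((hF.mdiff k).mul hG).integrable ((hF.mdiff k).mul (hG' k)).integrable]
  -- The function G' k is free of the coordinate k, hence orthogonal to the k-th martingale
  -- difference, and may be subtracted for free. The choice of G' is left open because the Stein
  -- identity needs a nonlinear one.
  have := integral_mul_avg_eq_zero (hF.mdiff (ρ := ρ) k) (hG' k) (hfree k) (avg_mdiff hF k)
  simp_rw [mul_comm (mdiff ρ k F _) (G' k _)]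
  rw [this, sub_zero]

lemma abs_cov_le (hF : BM F) (hG : BM G) {N : ℕ} (h : Upto N F) :
    |∫ x, (F x - ∫ x, F x ∂Measure.infinitePi ρ) * G x ∂Measure.infinitePi ρ|
      ≤ ∑ k ∈ Finset.range N, lpNorm (res ρ k F) 2 (Measure.infinitePi ρ)
          * lpNorm (res ρ k G) 2 (Measure.infinitePi ρ) := by
  rw [integral_sub_mul_eq_sum hF hG h (fun k => avg ρ k G) (fun k => hG.avg (ρ := ρ)) fun k => free_avg]
  refine (Finset.abs_sum_le_sum_abs _ _).trans (Finset.sum_le_sum fun k _ => ?_)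
  refine (abs_integral_mul_le (hF.mdiff k) (hG.res (ρ := ρ) k)).trans ?_
  gcongr
  · exact lpNorm_nonneg
  · exact_mod_cast lpNorm_mdiff_le (q := 2) (by norm_num) hF k

/-! ### A moment inequality -/

/-- In the binomial expansion every term of degree at least two in y is dominated by the two extreme
ones, and the coefficients sum to at most 2^(2r) = 4^r. The linear term is kept exactly because its
integral will vanish. -/
lemma add_pow_even_le (r : ℕ) (hr : 1 ≤ r) (x y : ℝ) :
    (x + y) ^ (2 * r) ≤ x ^ (2 * r) + 2 * r * x ^ (2 * r - 1) * y
      + 4 ^ r * (x ^ (2 * r - 2) * y ^ 2 + y ^ (2 * r)) := by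
  obtain ⟨s, rfl⟩ : ∃ s, r = s + 1 := ⟨r - 1, by lia⟩
  have e : 2 * (s + 1) = 2 * s + 2 := by ring
  rw [add_comm x y, add_pow, e, Finset.sum_range_succ', Finset.sum_range_succ']
  have hb : ∀ j ∈ Finset.range (2 * s + 1),
      y ^ (j + 1 + 1) * x ^ (2 * s + 2 - (j + 1 + 1)) * ((2 * s + 2).choose (j + 1 + 1) : ℝ)
      ≤ (x ^ (2 * s) * y ^ 2 + y ^ (2 * s + 2)) * ((2 * s + 2).choose (j + 1 + 1) : ℝ) := by
    intro j hj
    have hj' : j ≤ 2 * s := by simpa [Nat.lt_succ_iff] using hj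
    gcongr
    have h0 : 2 * s + 2 - (j + 1 + 1) = 2 * s - j := by lia
    rw [h0]
    refine (le_abs_self _).trans ?_
    rw [abs_mul, abs_pow, abs_pow]
    have e1 : x ^ (2 * s) * y ^ 2 = |x| ^ (2 * s) * |y| ^ 2 := by
      rw [pow_mul, pow_mul, sq_abs, sq_abs]
    have e2 : y ^ (2 * s + 2) = |y| ^ (2 * s + 2) := by
      rw [show 2 * s + 2 = 2 * (s + 1) by ring, pow_mul, pow_mul, sq_abs]
    rw [e1, e2]
    rcases le_total |x| |y| with h | h
    · have : |y| ^ (j + 1 + 1) * |x| ^ (2 * s - j) ≤ |y| ^ (j + 1 + 1) * |y| ^ (2 * s - j) := by gcongr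
      rw [← pow_add, show j + 1 + 1 + (2 * s - j) = 2 * s + 2 by lia] at this
      have h3 : 0 ≤ |x| ^ (2 * s) * |y| ^ 2 := by positivity
      linarith
    · have : |y| ^ (j + 1 + 1) * |x| ^ (2 * s - j) ≤ |y| ^ 2 * (|x| ^ j * |x| ^ (2 * s - j)) := by
        rw [show j + 1 + 1 = 2 + j by ring, pow_add, mul_assoc]
        gcongr
      rw [← pow_add, show j + (2 * s - j) = 2 * s by lia] at this
      have h3 : 0 ≤ |y| ^ (2 * s + 2) := by positivity
      linarith
  have hs := Finset.sum_le_sum hb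
  rw [← Finset.mul_sum] at hs
  have hc : ∑ j ∈ Finset.range (2 * s + 1), ((2 * s + 2).choose (j + 1 + 1) : ℝ) ≤ 4 ^ (s + 1) := by
    have h1 : ∑ j ∈ Finset.range (2 * s + 2 + 1), (2 * s + 2).choose j = 2 ^ (2 * s + 2) :=
      Nat.sum_range_choose _
    rw [Finset.sum_range_succ', Finset.sum_range_succ'] at h1
    have h2 : (4 : ℝ) ^ (s + 1) = ((2 ^ (2 * s + 2) : ℕ) : ℝ) := by
      push_cast; rw [show 2 * s + 2 = 2 * (s + 1) by ring, pow_mul]; norm_num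
    rw [h2, ← h1]
    push_cast
    have : (0 : ℝ) ≤ ((2 * s + 2).choose (0 + 1) : ℝ) + ((2 * s + 2).choose 0 : ℝ) := by positivity
    linarith
  have hpos : 0 ≤ x ^ (2 * s) * y ^ 2 + y ^ (2 * s + 2) := by
    rw [show 2 * s + 2 = 2 * (s + 1) by ring, pow_mul, pow_mul]; positivity
  have hm := mul_le_mul_of_nonneg_left hc hpos
  simp only [zero_add, Nat.choose_one_right, pow_one, pow_zero, Nat.choose_zero_right, Nat.sub_zero,
    show 2 * s + 2 - 1 = 2 * s + 1 by lia, show 2 * s + 2 - 2 = 2 * s by lia] at hs ⊢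
  push_cast at hs ⊢
  linarith

/-- Reassembles the three terms of the expansion into one r-th power with coefficient 1 in front of
A, so that bounds add up when coordinates are released one after another. -/
lemma pow_add_mul_le (r : ℕ) (hr : 1 ≤ r) {A B : ℝ} (hA : 0 ≤ A) (hB : 0 ≤ B) :
    A ^ r + A ^ (r - 1) * B + B ^ r ≤ (A + 2 * B) ^ r := by
  induction r, hr using Nat.le_induction with
  | base => simp; linarith
  | succ r hr ih =>
    have h1 : A ^ (r - 1) * A = A ^ r := by
      rw [← pow_succ]; congr 1; lia
    rw [pow_succ (A + 2 * B)]
    refine le_trans ?_ (mul_le_mul_of_nonneg_right ih (by positivity))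
    simp only [Nat.add_sub_cancel, pow_succ]
    have h2 : 0 ≤ A ^ (r - 1) * B * B := by positivity
    have h3 : 0 ≤ A ^ r * B := by positivity
    have h4 : 0 ≤ B ^ r * A := by positivity
    have h5 : 0 ≤ B ^ r * B := by positivity
    have h6 : A ^ (r - 1) * B * A = A ^ r * B := by rw [← h1]; ring
    nlinarith

/-- One martingale step. The linear term vanishes by `h0`, and the mixed term is handled by Young's
inequality after X² and Y² are normalised by A and B, which is why both must be positive. Squared
norms grow additively, with the factor 4·4^r on the new increment only. -/
lemma integral_add_pow_le {μ : Measure (ℕ → ℝ)} [IsProbabilityMeasure μ] {r : ℕ} (hr : 1 ≤ r)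
    {X Y : (ℕ → ℝ) → ℝ} (hX : BM X) (hY : BM Y) {A B : ℝ} (hA : 0 < A) (hB : 0 < B)
    (hXA : ∫ x, X x ^ (2 * r) ∂μ ≤ A ^ r) (hYB : ∫ x, Y x ^ (2 * r) ∂μ ≤ B ^ r)
    (h0 : ∫ x, X x ^ (2 * r - 1) * Y x ∂μ = 0) :
    ∫ x, (X x + Y x) ^ (2 * r) ∂μ ≤ (A + 2 * (2 * 4 ^ r * B)) ^ r := by
  have hcross : ∫ x, X x ^ (2 * r - 2) * Y x ^ 2 ∂μ ≤ 2 * (A ^ (r - 1) * B) := by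
    have hpt : ∀ x, X x ^ (2 * r - 2) * Y x ^ 2
        ≤ (A ^ (r - 1) * B) * (X x ^ (2 * r) * (A ^ r)⁻¹ + Y x ^ (2 * r) * (B ^ r)⁻¹) := by
      intro x
      obtain ⟨s, rfl⟩ : ∃ s, r = s + 1 := ⟨r - 1, by lia⟩
      have e : 2 * (s + 1) - 2 = 2 * s := by lia
      rw [e, pow_mul, pow_mul, pow_mul, Nat.add_sub_cancel]
      set u := X x ^ 2 / A with hu
      set v := Y x ^ 2 / B with hv
      have hu0 : 0 ≤ u := by positivity
      have hv0 : 0 ≤ v := by positivity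
      have hX2 : X x ^ 2 = u * A := by rw [hu]; field_simp
      have hY2 : Y x ^ 2 = v * B := by rw [hv]; field_simp
      rw [hX2, hY2]
      have hrhs : A ^ s * B * ((u * A) ^ (s + 1) * (A ^ (s + 1))⁻¹ + (v * B) ^ (s + 1) * (B ^ (s + 1))⁻¹)
          = A ^ s * B * (u ^ (s + 1) + v ^ (s + 1)) := by
        rw [mul_pow, mul_pow]; field_simp
      rw [hrhs, mul_pow]
      have : u ^ s * v ≤ u ^ (s + 1) + v ^ (s + 1) := by
        rcases le_total u v with h | h
        · have : u ^ s * v ≤ v ^ s * v := by gcongr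
          have h2 : 0 ≤ u ^ (s + 1) := by positivity
          rw [pow_succ v]; linarith
        · have : u ^ s * v ≤ u ^ s * u := by gcongr
          have h2 : 0 ≤ v ^ (s + 1) := by positivity
          rw [pow_succ u]; linarith
      calc u ^ s * A ^ s * (v * B) = A ^ s * B * (u ^ s * v) := by ring
        _ ≤ _ := by gcongr
    have hi : Integrable (fun x => A ^ (r - 1) * B *
        (X x ^ (2 * r) * (A ^ r)⁻¹ + Y x ^ (2 * r) * (B ^ r)⁻¹)) μ :=
      (((hX.pow _).integrable.mul_const _).add ((hY.pow _).integrable.mul_const _)).const_mul _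
    refine (integral_mono ((hX.pow _).mul (hY.pow 2)).integrable hi hpt).trans ?_
    rw [integral_const_mul, integral_add ((hX.pow _).integrable.mul_const _)
      ((hY.pow _).integrable.mul_const _), integral_mul_const, integral_mul_const]
    have h1 : (∫ x, X x ^ (2 * r) ∂μ) * (A ^ r)⁻¹ ≤ 1 := by
      rw [← div_eq_mul_inv]; exact (div_le_one (by positivity)).2 hXA
    have h2 : (∫ x, Y x ^ (2 * r) ∂μ) * (B ^ r)⁻¹ ≤ 1 := by
      rw [← div_eq_mul_inv]; exact (div_le_one (by positivity)).2 hYB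
    have h3 : 0 ≤ A ^ (r - 1) * B := by positivity
    nlinarith
  have hI1 := (hX.pow (2 * r)).integrable (μ := μ)
  have hI2 : Integrable (fun x => 2 * r * (X x ^ (2 * r - 1) * Y x)) μ :=
    (((hX.pow (2 * r - 1)).mul hY).const_mul (2 * r)).integrable
  have hI3 : Integrable (fun x => 4 ^ r * (X x ^ (2 * r - 2) * Y x ^ 2 + Y x ^ (2 * r))) μ :=
    ((((hX.pow (2 * r - 2)).mul (hY.pow 2)).add (hY.pow (2 * r))).const_mul (4 ^ r)).integrable
  have hle : ∫ x, (X x + Y x) ^ (2 * r) ∂μ ≤ ∫ x, (X x ^ (2 * r) + 2 * r * (X x ^ (2 * r - 1) * Y x)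
      + 4 ^ r * (X x ^ (2 * r - 2) * Y x ^ 2 + Y x ^ (2 * r))) ∂μ := by
    refine integral_mono ((hX.add hY).pow _).integrable ((hI1.add hI2).add hI3) fun x => ?_
    refine (add_pow_even_le r hr (X x) (Y x)).trans (le_of_eq ?_)
    ring
  refine hle.trans ?_
  have e1 : ∫ x, (X x ^ (2 * r) + 2 * r * (X x ^ (2 * r - 1) * Y x)
      + 4 ^ r * (X x ^ (2 * r - 2) * Y x ^ 2 + Y x ^ (2 * r))) ∂μ
      = ∫ x, X x ^ (2 * r) ∂μ + 4 ^ r * (∫ x, X x ^ (2 * r - 2) * Y x ^ 2 ∂μ + ∫ x, Y x ^ (2 * r) ∂μ) := by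
    rw [integral_add (f := fun x => X x ^ (2 * r) + 2 * r * (X x ^ (2 * r - 1) * Y x)) (hI1.add hI2) hI3,
      integral_add hI1 hI2, integral_const_mul, h0, integral_const_mul,
      integral_add ((hX.pow _).mul (hY.pow 2)).integrable (hY.pow _).integrable]
    ring
  rw [e1]
  refine le_trans ?_ (pow_add_mul_le r hr hA.le (B := 2 * 4 ^ r * B) (by positivity))
  have h4 : (4 : ℝ) ^ r * B ^ r ≤ (2 * 4 ^ r * B) ^ r := by
    rw [← mul_pow]
    have : (4 : ℝ) ≤ 2 * 4 ^ r := by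
      have : (4 : ℝ) ^ 1 ≤ 4 ^ r := pow_le_pow_right₀ (by norm_num) hr
      linarith
    gcongr
  have h5 := mul_le_mul_of_nonneg_left hcross (by positivity : (0 : ℝ) ≤ 4 ^ r)
  have h6 := mul_le_mul_of_nonneg_left hYB (by positivity : (0 : ℝ) ≤ 4 ^ r)
  nlinarith

/-- A Burkholder-type inequality in which the square function is replaced by the sum of the squared
norms of the single-coordinate effects. It underlies every moment and variance bound for the errors.
-/
lemma lpNorm_sub_integral_sq_le {r : ℕ} (hr : 1 ≤ r) (hF : BM F) {N : ℕ} (h : Upto N F) :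
    lpNorm (fun x => F x - ∫ x, F x ∂Measure.infinitePi ρ) (2 * r : ℕ) (Measure.infinitePi ρ) ^ 2
      ≤ 4 * 4 ^ r * ∑ k ∈ Finset.range N,
        lpNorm (res ρ k F) (2 * r : ℕ) (Measure.infinitePi ρ) ^ 2 := by
  set μ := Measure.infinitePi ρ with hμ
  set c := ∫ x, F x ∂μ with hc
  have h2r : 2 * r ≠ 0 := by lia
  have habs : ∀ a : ℝ, |a| ^ (2 * r) = a ^ (2 * r) := fun a => by rw [pow_mul, sq_abs, ← pow_mul]
  -- The induction releases one coordinate at a time, starting from `pre ρ N F`, which is constant.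
  -- The parameter η keeps the bounds of the one-step lemma positive and is sent to zero at the end.
  have key : ∀ η : ℝ, 0 < η → ∀ t ≤ N, ∫ x, (pre ρ (N - t) F x - c) ^ (2 * r) ∂μ ≤
      (η + 4 * 4 ^ r * ∑ k ∈ Finset.Ico (N - t) N, (lpNorm (res ρ k F) (2 * r : ℕ) μ ^ 2 + η)) ^ r := by
    intro η hη t
    induction t with
    | zero =>
      intro _
      simp only [Nat.sub_zero, pre_eq_integral hF h, ← hc, ← hμ, sub_self, Finset.Ico_self,
        Finset.sum_empty, mul_zero, add_zero]
      simp only [zero_pow h2r, integral_zero]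
      positivity
    | succ t ih =>
      intro ht
      have ih := ih (by lia)
      set s := N - (t + 1) with hs
      have hs1 : N - t = s + 1 := by lia
      rw [hs1] at ih
      have hX : BM fun x => pre ρ (s + 1) F x - c := (hF.pre _).sub (BM.const c)
      have hYB : ∫ x, mdiff ρ s F x ^ (2 * r) ∂μ ≤ (lpNorm (res ρ s F) (2 * r : ℕ) μ ^ 2 + η) ^ r := by
        have h1 := lpNorm_mdiff_le (ρ := ρ) (q := 2 * r) (by lia) hF s
        have h2 := lpNorm_pow_eq_integral (μ := μ) h2r (hF.mdiff (ρ := ρ) s)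
        simp only [habs] at h2
        rw [← h2, pow_mul]
        refine pow_le_pow_left₀ (by positivity) ?_ r
        have : lpNorm (mdiff ρ s F) (2 * r : ℕ) μ ^ 2 ≤ lpNorm (res ρ s F) (2 * r : ℕ) μ ^ 2 :=
          pow_le_pow_left₀ lpNorm_nonneg h1 2
        linarith
      have hfree : Free s fun x => (pre ρ (s + 1) F x - c) ^ (2 * r - 1) := fun x y => by
        have := free_pre (ρ := ρ) (F := F) (Nat.lt_succ_self s) x y
        simp only [Nat.succ_eq_add_one] at this
        simp only [this]
      have hS0 : 0 ≤ ∑ k ∈ Finset.Ico (s + 1) N, (lpNorm (res ρ k F) (2 * r : ℕ) μ ^ 2 + η) :=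
        Finset.sum_nonneg fun k _ => by positivity
      have := integral_add_pow_le (μ := μ) hr hX (hF.mdiff (ρ := ρ) s) (by positivity)
        (B := lpNorm (res ρ s F) (2 * r : ℕ) μ ^ 2 + η) (by positivity) ih hYB
        (integral_mul_avg_eq_zero (hF.mdiff s) (hX.pow _) hfree (avg_mdiff hF s))
      have e : ∀ x, pre ρ (s + 1) F x - c + mdiff ρ s F x = pre ρ s F x - c := fun x => by
        simp only [mdiff]; ring
      simp only [e] at this
      refine this.trans (le_of_eq ?_)
      rw [Finset.sum_eq_sum_Ico_succ_bot (a := s) (by lia)]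
      congr 1
      ring
  have hBM : BM fun x => F x - c := hF.sub (BM.const c)
  set Z := lpNorm (fun x => F x - c) (2 * r : ℕ) μ with hZ
  have hlim : ∀ η : ℝ, 0 < η → Z ^ 2 ≤ η + 4 * 4 ^ r *
      ∑ k ∈ Finset.range N, (lpNorm (res ρ k F) (2 * r : ℕ) μ ^ 2 + η) := by
    intro η hη
    have := key η hη N le_rfl
    simp only [Nat.sub_self, pre] at this
    have h2 := lpNorm_pow_eq_integral (μ := μ) h2r hBM
    simp only [habs] at h2
    rw [← h2, pow_mul, ← Finset.range_eq_Ico] at this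
    have hS0 : 0 ≤ ∑ k ∈ Finset.range N, (lpNorm (res ρ k F) (2 * r : ℕ) μ ^ 2 + η) :=
      Finset.sum_nonneg fun k _ => by positivity
    exact le_of_pow_le_pow_left₀ (by lia) (by positivity) this
  have ht : Tendsto (fun η : ℝ => η + 4 * 4 ^ r *
      ∑ k ∈ Finset.range N, (lpNorm (res ρ k F) (2 * r : ℕ) μ ^ 2 + η)) (𝓝[>] 0)
      (𝓝 (0 + 4 * 4 ^ r * ∑ k ∈ Finset.range N, (lpNorm (res ρ k F) (2 * r : ℕ) μ ^ 2 + 0))) := by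
    refine Tendsto.mono_left ?_ nhdsWithin_le_nhds
    exact (Continuous.tendsto (by fun_prop) 0)
  simp only [zero_add, add_zero] at ht
  exact ge_of_tendsto ht (eventually_nhdsWithin_of_forall fun η hη => hlim η hη)

end RidgeBootstrap

namespace RidgeBootstrap

set_option linter.unusedSectionVars false

/-! ### Moment and variance bounds for linear and quadratic forms -/

/-- Schur's test: a nonnegative matrix with row and column sums at most R has operator norm at most
R. It follows from Cauchy–Schwarz with weights √d. -/
lemma sum_sq_weighted_le {ι : Type*} [Fintype ι] (N : ℕ) (d : ι → ℕ → ℝ) (hd : ∀ l k, 0 ≤ d l k)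
    {R : ℝ} (hR : 0 ≤ R) (hrow : ∀ l, ∑ k ∈ Finset.range N, d l k ≤ R) (hcol : ∀ k, ∑ l, d l k ≤ R)
    (a : ι → ℝ) :
    ∑ k ∈ Finset.range N, (∑ l, |a l| * d l k) ^ 2 ≤ R ^ 2 * ∑ l, a l ^ 2 := by
  have h1 : ∀ k, (∑ l, |a l| * d l k) ^ 2 ≤ R * ∑ l, a l ^ 2 * d l k := by
    intro k
    have := Finset.sum_mul_sq_le_sq_mul_sq Finset.univ (fun l => √(d l k)) (fun l => |a l| * √(d l k))
    have e1 : ∀ l, √(d l k) * (|a l| * √(d l k)) = |a l| * d l k := fun l => by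
      rw [mul_left_comm, Real.mul_self_sqrt (hd l k)]
    have e2 : ∀ l, (|a l| * √(d l k)) ^ 2 = a l ^ 2 * d l k := fun l => by
      rw [mul_pow, Real.sq_sqrt (hd l k), sq_abs]
    simp only [e1, e2, Real.sq_sqrt (hd _ k)] at this
    refine this.trans ?_
    gcongr
    · exact Finset.sum_nonneg fun l _ => mul_nonneg (sq_nonneg _) (hd l k)
    · exact hcol k
  refine (Finset.sum_le_sum fun k _ => h1 k).trans ?_
  rw [← Finset.mul_sum, Finset.sum_comm, sq, mul_assoc]
  gcongr
  rw [Finset.mul_sum]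
  refine Finset.sum_le_sum fun l _ => ?_
  rw [← Finset.mul_sum, mul_comm]
  gcongr
  exact hrow l

variable {ρ : ℕ → Measure ℝ} [∀ k, IsProbabilityMeasure (ρ k)]
variable {ι : Type*} [Fintype ι] {h : ι → (ℕ → ℝ) → ℝ} {d : ι → ℕ → ℝ} {N : ℕ} {R : ℝ} {q : ℕ}

lemma BM.linear (hh : ∀ l, BM (h l)) (a : ι → ℝ) : BM fun x => ∑ l, a l * h l x :=
  BM.sum fun l _ => (hh l).const_mul _

lemma res_linear (hh : ∀ l, BM (h l)) (a : ι → ℝ) (k : ℕ) :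
    res ρ k (fun x => ∑ l, a l * h l x) = fun x => ∑ l, a l * res ρ k (h l) x := by
  ext x
  simp only [res, avg_sum fun l _ => (hh l).const_mul (a l), avg_const_mul, mul_sub,
    Finset.sum_sub_distrib]

lemma lpNorm_res_linear_le (hq : 1 ≤ q) (hh : ∀ l, BM (h l))
    (hd : ∀ l k, lpNorm (res ρ k (h l)) q (Measure.infinitePi ρ) ≤ d l k) (a : ι → ℝ) (k : ℕ) :
    lpNorm (res ρ k (fun x => ∑ l, a l * h l x)) q (Measure.infinitePi ρ) ≤ ∑ l, |a l| * d l k := by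
  rw [res_linear hh]
  refine (lpNorm_sum_le_of_bm hq fun l _ => ((hh l).res k).const_mul _).trans
    (Finset.sum_le_sum fun l _ => ?_)
  rw [lpNorm_const_mul']
  gcongr
  exact hd l k

lemma Upto.linear (hu : ∀ l, Upto N (h l)) (a : ι → ℝ) : Upto N fun x => ∑ l, a l * h l x := by
  intro x y hxy
  exact Finset.sum_congr rfl fun l _ => by rw [hu l hxy]

lemma integral_linear_eq_zero (hh : ∀ l, BM (h l)) (h0 : ∀ l, ∫ x, h l x ∂Measure.infinitePi ρ = 0)
    (a : ι → ℝ) : ∫ x, ∑ l, a l * h l x ∂Measure.infinitePi ρ = 0 := by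
  rw [integral_finsetSum _ fun l _ => ((hh l).const_mul _).integrable]
  simp [integral_const_mul, h0]

lemma lpNorm_linear_sq_le {r : ℕ} (hr : 1 ≤ r) (hh : ∀ l, BM (h l)) (hu : ∀ l, Upto N (h l))
    (h0 : ∀ l, ∫ x, h l x ∂Measure.infinitePi ρ = 0) (hd0 : ∀ l k, 0 ≤ d l k)
    (hd : ∀ l k, lpNorm (res ρ k (h l)) (2 * r : ℕ) (Measure.infinitePi ρ) ≤ d l k)
    (hR : 0 ≤ R) (hrow : ∀ l, ∑ k ∈ Finset.range N, d l k ≤ R) (hcol : ∀ k, ∑ l, d l k ≤ R)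
    (a : ι → ℝ) :
    lpNorm (fun x => ∑ l, a l * h l x) (2 * r : ℕ) (Measure.infinitePi ρ) ^ 2
      ≤ 4 * 4 ^ r * R ^ 2 * ∑ l, a l ^ 2 := by
  have := lpNorm_sub_integral_sq_le (ρ := ρ) hr (BM.linear hh a) (Upto.linear hu a)
  simp only [integral_linear_eq_zero hh h0, sub_zero] at this
  refine this.trans ?_
  rw [mul_assoc (4 * 4 ^ r)]
  gcongr
  refine le_trans (Finset.sum_le_sum fun k _ => ?_) (sum_sq_weighted_le N d hd0 hR hrow hcol a)
  exact pow_le_pow_left₀ lpNorm_nonneg (lpNorm_res_linear_le (by lia) hh hd a k) 2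

lemma lpNorm_four_linear_le (hh : ∀ l, BM (h l)) (hu : ∀ l, Upto N (h l))
    (h0 : ∀ l, ∫ x, h l x ∂Measure.infinitePi ρ = 0) (hd0 : ∀ l k, 0 ≤ d l k)
    (hd : ∀ l k, lpNorm (res ρ k (h l)) 4 (Measure.infinitePi ρ) ≤ d l k)
    (hR : 0 ≤ R) (hrow : ∀ l, ∑ k ∈ Finset.range N, d l k ≤ R) (hcol : ∀ k, ∑ l, d l k ≤ R)
    (a : ι → ℝ) :
    lpNorm (fun x => ∑ l, a l * h l x) 4 (Measure.infinitePi ρ) ≤ 8 * R * √(∑ l, a l ^ 2) := by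
  have := lpNorm_linear_sq_le (r := 2) (by norm_num) hh hu h0 hd0 (by exact_mod_cast hd) hR hrow hcol a
  refine abs_le_of_sq_le_sq' ?_ (by positivity) |>.2
  rw [mul_pow, Real.sq_sqrt (Finset.sum_nonneg fun l _ => sq_nonneg _)]
  norm_num at this ⊢
  linarith

/-- A product rule for `res`: FG is compared with the product of the averages of F and G, and the
difference splits as (res F)·G + (avg F)·(res G). -/
lemma lpNorm_res_mul_le {F G : (ℕ → ℝ) → ℝ} (hF : BM F) (hG : BM G) (k : ℕ) :
    lpNorm (res ρ k fun x => F x * G x) 2 (Measure.infinitePi ρ)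
      ≤ 2 * (lpNorm (res ρ k F) 4 (Measure.infinitePi ρ) * lpNorm G 4 (Measure.infinitePi ρ)
        + lpNorm F 4 (Measure.infinitePi ρ) * lpNorm (res ρ k G) 4 (Measure.infinitePi ρ)) := by
  have hfree : Free k fun x => avg ρ k F x * avg ρ k G x := fun x y => by
    simp only [free_avg (F := F) x y, free_avg (F := G) x y]
  have h1 := lpNorm_res_le_of_free (ρ := ρ) (q := 2) (by norm_num) (hF.mul hG)
    (hF.avg.mul hG.avg) hfree
  refine le_trans (by exact_mod_cast h1) ?_
  gcongr
  have e : (fun x => F x * G x - avg ρ k F x * avg ρ k G x)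
      = fun x => res ρ k F x * G x + avg ρ k F x * res ρ k G x := by
    ext x; simp only [res]; ring
  rw [e]
  refine le_trans (by exact_mod_cast lpNorm_add_le_of_bm (q := 2) (by norm_num) ((hF.res k).mul hG)) ?_
  gcongr
  · exact lpNorm_two_mul_le (hF.res k) hG
  · refine (lpNorm_two_mul_le hF.avg (hG.res k)).trans ?_
    gcongr
    · exact lpNorm_nonneg
    · exact_mod_cast lpNorm_avg_le ρ (q := 4) (by norm_num) hF k

/-- The product rule for a double sum. Each effect `res ρ k (h l)` is multiplied by a whole linear
form, with coefficients either row l or column l of a. The L⁴ norm of that form is of the order of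
the Euclidean length of the row or column, so no sum of absolute values of a is ever taken. -/
lemma lpNorm_res_quadratic_le (hh : ∀ l, BM (h l)) (hu : ∀ l, Upto N (h l))
    (h0 : ∀ l, ∫ x, h l x ∂Measure.infinitePi ρ = 0) (hd0 : ∀ l k, 0 ≤ d l k)
    (hd : ∀ l k, lpNorm (res ρ k (h l)) 4 (Measure.infinitePi ρ) ≤ d l k)
    (hR : 0 ≤ R) (hrow : ∀ l, ∑ k ∈ Finset.range N, d l k ≤ R) (hcol : ∀ k, ∑ l, d l k ≤ R)
    (a : ι → ι → ℝ) (k : ℕ) :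
    lpNorm (res ρ k fun x => ∑ l, ∑ l', a l l' * (h l x * h l' x)) 2 (Measure.infinitePi ρ)
      ≤ 16 * R * ∑ l, |√(∑ l', a l l' ^ 2) + √(∑ l', a l' l ^ 2)| * d l k := by
  have hA : ∀ l, BM (avg ρ k (h l)) := fun l => (hh l).avg
  have hfree : Free k fun x => ∑ l, ∑ l', a l l' * (avg ρ k (h l) x * avg ρ k (h l') x) := by
    intro x y
    refine Finset.sum_congr rfl fun l _ => Finset.sum_congr rfl fun l' _ => ?_
    rw [free_avg (F := h l) x y, free_avg (F := h l') x y]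
  have hQ : ∀ {g : ι → (ℕ → ℝ) → ℝ}, (∀ l, BM (g l)) →
      BM fun x => ∑ l, ∑ l', a l l' * (g l x * g l' x) := fun hg =>
    BM.sum fun l _ => BM.sum fun l' _ => ((hg l).mul (hg l')).const_mul _
  have h1 := lpNorm_res_le_of_free (ρ := ρ) (q := 2) (by norm_num) (hQ hh) (hQ hA) hfree
  refine le_trans (by exact_mod_cast h1) ?_
  have e : (fun x => ∑ l, ∑ l', a l l' * (h l x * h l' x)
        - ∑ l, ∑ l', a l l' * (avg ρ k (h l) x * avg ρ k (h l') x))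
      = fun x => ∑ l, (res ρ k (h l) x * (∑ l', a l l' * h l' x)
        + avg ρ k (fun x => ∑ l', a l' l * h l' x) x * res ρ k (h l) x) := by
    ext x
    simp only [avg_sum fun l' _ => (hh l').const_mul (a l' _), avg_const_mul]
    rw [Finset.sum_add_distrib]
    simp only [Finset.mul_sum, Finset.sum_mul]
    rw [Finset.sum_comm (f := fun l i => a i l * avg ρ k (h i) x * res ρ k (h l) x)]
    simp only [← Finset.sum_sub_distrib, ← Finset.sum_add_distrib]
    refine Finset.sum_congr rfl fun l _ => Finset.sum_congr rfl fun l' _ => ?_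
    simp only [res]; ring
  rw [e]
  have hL := lpNorm_four_linear_le hh hu h0 hd0 hd hR hrow hcol
  have hb1 : ∀ l, BM fun x => res ρ k (h l) x * (∑ l', a l l' * h l' x) := fun l =>
    ((hh l).res k).mul (BM.linear hh _)
  have hb2 : ∀ l, BM fun x => avg ρ k (fun x => ∑ l', a l' l * h l' x) x * res ρ k (h l) x := fun l =>
    (BM.linear hh _).avg.mul ((hh l).res k)
  have h2 : lpNorm (fun x => ∑ l, (res ρ k (h l) x * (∑ l', a l l' * h l' x)
        + avg ρ k (fun x => ∑ l', a l' l * h l' x) x * res ρ k (h l) x)) 2 (Measure.infinitePi ρ)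
      ≤ ∑ l, 8 * R * (|√(∑ l', a l l' ^ 2) + √(∑ l', a l' l ^ 2)| * d l k) := by
    refine le_trans (by exact_mod_cast lpNorm_sum_le_of_bm (q := 2) (by norm_num) fun l _ => (hb1 l).add (hb2 l)) (Finset.sum_le_sum fun l _ => ?_)
    refine le_trans (by exact_mod_cast lpNorm_add_le_of_bm (q := 2) (by norm_num) (hb1 l)) ?_
    have i1 := lpNorm_two_mul_le (μ := Measure.infinitePi ρ) ((hh l).res (ρ := ρ) k)
      (BM.linear hh fun l' => a l l')
    have i2 := lpNorm_two_mul_le (μ := Measure.infinitePi ρ)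
      ((BM.linear hh fun l' => a l' l).avg (ρ := ρ) (k := k)) ((hh l).res (ρ := ρ) k)
    have i3 : lpNorm (avg ρ k fun x => ∑ l', a l' l * h l' x) 4 (Measure.infinitePi ρ)
        ≤ lpNorm (fun x => ∑ l', a l' l * h l' x) 4 (Measure.infinitePi ρ) := by
      exact_mod_cast lpNorm_avg_le ρ (q := 4) (by norm_num) (BM.linear hh fun l' => a l' l) k
    have j1 := mul_le_mul (hd l k) (hL fun l' => a l l') lpNorm_nonneg (hd0 l k)
    have j2 := mul_le_mul (i3.trans (hL fun l' => a l' l)) (hd l k) lpNorm_nonneg (by positivity)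
    rw [abs_of_nonneg (by positivity)]
    refine (add_le_add (i1.trans j1) (i2.trans j2)).trans (le_of_eq ?_)
    ring
  rw [← Finset.mul_sum] at h2
  linarith

/-- The variance of a quadratic form. -/
lemma lpNorm_quadratic_sq_le (hh : ∀ l, BM (h l)) (hu : ∀ l, Upto N (h l))
    (h0 : ∀ l, ∫ x, h l x ∂Measure.infinitePi ρ = 0) (hd0 : ∀ l k, 0 ≤ d l k)
    (hd : ∀ l k, lpNorm (res ρ k (h l)) 4 (Measure.infinitePi ρ) ≤ d l k)
    (hR : 0 ≤ R) (hrow : ∀ l, ∑ k ∈ Finset.range N, d l k ≤ R) (hcol : ∀ k, ∑ l, d l k ≤ R)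
    (a : ι → ι → ℝ) :
    lpNorm (fun x => ∑ l, ∑ l', a l l' * (h l x * h l' x)
        - ∫ x, ∑ l, ∑ l', a l l' * (h l x * h l' x) ∂Measure.infinitePi ρ) 2 (Measure.infinitePi ρ) ^ 2
      ≤ 16384 * R ^ 4 * ∑ l, ∑ l', a l l' ^ 2 := by
  have hQ : BM fun x => ∑ l, ∑ l', a l l' * (h l x * h l' x) :=
    BM.sum fun l _ => BM.sum fun l' _ => ((hh l).mul (hh l')).const_mul _
  have hU : Upto N fun x => ∑ l, ∑ l', a l l' * (h l x * h l' x) := fun x y hxy =>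
    Finset.sum_congr rfl fun l _ => Finset.sum_congr rfl fun l' _ => by
      rw [hu l hxy, hu l' hxy]
  have h1 := lpNorm_sub_integral_sq_le (ρ := ρ) (r := 1) le_rfl hQ hU
  norm_num at h1
  refine h1.trans ?_
  set β : ι → ℝ := fun l => √(∑ l', a l l' ^ 2) + √(∑ l', a l' l ^ 2) with hβ
  have h2 : ∀ k ∈ Finset.range N,
      lpNorm (res ρ k fun x => ∑ l, ∑ l', a l l' * (h l x * h l' x)) 2 (Measure.infinitePi ρ) ^ 2
      ≤ (16 * R) ^ 2 * (∑ l, |β l| * d l k) ^ 2 := by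
    intro k _
    rw [← mul_pow]
    exact pow_le_pow_left₀ lpNorm_nonneg
      (lpNorm_res_quadratic_le hh hu h0 hd0 hd hR hrow hcol a k) 2
  have h3 := Finset.sum_le_sum h2
  rw [← Finset.mul_sum] at h3
  have h4 := sum_sq_weighted_le N d hd0 hR hrow hcol β
  have h5 : ∑ l, β l ^ 2 ≤ 4 * ∑ l, ∑ l', a l l' ^ 2 := by
    have : ∀ l, β l ^ 2 ≤ 2 * ∑ l', a l l' ^ 2 + 2 * ∑ l', a l' l ^ 2 := by
      intro l
      have s1 := Real.sq_sqrt (Finset.sum_nonneg fun l' (_ : l' ∈ Finset.univ) => sq_nonneg (a l l'))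
      have s2 := Real.sq_sqrt (Finset.sum_nonneg fun l' (_ : l' ∈ Finset.univ) => sq_nonneg (a l' l))
      rw [← s1, ← s2, hβ]
      simp only
      nlinarith [sq_nonneg (√(∑ l', a l l' ^ 2) - √(∑ l', a l' l ^ 2))]
    refine (Finset.sum_le_sum fun l _ => this l).trans ?_
    rw [Finset.sum_add_distrib, ← Finset.mul_sum, ← Finset.mul_sum,
      Finset.sum_comm (f := fun l l' => a l' l ^ 2)]
    linarith
  have h6 : (16 * R) ^ 2 * ∑ k ∈ Finset.range N, (∑ l, |β l| * d l k) ^ 2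
      ≤ (16 * R) ^ 2 * (R ^ 2 * (4 * ∑ l, ∑ l', a l l' ^ 2)) := by
    gcongr
    exact h4.trans (by gcongr)
  -- 16384 = 16·256·4: the moment inequality with r = 1, the squared constant of the product rule,
  -- and the bound of Σ β² by the squared entries of a.
  refine (mul_le_mul_of_nonneg_left (h3.trans h6) (by norm_num)).trans (le_of_eq ?_)
  ring

/-! ### Normal approximation -/

/-- The mean value inequality for x ↦ f x − f'(a)x, whose derivative is at most |a − b| between a
and b. -/
lemma abs_sub_sub_deriv_mul_le {f f' : ℝ → ℝ} (hf : ∀ x, HasDerivAt f (f' x) x)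
    (hL : ∀ x y, |f' x - f' y| ≤ |x - y|) (a b : ℝ) :
    |f a - f b - f' a * (a - b)| ≤ (a - b) ^ 2 := by
  have := Convex.norm_image_sub_le_of_norm_hasDerivWithin_le (f := fun x => f x - f' a * x)
    (f' := fun x => f' x - f' a) (s := Set.uIcc a b) (C := |a - b|) (x := b) (y := a)
    (fun x _ => ((hf x).sub (by simpa using (hasDerivAt_id x).const_mul (f' a))).hasDerivWithinAt)
    (fun x hx => (hL x a).trans (Set.abs_sub_left_of_mem_uIcc hx |>.trans (by rw [abs_sub_comm])))
    (convex_uIcc a b) Set.right_mem_uIcc Set.left_mem_uIcc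
  simp only [Real.norm_eq_abs] at this
  rw [abs_mul_abs_self, ← sq] at this
  refine le_trans (le_of_eq ?_) this
  congr 1; ring

/-- The equation y' = −t s y holds up to ε. The integrating factor exp(st²/2) is at most exp(s/2) on
[0,1], and dividing by its final value leaves exactly ε, however large s is. -/
lemma abs_sub_exp_le_of_deriv {y y' : ℝ → ℝ} {s ε : ℝ} (hs : 0 ≤ s)
    (hy : ∀ t, HasDerivAt y (y' t) t) (h : ∀ t ∈ Set.Icc (0 : ℝ) 1, |y' t + t * s * y t| ≤ ε) :
    |y 1 - Real.exp (-(s / 2)) * y 0| ≤ ε := by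
  have hw : ∀ t, HasDerivAt (fun t => Real.exp (s * t ^ 2 / 2) * y t)
      (Real.exp (s * t ^ 2 / 2) * (y' t + t * s * y t)) t := by
    intro t
    have h1 : HasDerivAt (fun t : ℝ => s * t ^ 2 / 2) (s * t) t := by
      have := (((hasDerivAt_id t).pow 2).const_mul s).div_const 2
      refine this.congr_deriv ?_
      simp; ring
    refine (h1.exp.mul (hy t)).congr_deriv ?_
    ring
  have := (convex_Icc (0 : ℝ) 1).norm_image_sub_le_of_norm_hasDerivWithin_le
    (fun t _ => (hw t).hasDerivWithinAt) (C := Real.exp (s / 2) * ε) (fun t ht => by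
      rw [norm_mul, Real.norm_eq_abs, Real.norm_eq_abs, abs_of_pos (Real.exp_pos _)]
      have : s * t ^ 2 / 2 ≤ s / 2 := by
        have : t ^ 2 ≤ 1 := pow_le_one₀ ht.1 ht.2
        nlinarith
      gcongr
      exact h t ht) (x := 0) (y := 1) (by simp) (by simp)
  simp only [Real.norm_eq_abs] at this
  norm_num at this
  have e : Real.exp (s / 2) * y 1 - y 0 = Real.exp (s / 2) * (y 1 - Real.exp (-(s / 2)) * y 0) := by
    rw [mul_sub, ← mul_assoc, ← Real.exp_add]; simp
  rw [e, abs_mul, abs_of_pos (Real.exp_pos _)] at this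
  exact le_of_mul_le_mul_left this (Real.exp_pos _)

lemma integral_abs_mul_sq_le {μ : Measure (ℕ → ℝ)} [IsProbabilityMeasure μ] {F G : (ℕ → ℝ) → ℝ}
    (hF : BM F) (hG : BM G) :
    ∫ x, |F x| * G x ^ 2 ∂μ ≤ lpNorm F 2 μ * lpNorm G 4 μ ^ 2 := by
  have h1 := (le_abs_self _).trans (abs_integral_mul_le (μ := μ) hF.abs (hG.pow 2))
  rw [lpNorm_fun_abs hF.1.aestronglyMeasurable] at h1
  refine h1.trans ?_
  gcongr
  · exact lpNorm_nonneg
  · have := lpNorm_two_mul_le (μ := μ) hG hG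
    simpa [sq] using this

section stein

variable (v : ι → ℝ) {V W : ℝ}

/-- The Stein identity up to an error term. -/
lemma abs_integral_mul_sub_le (hh : ∀ l, BM (h l)) (hu : ∀ l, Upto N (h l))
    (h0 : ∀ l, ∫ x, h l x ∂Measure.infinitePi ρ = 0) (hd0 : ∀ l k, 0 ≤ d l k)
    (hd : ∀ l k, lpNorm (res ρ k (h l)) 4 (Measure.infinitePi ρ) ≤ d l k)
    (hR : 0 ≤ R) (hrow : ∀ l, ∑ k ∈ Finset.range N, d l k ≤ R) (hcol : ∀ k, ∑ l, d l k ≤ R)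
    (hW : 0 ≤ W)
    (hmrow : ∀ l, ∑ k ∈ Finset.range N, ∑ j ∈ Finset.range N, min (d l j) (d l k) ≤ W)
    (hmcol : ∀ k, ∑ l, ∑ j ∈ Finset.range N, min (d l j) (d l k) ≤ W)
    (hV : ∀ l, |v l| ≤ V) (hV0 : 0 ≤ V)
    {f f' : ℝ → ℝ} (hf : ∀ x, HasDerivAt f (f' x) x) (hf'm : Measurable f')
    (hL : ∀ x y, |f' x - f' y| ≤ |x - y|) (hf1 : ∀ x, |f x| ≤ 1) (hf'1 : ∀ x, |f' x| ≤ 1) :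
    |∫ x, (∑ l, v l * h l x) * f (∑ l, v l * h l x) ∂Measure.infinitePi ρ
      - (∫ x, (∑ l, v l * h l x) ^ 2 ∂Measure.infinitePi ρ)
        * ∫ x, f' (∑ l, v l * h l x) ∂Measure.infinitePi ρ|
      ≤ V * (32 * R * W * √(∑ l, v l ^ 2) + R ^ 3 * ∑ l, v l ^ 2) := by
  set μ := Measure.infinitePi ρ with hμ
  set S : (ℕ → ℝ) → ℝ := fun x => ∑ l, v l * h l x with hS
  set g : ℕ → ℝ := fun k => ∑ l, |v l| * d l k with hg
  have hSB : BM S := BM.linear hh v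
  have hSU : Upto N S := Upto.linear hu v
  have hS0 : ∫ x, S x ∂μ = 0 := integral_linear_eq_zero hh h0 v
  have hfm : Measurable f := (continuous_iff_continuousAt.2 fun x => (hf x).continuousAt).measurable
  have hg0 : ∀ k, 0 ≤ g k := fun k => Finset.sum_nonneg fun l _ => mul_nonneg (abs_nonneg _) (hd0 l k)
  have hgV : ∀ k, g k ≤ V * R := by
    intro k
    calc g k ≤ ∑ l, V * d l k := Finset.sum_le_sum fun l _ =>
          mul_le_mul_of_nonneg_right (hV l) (hd0 l k)
      _ = V * ∑ l, d l k := by rw [Finset.mul_sum]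
      _ ≤ V * R := by gcongr; exact hcol k
  have hres4 : ∀ k, lpNorm (res ρ k S) 4 μ ≤ g k := fun k => by
    exact_mod_cast lpNorm_res_linear_le (q := 4) (by norm_num) hh (by exact_mod_cast hd) v k
  have hm4 : ∀ k, lpNorm (mdiff ρ k S) 4 μ ≤ g k := fun k =>
    le_trans (by exact_mod_cast lpNorm_mdiff_le (q := 4) (by norm_num) hSB k) (hres4 k)
  have hm2 : ∀ k, lpNorm (mdiff ρ k S) 2 μ ≤ g k := fun k =>
    le_trans (by exact_mod_cast lpNorm_mono_exp (p := 2) (q := 4) (by norm_num) (hSB.mdiff k)) (hm4 k)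
  have hgsq : ∑ k ∈ Finset.range N, g k ^ 2 ≤ R ^ 2 * ∑ l, v l ^ 2 :=
    sum_sq_weighted_le N d hd0 hR hrow hcol v
  -- T is the random version of E S² in Stein's identity: its mean is exactly E S², and its variance
  -- is small because changing one coordinate affects few of its summands strongly.
  set T : (ℕ → ℝ) → ℝ := fun x => ∑ k ∈ Finset.range N, mdiff ρ k S x * res ρ k S x with hT
  have hTB : BM T := BM.sum fun k _ => (hSB.mdiff k).mul (hSB.res k)
  have hTU : Upto N T := fun x y hxy => Finset.sum_congr rfl fun k _ => by
    simp only [mdiff, res, hSU.pre k hxy, hSU.pre (k + 1) hxy, hSU hxy, hSU.avg k hxy]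
  have hfSB : BM fun x => f (S x) := BM.bounded_comp hfm hf1 hSB.1
  have hf'SB : BM fun x => f' (S x) := BM.bounded_comp hf'm hf'1 hSB.1
  -- the mean of `T`
  have hET : ∫ x, T x ∂μ = ∫ x, S x ^ 2 ∂μ := by
    have := integral_sub_mul_eq_sum (ρ := ρ) hSB hSB hSU (fun k => avg ρ k S) (fun k => hSB.avg)
      fun k => free_avg
    simp only [← hμ, hS0, sub_zero] at this
    rw [hT, integral_finsetSum _ fun k _ => ((hSB.mdiff k).mul (hSB.res k)).integrable]
    simp only [sq]
    exact this.symm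
  -- the second differences
  have hsec : ∀ j k, lpNorm (res ρ k (res ρ j S)) 4 μ ≤ 2 * ∑ l, |v l| * min (d l j) (d l k) := by
    intro j k
    have e : res ρ j S = fun x => ∑ l, v l * res ρ j (h l) x := res_linear hh v j
    rw [e, Finset.mul_sum]
    have hd' : ∀ l k, lpNorm (res ρ k (res ρ j (h l))) (4 : ℕ) μ ≤ 2 * min (d l j) (d l k) := ?_
    · have := lpNorm_res_linear_le (ρ := ρ) (q := 4) (by norm_num)
        (fun l => (hh l).res (ρ := ρ) j) hd' v k
      refine le_trans (by exact_mod_cast this) (le_of_eq (Finset.sum_congr rfl fun l _ => by ring))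
    intro l k
    have c1 : lpNorm (res ρ k (res ρ j (h l))) (4 : ℕ) μ ≤ 2 * lpNorm (res ρ j (h l)) (4 : ℕ) μ :=
      lpNorm_res_le (by norm_num) ((hh l).res j) k
    have c2 : lpNorm (res ρ j (res ρ k (h l))) (4 : ℕ) μ ≤ 2 * lpNorm (res ρ k (h l)) (4 : ℕ) μ :=
      lpNorm_res_le (by norm_num) ((hh l).res k) j
    -- Second differences are symmetric in the two coordinates, so each is bounded by the smaller of
    -- the two first-order effects. This is where the minimum comes from.
    have comm : res ρ k (res ρ j (h l)) = res ρ j (res ρ k (h l)) := by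
      ext x
      simp only [res]
      have a1 := congrFun (avg_sub (ρ := ρ) (k := k) (hh l) ((hh l).avg (ρ := ρ) (k := j))) x
      have a2 := congrFun (avg_sub (ρ := ρ) (k := j) (hh l) ((hh l).avg (ρ := ρ) (k := k))) x
      have a3 := congrFun (avg_comm (ρ := ρ) (k := k) (j := j) (hh l)) x
      have e1 : avg ρ k (res ρ j (h l)) x = avg ρ k (fun x => h l x - avg ρ j (h l) x) x := rfl
      have e2 : avg ρ j (res ρ k (h l)) x = avg ρ j (fun x => h l x - avg ρ k (h l) x) x := rfl
      rw [e1, e2, a1, a2, a3]; ring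
    rw [← comm] at c2
    push_cast at c1 c2 ⊢
    rcases le_total (d l j) (d l k) with hle | hle
    · rw [min_eq_left hle]; linarith [hd l j]
    · rw [min_eq_right hle]; linarith [hd l k]
  -- the variance of `T`
  have hresT : ∀ k ∈ Finset.range N, lpNorm (res ρ k T) 2 μ
      ≤ 8 * (V * R) * ∑ l, |v l| * ∑ j ∈ Finset.range N, min (d l j) (d l k) := by
    intro k _
    have e : res ρ k T = fun x => ∑ j ∈ Finset.range N,
        res ρ k (fun x => mdiff ρ j S x * res ρ j S x) x := by
      ext x
      simp only [res, hT]
      rw [avg_sum fun j _ => (hSB.mdiff j).mul (hSB.sub hSB.avg), Finset.sum_sub_distrib]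
    rw [e]
    refine le_trans (by exact_mod_cast lpNorm_sum_le_of_bm (q := 2) (by norm_num) fun j _ => (((hSB.mdiff j).mul (hSB.res j)).res k)) ?_
    have hj : ∀ j ∈ Finset.range N, lpNorm (res ρ k (fun x => mdiff ρ j S x * res ρ j S x)) 2 μ
        ≤ 8 * (V * R) * ∑ l, |v l| * min (d l j) (d l k) := by
      intro j _
      refine (lpNorm_res_mul_le (hSB.mdiff j) (hSB.res j) k).trans ?_
      -- The martingale difference is `pre` of a first-order effect and `pre` commutes with `res ρ
      -- k`, so the effect of k on it is again dominated by a second difference.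
      have e1 : res ρ k (mdiff ρ j S) = pre ρ j (res ρ k (res ρ j S)) := by
        have p1 := pre_sub (ρ := ρ) (hSB.res (ρ := ρ) j) ((hSB.res (ρ := ρ) j).avg (ρ := ρ) (k := k)) j
        rw [mdiff_eq_pre_res hSB]
        ext x
        change pre ρ j (res ρ j S) x - avg ρ k (pre ρ j (res ρ j S)) x = _
        rw [avg_pre_comm (hSB.res (ρ := ρ) j)]
        exact (congrFun p1 x).symm
      have i1 : lpNorm (res ρ k (mdiff ρ j S)) 4 μ ≤ 2 * ∑ l, |v l| * min (d l j) (d l k) := by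
        rw [e1]
        refine le_trans ?_ (hsec j k)
        exact_mod_cast lpNorm_pre_le (ρ := ρ) (q := 4) (by norm_num) ((hSB.res j).res k) j
      have i2 := (hres4 j).trans (hgV j)
      have i3 := (hm4 j).trans (hgV j)
      have hVR : 0 ≤ V * R := by positivity
      have j1 := mul_le_mul i1 i2 lpNorm_nonneg (lpNorm_nonneg.trans i1)
      have j2 := mul_le_mul i3 (hsec j k) lpNorm_nonneg hVR
      linarith
    refine (Finset.sum_le_sum hj).trans (le_of_eq ?_)
    rw [← Finset.mul_sum, Finset.sum_comm]
    simp only [Finset.mul_sum]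
  have hsd : lpNorm (fun x => T x - ∫ x, T x ∂μ) 2 μ ≤ 32 * (V * R) * W * √(∑ l, v l ^ 2) := by
    have h1 := lpNorm_sub_integral_sq_le (ρ := ρ) (r := 1) le_rfl hTB hTU
    norm_num at h1
    refine abs_le_of_sq_le_sq' ?_ (by positivity) |>.2
    refine h1.trans ?_
    rw [mul_pow, Real.sq_sqrt (Finset.sum_nonneg fun l _ => sq_nonneg _)]
    have h2 := Finset.sum_le_sum fun k hk => pow_le_pow_left₀ (lpNorm_nonneg) (hresT k hk) 2
    simp only [mul_pow _ (∑ l, |v l| * ∑ j ∈ Finset.range N, min (d l j) (d l _)) 2] at h2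
    rw [← Finset.mul_sum] at h2
    have h3 := sum_sq_weighted_le N (fun l k => ∑ j ∈ Finset.range N, min (d l j) (d l k))
      (fun l k => Finset.sum_nonneg fun j _ => le_min (hd0 l j) (hd0 l k)) hW hmrow hmcol v
    have h4 := mul_le_mul_of_nonneg_left h3 (sq_nonneg (8 * (V * R)))
    nlinarith
  -- the Stein identity
  have hst := integral_sub_mul_eq_sum (ρ := ρ) hSB hfSB hSU (fun k x => f (avg ρ k S x))
    (fun k => BM.bounded_comp hfm hf1 (hSB.avg (ρ := ρ)).1)
    fun k x y => by simp only [free_avg (F := S) x y]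
  simp only [← hμ, hS0, sub_zero] at hst
  have hTf : ∫ x, T x * f' (S x) ∂μ
      = ∑ k ∈ Finset.range N, ∫ x, mdiff ρ k S x * (res ρ k S x * f' (S x)) ∂μ := by
    simp only [hT, Finset.sum_mul]
    rw [integral_finsetSum _ fun k _ => (((hSB.mdiff k).mul (hSB.res k)).mul hf'SB).integrable]
    simp only [mul_assoc]
  -- Each martingale difference multiplies f(S) − f(avg S), which is f'(S) res S up to (res S)². The
  -- remainders are of third order, and one factor is bounded by V·R.
  have hA : |∫ x, S x * f (S x) ∂μ - ∫ x, T x * f' (S x) ∂μ| ≤ V * (R ^ 3 * ∑ l, v l ^ 2) := by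
    rw [hst, hTf, ← Finset.sum_sub_distrib]
    have hk : ∀ k ∈ Finset.range N,
        |∫ x, mdiff ρ k S x * (f (S x) - f (avg ρ k S x)) ∂μ
          - ∫ x, mdiff ρ k S x * (res ρ k S x * f' (S x)) ∂μ| ≤ V * R * g k ^ 2 := by
      intro k _
      have hb : BM fun x => f (avg ρ k S x) := BM.bounded_comp hfm hf1 (hSB.avg (ρ := ρ)).1
      rw [← integral_sub ((hSB.mdiff k).mul (hfSB.sub hb)).integrable
        ((hSB.mdiff k).mul ((hSB.res k).mul hf'SB)).integrable]
      have hle : ∫ x, |mdiff ρ k S x| * res ρ k S x ^ 2 ∂μ ≤ V * R * g k ^ 2 := by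
        refine (integral_abs_mul_sq_le (hSB.mdiff k) (hSB.res k)).trans ?_
        exact mul_le_mul ((hm2 k).trans (hgV k)) (pow_le_pow_left₀ lpNorm_nonneg (hres4 k) 2)
          (by positivity) (by positivity)
      refine le_trans ?_ hle
      refine (norm_integral_le_integral_norm (μ := μ) _).trans (integral_mono
        (((hSB.mdiff k).mul (hfSB.sub hb)).sub ((hSB.mdiff k).mul ((hSB.res k).mul hf'SB))).integrable.norm
        ((hSB.mdiff k).abs.mul ((hSB.res k).pow 2)).integrable fun x => ?_)
      rw [← mul_sub, norm_mul, Real.norm_eq_abs, Real.norm_eq_abs]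
      refine mul_le_mul_of_nonneg_left ?_ (abs_nonneg _)
      have := abs_sub_sub_deriv_mul_le hf hL (S x) (avg ρ k S x)
      rw [mul_comm (f' _)] at this
      exact this
    refine (Finset.abs_sum_le_sum_abs _ _).trans ((Finset.sum_le_sum hk).trans ?_)
    rw [← Finset.mul_sum]
    calc V * R * ∑ k ∈ Finset.range N, g k ^ 2 ≤ V * R * (R ^ 2 * ∑ l, v l ^ 2) := by gcongr
      _ = _ := by ring
  -- As f' is bounded by one, T may be replaced by its mean at the price of its standard deviation.
  have hB : |∫ x, T x * f' (S x) ∂μ - (∫ x, S x ^ 2 ∂μ) * ∫ x, f' (S x) ∂μ|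
      ≤ 32 * (V * R) * W * √(∑ l, v l ^ 2) := by
    rw [← hET, ← integral_const_mul, ← integral_sub (hTB.mul hf'SB).integrable
      (hf'SB.const_mul _).integrable]
    simp only [← sub_mul]
    refine (abs_integral_mul_le (hTB.sub (BM.const _)) hf'SB).trans ?_
    have : lpNorm (fun x => f' (S x)) 2 μ ≤ 1 := by
      refine lpNorm_le_of_integral_le (q := 2) two_ne_zero hf'SB zero_le_one ?_
      have : ∫ x, |f' (S x)| ^ 2 ∂μ ≤ ∫ x, (1 : ℝ) ∂μ :=
        integral_mono (hf'SB.abs.pow 2).integrable (integrable_const _) fun x =>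
          pow_le_one₀ (abs_nonneg _) (hf'1 _)
      simpa using this
    calc _ ≤ lpNorm (fun x => T x - ∫ x, T x ∂μ) 2 μ * 1 := by gcongr; exact lpNorm_nonneg
      _ ≤ _ := by rw [mul_one]; exact hsd
  refine (abs_sub_le _ (∫ x, T x * f' (S x) ∂μ) _).trans ((add_le_add hA hB).trans (le_of_eq ?_))
  ring

lemma hasDerivAt_integral_comp_mul {S : (ℕ → ℝ) → ℝ} (hS : BM S) {f f' : ℝ → ℝ}
    {μ : Measure (ℕ → ℝ)} [IsProbabilityMeasure μ]
    (hf : ∀ x, HasDerivAt f (f' x) x) (hf'm : Measurable f') (hf1 : ∀ x, |f x| ≤ 1)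
    (hf'1 : ∀ x, |f' x| ≤ 1) (t : ℝ) :
    HasDerivAt (fun t => ∫ x, f (t * S x) ∂μ) (∫ x, S x * f' (t * S x) ∂μ) t := by
  have hfm : Measurable f := (continuous_iff_continuousAt.2 fun x => (hf x).continuousAt).measurable
  obtain ⟨C, hC⟩ := hS.2
  refine (hasDerivAt_integral_of_dominated_loc_of_deriv_le (μ := μ) (x₀ := t) (s := Set.univ)
    (F := fun t x => f (t * S x)) (F' := fun t x => S x * f' (t * S x)) (bound := fun _ => C)
    univ_mem ?_ ?_ ?_ ?_ ?_ ?_).2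
  · exact Eventually.of_forall fun t => (hfm.comp (hS.1.const_mul t)).aestronglyMeasurable
  · exact (BM.bounded_comp hfm hf1 (hS.const_mul t).1).integrable
  · exact (hS.1.mul (hf'm.comp (hS.1.const_mul t))).aestronglyMeasurable
  · refine ae_of_all _ fun x s _ => ?_
    rw [norm_mul]
    calc ‖S x‖ * ‖f' (s * S x)‖ ≤ C * 1 :=
          mul_le_mul (hC x) (hf'1 _) (norm_nonneg _) ((abs_nonneg _).trans (hC x))
      _ = C := mul_one C
  · exact integrable_const _
  · refine ae_of_all _ fun x s _ => ?_
    have := (hf (s * S x)).comp s ((hasDerivAt_id s).mul_const (S x))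
    simpa [mul_comm, Function.comp_def] using this

/-- Normal approximation for linear forms, through `cos` and `sin`. -/
lemma abs_integral_cos_sin_sub_le (hh : ∀ l, BM (h l)) (hu : ∀ l, Upto N (h l))
    (h0 : ∀ l, ∫ x, h l x ∂Measure.infinitePi ρ = 0) (hd0 : ∀ l k, 0 ≤ d l k)
    (hd : ∀ l k, lpNorm (res ρ k (h l)) 4 (Measure.infinitePi ρ) ≤ d l k)
    (hR : 0 ≤ R) (hrow : ∀ l, ∑ k ∈ Finset.range N, d l k ≤ R) (hcol : ∀ k, ∑ l, d l k ≤ R)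
    (hW : 0 ≤ W)
    (hmrow : ∀ l, ∑ k ∈ Finset.range N, ∑ j ∈ Finset.range N, min (d l j) (d l k) ≤ W)
    (hmcol : ∀ k, ∑ l, ∑ j ∈ Finset.range N, min (d l j) (d l k) ≤ W)
    (hV : ∀ l, |v l| ≤ V) (hV0 : 0 ≤ V) :
    |∫ x, Real.cos (∑ l, v l * h l x) ∂Measure.infinitePi ρ
      - Real.exp (-((∫ x, (∑ l, v l * h l x) ^ 2 ∂Measure.infinitePi ρ) / 2))|
      ≤ V * (32 * R * W * √(∑ l, v l ^ 2) + R ^ 3 * ∑ l, v l ^ 2) ∧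
    |∫ x, Real.sin (∑ l, v l * h l x) ∂Measure.infinitePi ρ|
      ≤ V * (32 * R * W * √(∑ l, v l ^ 2) + R ^ 3 * ∑ l, v l ^ 2) := by
  set μ := Measure.infinitePi ρ with hμ
  set S : (ℕ → ℝ) → ℝ := fun x => ∑ l, v l * h l x with hS
  set ε := V * (32 * R * W * √(∑ l, v l ^ 2) + R ^ 3 * ∑ l, v l ^ 2) with hε
  have hSB : BM S := BM.linear hh v
  -- For t in [0,1] the rescaled function s ↦ f(ts) still meets the Lipschitz and boundedness
  -- requirements, so the Stein error is the same ε along the whole path. With f = sin this says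
  -- that t ↦ E cos(tS) nearly solves y' = −t (E S²) y, and f = cos gives the same for E sin(tS).
  have hεt : ∀ t ∈ Set.Icc (0 : ℝ) 1, ∀ f f' : ℝ → ℝ, (∀ x, HasDerivAt f (f' x) x) → Measurable f' →
      (∀ x y, |f' x - f' y| ≤ |x - y|) → (∀ x, |f x| ≤ 1) → (∀ x, |f' x| ≤ 1) →
      |∫ x, S x * f (t * S x) ∂μ - t * (∫ x, S x ^ 2 ∂μ) * ∫ x, f' (t * S x) ∂μ| ≤ ε := by
    intro t ht f f' hf hf'm hL hf1 hf'1
    have ht1 : |t| ≤ 1 := by rw [abs_of_nonneg ht.1]; exact ht.2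
    have := abs_integral_mul_sub_le (f := fun s => f (t * s)) (f' := fun s => t * f' (t * s)) v hh hu h0
      hd0 hd hR hrow hcol hW hmrow hmcol hV hV0
      (fun x => by
        have := (hf (t * x)).comp x ((hasDerivAt_id x).const_mul t)
        simpa [mul_comm, Function.comp_def] using this)
      ((hf'm.comp (measurable_const_mul t)).const_mul t)
      (fun x y => by
        rw [← mul_sub, abs_mul]
        refine (mul_le_mul ht1 (hL _ _) (abs_nonneg _) zero_le_one).trans ?_
        rw [one_mul, ← mul_sub, abs_mul]
        exact mul_le_of_le_one_left (abs_nonneg _) ht1)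
      (fun x => hf1 _)
      (fun x => by
        rw [abs_mul]
        exact mul_le_one₀ ht1 (abs_nonneg _) (hf'1 _))
    rw [integral_const_mul] at this
    refine le_trans (le_of_eq ?_) this
    congr 2
    ring
  have hcos := abs_sub_exp_le_of_deriv (s := ∫ x, S x ^ 2 ∂μ) (ε := ε)
    (integral_nonneg fun x => sq_nonneg _)
    (hasDerivAt_integral_comp_mul (μ := μ) (f := Real.cos) (f' := fun x => -Real.sin x) hSB
      Real.hasDerivAt_cos (by fun_prop) Real.abs_cos_le_one
      (fun x => by rw [abs_neg]; exact Real.abs_sin_le_one x))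
    (fun t ht => by
      have := hεt t ht Real.sin Real.cos Real.hasDerivAt_sin (by fun_prop)
        (fun x y => Real.abs_cos_sub_cos_le x y) Real.abs_sin_le_one Real.abs_cos_le_one
      rw [← abs_neg] at this
      refine le_trans (le_of_eq ?_) this
      congr 1
      simp only [mul_neg, integral_neg]
      ring)
  have hsin := abs_sub_exp_le_of_deriv (s := ∫ x, S x ^ 2 ∂μ) (ε := ε)
    (integral_nonneg fun x => sq_nonneg _)
    (hasDerivAt_integral_comp_mul (μ := μ) (f := Real.sin) (f' := Real.cos) hSB
      Real.hasDerivAt_sin (by fun_prop) Real.abs_sin_le_one Real.abs_cos_le_one)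
    (fun t ht => by
      have := hεt t ht Real.cos (fun x => -Real.sin x) Real.hasDerivAt_cos (by fun_prop)
        (fun x y => by
          rw [← neg_sub', abs_neg]
          exact Real.abs_sin_sub_sin_le x y) Real.abs_cos_le_one
        (fun x => by rw [abs_neg]; exact Real.abs_sin_le_one x)
      refine le_trans (le_of_eq ?_) this
      congr 1
      simp only [integral_neg]
      ring)
  simp only [one_mul, zero_mul, Real.cos_zero, Real.sin_zero, integral_const, smul_eq_mul,
    probReal_univ, mul_one, mul_zero, sub_zero] at hcos hsin
  exact ⟨hcos, hsin⟩

end stein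

end RidgeBootstrap

namespace RidgeBootstrap

set_option linter.unusedSectionVars false

/-! ### Approximation by functions of finitely many innovations -/

/-- The first `J` coordinates of `x` followed by the coordinates of `w`. -/
def mix (J : ℕ) (x w : ℕ → ℝ) : ℕ → ℝ := fun i => if i < J then x i else w i

lemma measurable_mix (J : ℕ) : Measurable fun p : (ℕ → ℝ) × (ℕ → ℝ) => mix J p.1 p.2 := by
  refine measurable_pi_iff.2 fun i => ?_
  unfold mix
  by_cases h : i < J
  · simp only [h, if_true]; exact (measurable_pi_apply i).comp measurable_fst
  · simp only [h, if_false]; exact (measurable_pi_apply i).comp measurable_snd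

lemma measurable_mix_left (J : ℕ) (w : ℕ → ℝ) : Measurable fun x => mix J x w :=
  (measurable_mix J).comp (measurable_id.prodMk measurable_const)

lemma measurable_mix_right (J : ℕ) (x : ℕ → ℝ) : Measurable fun w => mix J x w :=
  (measurable_mix J).comp (measurable_const.prodMk measurable_id)

lemma mix_congr {J : ℕ} {x y : ℕ → ℝ} (h : ∀ i ∈ Set.Iio J, x i = y i) (w : ℕ → ℝ) :
    mix J x w = mix J y w := by
  ext i
  unfold mix
  split_ifs with hi
  · exact h i hi
  · rfl

lemma mix_mix {I J : ℕ} (h : I ≤ J) (x w : ℕ → ℝ) (w' : ℕ → ℝ) : mix I (mix J x w') w = mix I x w := by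
  ext i
  unfold mix
  split_ifs with h1 h2
  · rfl
  · lia
  · rfl

lemma mix_update {J k : ℕ} (h : k < J) (x w : ℕ → ℝ) (y : ℝ) :
    mix J (Function.update x k y) w = Function.update (mix J x w) k y := by
  ext i
  by_cases hi : i = k
  · subst hi; simp [mix, h]
  · simp [mix, Function.update_of_ne hi]

variable (ρ : ℕ → Measure ℝ) [∀ k, IsProbabilityMeasure (ρ k)]

lemma map_mix_infinitePi (J : ℕ) :
    ((Measure.infinitePi ρ).prod (Measure.infinitePi ρ)).map (fun p => mix J p.1 p.2)
      = Measure.infinitePi ρ := by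
  refine Measure.eq_infinitePi ρ fun s t ht => ?_
  classical
  rw [Measure.map_apply (measurable_mix J)
    (MeasurableSet.pi (Set.to_countable _) fun i _ => ht i)]
  have : (fun p : (ℕ → ℝ) × (ℕ → ℝ) => mix J p.1 p.2) ⁻¹' (Set.pi s t)
      = (Set.pi (s.filter (· < J) : Finset ℕ) t) ×ˢ (Set.pi (s.filter (¬ · < J) : Finset ℕ) t) := by
    ext ⟨x, w⟩
    simp only [Set.mem_preimage, Set.mem_pi, Finset.mem_coe, Set.mem_prod, Finset.mem_filter, mix]
    constructor
    · intro h
      exact ⟨fun i hi => by simpa [hi.2] using h i hi.1, fun i hi => by simpa [hi.2] using h i hi.1⟩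
    · rintro ⟨h1, h2⟩ i hi
      by_cases hiJ : i < J
      · simpa [hiJ] using h1 i ⟨hi, hiJ⟩
      · simpa [hiJ] using h2 i ⟨hi, hiJ⟩
  rw [this, Measure.prod_prod, Measure.infinitePi_pi _ (fun i _ => ht i),
    Measure.infinitePi_pi _ (fun i _ => ht i), Finset.prod_filter_mul_prod_filter_not]

/-- Integrate all coordinates from `J` on out. -/
noncomputable def tr (J : ℕ) (F : (ℕ → ℝ) → ℝ) (x : ℕ → ℝ) : ℝ :=
  ∫ w, F (mix J x w) ∂Measure.infinitePi ρ

variable {ρ} {F G : (ℕ → ℝ) → ℝ} {J k q : ℕ}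

lemma BM.integrable_mix (hF : BM F) (x : ℕ → ℝ) :
    Integrable (fun w => F (mix J x w)) (Measure.infinitePi ρ) := by
  obtain ⟨hF, C, hC⟩ := hF
  exact Integrable.of_bound (hF.comp (measurable_mix_right J x)).aestronglyMeasurable C
    (ae_of_all _ fun y => hC _)

lemma abs_tr_le {C : ℝ} (hC : ∀ x, |F x| ≤ C) (x : ℕ → ℝ) : |tr ρ J F x| ≤ C := by
  refine (norm_integral_le_of_norm_le_const (μ := Measure.infinitePi ρ) (f := fun w => F (mix J x w))
    (C := C) (ae_of_all _ fun y => hC _)).trans ?_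
  simp

lemma BM.tr (hF : BM F) : BM (tr ρ J F) := by
  refine ⟨?_, ?_⟩
  · exact (StronglyMeasurable.integral_prod_right
      (f := fun x w => F (mix J x w))
      (hF.1.comp (measurable_mix J)).stronglyMeasurable).measurable
  · obtain ⟨hF, C, hC⟩ := hF
    exact ⟨C, abs_tr_le hC⟩

lemma upto_tr : Upto J (tr ρ J F) := by
  intro x y hxy
  simp only [tr, mix_congr hxy]

lemma Upto.mono {N N' : ℕ} (h : Upto N F) (hN : N ≤ N') : Upto N' F := fun _ _ hxy =>
  h fun i hi => hxy i (lt_of_lt_of_le hi hN)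

lemma integral_tr (hF : BM F) :
    ∫ x, tr ρ J F x ∂Measure.infinitePi ρ = ∫ x, F x ∂Measure.infinitePi ρ := by
  conv_rhs => rw [← map_mix_infinitePi ρ J]
  rw [integral_map (measurable_mix J).aemeasurable hF.1.aestronglyMeasurable, integral_prod]
  · rfl
  · obtain ⟨hF, C, hC⟩ := hF
    exact Integrable.of_bound (C := C) (hF.comp (measurable_mix J)).aestronglyMeasurable
      (ae_of_all _ fun p => hC _)

lemma lpNorm_tr_le (hq : 1 ≤ q) (hF : BM F) :
    lpNorm (tr ρ J F) q (Measure.infinitePi ρ) ≤ lpNorm F q (Measure.infinitePi ρ) := by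
  have hq0 : q ≠ 0 := by lia
  refine lpNorm_le_of_integral_le hq0 hF.tr lpNorm_nonneg ?_
  rw [lpNorm_pow_eq_integral hq0 hF, ← integral_tr (J := J) (hF.abs.pow q)]
  refine integral_mono (hF.tr.abs.pow q).integrable (hF.abs.pow q).tr.integrable fun x => ?_
  have h1 : |tr ρ J F x| ≤ ∫ y, |F (mix J x y)| ∂Measure.infinitePi ρ :=
    norm_integral_le_integral_norm (fun y => F (mix J x y))
  refine (pow_le_pow_left₀ (abs_nonneg _) h1 q).trans ?_
  exact (convexOn_pow q).map_integral_le (continuous_pow q).continuousOn isClosed_Ici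
    (ae_of_all _ fun y => Set.mem_Ici.2 (abs_nonneg _)) (hF.abs.integrable_mix x)
    ((hF.abs.pow q).integrable_mix x)

lemma tr_sub (hF : BM F) (hG : BM G) :
    tr ρ J (fun x => F x - G x) = fun x => tr ρ J F x - tr ρ J G x := by
  ext x
  exact integral_sub (hF.integrable_mix x) (hG.integrable_mix x)

lemma avg_tr (hF : BM F) (hk : k < J) : avg ρ k (tr ρ J F) = tr ρ J (avg ρ k F) := by
  ext x
  simp only [avg, tr]
  rw [integral_integral_swap]
  · simp only [mix_update hk]
  · obtain ⟨hF, C, hC⟩ := hF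
    refine Integrable.of_bound (C := C) ?_ (ae_of_all _ fun p => hC _)
    refine (hF.comp ?_).aestronglyMeasurable
    have h1 : Measurable fun p : ℝ × (ℕ → ℝ) => (Function.update x k p.1, p.2) :=
      ((measurable_update x).comp measurable_fst).prodMk measurable_snd
    exact (measurable_mix J).comp h1

/-- For k < J the two averages commute, and for k ≥ J nothing is left to measure. The truncated
function thus keeps the dependence coefficients without any loss of constant. -/
lemma lpNorm_res_tr_le (hq : 1 ≤ q) (hF : BM F) (k : ℕ) :
    lpNorm (res ρ k (tr ρ J F)) q (Measure.infinitePi ρ)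
      ≤ lpNorm (res ρ k F) q (Measure.infinitePi ρ) := by
  rcases lt_or_ge k J with hk | hk
  · have e : res ρ k (tr ρ J F) = tr ρ J (res ρ k F) := by
      unfold res
      rw [tr_sub hF hF.avg, avg_tr hF hk]
    rw [e]
    exact lpNorm_tr_le hq (hF.res k)
  · have e : res ρ k (tr ρ J F) = fun _ => 0 := by
      ext x
      simp only [res]
      rw [avg_of_free (upto_tr.free hk), sub_self]
    rw [e, lpNorm_fun_zero]
    exact lpNorm_nonneg

/-- The filtration of the first coordinates. -/
def firstCoords : Filtration ℕ (inferInstance : MeasurableSpace (ℕ → ℝ)) where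
  seq J := MeasurableSpace.comap (fun x => mix J x 0) inferInstance
  mono' := by
    intro I J h
    have e : (fun x => mix I x 0) = (fun x => mix I x 0) ∘ fun x => mix J x 0 := by
      ext x : 1
      exact (mix_mix h x 0 0).symm
    change MeasurableSpace.comap (fun x => mix I x 0) _ ≤ MeasurableSpace.comap (fun x => mix J x 0) _
    rw [e, ← MeasurableSpace.comap_comp]
    exact MeasurableSpace.comap_mono (measurable_mix_left I 0).comap_le
  le' J := (measurable_mix_left J 0).comap_le

lemma iSup_firstCoords : (⨆ J, firstCoords J) = (inferInstance : MeasurableSpace (ℕ → ℝ)) := by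
  refine le_antisymm (iSup_le fun J => firstCoords.le J) ?_
  refine iSup_le fun i => ?_
  refine le_trans ?_ (le_iSup _ (i + 1))
  have e : (fun x : ℕ → ℝ => x i) = (fun x => x i) ∘ fun x => mix (i + 1) x 0 := by
    ext x; simp [mix]
  change MeasurableSpace.comap (fun x : ℕ → ℝ => x i) _
    ≤ MeasurableSpace.comap (fun x => mix (i + 1) x 0) _
  rw [e, ← MeasurableSpace.comap_comp]
  exact MeasurableSpace.comap_mono (measurable_pi_apply i).comap_le

/-- This identification serves only to make the martingale convergence theorem available. -/
lemma tr_ae_eq_condExp (hF : BM F) (J : ℕ) :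
    tr ρ J F =ᵐ[Measure.infinitePi ρ] (Measure.infinitePi ρ)[F | firstCoords J] := by
  refine ae_eq_condExp_of_forall_setIntegral_eq (firstCoords.le J) hF.integrable
    (fun s _ _ => hF.tr.integrable.integrableOn) ?_ ?_
  · rintro s ⟨t, ht, rfl⟩ _
    have hm : MeasurableSet ((fun x => mix J x 0) ⁻¹' t) := measurable_mix_left J 0 ht
    rw [← integral_indicator hm, ← integral_indicator hm]
    have hB : BM (((fun x => mix J x 0) ⁻¹' t).indicator F) := by
      refine ⟨hF.1.indicator hm, ?_⟩
      obtain ⟨_, C, hC⟩ := hF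
      refine ⟨C, fun x => ?_⟩
      by_cases hx : x ∈ (fun x => mix J x 0) ⁻¹' t
      · rw [Set.indicator_of_mem hx]; exact hC x
      · rw [Set.indicator_of_notMem hx, abs_zero]; exact (abs_nonneg _).trans (hC x)
    rw [← integral_tr (J := J) hB]
    congr 1
    ext x
    have hmem : ∀ w, mix J x w ∈ (fun x => mix J x 0) ⁻¹' t ↔ x ∈ (fun x => mix J x 0) ⁻¹' t := by
      intro w
      simp only [Set.mem_preimage, mix_mix le_rfl]
    by_cases hx : x ∈ (fun x => mix J x 0) ⁻¹' t
    · rw [Set.indicator_of_mem hx]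
      simp only [tr]
      congr 1; ext w
      rw [Set.indicator_of_mem ((hmem w).2 hx)]
    · rw [Set.indicator_of_notMem hx]
      simp only [tr]
      have : ∀ w, ((fun x => mix J x 0) ⁻¹' t).indicator F (mix J x w) = 0 := fun w =>
        Set.indicator_of_notMem (fun h => hx ((hmem w).1 h)) _
      simp [this]
  · have e : tr ρ J F = tr ρ J F ∘ fun x => mix J x 0 := by
      ext x
      simp only [tr, Function.comp, mix_mix le_rfl]
    have : Measurable[firstCoords J] (tr ρ J F) := by
      rw [e]
      exact hF.tr.1.comp (comap_measurable _)
    exact this.stronglyMeasurable.aestronglyMeasurable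

/-- Lévy's upward theorem gives convergence in L¹. The difference is bounded by 2C, so its q-th
power is at most (2C)^(q−1) times its absolute value. -/
lemma tendsto_lpNorm_tr_sub (hq : 1 ≤ q) (hF : BM F) :
    Tendsto (fun J => lpNorm (fun x => tr ρ J F x - F x) q (Measure.infinitePi ρ)) atTop (𝓝 0) := by
  set μ := Measure.infinitePi ρ
  have hq0 : q ≠ 0 := by lia
  have h1 : Tendsto (fun J => ∫ x, |tr ρ J F x - F x| ∂μ) atTop (𝓝 0) := by
    have h := tendsto_eLpNorm_condExp (μ := μ) (ℱ := firstCoords) F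
    rw [iSup_firstCoords, condExp_of_stronglyMeasurable le_rfl hF.1.stronglyMeasurable hF.integrable] at h
    have h2 := (ENNReal.tendsto_toReal ENNReal.zero_ne_top).comp h
    simp only [ENNReal.toReal_zero] at h2
    refine h2.congr fun J => ?_
    have h3 := lpNorm_pow_eq_integral (μ := μ) one_ne_zero (hF.tr.sub hF : BM fun x => tr ρ J F x - F x)
    simp only [pow_one, Nat.cast_one] at h3
    rw [← h3, ← toReal_eLpNorm (hF.tr.sub hF).1.aestronglyMeasurable]
    simp only [Function.comp]
    congr 1
    refine eLpNorm_congr_ae ?_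
    filter_upwards [tr_ae_eq_condExp (ρ := ρ) hF J] with x hx
    rw [Pi.sub_apply, ← hx]
  obtain ⟨_, C, hC⟩ := id hF
  have hC0 : 0 ≤ C := (abs_nonneg _).trans (hC 0)
  have h2 : Tendsto (fun J => lpNorm (fun x => tr ρ J F x - F x) q μ ^ q) atTop (𝓝 0) := by
    refine squeeze_zero (fun J => pow_nonneg lpNorm_nonneg q) (fun J => ?_)
      (by simpa using h1.const_mul ((2 * C) ^ (q - 1)))
    rw [lpNorm_pow_eq_integral hq0 (hF.tr.sub hF), ← integral_const_mul]
    refine integral_mono ((hF.tr.sub hF).abs.pow q).integrable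
      ((hF.tr.sub hF).abs.const_mul _).integrable fun x => ?_
    have hb : |tr ρ J F x - F x| ≤ 2 * C := by
      refine (abs_sub _ _).trans ?_
      linarith [abs_tr_le (ρ := ρ) (J := J) hC x, hC x]
    obtain ⟨s, rfl⟩ : ∃ s, q = s + 1 := ⟨q - 1, by lia⟩
    simp only [pow_succ, Nat.add_sub_cancel]
    gcongr
  have hqi : 0 < ((q : ℝ)⁻¹) := inv_pos.2 (Nat.cast_pos.2 (by lia))
  have h3 := (Real.continuousAt_rpow_const (0 : ℝ) ((q : ℝ)⁻¹) (Or.inr hqi.le)).tendsto.comp h2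
  rw [Real.zero_rpow (inv_ne_zero (by exact_mod_cast hq0))] at h3
  refine h3.congr fun J => ?_
  exact Real.pow_rpow_inv_natCast lpNorm_nonneg hq0

/-- Truncation at the level `M`. -/
noncomputable def clip (M t : ℝ) : ℝ := max (-M) (min t M)

lemma abs_clip_sub_le (M s t : ℝ) : |clip M s - clip M t| ≤ |s - t| := by
  have h1 := abs_max_sub_max_le_abs (min s M) (min t M) (-M)
  have h2 := abs_min_sub_min_le_max s M t M
  unfold clip
  rw [max_comm, max_comm (-M)]
  refine h1.trans (h2.trans ?_)
  simp

lemma abs_clip_le {M : ℝ} (hM : 0 ≤ M) (t : ℝ) : |clip M t| ≤ M := by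
  rw [abs_le]
  exact ⟨le_max_left _ _, max_le (by linarith) (min_le_right _ _)⟩

lemma clip_eq {M t : ℝ} (h : |t| ≤ M) : clip M t = t := by
  obtain ⟨h1, h2⟩ := abs_le.1 h
  simp [clip, h1, h2]

lemma measurable_clip (M : ℝ) : Measurable (clip M) := by
  unfold clip; fun_prop

lemma tendsto_eLpNorm_clip_sub {α : Type*} [MeasurableSpace α] {μ : Measure α} {f : α → ℝ} {p : ℝ≥0∞}
    (hp : 1 ≤ p) (hp' : p ≠ ∞) (hf : MemLp f p μ) (hfm : Measurable f) :
    Tendsto (fun M : ℕ => eLpNorm (fun x => clip M (f x) - f x) p μ) atTop (𝓝 0) := by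
  have hp0 : p ≠ 0 := fun h => by simp [h] at hp
  have hpos : 0 < p.toReal := ENNReal.toReal_pos hp0 hp'
  simp only [eLpNorm_eq_lintegral_rpow_enorm_toReal hp0 hp']
  have : Tendsto (fun M : ℕ => ∫⁻ x, ‖clip M (f x) - f x‖ₑ ^ p.toReal ∂μ) atTop
      (𝓝 (∫⁻ _, 0 ∂μ)) := by
    refine tendsto_lintegral_of_dominated_convergence (fun x => ‖f x‖ₑ ^ p.toReal) ?_ ?_ ?_ ?_
    · exact fun M => ((((measurable_clip M).comp hfm).sub hfm).enorm.pow_const _)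
    · refine fun M => ae_of_all _ fun x => ?_
      have : |clip M (f x) - f x| ≤ |f x| := by
        rcases le_total |f x| M with h | h
        · rw [clip_eq h]; simp
        · rcases abs_cases (f x) with ⟨e, h0⟩ | ⟨e, h0⟩
          · rw [e] at h ⊢
            rw [clip, min_eq_right h, max_eq_right (by linarith), abs_sub_comm,
              abs_of_nonneg (by linarith)]
            have : (0 : ℝ) ≤ M := Nat.cast_nonneg M
            linarith
          · rw [e] at h ⊢
            have : (0 : ℝ) ≤ M := Nat.cast_nonneg M
            rw [clip, min_eq_left (by linarith), max_eq_left (by linarith),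
              abs_of_nonneg (by linarith)]
            linarith
      exact ENNReal.rpow_le_rpow (enorm_le_iff_norm_le.2 this) hpos.le
    · exact (lintegral_rpow_enorm_lt_top_of_eLpNorm_lt_top hp0 hp' hf.2).ne
    · refine ae_of_all _ fun x => ?_
      refine tendsto_const_nhds.congr' ?_
      obtain ⟨M₀, hM₀⟩ := exists_nat_ge |f x|
      filter_upwards [eventually_ge_atTop M₀] with M hM
      rw [clip_eq (hM₀.trans (by exact_mod_cast hM))]
      simp [hpos]
  simp only [lintegral_zero] at this
  have h2 := this.ennrpow_const (1 / p.toReal)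
  rwa [ENNReal.zero_rpow_of_pos (by positivity)] at h2

/-- `res` is the average of the coupled difference over the fresh copy of the coordinate, so
Jensen's inequality bounds it by the coupling distance. Clipping is 1-Lipschitz and does not
increase that distance. Here the physical dependence measure enters the martingale estimates. -/
lemma lpNorm_res_clip_le (hq : 1 ≤ q) (hG : Measurable G) {M : ℝ} (hM : 0 ≤ M) {δ : ℝ} (hδ : 0 ≤ δ)
    (h : eLpNorm (fun p : (ℕ → ℝ) × ℝ => G p.1 - G (Function.update p.1 k p.2)) q
      ((Measure.infinitePi ρ).prod (ρ k)) ≤ ENNReal.ofReal δ) :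
    lpNorm (res ρ k fun x => clip M (G x)) q (Measure.infinitePi ρ) ≤ δ := by
  have hq0 : q ≠ 0 := by lia
  set F : (ℕ → ℝ) → ℝ := fun x => clip M (G x) with hFdef
  have hF : BM F := BM.bounded_comp (measurable_clip M) (abs_clip_le hM) hG
  set D : (ℕ → ℝ) × ℝ → ℝ := fun p => F p.1 - F (Function.update p.1 k p.2) with hD
  have hDm : Measurable D := (hF.1.comp measurable_fst).sub (hF.1.comp (measurable_update_uncurry k))
  have hDb : ∀ p, |D p| ≤ 2 * M := fun p => (abs_sub _ _).trans (by
    linarith [abs_clip_le hM (G p.1), abs_clip_le hM (G (Function.update p.1 k p.2))])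
  have hDp : Integrable (fun p => |D p| ^ q) ((Measure.infinitePi ρ).prod (ρ k)) := by
    refine Integrable.of_bound (C := (2 * M) ^ q) (hDm.abs.pow_const q).aestronglyMeasurable
      (ae_of_all _ fun p => ?_)
    rw [Real.norm_eq_abs, abs_pow, abs_abs]
    exact pow_le_pow_left₀ (abs_nonneg _) (hDb p) q
  have h1 : ∫ p, |D p| ^ q ∂((Measure.infinitePi ρ).prod (ρ k)) ≤ δ ^ q := by
    have hle : eLpNorm D q ((Measure.infinitePi ρ).prod (ρ k)) ≤ ENNReal.ofReal δ := by
      refine le_trans (eLpNorm_mono fun p => ?_) h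
      exact abs_clip_sub_le M _ _
    have hlp : lpNorm D q ((Measure.infinitePi ρ).prod (ρ k)) ≤ δ := by
      rw [← toReal_eLpNorm hDm.aestronglyMeasurable]
      exact ENNReal.toReal_le_of_le_ofReal hδ hle
    have e := lpNorm_eq_integral_norm_rpow_toReal (p := (q : ℝ≥0∞)) (by simpa using hq0) (by simp)
      (hDm.aestronglyMeasurable (μ := (Measure.infinitePi ρ).prod (ρ k)))
    simp only [ENNReal.toReal_natCast, Real.rpow_natCast, Real.norm_eq_abs] at e
    calc ∫ p, |D p| ^ q ∂((Measure.infinitePi ρ).prod (ρ k))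
        = lpNorm D q ((Measure.infinitePi ρ).prod (ρ k)) ^ q := by
          rw [e]; exact (Real.rpow_inv_natCast_pow (integral_nonneg fun _ => by positivity) hq0).symm
      _ ≤ δ ^ q := pow_le_pow_left₀ lpNorm_nonneg hlp q
  refine lpNorm_le_of_integral_le hq0 (hF.res k) hδ (le_trans ?_ h1)
  rw [integral_prod _ hDp]
  refine integral_mono ((hF.res k).abs.pow q).integrable hDp.integral_prod_left fun x => ?_
  have hi : Integrable (fun y => D (x, y)) (ρ k) :=
    (integrable_const (F x)).sub (hF.integrable_update (ρ k) x k)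
  have e : res ρ k F x = ∫ y, D (x, y) ∂ρ k := by
    simp only [res, hD, avg]
    rw [integral_sub (integrable_const _) (hF.integrable_update _ x k)]
    simp
  have h2 : |res ρ k F x| ≤ ∫ y, |D (x, y)| ∂ρ k := by
    rw [e]; exact norm_integral_le_integral_norm (fun y => D (x, y))
  refine (pow_le_pow_left₀ (abs_nonneg _) h2 q).trans ?_
  refine (convexOn_pow q).map_integral_le (continuous_pow q).continuousOn isClosed_Ici
    (ae_of_all _ fun y => Set.mem_Ici.2 (abs_nonneg _)) hi.abs ?_
  refine Integrable.of_bound (C := (2 * M) ^ q)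
    ((hDm.comp measurable_prodMk_left).abs.pow_const q).aestronglyMeasurable (ae_of_all _ fun y => ?_)
  rw [Function.comp, Real.norm_eq_abs, abs_pow, abs_abs]
  exact pow_le_pow_left₀ (abs_nonneg _) (hDb _) q

/-- Clip, integrate the late coordinates out, recentre: each step costs at most τ/3 in L^q and none
enlarges the dependence bounds. -/
lemma exists_approx_single (hq : 1 ≤ q) (hG : Measurable G)
    (hGL : MemLp G q (Measure.infinitePi ρ)) (hG0 : ∫ x, G x ∂Measure.infinitePi ρ = 0)
    {δ : ℕ → ℝ} (hδ : ∀ k, 0 ≤ δ k)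
    (h : ∀ k, eLpNorm (fun p : (ℕ → ℝ) × ℝ => G p.1 - G (Function.update p.1 k p.2)) q
      ((Measure.infinitePi ρ).prod (ρ k)) ≤ ENNReal.ofReal (δ k)) {τ : ℝ} (hτ : 0 < τ) :
    ∃ (N : ℕ) (F : (ℕ → ℝ) → ℝ), BM F ∧ Upto N F ∧ ∫ x, F x ∂Measure.infinitePi ρ = 0 ∧
      (∀ k, lpNorm (res ρ k F) q (Measure.infinitePi ρ) ≤ δ k) ∧
      eLpNorm (fun x => F x - G x) q (Measure.infinitePi ρ) ≤ ENNReal.ofReal τ := by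
  set μ := Measure.infinitePi ρ
  have hq1 : (1 : ℝ≥0∞) ≤ q := by exact_mod_cast hq
  have ht := tendsto_eLpNorm_clip_sub hq1 (by simp) hGL hG
  obtain ⟨M, hM⟩ := (ht.eventually_le_const (u := ENNReal.ofReal (τ / 3)) (by simpa using by positivity)).exists
  set C : (ℕ → ℝ) → ℝ := fun x => clip M (G x) with hC
  have hCB : BM C := BM.bounded_comp (measurable_clip M) (abs_clip_le (Nat.cast_nonneg M)) hG
  obtain ⟨J, hJ⟩ := ((tendsto_lpNorm_tr_sub (ρ := ρ) hq hCB).eventually_le_const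
    (u := τ / 3) (by positivity)).exists
  have hTB : BM (tr ρ J C) := hCB.tr
  set c := ∫ x, tr ρ J C x ∂μ with hc
  have hc' : |c| ≤ τ / 3 := by
    have e : c = ∫ x, (C x - G x) ∂μ := by
      rw [integral_sub hCB.integrable (hGL.integrable hq1), hG0, sub_zero, hc, integral_tr hCB]
    rw [e]
    have hint : MemLp (fun x => C x - G x) q μ := (hCB.memLp _).sub hGL
    refine (norm_integral_le_integral_norm (fun x => C x - G x)).trans ?_
    rw [← lpNorm_one_eq_integral_norm hint.1, ← toReal_eLpNorm hint.1]
    refine ENNReal.toReal_le_of_le_ofReal (by positivity) (le_trans ?_ hM)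
    exact eLpNorm_le_eLpNorm_of_exponent_le hq1 hint.1
  refine ⟨J, fun x => tr ρ J C x - c, hTB.sub (BM.const c), ?_, ?_, ?_, ?_⟩
  · intro x y hxy
    simp only [upto_tr hxy]
  · rw [integral_sub hTB.integrable (integrable_const _)]
    simp [hc, μ]
  · intro k
    have e : res ρ k (fun x => tr ρ J C x - c) = res ρ k (tr ρ J C) := by
      ext x
      simp only [res, avg_sub hTB (BM.const c), avg_of_free (k := k) (F := fun _ => c) fun _ _ => rfl]
      ring
    rw [e]
    exact (lpNorm_res_tr_le hq hCB k).trans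
      (lpNorm_res_clip_le hq hG (Nat.cast_nonneg M) (hδ k) (h k))
  · have e : (fun x => tr ρ J C x - c - G x)
        = ((fun x => tr ρ J C x - C x) + fun x => C x - G x) - fun _ => c := by
      ext x
      simp only [Pi.sub_apply, Pi.add_apply]
      ring
    rw [e]
    have m1 := (hTB.sub hCB).1.aestronglyMeasurable (μ := μ)
    have m2 := (hCB.1.sub hG).aestronglyMeasurable (μ := μ)
    refine (eLpNorm_sub_le (m1.add m2) aestronglyMeasurable_const hq1).trans ?_
    have h1 : eLpNorm (fun x => tr ρ J C x - C x) q μ ≤ ENNReal.ofReal (τ / 3) := by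
      rw [← ofReal_lpNorm ((hTB.sub hCB).memLp _)]
      exact ENNReal.ofReal_le_ofReal hJ
    have h3 : eLpNorm (fun _ : ℕ → ℝ => c) q μ ≤ ENNReal.ofReal (τ / 3) := by
      rw [eLpNorm_const' _ (by simpa using (by lia : q ≠ 0)) (by simp)]
      simp only [measure_univ, ENNReal.one_rpow, mul_one]
      rw [Real.enorm_eq_ofReal_abs]
      exact ENNReal.ofReal_le_ofReal hc'
    refine (add_le_add ((eLpNorm_add_le m1 m2 hq1).trans (add_le_add h1 hM)) h3).trans (le_of_eq ?_)
    rw [← ENNReal.ofReal_add (by positivity) (by positivity),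
      ← ENNReal.ofReal_add (by positivity) (by positivity)]
    congr 1; ring

end RidgeBootstrap

namespace RidgeBootstrap

set_option linter.unusedSectionVars false

/-! ### Convergence in `L^p` -/

/-- Convergence in `L^p`. -/
structure TendstoLp {α : Type*} [MeasurableSpace α] (μ : Measure α) (p : ℝ≥0∞) (F : ℕ → α → ℝ)
    (G : α → ℝ) : Prop where
  memLp_seq : ∀ t, MemLp (F t) p μ
  memLp_lim : MemLp G p μ
  tendsto : Tendsto (fun t => eLpNorm (F t - G) p μ) atTop (𝓝 0)

namespace TendstoLp

variable {α : Type*} [MeasurableSpace α] {μ : Measure α} [IsProbabilityMeasure μ] {p q : ℝ≥0∞}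
  {F F' : ℕ → α → ℝ} {G G' : α → ℝ}

lemma mono (h : TendstoLp μ q F G) (hpq : p ≤ q) : TendstoLp μ p F G where
  memLp_seq t := (h.memLp_seq t).mono_exponent hpq
  memLp_lim := h.memLp_lim.mono_exponent hpq
  tendsto := tendsto_of_tendsto_of_tendsto_of_le_of_le tendsto_const_nhds h.tendsto
    (fun _ => zero_le) fun t =>
      eLpNorm_le_eLpNorm_of_exponent_le hpq ((h.memLp_seq t).sub h.memLp_lim).1

lemma add (h : TendstoLp μ p F G) (h' : TendstoLp μ p F' G') (hp : 1 ≤ p) :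
    TendstoLp μ p (fun t x => F t x + F' t x) (fun x => G x + G' x) where
  memLp_seq t := (h.memLp_seq t).add (h'.memLp_seq t)
  memLp_lim := h.memLp_lim.add h'.memLp_lim
  tendsto := by
    have := h.tendsto.add h'.tendsto
    rw [add_zero] at this
    refine tendsto_of_tendsto_of_tendsto_of_le_of_le tendsto_const_nhds this (fun _ => zero_le)
      fun t => ?_
    have e : ((fun x => F t x + F' t x) - fun x => G x + G' x) = (F t - G) + (F' t - G') := by
      ext x; simp only [Pi.sub_apply, Pi.add_apply]; ring
    simp only [e]
    exact eLpNorm_add_le ((h.memLp_seq t).sub h.memLp_lim).1 ((h'.memLp_seq t).sub h'.memLp_lim).1 hp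

lemma const_mul (h : TendstoLp μ p F G) (c : ℝ) :
    TendstoLp μ p (fun t x => c * F t x) (fun x => c * G x) where
  memLp_seq t := (h.memLp_seq t).const_mul c
  memLp_lim := h.memLp_lim.const_mul c
  tendsto := by
    have := ENNReal.Tendsto.const_mul (a := ‖c‖ₑ) h.tendsto (Or.inr (by simp))
    rw [mul_zero] at this
    refine this.congr fun t => ?_
    rw [← eLpNorm_const_smul]
    congr 1
    ext x; simp [mul_sub]

lemma const (c : ℝ) : TendstoLp μ p (fun _ _ => c) (fun _ => c) where
  memLp_seq _ := memLp_const c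
  memLp_lim := memLp_const c
  tendsto := by simp

lemma sum {ι : Type*} {s : Finset ι} {F : ι → ℕ → α → ℝ} {G : ι → α → ℝ} (hp : 1 ≤ p)
    (h : ∀ i ∈ s, TendstoLp μ p (F i) (G i)) :
    TendstoLp μ p (fun t x => ∑ i ∈ s, F i t x) (fun x => ∑ i ∈ s, G i x) := by
  classical
  induction s using Finset.induction_on with
  | empty => simpa using TendstoLp.const 0
  | insert a s ha ih =>
    simp only [Finset.sum_insert ha]
    exact (h a (by simp)).add (ih fun i hi => h i (by simp [hi])) hp

lemma mul {r : ℝ≥0∞} [hr : ENNReal.HolderTriple p q r] (h : TendstoLp μ p F G)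
    (h' : TendstoLp μ q F' G') (hq : 1 ≤ q) (hr1 : 1 ≤ r) :
    TendstoLp μ r (fun t x => F t x * F' t x) (fun x => G x * G' x) where
  memLp_seq t := (h'.memLp_seq t).mul (h.memLp_seq t)
  memLp_lim := h'.memLp_lim.mul h.memLp_lim
  tendsto := by
    have hb : Tendsto (fun t => eLpNorm (F t - G) p μ * (eLpNorm (F' t - G') q μ + eLpNorm G' q μ)
        + eLpNorm G p μ * eLpNorm (F' t - G') q μ) atTop
        (𝓝 (0 * (0 + eLpNorm G' q μ) + eLpNorm G p μ * 0)) := by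
      refine Tendsto.add (ENNReal.Tendsto.mul h.tendsto (Or.inr ?_)
        (h'.tendsto.add tendsto_const_nhds) (Or.inr (by simp)))
        (ENNReal.Tendsto.const_mul h'.tendsto (Or.inr h.memLp_lim.2.ne))
      simpa using h'.memLp_lim.2.ne
    rw [zero_mul, mul_zero, add_zero] at hb
    refine tendsto_of_tendsto_of_tendsto_of_le_of_le tendsto_const_nhds hb (fun _ => zero_le)
      fun t => ?_
    have m1 := (h.memLp_seq t).sub h.memLp_lim
    have m2 := (h'.memLp_seq t).sub h'.memLp_lim
    have e : ((fun x => F t x * F' t x) - fun x => G x * G' x)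
        = (F t - G) • F' t + G • (F' t - G') := by
      ext x; simp only [Pi.sub_apply, Pi.add_apply, smul_eq_mul, Pi.mul_apply]; ring
    have e2 : F' t = (F' t - G') + G' := by ext x; simp
    simp only [e]
    refine (eLpNorm_add_le (m1.1.smul (h'.memLp_seq t).1) (h.memLp_lim.1.smul m2.1) hr1).trans
      (add_le_add ?_ ?_)
    · refine (eLpNorm_smul_le_mul_eLpNorm (p := p) (q := q) (h'.memLp_seq t).1 m1.1).trans ?_
      gcongr
      conv_lhs => rw [e2]
      exact eLpNorm_add_le m2.1 h'.memLp_lim.1 hq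
    · exact eLpNorm_smul_le_mul_eLpNorm (p := p) (q := q) m2.1 h.memLp_lim.1

lemma tendsto_integral (h : TendstoLp μ p F G) (hp : 1 ≤ p) :
    Tendsto (fun t => ∫ x, F t x ∂μ) atTop (𝓝 (∫ x, G x ∂μ)) :=
  tendsto_integral_of_L1' G h.memLp_lim.1
    (Eventually.of_forall fun t => (h.memLp_seq t).integrable hp) (h.mono hp).tendsto

lemma tendsto_lpNorm (h : TendstoLp μ p F G) (hp : 1 ≤ p) :
    Tendsto (fun t => lpNorm (F t) p μ) atTop (𝓝 (lpNorm G p μ)) := by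
  have h0 : Tendsto (fun t => lpNorm (F t - G) p μ) atTop (𝓝 0) := by
    have := (ENNReal.tendsto_toReal ENNReal.zero_ne_top).comp h.tendsto
    refine this.congr fun t => ?_
    exact toReal_eLpNorm ((h.memLp_seq t).sub h.memLp_lim).1
  rw [tendsto_iff_dist_tendsto_zero]
  refine squeeze_zero (fun _ => dist_nonneg) (fun t => ?_) h0
  rw [Real.dist_eq, abs_sub_le_iff]
  have h1 := lpNorm_le_lpNorm_add_lpNorm_sub' (f := F t) h.memLp_lim hp
  have h2 := lpNorm_le_lpNorm_add_lpNorm_sub (f := G) (h.memLp_seq t) hp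
  exact ⟨by linarith, by linarith⟩

lemma tendsto_integral_lipschitz (h : TendstoLp μ p F G) (hp : 1 ≤ p) {f : ℝ → ℝ}
    (hf : ∀ x y, |f x - f y| ≤ |x - y|) (hfm : Measurable f) (hb : ∀ x, |f x| ≤ 1) :
    Tendsto (fun t => ∫ x, f (F t x) ∂μ) atTop (𝓝 (∫ x, f (G x) ∂μ)) := by
  have hi : ∀ H : α → ℝ, AEStronglyMeasurable H μ → Integrable (fun x => f (H x)) μ := fun H hH =>
    Integrable.of_bound (hfm.comp_aemeasurable hH.aemeasurable).aestronglyMeasurable 1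
      (ae_of_all _ fun x => hb _)
  refine tendsto_integral_of_L1' _ (hi _ h.memLp_lim.1).1
    (Eventually.of_forall fun t => hi _ (h.memLp_seq t).1) ?_
  refine tendsto_of_tendsto_of_tendsto_of_le_of_le tendsto_const_nhds (h.mono hp).tendsto
    (fun _ => zero_le) fun t => ?_
  exact eLpNorm_mono fun x => hf _ _

end TendstoLp

/-! ### Linear and quadratic forms in functions of infinitely many innovations -/

/-- The exponents for quadratic forms: a product of two L⁴ functions lies in L². -/
instance : ENNReal.HolderTriple 4 4 2 where
  inv_add_inv_eq_inv := by
    rw [← two_mul, show (4 : ℝ≥0∞) = 2 * 2 by norm_num, ENNReal.mul_inv (by simp) (by simp),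
      ← mul_assoc, ENNReal.mul_inv_cancel (by simp) (by simp), one_mul]

/-- An array of centred functions of the innovations whose dependence on the single innovations is
controlled by `d`. -/
structure WeakArray {ι : Type*} (ρ : ℕ → Measure ℝ) (q : ℕ) (G : ι → (ℕ → ℝ) → ℝ) (d : ι → ℕ → ℝ) :
    Prop where
  measurable : ∀ l, Measurable (G l)
  memLp : ∀ l, MemLp (G l) q (Measure.infinitePi ρ)
  centred : ∀ l, ∫ x, G l x ∂Measure.infinitePi ρ = 0
  nonneg : ∀ l k, 0 ≤ d l k
  dep_le : ∀ l k, eLpNorm (fun p : (ℕ → ℝ) × ℝ => G l p.1 - G l (Function.update p.1 k p.2)) q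
      ((Measure.infinitePi ρ).prod (ρ k)) ≤ ENNReal.ofReal (d l k)

variable {ρ : ℕ → Measure ℝ} [∀ k, IsProbabilityMeasure (ρ k)]
variable {ι : Type*} [Fintype ι] {G : ι → (ℕ → ℝ) → ℝ} {d : ι → ℕ → ℝ} {R W : ℝ} {q : ℕ}

namespace WeakArray

lemma exists_approx (hq : 1 ≤ q) (h : WeakArray ρ q G d) :
    ∃ (N : ℕ → ℕ) (F : ℕ → ι → (ℕ → ℝ) → ℝ), (∀ t l, BM (F t l)) ∧ (∀ t l, Upto (N t) (F t l)) ∧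
      (∀ t l, ∫ x, F t l x ∂Measure.infinitePi ρ = 0) ∧
      (∀ t l k, lpNorm (res ρ k (F t l)) q (Measure.infinitePi ρ) ≤ d l k) ∧
      ∀ l, TendstoLp (Measure.infinitePi ρ) q (fun t => F t l) (G l) := by
  have key : ∀ (t : ℕ) (l : ι), _ := fun t l => exists_approx_single (ρ := ρ) hq (h.measurable l)
    (h.memLp l) (h.centred l) (h.nonneg l) (h.dep_le l) (τ := 1 / (t + 1)) (by positivity)
  choose N F h1 h2 h3 h4 h5 using key
  refine ⟨fun t => Finset.univ.sup (N t), F, h1, fun t l => (h2 t l).mono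
    (Finset.le_sup (f := N t) (Finset.mem_univ l)), h3, h4, fun l => ⟨fun t => (h1 t l).memLp _,
    h.memLp l, ?_⟩⟩
  have h0 : Tendsto (fun t : ℕ => ENNReal.ofReal (1 / ((t : ℝ) + 1))) atTop (𝓝 0) := by
    have := ENNReal.tendsto_ofReal (tendsto_one_div_add_atTop_nhds_zero_nat (𝕜 := ℝ))
    simpa using this
  exact tendsto_of_tendsto_of_tendsto_of_le_of_le tendsto_const_nhds h0 (fun _ => zero_le)
    fun t => h5 t l

variable (hR : 0 ≤ R) (hrow : ∀ N l, ∑ k ∈ Finset.range N, d l k ≤ R) (hcol : ∀ k, ∑ l, d l k ≤ R)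

include hR hrow hcol

lemma lpNorm_linear_sq_le {r : ℕ} (hr : 1 ≤ r) (h : WeakArray ρ (2 * r) G d) (a : ι → ℝ) :
    lpNorm (fun x => ∑ l, a l * G l x) (2 * r : ℕ) (Measure.infinitePi ρ) ^ 2
      ≤ 4 * 4 ^ r * R ^ 2 * ∑ l, a l ^ 2 := by
  obtain ⟨N, F, h1, h2, h3, h4, h5⟩ := h.exists_approx (by lia)
  have hp : (1 : ℝ≥0∞) ≤ (2 * r : ℕ) := by exact_mod_cast (by lia : 1 ≤ 2 * r)
  have ht := (TendstoLp.sum (s := Finset.univ) hp fun l _ => (h5 l).const_mul (a l)).tendsto_lpNorm hp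
  refine le_of_tendsto (ht.pow 2) (Eventually.of_forall fun t => ?_)
  exact RidgeBootstrap.lpNorm_linear_sq_le hr (h1 t) (h2 t) (h3 t) h.nonneg (h4 t) hR (hrow (N t))
    hcol a

lemma integral_linear_sq_le (hq : 2 ≤ q) (h : WeakArray ρ q G d) (a : ι → ℝ) :
    ∫ x, (∑ l, a l * G l x) ^ 2 ∂Measure.infinitePi ρ ≤ 16 * R ^ 2 * ∑ l, a l ^ 2 := by
  obtain ⟨N, F, h1, h2, h3, h4, h5⟩ := h.exists_approx (by lia)
  have hp : (2 : ℝ≥0∞) ≤ q := by exact_mod_cast hq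
  have ht := TendstoLp.sum (s := Finset.univ) one_le_two
    fun l _ => ((h5 l).mono hp).const_mul (a l)
  have ht2 := (ht.mul ht one_le_two le_rfl).tendsto_integral (p := 1) le_rfl
  simp only [← sq] at ht2
  refine le_of_tendsto ht2 (Eventually.of_forall fun t => ?_)
  have hd : ∀ l k, lpNorm (res ρ k (F t l)) (2 * 1 : ℕ) (Measure.infinitePi ρ) ≤ d l k := fun l k =>
    (lpNorm_mono_exp (by lia) ((h1 t l).res k)).trans (h4 t l k)
  have := RidgeBootstrap.lpNorm_linear_sq_le (r := 1) le_rfl (h1 t) (h2 t) (h3 t) h.nonneg hd hR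
    (hrow (N t)) hcol a
  have e := lpNorm_pow_eq_integral (μ := Measure.infinitePi ρ) two_ne_zero
    (BM.linear (h1 t) a)
  simp only [mul_one, sq_abs] at this e
  rw [e] at this
  linarith

lemma integral_quadratic_sq_le (hq : 4 ≤ q) (h : WeakArray ρ q G d) (a : ι → ι → ℝ) :
    ∫ x, (∑ l, ∑ l', a l l' * (G l x * G l' x)
        - ∫ x, ∑ l, ∑ l', a l l' * (G l x * G l' x) ∂Measure.infinitePi ρ) ^ 2 ∂Measure.infinitePi ρ
      ≤ 16384 * R ^ 4 * ∑ l, ∑ l', a l l' ^ 2 := by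
  obtain ⟨N, F, h1, h2, h3, h4, h5⟩ := h.exists_approx (by lia)
  have hp : (4 : ℝ≥0∞) ≤ q := by exact_mod_cast hq
  have h14 : (1 : ℝ≥0∞) ≤ 4 := by norm_num
  have ht := TendstoLp.sum (s := Finset.univ) (p := 2) one_le_two fun l _ =>
    TendstoLp.sum (s := Finset.univ) (p := 2) one_le_two fun l' _ =>
      (TendstoLp.mul ((h5 l).mono hp) ((h5 l').mono hp) h14 one_le_two).const_mul (a l l')
  have hc := ht.tendsto_integral one_le_two
  have hcL : TendstoLp (Measure.infinitePi ρ) 2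
      (fun t _ => ∫ x, ∑ l, ∑ l', a l l' * (F t l x * F t l' x) ∂Measure.infinitePi ρ)
      (fun _ => ∫ x, ∑ l, ∑ l', a l l' * (G l x * G l' x) ∂Measure.infinitePi ρ) := by
    refine ⟨fun t => memLp_const _, memLp_const _, ?_⟩
    have : Tendsto (fun t => ‖(∫ x, ∑ l, ∑ l', a l l' * (F t l x * F t l' x) ∂Measure.infinitePi ρ)
        - ∫ x, ∑ l, ∑ l', a l l' * (G l x * G l' x) ∂Measure.infinitePi ρ‖ₑ) atTop (𝓝 0) := by
      have h0 := (tendsto_sub_nhds_zero_iff.2 hc).enorm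
      simpa using h0
    refine this.congr fun t => ?_
    have e := eLpNorm_const' (μ := Measure.infinitePi ρ) (p := 2)
      ((∫ x, ∑ l, ∑ l', a l l' * (F t l x * F t l' x) ∂Measure.infinitePi ρ)
        - ∫ x, ∑ l, ∑ l', a l l' * (G l x * G l' x) ∂Measure.infinitePi ρ) (by simp) (by simp)
    simp only [measure_univ, ENNReal.one_rpow, mul_one] at e
    rw [← e]
    rfl
  have hd := (ht.add (hcL.const_mul (-1)) one_le_two)
  have hd2 := (hd.mul hd one_le_two le_rfl).tendsto_integral (p := 1) le_rfl
  simp only [← sq, neg_one_mul, ← sub_eq_add_neg] at hd2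
  refine le_of_tendsto hd2 (Eventually.of_forall fun t => ?_)
  have hd4 : ∀ l k, lpNorm (res ρ k (F t l)) 4 (Measure.infinitePi ρ) ≤ d l k := fun l k =>
    le_trans (by exact_mod_cast lpNorm_mono_exp hq ((h1 t l).res k)) (h4 t l k)
  have := lpNorm_quadratic_sq_le (h1 t) (h2 t) (h3 t) h.nonneg hd4 hR (hrow (N t)) hcol a
  have hQ : BM fun x => ∑ l, ∑ l', a l l' * (F t l x * F t l' x)
        - ∫ x, ∑ l, ∑ l', a l l' * (F t l x * F t l' x) ∂Measure.infinitePi ρ :=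
    (BM.sum fun l _ => BM.sum fun l' _ => ((h1 t l).mul (h1 t l')).const_mul _).sub (BM.const _)
  have e := lpNorm_pow_eq_integral (μ := Measure.infinitePi ρ) two_ne_zero hQ
  simp only [sq_abs, Nat.cast_ofNat] at e
  rwa [e] at this

omit hR hrow hcol in
-- The bound M is required for every N because the number of coordinates in the approximating
-- functions is not bounded.
lemma sum_abs_cov_le (hq : 2 ≤ q) (h : WeakArray ρ q G d) (l : ι) (c : ι → ℝ) (hc : ∀ l', 0 ≤ c l')
    {M : ℝ} (hM : ∀ N, ∑ l', c l' * ∑ k ∈ Finset.range N, d l k * d l' k ≤ M) :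
    ∑ l', c l' * |∫ x, G l x * G l' x ∂Measure.infinitePi ρ| ≤ M := by
  obtain ⟨N, F, h1, h2, h3, h4, h5⟩ := h.exists_approx (by lia)
  have hp : (2 : ℝ≥0∞) ≤ q := by exact_mod_cast hq
  have ht : Tendsto (fun t => ∑ l', c l' * |∫ x, F t l x * F t l' x ∂Measure.infinitePi ρ|) atTop
      (𝓝 (∑ l', c l' * |∫ x, G l x * G l' x ∂Measure.infinitePi ρ|)) := by
    refine tendsto_finsetSum _ fun l' _ => Tendsto.const_mul _ (Tendsto.abs ?_)
    exact (((h5 l).mono hp).mul ((h5 l').mono hp) one_le_two le_rfl).tendsto_integral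
      (p := 1) le_rfl
  refine le_of_tendsto ht (Eventually.of_forall fun t => le_trans (Finset.sum_le_sum fun l' _ => ?_)
    (hM (N t)))
  refine mul_le_mul_of_nonneg_left ?_ (hc l')
  have := abs_cov_le (ρ := ρ) (h1 t l) (h1 t l') (h2 t l)
  simp only [h3, sub_zero] at this
  refine this.trans (Finset.sum_le_sum fun k _ => ?_)
  have h2q : ∀ l, lpNorm (res ρ k (F t l)) 2 (Measure.infinitePi ρ) ≤ d l k := fun l =>
    le_trans (by exact_mod_cast lpNorm_mono_exp hq ((h1 t l).res k)) (h4 t l k)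
  exact mul_le_mul (h2q l) (h2q l') lpNorm_nonneg (h.nonneg l k)

lemma abs_integral_cos_sin_sub_le (hq : 4 ≤ q) (h : WeakArray ρ q G d) (hW : 0 ≤ W)
    (hmrow : ∀ N l, ∑ k ∈ Finset.range N, ∑ j ∈ Finset.range N, min (d l j) (d l k) ≤ W)
    (hmcol : ∀ N k, ∑ l, ∑ j ∈ Finset.range N, min (d l j) (d l k) ≤ W)
    (v : ι → ℝ) {V : ℝ} (hV : ∀ l, |v l| ≤ V) (hV0 : 0 ≤ V) :
    |∫ x, Real.cos (∑ l, v l * G l x) ∂Measure.infinitePi ρ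
      - Real.exp (-((∫ x, (∑ l, v l * G l x) ^ 2 ∂Measure.infinitePi ρ) / 2))|
      ≤ V * (32 * R * W * √(∑ l, v l ^ 2) + R ^ 3 * ∑ l, v l ^ 2) ∧
    |∫ x, Real.sin (∑ l, v l * G l x) ∂Measure.infinitePi ρ|
      ≤ V * (32 * R * W * √(∑ l, v l ^ 2) + R ^ 3 * ∑ l, v l ^ 2) := by
  obtain ⟨N, F, h1, h2, h3, h4, h5⟩ := h.exists_approx (by lia)
  have hp : (2 : ℝ≥0∞) ≤ q := by exact_mod_cast (by lia : 2 ≤ q)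
  have hd4 : ∀ t l k, lpNorm (res ρ k (F t l)) 4 (Measure.infinitePi ρ) ≤ d l k := fun t l k =>
    le_trans (by exact_mod_cast lpNorm_mono_exp hq ((h1 t l).res k)) (h4 t l k)
  have ht := TendstoLp.sum (s := Finset.univ) one_le_two
    fun l _ => ((h5 l).mono hp).const_mul (v l)
  have ht2 := (ht.mul ht one_le_two le_rfl).tendsto_integral (p := 1) le_rfl
  simp only [← sq] at ht2
  have hcos := ht.tendsto_integral_lipschitz one_le_two
    (fun x y => Real.abs_cos_sub_cos_le x y) (by fun_prop) Real.abs_cos_le_one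
  have hsin := ht.tendsto_integral_lipschitz one_le_two
    (fun x y => Real.abs_sin_sub_sin_le x y) (by fun_prop) Real.abs_sin_le_one
  have hb := fun t => RidgeBootstrap.abs_integral_cos_sin_sub_le v (h1 t) (h2 t) (h3 t) h.nonneg
    (hd4 t) hR (hrow (N t)) hcol hW (hmrow (N t)) (hmcol (N t)) hV hV0
  constructor
  · refine le_of_tendsto (hcos.sub ((Real.continuous_exp.tendsto _).comp (ht2.div_const 2).neg)).abs
      (Eventually.of_forall fun t => (hb t).1)
  · exact le_of_tendsto hsin.abs (Eventually.of_forall fun t => (hb t).2)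

end WeakArray

end RidgeBootstrap

namespace RidgeBootstrap

set_option linter.unusedSectionVars false

/-! ### Shifted dependence coefficients -/

/-- `f` shifted to the right so that it starts at the innovation of the time `l`. -/
def shiftd {n : ℕ} (f : ℕ → ℝ) (l : Fin n) (k : ℕ) : ℝ :=
  if k < n - 1 - l.val then 0 else f (k - (n - 1 - l.val))

section shift

variable {n : ℕ} {f : ℕ → ℝ} {B : ℝ}

lemma shiftd_nonneg (hf : ∀ a, 0 ≤ f a) (l : Fin n) (k : ℕ) : 0 ≤ shiftd f l k := by
  unfold shiftd
  split_ifs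
  · exact le_rfl
  · exact hf _

lemma sum_range_shiftd_le (hf : ∀ a, 0 ≤ f a) (hB : ∀ K, ∑ a ∈ Finset.range K, f a ≤ B) (N : ℕ)
    (l : Fin n) : ∑ k ∈ Finset.range N, shiftd f l k ≤ B := by
  have h1 : ∑ k ∈ Finset.range N, shiftd f l k ≤ ∑ k ∈ Finset.range (n - 1 - l.val + N), shiftd f l k :=
    Finset.sum_le_sum_of_subset_of_nonneg (Finset.range_mono (by lia))
      fun k _ _ => shiftd_nonneg hf l k
  refine h1.trans ?_
  rw [Finset.sum_range_add]
  have e1 : ∑ k ∈ Finset.range (n - 1 - l.val), shiftd f l k = 0 :=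
    Finset.sum_eq_zero fun k hk => by simp [shiftd, Finset.mem_range.1 hk]
  have e2 : ∀ x, shiftd f l (n - 1 - l.val + x) = f x := fun x => by simp [shiftd]
  rw [e1, zero_add]
  simp only [e2]
  exact hB N

/-- For a fixed innovation, different errors see it at different lags, so a column sum is at most a
sum of f over distinct arguments. Reversing the index set makes this visible. -/
lemma sum_fin_shiftd_le (hf : ∀ a, 0 ≤ f a) (hB : ∀ K, ∑ a ∈ Finset.range K, f a ≤ B) (k : ℕ) :
    ∑ l : Fin n, shiftd f l k ≤ B := by
  have e : ∑ l : Fin n, shiftd f l k = ∑ s ∈ Finset.range n, if k < s then 0 else f (k - s) := by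
    rw [← Equiv.sum_comp Fin.revPerm, Finset.sum_range]
    refine Finset.sum_congr rfl fun l _ => ?_
    have : n - 1 - (Fin.rev l).val = l.val := by
      have := l.2
      simp only [Fin.val_rev]; lia
    simp only [shiftd, Fin.revPerm_apply, this]
  rw [e]
  have h1 : ∑ s ∈ Finset.range n, (if k < s then 0 else f (k - s))
      ≤ ∑ s ∈ Finset.range (k + 1 + n), if k < s then 0 else f (k - s) :=
    Finset.sum_le_sum_of_subset_of_nonneg (Finset.range_mono (by lia)) fun s _ _ => by
      split_ifs
      · exact le_rfl
      · exact hf _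
  refine h1.trans ?_
  rw [Finset.sum_range_add]
  have e1 : ∑ s ∈ Finset.range n, (if k < k + 1 + s then 0 else f (k - (k + 1 + s))) = 0 :=
    Finset.sum_eq_zero fun s _ => by rw [if_pos (by lia)]
  have e2 : ∑ s ∈ Finset.range (k + 1), (if k < s then 0 else f (k - s))
      = ∑ s ∈ Finset.range (k + 1), f (k + 1 - 1 - s) :=
    Finset.sum_congr rfl fun s hs => by
      rw [if_neg (by have := Finset.mem_range.1 hs; lia)]; rfl
  rw [e1, add_zero, e2, Finset.sum_range_reflect]
  exact hB _

/-- Both arguments of the minimum carry the same shift, so the inner sum is bounded by a shifted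
function of one variable, to which the row and column bounds apply once more. -/
lemma sum_min_shiftd_le (hf : ∀ a, 0 ≤ f a) (N : ℕ) (l : Fin n) (k : ℕ) :
    ∑ j ∈ Finset.range N, min (shiftd f l j) (shiftd f l k)
      ≤ shiftd (fun a => ∑ i ∈ Finset.range N, min (f i) (f a)) l k := by
  by_cases hk : k < n - 1 - l.val
  · have : shiftd f l k = 0 := by simp [shiftd, hk]
    rw [this]
    simp only [shiftd, hk, if_true]
    exact (Finset.sum_le_sum fun j _ => min_le_right _ _).trans (by simp)
  · set c := f (k - (n - 1 - l.val)) with hc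
    have e : shiftd f l k = c := by simp [shiftd, hk, hc]
    have e2 : ∀ j, min (shiftd f l j) c = shiftd (fun i => min (f i) c) l j := fun j => by
      unfold shiftd
      split_ifs
      · exact min_eq_left (hf _)
      · rfl
    rw [e]
    simp only [e2]
    have e3 : shiftd (fun a => ∑ i ∈ Finset.range N, min (f i) (f a)) l k
        = ∑ i ∈ Finset.range N, min (f i) c := by simp [shiftd, hk, hc]
    rw [e3]
    -- a shifted window of the sum
    have hg : ∀ a, 0 ≤ min (f a) c := fun a => le_min (hf a) (hf _)
    have h1 : ∑ j ∈ Finset.range N, shiftd (fun i => min (f i) c) l j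
        ≤ ∑ j ∈ Finset.range (n - 1 - l.val + N), shiftd (fun i => min (f i) c) l j :=
      Finset.sum_le_sum_of_subset_of_nonneg (Finset.range_mono (by lia))
        fun k _ _ => shiftd_nonneg hg l k
    refine h1.trans (le_of_eq ?_)
    rw [Finset.sum_range_add]
    have e1 : ∑ k ∈ Finset.range (n - 1 - l.val), shiftd (fun i => min (f i) c) l k = 0 :=
      Finset.sum_eq_zero fun k hk => by simp [shiftd, Finset.mem_range.1 hk]
    rw [e1, zero_add]
    exact Finset.sum_congr rfl fun x _ => by simp [shiftd]

/-- The minimum is at most the value at the larger index. With the smaller index fixed, summing over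
the larger one leaves a tail of f, and the tails are summable. -/
lemma sum_sum_min_le (hf : ∀ a, 0 ≤ f a) {β : ℕ → ℝ} (hβ : ∀ k K, ∑ a ∈ Finset.Ico k K, f a ≤ β k)
    (hβ0 : ∀ k, 0 ≤ β k) (hβs : Summable β) (N K : ℕ) :
    ∑ a ∈ Finset.range K, ∑ i ∈ Finset.range N, min (f i) (f a) ≤ 2 * ∑' k, β k := by
  set L := max N K
  have hm : ∀ i a, 0 ≤ min (f i) (f a) := fun i a => le_min (hf i) (hf a)
  have h1 : ∑ a ∈ Finset.range K, ∑ i ∈ Finset.range N, min (f i) (f a)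
      ≤ ∑ a ∈ Finset.range L, ∑ i ∈ Finset.range L, min (f i) (f a) := by
    refine (Finset.sum_le_sum fun a _ => Finset.sum_le_sum_of_subset_of_nonneg
      (Finset.range_mono (le_max_left N K)) fun i _ _ => hm i a).trans ?_
    exact Finset.sum_le_sum_of_subset_of_nonneg (Finset.range_mono (le_max_right N K))
      fun a _ _ => Finset.sum_nonneg fun i _ => hm i a
  have h2 : ∀ a ∈ Finset.range L, ∀ i ∈ Finset.range L,
      min (f i) (f a) ≤ (if i ≤ a then f a else 0) + (if a ≤ i then f i else 0) := by
    intro a _ i _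
    rcases le_total i a with h | h
    · rw [if_pos h]
      refine (min_le_right _ _).trans (le_add_of_nonneg_right ?_)
      split_ifs
      · exact hf _
      · exact le_rfl
    · rw [if_pos h]
      refine (min_le_left _ _).trans (le_add_of_nonneg_left ?_)
      split_ifs
      · exact hf _
      · exact le_rfl
  have h3 : ∑ i ∈ Finset.range L, ∑ a ∈ Finset.range L, (if i ≤ a then f a else 0) ≤ ∑' k, β k := by
    refine (Finset.sum_le_sum fun i _ => ?_).trans
      (hβs.sum_le_tsum (Finset.range L) fun k _ => hβ0 k)
    rw [← Finset.sum_filter]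
    refine le_trans (le_of_eq (Finset.sum_congr ?_ fun _ _ => rfl)) (hβ i L)
    ext a; simp [and_comm]
  refine (h1.trans (Finset.sum_le_sum fun a ha => Finset.sum_le_sum fun i hi => h2 a ha i hi)).trans ?_
  simp only [Finset.sum_add_distrib]
  rw [Finset.sum_comm (f := fun a i => if i ≤ a then f a else 0)]
  linarith

end shift

/-! ### Bounds for the errors -/

/-- Bounds for sums and quadratic forms of the errors. -/
structure NoiseBounds {n : ℕ} {Ω : Type*} [MeasurableSpace Ω] {P : Measure Ω} (E : ErrorProcess n P)
    (r : ℕ) (R W : ℝ) (T : ℕ → ℝ) : Prop where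
  memLp : ∀ i, MemLp (E.ε i) (2 * r : ℕ) P
  linear_pow : ∀ a : Fin n → ℝ,
    ∫ ω, (∑ i, a i * E.ε i ω) ^ (2 * r) ∂P ≤ (4 * 4 ^ r * R ^ 2 * ∑ i, a i ^ 2) ^ r
  linear_sq : ∀ a : Fin n → ℝ, ∫ ω, (∑ i, a i * E.ε i ω) ^ 2 ∂P ≤ 16 * R ^ 2 * ∑ i, a i ^ 2
  quadratic : ∀ a : Fin n → Fin n → ℝ,
    ∫ ω, (∑ i, ∑ j, a i j * (E.ε i ω * E.ε j ω) - ∑ i, ∑ j, a i j * E.cov i j) ^ 2 ∂P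
      ≤ 16384 * R ^ 4 * ∑ i, ∑ j, a i j ^ 2
  cov_sum : ∀ (S : ℕ) (κ : ℝ) (i : Fin n) (c : Fin n → ℝ), 0 ≤ κ → (∀ j, 0 ≤ c j) → (∀ j, c j ≤ 1) →
    (∀ j : Fin n, |(i.val : ℤ) - j.val| < S → c j ≤ κ) →
    ∑ j, c j * |E.cov i j| ≤ κ * R ^ 2 + 2 * R * T S
  cos_sin : ∀ (v : Fin n → ℝ) (V : ℝ), 0 ≤ V → (∀ i, |v i| ≤ V) →
    |∫ ω, Real.cos (∑ i, v i * E.ε i ω) ∂P - Real.exp (-((∑ i, ∑ j, v i * v j * E.cov i j) / 2))|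
      ≤ V * (32 * R * W * √(∑ i, v i ^ 2) + R ^ 3 * ∑ i, v i ^ 2) ∧
    |∫ ω, Real.sin (∑ i, v i * E.ε i ω) ∂P|
      ≤ V * (32 * R * W * √(∑ i, v i ^ 2) + R ^ 3 * ∑ i, v i ^ 2)

namespace ErrorProcess

variable {n : ℕ} {Ω : Type*} [MeasurableSpace Ω] {P : Measure Ω} [IsProbabilityMeasure P]
  (E : ErrorProcess n P)

/-- The innovations, backwards in time. -/
def innov (ω : Ω) (k : ℕ) : ℝ := E.e ((n : ℤ) - k) ω

/-- The laws of the innovations. -/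
noncomputable def innovLaw (k : ℕ) : Measure ℝ := P.map (E.e ((n : ℤ) - k))

/-- The errors as functions of the innovations. -/
def errFun (l : Fin n) (x : ℕ → ℝ) : ℝ := E.g l fun k => x (k + (n - 1 - l.val))

instance (k : ℕ) : IsProbabilityMeasure (E.innovLaw k) :=
  Measure.isProbabilityMeasure_map (E.measurable_e _).aemeasurable

lemma measurable_innov : Measurable E.innov := measurable_pi_iff.2 fun _ => E.measurable_e _

lemma measurable_errFun (l : Fin n) : Measurable (E.errFun l) :=
  (E.measurable_g l).comp (measurable_pi_iff.2 fun _ => measurable_pi_apply _)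

lemma ε_eq (l : Fin n) (ω : Ω) : E.ε l ω = E.errFun l (E.innov ω) := by
  unfold ε errFun innov
  congr 1
  ext k
  have := l.2
  have e : ((l.val : ℤ) + 1 - k) = (n : ℤ) - ((k + (n - 1 - l.val) : ℕ) : ℤ) := by lia
  rw [e]

lemma εCoupled_eq (l : Fin n) (j : ℕ) (ω : Ω) :
    E.εCoupled l j ω = E.errFun l (Function.update (E.innov ω) (j + (n - 1 - l.val))
      (E.eDag ((n : ℤ) - (j + (n - 1 - l.val) : ℕ)) ω)) := by
  unfold εCoupled errFun innov
  congr 1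
  ext k
  have := l.2
  have e : ((l.val : ℤ) + 1 - k) = (n : ℤ) - ((k + (n - 1 - l.val) : ℕ) : ℤ) := by lia
  rw [e]
  split_ifs with h
  · subst h; simp
  · rw [Function.update_of_ne (by lia)]

lemma measurable_ε (l : Fin n) : Measurable (E.ε l) := by
  have : E.ε l = E.errFun l ∘ E.innov := funext (E.ε_eq l)
  rw [this]
  exact (E.measurable_errFun l).comp E.measurable_innov

lemma map_innov : P.map E.innov = Measure.infinitePi E.innovLaw := by
  have h := E.indep.precomp (g := fun k : ℕ => (Sum.inl ((n : ℤ) - k) : ℤ ⊕ ℤ)) (by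
    intro a b hab
    simp only [Sum.inl.injEq] at hab
    lia)
  exact iIndepFun.map_fun_eq_infinitePi_map (X := fun (k : ℕ) => E.e ((n : ℤ) - k))
    (fun k => E.measurable_e _) h

/-- The replacement innovation is independent of the whole sequence and has the law of the
coordinate it replaces, so the coupled pair lives on the product of the innovation law with one
extra factor. -/
lemma map_innov_prod (k : ℕ) :
    P.map (fun ω => (E.innov ω, E.eDag ((n : ℤ) - k) ω))
      = (Measure.infinitePi E.innovLaw).prod (E.innovLaw k) := by
  have hm : ∀ i, Measurable (Sum.elim E.e E.eDag i) := by
    rintro (i | i)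
    · exact E.measurable_e i
    · exact E.measurable_eDag i
  have hi : IndepFun E.innov (E.eDag ((n : ℤ) - k)) P := by
    rw [IndepFun_iff_Indep]
    have h := indep_iSup_of_disjoint (fun i => (hm i).comap_le) E.indep.iIndep
      (S := Set.range Sum.inl) (T := Set.range Sum.inr)
      (Set.disjoint_left.2 (by rintro _ ⟨a, rfl⟩ ⟨b, hb⟩; simp at hb))
    refine indep_of_indep_of_le_left (m₁ := ⨆ i ∈ Set.range Sum.inl, MeasurableSpace.comap (Sum.elim E.e E.eDag i) inferInstance) (indep_of_indep_of_le_right (m₂ := ⨆ i ∈ Set.range Sum.inr, MeasurableSpace.comap (Sum.elim E.e E.eDag i) inferInstance) h ?_) ?_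
    · exact le_iSup₂_of_le (Sum.inr ((n : ℤ) - k)) ⟨_, rfl⟩ le_rfl
    · simp only [MeasurableSpace.pi, MeasurableSpace.comap_iSup, MeasurableSpace.comap_comp]
      refine iSup_le fun j => ?_
      exact le_iSup₂_of_le (f := fun (i : ℤ ⊕ ℤ) (_ : i ∈ Set.range Sum.inl) =>
        MeasurableSpace.comap (Sum.elim E.e E.eDag i) inferInstance)
        (Sum.inl ((n : ℤ) - j)) ⟨_, rfl⟩ le_rfl
  rw [hi.map_prod_eq_prod_map_map E.measurable_innov.aemeasurable
    (E.measurable_eDag _).aemeasurable, E.map_innov, (E.identDistrib _).map_eq]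
  rfl

lemma integral_comp_ε {φ : (Fin n → ℝ) → ℝ} (hφ : Measurable φ) :
    ∫ ω, φ (fun i => E.ε i ω) ∂P = ∫ x, φ (fun i => E.errFun i x) ∂Measure.infinitePi E.innovLaw := by
  have h := integral_map (μ := P) (φ := E.innov) (f := fun x => φ (fun i => E.errFun i x))
    E.measurable_innov.aemeasurable
    (hφ.comp (measurable_pi_iff.2 fun i => E.measurable_errFun i)).aestronglyMeasurable
  rw [← E.map_innov, h]
  simp only [E.ε_eq]

lemma memLp_errFun_iff (l : Fin n) (p : ℝ≥0∞) :
    MemLp (E.errFun l) p (Measure.infinitePi E.innovLaw) ↔ MemLp (E.ε l) p P := by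
  rw [← E.map_innov, memLp_map_measure_iff (E.measurable_errFun l).aestronglyMeasurable
    E.measurable_innov.aemeasurable]
  have : E.ε l = E.errFun l ∘ E.innov := funext (E.ε_eq l)
  rw [this]

/-- Coordinate k carries the innovation of time n − k, and the index l stands for time l + 1. An
innovation with k < n − 1 − l is later than the error and has no effect. Otherwise its lag is k − (n
− 1 − l). -/
lemma weakArray {m : ℝ} {q : ℕ} (hqm : (q : ℝ) ≤ m)
    (hmom : ∀ l, eLpNorm (E.ε l) (ENNReal.ofReal m) P < ∞) (h0 : ∀ l, ∫ ω, E.ε l ω ∂P = 0)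
    {D : ℕ → ℝ} (hD0 : ∀ a, 0 ≤ D a) (hD : ∀ l a, E.dep m l a ≤ ENNReal.ofReal (D a)) :
    WeakArray E.innovLaw q E.errFun (shiftd D) where
  measurable := E.measurable_errFun
  memLp l := by
    rw [E.memLp_errFun_iff]
    have h : MemLp (E.ε l) (ENNReal.ofReal m) P := ⟨(E.measurable_ε l).aestronglyMeasurable, hmom l⟩
    refine h.mono_exponent ?_
    rw [← ENNReal.ofReal_natCast]
    exact ENNReal.ofReal_le_ofReal hqm
  centred l := by
    have := E.integral_comp_ε (φ := fun x => x l) (measurable_pi_apply l)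
    rw [← this]; exact h0 l
  nonneg := shiftd_nonneg hD0
  dep_le l k := by
    have hm : Measurable fun p : (ℕ → ℝ) × ℝ =>
        E.errFun l p.1 - E.errFun l (Function.update p.1 k p.2) :=
      ((E.measurable_errFun l).comp measurable_fst).sub
        ((E.measurable_errFun l).comp (measurable_update_uncurry k))
    rw [← E.map_innov_prod k, eLpNorm_map_measure hm.aestronglyMeasurable
      (E.measurable_innov.prodMk (E.measurable_eDag _)).aemeasurable]
    unfold shiftd
    split_ifs with hk
    · have : ((fun p : (ℕ → ℝ) × ℝ => E.errFun l p.1 - E.errFun l (Function.update p.1 k p.2)) ∘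
          fun ω => (E.innov ω, E.eDag ((n : ℤ) - k) ω)) = fun _ => 0 := by
        ext ω
        simp only [Function.comp, errFun, sub_eq_zero]
        congr 1
        ext i
        rw [Function.update_of_ne (by lia)]
      rw [this]; simp
    · refine le_trans ?_ (hD l (k - (n - 1 - l.val)))
      unfold dep
      have e : ((fun p : (ℕ → ℝ) × ℝ => E.errFun l p.1 - E.errFun l (Function.update p.1 k p.2)) ∘
          fun ω => (E.innov ω, E.eDag ((n : ℤ) - k) ω))
          = fun ω => E.ε l ω - E.εCoupled l (k - (n - 1 - l.val)) ω := by
        ext ω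
        rw [E.εCoupled_eq, E.ε_eq, Nat.sub_add_cancel (not_lt.1 hk)]
        rfl
      rw [e]
      refine eLpNorm_le_eLpNorm_of_exponent_le ?_ ?_
      · rw [← ENNReal.ofReal_natCast]
        exact ENNReal.ofReal_le_ofReal hqm
      · rw [← e]
        exact (hm.comp (E.measurable_innov.prodMk (E.measurable_eDag _))).aestronglyMeasurable

/-- With β k dominating the tail of the dependence coefficients from lag k on, β 0 bounds all row
and column sums, twice the sum of the tails bounds the sums of minima, and β S bounds the
covariances at distance at least S. -/
lemma noiseBounds {m : ℝ} {r : ℕ} (hr : 2 ≤ r) (hqm : ((2 * r : ℕ) : ℝ) ≤ m)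
    (hmom : ∀ l, eLpNorm (E.ε l) (ENNReal.ofReal m) P < ∞) (h0 : ∀ l, ∫ ω, E.ε l ω ∂P = 0)
    {D : ℕ → ℝ} (hD0 : ∀ a, 0 ≤ D a) (hD : ∀ l a, E.dep m l a ≤ ENNReal.ofReal (D a))
    {β : ℕ → ℝ} (hβ : ∀ k K, ∑ a ∈ Finset.Ico k K, D a ≤ β k) (hβs : Summable β) :
    NoiseBounds E r (β 0) (2 * ∑' k, β k) β := by
  have hβ0 : ∀ k, 0 ≤ β k := fun k => by simpa using hβ k k
  have hsum : ∀ K, ∑ a ∈ Finset.range K, D a ≤ β 0 := fun K => by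
    rw [Finset.range_eq_Ico]; exact hβ 0 K
  have hW := E.weakArray (q := 2 * r) hqm hmom h0 hD0 hD
  have hrow := fun N (l : Fin n) => sum_range_shiftd_le (n := n) hD0 hsum N l
  have hcol := fun k => sum_fin_shiftd_le (n := n) hD0 hsum k
  have hR := hβ0 0
  have hmm0 : ∀ N a, 0 ≤ ∑ i ∈ Finset.range N, min (D i) (D a) := fun N a =>
    Finset.sum_nonneg fun i _ => le_min (hD0 i) (hD0 a)
  have hcov : ∀ i j, E.cov i j = ∫ x, E.errFun i x * E.errFun j x ∂Measure.infinitePi E.innovLaw :=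
    fun i j => E.integral_comp_ε (φ := fun x => x i * x j) (by fun_prop)
  have hmem : ∀ i, MemLp (E.errFun i) 2 (Measure.infinitePi E.innovLaw) := fun i =>
    (hW.memLp i).mono_exponent (by exact_mod_cast (by lia : 2 ≤ 2 * r))
  have hint : ∀ i j, Integrable (fun x => E.errFun i x * E.errFun j x)
      (Measure.infinitePi E.innovLaw) := fun i j => (hmem i).integrable_mul (hmem j)
  have hquad : ∀ a : Fin n → Fin n → ℝ, ∑ i, ∑ j, a i j * E.cov i j
      = ∫ x, ∑ i, ∑ j, a i j * (E.errFun i x * E.errFun j x) ∂Measure.infinitePi E.innovLaw := by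
    intro a
    rw [integral_finsetSum _ fun i _ => integrable_finsetSum _ fun j _ => (hint i j).const_mul _]
    refine Finset.sum_congr rfl fun i _ => ?_
    rw [integral_finsetSum _ fun j _ => (hint i j).const_mul _]
    simp only [integral_const_mul, hcov]
  refine ⟨?_, ?_, ?_, ?_, ?_, ?_⟩
  · exact fun i => (E.memLp_errFun_iff i _).1 (hW.memLp i)
  · intro a
    rw [E.integral_comp_ε (φ := fun x => (∑ i, a i * x i) ^ (2 * r)) (by fun_prop)]
    have h1 := WeakArray.lpNorm_linear_sq_le hR hrow hcol (by lia) hW a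
    have hm : AEStronglyMeasurable (fun x => ∑ i, a i * E.errFun i x)
        (Measure.infinitePi E.innovLaw) :=
      (Finset.measurable_sum _ fun i _ => (E.measurable_errFun i).const_mul _).aestronglyMeasurable
    have e := lpNorm_eq_integral_norm_rpow_toReal (p := ((2 * r : ℕ) : ℝ≥0∞))
      (by exact_mod_cast (by lia : 2 * r ≠ 0)) (ENNReal.natCast_ne_top _) hm
    have e2 : ∫ x, (∑ i, a i * E.errFun i x) ^ (2 * r) ∂Measure.infinitePi E.innovLaw
        = lpNorm (fun x => ∑ i, a i * E.errFun i x) (2 * r : ℕ) (Measure.infinitePi E.innovLaw)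
          ^ (2 * r) := by
      rw [e]
      simp only [ENNReal.toReal_natCast, Real.rpow_natCast, Real.norm_eq_abs]
      rw [Real.rpow_inv_natCast_pow (integral_nonneg fun _ => by positivity) (by lia)]
      refine integral_congr_ae (ae_of_all _ fun x => ?_)
      simp only [pow_mul, sq_abs]
    rw [e2, pow_mul]
    exact pow_le_pow_left₀ (by positivity) h1 r
  · intro a
    rw [E.integral_comp_ε (φ := fun x => (∑ i, a i * x i) ^ 2) (by fun_prop)]
    exact WeakArray.integral_linear_sq_le hR hrow hcol (by lia) hW a
  · intro a
    rw [E.integral_comp_ε (φ := fun x => (∑ i, ∑ j, a i j * (x i * x j)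
      - ∑ i, ∑ j, a i j * E.cov i j) ^ 2) (by fun_prop), hquad]
    exact WeakArray.integral_quadratic_sq_le hR hrow hcol (by lia) hW a
  · intro S κ i c hκ hc0 hc1 hcκ
    simp only [hcov]
    refine hW.sum_abs_cov_le (by lia) i c hc0 fun N => ?_
    -- DS keeps the lags of at least S. If two errors are at least S apart, any innovation common to
    -- both has lag at least S from the later one, so one of the two coefficients may be replaced by
    -- its DS version.
    set DS : ℕ → ℝ := fun a => if S ≤ a then D a else 0 with hDS
    have hDS0 : ∀ a, 0 ≤ DS a := fun a => by
      simp only [hDS]; split_ifs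
      · exact hD0 a
      · exact le_rfl
    have hDSsum : ∀ K, ∑ a ∈ Finset.range K, DS a ≤ β S := fun K => by
      refine le_trans (le_of_eq ?_) (hβ S K)
      rw [← Finset.sum_filter]
      refine Finset.sum_congr ?_ fun _ _ => rfl
      ext a; simp [and_comm]
    have hpt : ∀ j k, c j * (shiftd D i k * shiftd D j k) ≤ κ * (shiftd D i k * shiftd D j k)
        + (shiftd DS i k * shiftd D j k + shiftd D i k * shiftd DS j k) := by
      intro j k
      have p1 := shiftd_nonneg hD0 i k
      have p2 := shiftd_nonneg hD0 j k
      have p3 := shiftd_nonneg hDS0 i k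
      have p4 := shiftd_nonneg hDS0 j k
      by_cases hS : |(i.val : ℤ) - j.val| < S
      · have := mul_le_mul_of_nonneg_right (hcκ j hS) (mul_nonneg p1 p2)
        have q1 := mul_nonneg p3 p2
        have q2 := mul_nonneg p1 p4
        linarith
      · have hle : c j * (shiftd D i k * shiftd D j k) ≤ shiftd D i k * shiftd D j k :=
          mul_le_of_le_one_left (mul_nonneg p1 p2) (hc1 j)
        have q0 := mul_nonneg hκ (mul_nonneg p1 p2)
        refine hle.trans (le_trans ?_ (le_add_of_nonneg_left q0))
        by_cases hi : k < n - 1 - i.val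
        · have : shiftd D i k = 0 := by simp [shiftd, hi]
          rw [this]; simp only [zero_mul, add_zero]; positivity
        by_cases hj : k < n - 1 - j.val
        · have : shiftd D j k = 0 := by simp [shiftd, hj]
          rw [this]; simp only [mul_zero, zero_add]; positivity
        have hi2 := i.2
        have hj2 := j.2
        rcases le_total i.val j.val with hij | hij
        · have hjs : S ≤ k - (n - 1 - j.val) := by
            rcases le_abs.1 (not_lt.1 hS) with h | h <;> omega
          have : shiftd DS j k = shiftd D j k := by simp [shiftd, hj, hDS, hjs]
          rw [this]
          have := mul_nonneg p3 p2
          linarith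
        · have hjs : S ≤ k - (n - 1 - i.val) := by
            rcases le_abs.1 (not_lt.1 hS) with h | h <;> omega
          have : shiftd DS i k = shiftd D i k := by simp [shiftd, hi, hDS, hjs]
          rw [this]
          have := mul_nonneg p1 p4
          linarith
    have hpair : ∀ f g : ℕ → ℝ, (∀ a, 0 ≤ f a) → (∀ a, 0 ≤ g a) → ∀ A B, 
        (∀ K, ∑ a ∈ Finset.range K, f a ≤ A) → (∀ K, ∑ a ∈ Finset.range K, g a ≤ B) → 
        ∑ j : Fin n, ∑ k ∈ Finset.range N, shiftd f i k * shiftd g j k ≤ A * B := by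
      intro f g hf hg A B hA hB
      have hB0 : 0 ≤ B := by simpa using hB 0
      rw [Finset.sum_comm]
      simp only [← Finset.mul_sum]
      calc ∑ k ∈ Finset.range N, shiftd f i k * ∑ j : Fin n, shiftd g j k
          ≤ ∑ k ∈ Finset.range N, shiftd f i k * B := Finset.sum_le_sum fun k _ =>
            mul_le_mul_of_nonneg_left (sum_fin_shiftd_le hg hB k) (shiftd_nonneg hf i k)
        _ = (∑ k ∈ Finset.range N, shiftd f i k) * B := by rw [Finset.sum_mul]
        _ ≤ A * B := by gcongr; exact sum_range_shiftd_le hf hA N i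
    have h1 := hpair D D hD0 hD0 _ _ hsum hsum
    have h2 := hpair DS D hDS0 hD0 _ _ hDSsum hsum
    have h3 := hpair D DS hD0 hDS0 _ _ hsum hDSsum
    calc ∑ j, c j * ∑ k ∈ Finset.range N, shiftd D i k * shiftd D j k
        ≤ ∑ j : Fin n, ∑ k ∈ Finset.range N, (κ * (shiftd D i k * shiftd D j k)
          + (shiftd DS i k * shiftd D j k + shiftd D i k * shiftd DS j k)) := by
          refine Finset.sum_le_sum fun j _ => ?_
          rw [Finset.mul_sum]
          exact Finset.sum_le_sum fun k _ => hpt j k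
      _ = κ * (∑ j : Fin n, ∑ k ∈ Finset.range N, shiftd D i k * shiftd D j k)
          + (∑ j : Fin n, ∑ k ∈ Finset.range N, shiftd DS i k * shiftd D j k
            + ∑ j : Fin n, ∑ k ∈ Finset.range N, shiftd D i k * shiftd DS j k) := by
          simp only [Finset.sum_add_distrib, Finset.mul_sum]
      _ ≤ κ * (β 0 * β 0) + (β S * β 0 + β 0 * β S) := by gcongr
      _ = _ := by ring
  · intro v V hV0 hV
    rw [E.integral_comp_ε (φ := fun x => Real.cos (∑ i, v i * x i)) (by fun_prop),
      E.integral_comp_ε (φ := fun x => Real.sin (∑ i, v i * x i)) (by fun_prop)]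
    have e : ∑ i, ∑ j, v i * v j * E.cov i j
        = ∫ x, (∑ i, v i * E.errFun i x) ^ 2 ∂Measure.infinitePi E.innovLaw := by
      rw [hquad fun i j => v i * v j]
      refine integral_congr_ae (ae_of_all _ fun x => ?_)
      simp only [sq, Finset.sum_mul_sum]
      exact Finset.sum_congr rfl fun i _ => Finset.sum_congr rfl fun j _ => by ring
    rw [e]
    have hZ : 0 ≤ ∑' k, β k := tsum_nonneg hβ0
    refine WeakArray.abs_integral_cos_sin_sub_le hR hrow hcol (by lia) hW (by positivity) ?_ ?_ v hV hV0
    · intro N l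
      refine (Finset.sum_le_sum fun k _ => sum_min_shiftd_le hD0 N l k).trans ?_
      exact sum_range_shiftd_le (hmm0 N) (fun K => sum_sum_min_le hD0 hβ hβ0 hβs N K) N l
    · intro N k
      refine (Finset.sum_le_sum fun l _ => sum_min_shiftd_le hD0 N l k).trans ?_
      exact sum_fin_shiftd_le (hmm0 N) (fun K => sum_sum_min_le hD0 hβ hβ0 hβs N K) k

end ErrorProcess

/-- The conditions on the errors yield bounds that are uniform in the sample size. -/
lemma Assumption2.exists_noiseBounds {Ω : ℕ → Type*} [∀ n, MeasurableSpace (Ω n)]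
    {P : ∀ n, Measure (Ω n)} [∀ n, IsProbabilityMeasure (P n)] {E : ∀ n, ErrorProcess n (P n)}
    {η m αε : ℝ} (h : Assumption2 E η m αε) {r : ℕ} (hr : 2 ≤ r) (hqm : ((2 * r : ℕ) : ℝ) ≤ m) :
    ∃ (R W : ℝ) (T : ℕ → ℝ), 0 ≤ R ∧ 0 ≤ W ∧ Tendsto T atTop (𝓝 0) ∧ (∀ S, 0 ≤ T S) ∧
      ∀ n ≥ 1, NoiseBounds (E n) r R W T := by
  obtain ⟨C, hC⟩ := h.dep_bound
  obtain ⟨C', hC'⟩ := h.moment_bound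
  set B := max C 0
  -- The dependence condition gives tails of order (k+1)^(−αε). The requirement αε > 1 is what makes
  -- the tails themselves summable.
  set β : ℕ → ℝ := fun k => B * ((k : ℝ) + 1) ^ (-αε) with hβ
  have hB0 : 0 ≤ B := le_max_right _ _
  have hβ0 : ∀ k, 0 ≤ β k := fun k => mul_nonneg hB0 (by positivity)
  have hβs : Summable β := by
    refine Summable.mul_left B ?_
    have := (summable_nat_add_iff 1).2 (Real.summable_nat_rpow.2 (by linarith [h.αε_gt] : -αε < -1))
    simpa using this
  refine ⟨β 0, 2 * ∑' k, β k, β, hβ0 0, mul_nonneg zero_le_two (tsum_nonneg hβ0),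
    hβs.tendsto_atTop_zero, hβ0, fun n hn => ?_⟩
  set Δ : ℕ → ℝ≥0∞ := fun a => ⨆ i, (E n).dep m i a with hΔ
  have hpos : ∀ k : ℕ, (0 : ℝ) < ((k : ℝ) + 1) ^ αε := fun k => by positivity
  have hts : ∀ k : ℕ, ∑' j, Δ (k + j) ≤ ENNReal.ofReal (β k) := by
    intro k
    have h1 := hC n hn k
    have e : β k = B / ((k : ℝ) + 1) ^ αε := by
      simp only [hβ]; rw [Real.rpow_neg (by positivity), div_eq_mul_inv]
    rw [e, ENNReal.ofReal_div_of_pos (hpos k)]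
    rw [ENNReal.le_div_iff_mul_le (Or.inl (by simpa using hpos k)) (Or.inl (by simp)), mul_comm]
    exact h1.trans (ENNReal.ofReal_le_ofReal (le_max_left _ _))
  have hΔle : ∀ a, Δ a ≤ ENNReal.ofReal (β a) := fun a =>
    le_trans (by simpa using ENNReal.le_tsum (f := fun j => Δ (a + j)) 0) (hts a)
  have hΔfin : ∀ a, Δ a ≠ ∞ := fun a => ((hΔle a).trans_lt ENNReal.ofReal_lt_top).ne
  refine (E n).noiseBounds hr hqm (fun l => (hC' n hn l).trans_lt ENNReal.ofReal_lt_top)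
    (h.mean_zero n hn) (D := fun a => (Δ a).toReal) (fun a => ENNReal.toReal_nonneg) ?_ ?_ hβs
  · intro l a
    rw [ENNReal.ofReal_toReal (hΔfin a)]
    exact le_iSup (fun i => (E n).dep m i a) l
  · intro k K
    rw [← ENNReal.toReal_sum fun a _ => hΔfin a]
    refine ENNReal.toReal_le_of_le_ofReal (hβ0 k) (le_trans ?_ (hts k))
    rw [Finset.sum_Ico_eq_sum_range]
    exact ENNReal.sum_le_tsum _

end RidgeBootstrap

namespace RidgeBootstrap

set_option linter.unusedSectionVars false

/-! ### Uniform convergence of distribution functions -/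

section Polya

/-- Pólya's theorem: a grid of mesh δ reaching to where G is nearly 1 needs only finitely many
pointwise limits. Monotonicity and the Lipschitz bound on G control what happens between grid
points. -/
lemma eventually_forall_abs_sub_le {F : ℕ → ℝ → ℝ} {G : ℝ → ℝ} {L : ℝ}
    (hFm : ∀ n, Monotone (F n)) (hF1 : ∀ n x, F n x ≤ 1) (hFneg : ∀ n x, x < 0 → F n x = 0)
    (hGm : Monotone G) (hG1 : ∀ x, G x ≤ 1) (hGneg : ∀ x, x < 0 → G x = 0)
    (hGtop : Tendsto G atTop (𝓝 1)) (hGL : ∀ x h, 0 ≤ h → G (x + h) ≤ G x + L * h)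
    (hlim : ∀ x, Tendsto (fun n => F n x) atTop (𝓝 (G x))) {r : ℝ} (hr : 0 < r) :
    ∀ᶠ n in atTop, ∀ x, |F n x - G x| ≤ r := by
  obtain ⟨δ, hδ, hLδ⟩ : ∃ δ > 0, L * δ ≤ r / 2 := by
    refine ⟨r / (2 * (|L| + 1)), by positivity, ?_⟩
    rw [mul_div_assoc', div_le_div_iff₀ (by positivity) (by norm_num)]
    nlinarith [le_abs_self L, abs_nonneg L]
  obtain ⟨X, hX⟩ := (hGtop.eventually (lt_mem_nhds (show 1 - r / 2 < 1 by linarith))).exists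
  obtain ⟨N, hN⟩ := exists_nat_gt (X / δ)
  have hNX : X ≤ N * δ := by rw [div_lt_iff₀ hδ] at hN; exact hN.le
  have hev : ∀ᶠ n in atTop, ∀ k ∈ Finset.range (N + 1), |F n (k * δ) - G (k * δ)| < r / 2 := by
    rw [Filter.eventually_all_finset]
    intro k _
    exact (hlim _).eventually (Metric.ball_mem_nhds _ (half_pos hr))
  filter_upwards [hev] with n hn x
  rcases lt_or_ge x 0 with hx | hx
  · rw [hFneg n x hx, hGneg x hx]; simpa using hr.le
  by_cases hxN : N * δ ≤ x
  · have h1 := hn N (by simp)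
    rw [abs_lt] at h1
    have h2 := hFm n hxN
    have h3 := hGm hxN
    have h4 := hGm hNX
    rw [abs_le]
    constructor <;> linarith [hF1 n x, hG1 x]
  · push Not at hxN
    have hk1 : (⌊x / δ⌋₊ : ℝ) * δ ≤ x := by
      rw [← le_div_iff₀ hδ]; exact Nat.floor_le (by positivity)
    have hk2 : x ≤ ((⌊x / δ⌋₊ + 1 : ℕ) : ℝ) * δ := by
      rw [← div_le_iff₀ hδ]; push_cast; exact (Nat.lt_floor_add_one _).le
    have hkN : ⌊x / δ⌋₊ < N := by
      rw [Nat.floor_lt (by positivity), div_lt_iff₀ hδ]; exact hxN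
    have h1 := hn ⌊x / δ⌋₊ (by simp; lia)
    have h2 := hn (⌊x / δ⌋₊ + 1) (by simp; lia)
    have h3 : G (((⌊x / δ⌋₊ + 1 : ℕ) : ℝ) * δ) ≤ G (⌊x / δ⌋₊ * δ) + L * δ := by
      have := hGL (⌊x / δ⌋₊ * δ) δ hδ.le
      convert this using 2; push_cast; ring
    have h4 := hFm n hk1
    have h5 := hFm n hk2
    have h6 := hGm hk1
    have h7 := hGm hk2
    rw [abs_lt] at h1 h2
    rw [abs_le]
    constructor <;> linarith

end Polya

/-! ### Gaussian measure of centred cubes -/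

section Gauss

lemma gaussianReal_Ioc_le {v c : ℝ} (hc : 0 < c) (hcv : c ≤ v) (x h : ℝ) (hh : 0 ≤ h) :
    (gaussianReal 0 v.toNNReal).real (Set.Icc x (x + h)) ≤ h / √c := by
  have hv : v.toNNReal ≠ 0 := by
    rw [Ne, Real.toNNReal_eq_zero, not_le]; linarith
  have hv' : ((v.toNNReal : NNReal) : ℝ) = v := Real.coe_toNNReal _ (by linarith)
  rw [Measure.real, gaussianReal_apply_eq_integral _ hv, ENNReal.toReal_ofReal]
  · have hb : ∀ y, gaussianPDFReal 0 v.toNNReal y ≤ 1 / √c := by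
      intro y
      rw [gaussianPDFReal, hv']
      have h1 : Real.exp (-(y - 0) ^ 2 / (2 * v)) ≤ 1 := by
        rw [Real.exp_le_one_iff]
        apply div_nonpos_of_nonpos_of_nonneg
        · nlinarith [sq_nonneg (y - 0)]
        · linarith
      have h2 : √c ≤ √(2 * Real.pi * v) := by
        apply Real.sqrt_le_sqrt
        nlinarith [Real.pi_gt_three]
      have h3 : 0 < √c := Real.sqrt_pos.2 hc
      calc (√(2 * Real.pi * v))⁻¹ * Real.exp (-(y - 0) ^ 2 / (2 * v))
          ≤ (√(2 * Real.pi * v))⁻¹ * 1 := by gcongr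
        _ ≤ 1 / √c := by rw [mul_one, one_div]; gcongr
    calc ∫ y in Set.Icc x (x + h), gaussianPDFReal 0 v.toNNReal y
        ≤ ∫ _ in Set.Icc x (x + h), 1 / √c := by
          apply setIntegral_mono
          · exact (integrable_gaussianPDFReal _ _).integrableOn
          · exact integrable_const _
          · exact hb
      _ = h / √c := by
          rw [setIntegral_const]
          simp [Measure.real, Real.volume_Icc, ENNReal.toReal_ofReal hh, div_eq_mul_inv]
  · exact integral_nonneg fun y => gaussianPDFReal_nonneg _ _ _

/-- The centred cube of half-width `x`. -/
def cube (D : ℕ) (x : ℝ) : Set (EuclideanSpace ℝ (Fin D)) := {z | ∀ i, |z i| ≤ x}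

variable {D : ℕ}

lemma isClosed_cube (x : ℝ) : IsClosed (cube D x) := by
  simp only [cube, Set.ofPred_forall]
  exact isClosed_iInter fun i => isClosed_le (by fun_prop) (by fun_prop)

lemma measurableSet_cube (x : ℝ) : MeasurableSet (cube D x) := (isClosed_cube x).measurableSet

lemma cube_mono : Monotone (cube D) := fun _ _ h _ hz i => (hz i).trans h

lemma cube_neg [NeZero D] {x : ℝ} (hx : x < 0) : cube D x = ∅ := by
  ext z
  simp only [cube, Set.mem_ofPred_eq, Set.mem_empty_iff_false, iff_false, not_forall, not_le]
  exact ⟨0, hx.trans_le (abs_nonneg _)⟩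

lemma tendsto_real_cube (μ : Measure (EuclideanSpace ℝ (Fin D))) [IsProbabilityMeasure μ] :
    Tendsto (fun x => μ.real (cube D x)) atTop (𝓝 1) := by
  have h : ⋃ x, cube D x = Set.univ := by
    ext z
    simp only [Set.mem_iUnion, Set.mem_univ, iff_true]
    refine ⟨∑ i, |z i|, fun i => ?_⟩
    exact Finset.single_le_sum (f := fun i => |z i|) (fun i _ => abs_nonneg _) (Finset.mem_univ i)
  have := tendsto_measure_iUnion_atTop (μ := μ) (cube_mono (D := D))
  rw [h, measure_univ] at this
  exact (ENNReal.tendsto_toReal ENNReal.one_ne_top).comp this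

lemma cube_add_subset (x h : ℝ) : cube D (x + h) ⊆ cube D x ∪
    ⋃ i, ((fun z : EuclideanSpace ℝ (Fin D) => z i) ⁻¹' Set.Icc x (x + h) ∪
      (fun z : EuclideanSpace ℝ (Fin D) => z i) ⁻¹' Set.Icc (-x - h) (-x - h + h)) := by
  intro z hz
  by_cases hzx : z ∈ cube D x
  · exact Or.inl hzx
  right
  simp only [cube, Set.mem_ofPred_eq, not_forall, not_le] at hzx
  obtain ⟨i, hi⟩ := hzx
  refine Set.mem_iUnion.2 ⟨i, ?_⟩
  have h2 := hz i
  rcases abs_cases (z i) with ⟨h3, _⟩ | ⟨h3, _⟩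
  · left; exact ⟨by linarith, by linarith⟩
  · right; exact ⟨by linarith, by linarith⟩

/-- Anti-concentration: in the shell between two cubes some coordinate lies within h of x or of −x.
A union bound over coordinates suffices since the dimension stays fixed, and no nondegeneracy of V
beyond its diagonal enters. -/
lemma real_cube_add_le {V : Matrix (Fin D) (Fin D) ℝ} (hV : V.PosSemidef) {c : ℝ} (hc : 0 < c)
    (hcV : ∀ i, c ≤ V i i) (x h : ℝ) (hh : 0 ≤ h) :
    (multivariateGaussian 0 V).real (cube D (x + h))
      ≤ (multivariateGaussian 0 V).real (cube D x) + 2 * D / √c * h := by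
  refine (measureReal_mono (cube_add_subset x h)).trans ?_
  refine (measureReal_union_le _ _).trans ?_
  gcongr
  refine (measureReal_iUnion_fintype_le _).trans ?_
  have hI : ∀ i a, (multivariateGaussian 0 V).real
      ((fun z : EuclideanSpace ℝ (Fin D) => z i) ⁻¹' Set.Icc a (a + h)) ≤ h / √c := by
    intro i a
    have := (measurePreserving_eval_multivariateGaussian (μ := 0) hV (i := i)).measureReal_preimage
      (s := Set.Icc a (a + h)) measurableSet_Icc.nullMeasurableSet
    rw [this]
    exact gaussianReal_Ioc_le hc (hcV i) a h hh
  calc ∑ i : Fin D, _ ≤ ∑ i : Fin D, (h / √c + h / √c) := Finset.sum_le_sum fun i _ =>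
        (measureReal_union_le _ _).trans (add_le_add (hI i _) (hI i _))
    _ = 2 * D / √c * h := by simp; ring

end Gauss

/-! ### From characteristic functions to uniform closeness on cubes -/

section Weak

variable {D : ℕ}

/-- The continuity theorem gives weak convergence, cubes are continuity sets of the limit by
anti-concentration, and Pólya's theorem makes the convergence uniform. -/
lemma eventually_abs_real_cube_sub_le [NeZero D]
    {ν : ℕ → Measure (EuclideanSpace ℝ (Fin D))} [∀ n, IsProbabilityMeasure (ν n)]
    {V : Matrix (Fin D) (Fin D) ℝ} (hV : V.PosSemidef) {c : ℝ} (hc : 0 < c)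
    (hcV : ∀ i, c ≤ V i i)
    (h : ∀ t, Tendsto (fun n => charFun (ν n) t) atTop
      (𝓝 (Complex.exp (-((t ⬝ᵥ V *ᵥ t : ℝ) : ℂ) / 2)))) {r : ℝ} (hr : 0 < r) :
    ∀ᶠ n in atTop, ∀ x, |(ν n).real (cube D x) - (multivariateGaussian 0 V).real (cube D x)| ≤ r := by
  set γ := multivariateGaussian 0 V with hγ
  have hL := fun x h => real_cube_add_le hV hc hcV x h
  rw [← hγ] at hL
  let νp : ℕ → ProbabilityMeasure (EuclideanSpace ℝ (Fin D)) := fun n => ⟨ν n, inferInstance⟩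
  let γp : ProbabilityMeasure (EuclideanSpace ℝ (Fin D)) := ⟨γ, inferInstance⟩
  have hw : Tendsto νp atTop (𝓝 γp) := by
    rw [ProbabilityMeasure.tendsto_iff_tendsto_charFun]
    intro t
    have h2 : charFun γ t = Complex.exp (-((t ⬝ᵥ V *ᵥ t : ℝ) : ℂ) / 2) := by
      rw [hγ, charFun_multivariateGaussian hV]
      congr 1
      simp
      ring
    have h1 := h t
    rw [← h2] at h1
    exact h1
  refine eventually_forall_abs_sub_le (F := fun n x => (ν n).real (cube D x))
    (G := fun x => γ.real (cube D x)) (fun n x y hxy => measureReal_mono (cube_mono hxy))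
    (fun n x => measureReal_le_one) (fun n x hx => by rw [cube_neg hx]; simp)
    (fun x y hxy => measureReal_mono (cube_mono hxy))
    (fun x => measureReal_le_one) (fun x hx => by rw [cube_neg hx]; simp)
    (tendsto_real_cube γ) hL ?_ hr
  intro x
  -- The frontier lies between the cubes of half-widths x − h and x for every h > 0, and that shell
  -- has measure O(h).
  have hfr : γ (frontier (cube D x)) = 0 := by
    have hsub : ∀ h > 0, (γ.real (frontier (cube D x))) ≤ 2 * D / √c * h := by
      intro h hh
      have hsub : frontier (cube D x) ⊆ cube D x \ cube D (x - h) := by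
        intro z hz
        refine ⟨(isClosed_cube x).frontier_subset hz, fun hz' => ?_⟩
        have hop : IsOpen {z : EuclideanSpace ℝ (Fin D) | ∀ i, |z i| < x} := by
          simp only [Set.ofPred_forall]
          exact isOpen_iInter_of_finite fun i => isOpen_lt (by fun_prop) (by fun_prop)
        have hin : z ∈ interior (cube D x) := by
          rw [mem_interior]
          exact ⟨_, fun y hy i => (hy i).le, hop, fun i => (hz' i).trans_lt (by linarith)⟩
        exact hz.2 hin
      refine (measureReal_mono hsub).trans ?_
      rw [measureReal_sdiff (cube_mono (by linarith)) (measurableSet_cube _)]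
      have := hL (x - h) h hh.le
      rw [sub_add_cancel] at this
      linarith
    have h0 : γ.real (frontier (cube D x)) ≤ 0 := by
      refine le_of_forall_pos_le_add fun ε hε => ?_
      have hq : 0 < 2 * D / √c + 1 := by positivity
      refine (hsub (ε / (2 * D / √c + 1)) (by positivity)).trans ?_
      rw [zero_add, mul_div_assoc', div_le_iff₀ hq]
      nlinarith
    have h1 : γ.real (frontier (cube D x)) = 0 := le_antisymm h0 measureReal_nonneg
    exact (measureReal_eq_zero_iff).1 h1
  have := ProbabilityMeasure.tendsto_measure_of_null_frontier_of_tendsto' hw (E := cube D x) hfr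
  exact (ENNReal.tendsto_toReal (measure_ne_top γ _)).comp this

lemma posSemidef_of_tendsto {V : ℕ → Matrix (Fin D) (Fin D) ℝ} {V₀ : Matrix (Fin D) (Fin D) ℝ}
    (hV : ∀ n, (V n).PosSemidef) (h : Tendsto V atTop (𝓝 V₀)) : V₀.PosSemidef := by
  have hij : ∀ i j, Tendsto (fun n => V n i j) atTop (𝓝 (V₀ i j)) := fun i j =>
    ((continuous_apply_apply i j).tendsto V₀).comp h
  refine Matrix.PosSemidef.of_dotProduct_mulVec_nonneg ?_ ?_
  · ext i j
    have h1 := hij i j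
    have h2 := hij j i
    refine tendsto_nhds_unique h2 (h1.congr fun n => ?_)
    have := congrFun (congrFun (hV n).1 i) j
    simpa using this.symm
  · intro x
    have hc : Continuous fun U : Matrix (Fin D) (Fin D) ℝ => star x ⬝ᵥ (U *ᵥ x) := by fun_prop
    exact ge_of_tendsto' ((hc.tendsto V₀).comp h) fun n => (hV n).dotProduct_mulVec_nonneg x

/-- Uniform closeness on cubes to the Gaussian distributions with asymptotically the same
characteristic functions. -/
lemma eventually_abs_real_cube_sub_multivariateGaussian_le [NeZero D]
    {ν : ℕ → Measure (EuclideanSpace ℝ (Fin D))} [∀ n, IsProbabilityMeasure (ν n)]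
    {V : ℕ → Matrix (Fin D) (Fin D) ℝ} (hV : ∀ n, (V n).PosSemidef) {c B : ℝ} (hc : 0 < c)
    (hcV : ∀ n i, c ≤ V n i i) (hB : ∀ n i j, |V n i j| ≤ B)
    (h : ∀ t, Tendsto (fun n => charFun (ν n) t - Complex.exp (-((t ⬝ᵥ V n *ᵥ t : ℝ) : ℂ) / 2))
      atTop (𝓝 0)) {r : ℝ} (hr : 0 < r) :
    ∀ᶠ n in atTop, ∀ x,
      |(ν n).real (cube D x) - (multivariateGaussian 0 (V n)).real (cube D x)| ≤ r := by
  -- The covariances need not converge. Along a subsequence of failures, compactness yields a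
  -- limiting covariance, and both laws are eventually close to the same limiting Gaussian law.
  by_contra hcon
  rw [not_eventually] at hcon
  obtain ⟨φ, hφ, hbad⟩ := extraction_of_frequently_atTop hcon
  have hcomp : IsCompact (Set.pi Set.univ fun _ : Fin D => Set.pi Set.univ fun _ : Fin D =>
      Set.Icc (-B) B) := isCompact_univ_pi fun _ => isCompact_univ_pi fun _ => isCompact_Icc
  let U : ℕ → Fin D → Fin D → ℝ := fun n => V (φ n)
  obtain ⟨V₀, -, ψ, hψ, hlim⟩ := hcomp.tendsto_subseq (x := U)
    (fun n i _ j _ => abs_le.1 (hB _ i j))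
  have hlim' : Tendsto (fun n => V (φ (ψ n))) atTop (𝓝 (V₀ : Matrix (Fin D) (Fin D) ℝ)) := hlim
  have hV₀ := posSemidef_of_tendsto (fun n => hV (φ (ψ n))) hlim'
  have hcV₀ : ∀ i, c ≤ V₀ i i := fun i =>
    ge_of_tendsto' (((continuous_apply_apply i i).tendsto V₀).comp hlim') fun n => hcV _ i
  have hexp : ∀ t : EuclideanSpace ℝ (Fin D), Tendsto (fun n =>
      Complex.exp (-((t ⬝ᵥ V (φ (ψ n)) *ᵥ t : ℝ) : ℂ) / 2)) atTop
      (𝓝 (Complex.exp (-((t ⬝ᵥ Matrix.mulVec V₀ t : ℝ) : ℂ) / 2))) := by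
    intro t
    have hc : Continuous fun U : Matrix (Fin D) (Fin D) ℝ =>
      Complex.exp (-((t ⬝ᵥ (U *ᵥ t) : ℝ) : ℂ) / 2) := by fun_prop
    exact (hc.tendsto _).comp hlim'
  have htop : Tendsto (fun n => φ (ψ n)) atTop atTop := (hφ.comp hψ).tendsto_atTop
  have h1 := eventually_abs_real_cube_sub_le (ν := fun n => ν (φ (ψ n))) hV₀ hc hcV₀ (fun t => by
    have := ((h t).comp htop).add (hexp t)
    simpa using this) (half_pos hr)
  have h2 := eventually_abs_real_cube_sub_le (ν := fun n => multivariateGaussian 0 (V (φ (ψ n))))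
    hV₀ hc hcV₀ (fun t => by
      refine (hexp t).congr fun n => ?_
      rw [charFun_multivariateGaussian (hV _)]
      congr 1; simp; ring) (half_pos hr)
  obtain ⟨n, hn1, hn2⟩ := (h1.and h2).exists
  refine hbad (ψ n) fun x => ?_
  have e1 := hn1 x
  have e2 := hn2 x
  rw [abs_le] at *
  constructor <;> linarith

/-- Gaussian distributions with nearby covariance matrices are uniformly close on cubes. -/
lemma exists_forall_abs_real_cube_sub_le [NeZero D] {c B : ℝ} (hc : 0 < c) {r : ℝ} (hr : 0 < r) :
    ∃ κ > 0, ∀ V V' : Matrix (Fin D) (Fin D) ℝ, V.PosSemidef → V'.PosSemidef →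
      (∀ i, c ≤ V i i) → (∀ i j, |V i j| ≤ B) → (∀ i j, |V' i j - V i j| ≤ κ) →
      ∀ x, |(multivariateGaussian 0 V').real (cube D x)
        - (multivariateGaussian 0 V).real (cube D x)| ≤ r := by
  -- Compactness gives a tolerance κ uniform in the matrices: violations for κ = 1/(n+1) would form
  -- a sequence contradicting the previous result.
  by_contra hcon
  push Not at hcon
  choose V V' hV hV' hcV hB hVV' x hx using fun n : ℕ => hcon (1 / ((n : ℝ) + 1)) (by positivity)
  have h := eventually_abs_real_cube_sub_multivariateGaussian_le
    (ν := fun n => multivariateGaussian 0 (V' n)) hV hc hcV hB (fun t => ?_) hr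
  · obtain ⟨n, hn⟩ := h.exists
    exact absurd (hn (x n)) (not_le.2 (hx n))
  · have hdiff : Tendsto (fun n => t ⬝ᵥ V' n *ᵥ t - t ⬝ᵥ V n *ᵥ t) atTop (𝓝 0) := by
      have he : ∀ n, t ⬝ᵥ V' n *ᵥ t - t ⬝ᵥ V n *ᵥ t
          = ∑ i, t i * ∑ j, (V' n i j - V n i j) * t j := by
        intro n
        simp [dotProduct, Matrix.mulVec, ← Finset.sum_sub_distrib, ← mul_sub, sub_mul]
      simp_rw [he]
      have h0 : ∀ i j, Tendsto (fun n => V' n i j - V n i j) atTop (𝓝 0) := fun i j =>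
        squeeze_zero_norm (fun n => hVV' n i j) tendsto_one_div_add_atTop_nhds_zero_nat
      have := tendsto_finsetSum Finset.univ (fun i _ => (tendsto_finsetSum Finset.univ
        (fun j (_ : j ∈ Finset.univ) => (h0 i j).mul_const (t j))).const_mul (t i))
      simpa using this
    refine squeeze_zero_norm (fun n => ?_) (by simpa using hdiff.norm)
    rw [charFun_multivariateGaussian (hV' n)]
    have hn1 := (hV n).dotProduct_mulVec_nonneg t
    have hn2 := (hV' n).dotProduct_mulVec_nonneg t
    simp only [star_trivial] at hn1 hn2
    have key : ∀ a b : ℝ, 0 ≤ a → 0 ≤ b → |Real.exp (-a / 2) - Real.exp (-b / 2)| ≤ |a - b| := by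
      have aux : ∀ a b : ℝ, 0 ≤ a → a ≤ b → |Real.exp (-a / 2) - Real.exp (-b / 2)| ≤ |a - b| := by
        intro a b ha hab
        have e1 : Real.exp (-b / 2) = Real.exp (-a / 2) * Real.exp (-(b - a) / 2) := by
          rw [← Real.exp_add]; ring_nf
        have e2 := Real.add_one_le_exp (-(b - a) / 2)
        have e3 : Real.exp (-(b - a) / 2) ≤ 1 := Real.exp_le_one_iff.2 (by linarith)
        have e4 : Real.exp (-a / 2) ≤ 1 := Real.exp_le_one_iff.2 (by linarith)
        have e5 := Real.exp_pos (-a / 2)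
        rw [e1, abs_of_nonneg (by nlinarith), abs_sub_comm, abs_of_nonneg (by linarith)]
        nlinarith
      intro a b ha hb
      rcases le_total a b with hab | hab
      · exact aux a b ha hab
      · rw [abs_sub_comm, abs_sub_comm a b]; exact aux b a hb hab
    have := key _ _ hn2 hn1
    change _ ≤ |t ⬝ᵥ V' n *ᵥ t - t ⬝ᵥ V n *ᵥ t|
    refine le_trans (le_of_eq ?_) this
    rw [← Real.norm_eq_abs, ← Complex.norm_real]
    congr 1
    push_cast
    congr 2
    simp; ring

/-- A distribution whose characteristic function is close to a Gaussian one is uniformly close to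
the Gaussian distribution on cubes. -/
lemma exists_forall_abs_real_cube_sub_le_of_charFun [NeZero D] {c B : ℝ} (hc : 0 < c) {r : ℝ}
    (hr : 0 < r) :
    ∃ κ > 0, ∃ T : ℝ, ∀ (ν : Measure (EuclideanSpace ℝ (Fin D))) (V : Matrix (Fin D) (Fin D) ℝ),
      IsProbabilityMeasure ν → V.PosSemidef → (∀ i, c ≤ V i i) → (∀ i j, |V i j| ≤ B) →
      (∀ t : EuclideanSpace ℝ (Fin D), (∀ i, |t i| ≤ T) →
        ‖charFun ν t - Complex.exp (-((t ⬝ᵥ V *ᵥ t : ℝ) : ℂ) / 2)‖ ≤ κ) →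
      ∀ x, |ν.real (cube D x) - (multivariateGaussian 0 V).real (cube D x)| ≤ r := by
  -- The counterexamples are taken with κ = 1/(n+1) and frequency range T = n, so every fixed
  -- frequency is eventually inside the range.
  by_contra hcon
  push Not at hcon
  choose ν V hν hV hcV hB hch x hx using
    fun n : ℕ => hcon (1 / ((n : ℝ) + 1)) (by positivity) n
  have h := eventually_abs_real_cube_sub_multivariateGaussian_le (ν := ν) hV hc hcV hB
    (fun t => ?_) hr
  · obtain ⟨n, hn⟩ := h.exists
    exact absurd (hn (x n)) (not_le.2 (hx n))
  · refine squeeze_zero_norm' ?_ tendsto_one_div_add_atTop_nhds_zero_nat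
    obtain ⟨N, hN⟩ := exists_nat_ge (∑ i, |t i|)
    filter_upwards [eventually_ge_atTop N] with n hn
    refine hch n t fun i => ?_
    refine le_trans (Finset.single_le_sum (f := fun i => |t i|) (fun i _ => abs_nonneg _)
      (Finset.mem_univ i)) (hN.trans ?_)
    exact_mod_cast hn

end Weak

/-! ### Vectors of linear forms -/

section LinearImage

variable {D n : ℕ}

/-- The vector of linear forms `∑ l, A i l * x l`. -/
noncomputable def linImage (A : Matrix (Fin D) (Fin n) ℝ) (x : Fin n → ℝ) : EuclideanSpace ℝ (Fin D) :=
  WithLp.toLp 2 (A *ᵥ x)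

lemma measurable_linImage (A : Matrix (Fin D) (Fin n) ℝ) : Measurable (linImage A) := by
  unfold linImage
  fun_prop

lemma inner_linImage (A : Matrix (Fin D) (Fin n) ℝ) (x : Fin n → ℝ) (t : EuclideanSpace ℝ (Fin D)) :
    inner ℝ (linImage A x) t = ∑ l, (Aᵀ *ᵥ t) l * x l := by
  simp only [linImage, PiLp.inner_apply, Matrix.mulVec, dotProduct, Matrix.transpose_apply]
  simp only [RCLike.inner_apply, conj_trivial, Finset.mul_sum, Finset.sum_mul]
  rw [Finset.sum_comm]
  exact Finset.sum_congr rfl fun l _ => Finset.sum_congr rfl fun i _ => by ring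

lemma map_linImage_multivariateGaussian {V : Matrix (Fin n) (Fin n) ℝ} (hV : V.PosSemidef)
    (A : Matrix (Fin D) (Fin n) ℝ) :
    (multivariateGaussian 0 V).map (fun x : EuclideanSpace ℝ (Fin n) => linImage A x) = multivariateGaussian 0 (A * V * Aᵀ) := by
  have hAV : (A * V * Aᵀ).PosSemidef := by
    simpa using hV.mul_mul_conjTranspose_same A
  have hm : Measurable fun x : EuclideanSpace ℝ (Fin n) => linImage A x :=
    (measurable_linImage A).comp (by fun_prop)
  have := Measure.isProbabilityMeasure_map (μ := multivariateGaussian 0 V) hm.aemeasurable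
  refine Measure.ext_of_charFun ?_
  ext t
  rw [charFun_multivariateGaussian hAV, charFun_apply, integral_map hm.aemeasurable (by fun_prop)]
  have := charFun_multivariateGaussian (μ := 0) hV (WithLp.toLp 2 (Aᵀ *ᵥ t))
  rw [charFun_apply] at this
  have he : ∀ x : EuclideanSpace ℝ (Fin n), inner ℝ (linImage A x) t
      = inner ℝ x (WithLp.toLp 2 (Aᵀ *ᵥ t)) := by
    intro x
    rw [inner_linImage]
    simp [PiLp.inner_apply]
  simp_rw [he, this]
  congr 1
  simp only [inner_zero_right]
  congr 3
  rw [← Matrix.mulVec_mulVec, ← Matrix.mulVec_mulVec]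
  simp [Matrix.dotProduct_mulVec, Matrix.mulVec_transpose]

lemma linImage_mem_cube {A : Matrix (Fin D) (Fin n) ℝ} {x : Fin n → ℝ} {a : ℝ} :
    linImage A x ∈ cube D a ↔ ∀ i, |∑ l, A i l * x l| ≤ a := Iff.rfl

end LinearImage

end RidgeBootstrap

namespace RidgeBootstrap

set_option linter.unusedSectionVars false

/-! ### Algebra of the de-biased and thresholded estimator -/

section Matrices

variable {m p : ℕ}

lemma sum_mulVec_sq_of_orthonormal {P : Matrix (Fin m) (Fin p) ℝ} (hP : Pᵀ * P = 1)
    (f : Fin p → ℝ) : ∑ l, (P *ᵥ f) l ^ 2 = ∑ j, f j ^ 2 := by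
  have h : (P *ᵥ f) ⬝ᵥ (P *ᵥ f) = f ⬝ᵥ f := by
    rw [Matrix.dotProduct_mulVec, Matrix.vecMul_mulVec, hP, Matrix.vecMul_one]
  simpa [dotProduct, sq] using h

lemma abs_sum_mul_le_sqrt {ι : Type*} (s : Finset ι) (f g : ι → ℝ) :
    |∑ i ∈ s, f i * g i| ≤ √(∑ i ∈ s, f i ^ 2) * √(∑ i ∈ s, g i ^ 2) := by
  rw [← Real.sqrt_mul (Finset.sum_nonneg fun i _ => sq_nonneg _)]
  exact Real.abs_le_sqrt (Finset.sum_mul_sq_le_sq_mul_sq s f g)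

end Matrices

namespace Setting

variable {n : ℕ} (S : Setting n)

/-- The matrix applied to the errors in the de-biased estimator. -/
noncomputable def noiseMat : Matrix (Fin S.p) (Fin n) ℝ := S.Q * Matrix.diagonal S.weight * S.Pᵀ

/-- The remaining relative bias in the direction of the `j`-th singular vector. -/
noncomputable def shrink (j : Fin S.p) : ℝ := S.ρ ^ 2 / (S.lam j ^ 2 + S.ρ) ^ 2

/-- The bias of the de-biased estimator. -/
noncomputable def bias (v : Fin S.p → ℝ) : Fin S.p → ℝ :=
  (S.Q * Matrix.diagonal S.shrink * S.Qᵀ) *ᵥ v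

/-- Everything is diagonal in the singular basis. The signal is multiplied by weight·λ = 1 −
ρ²/(λ²+ρ)², since the correction cancels the first-order shrinkage. The sign of ρ is free, so the
denominators must be assumed nonzero. -/
lemma debiased_eq (hd : ∀ j, S.lam j ^ 2 + S.ρ ≠ 0) (v : Fin S.p → ℝ) (e : Fin n → ℝ) :
    S.debiased (S.X *ᵥ v + e) = v - S.bias v + S.noiseMat *ᵥ e := by
  set d : Fin S.p → ℝ := fun j => S.lam j ^ 2 + S.ρ with hdd
  have hQ := S.Q_orthonormal
  have hQ' := S.Q_orthonormal_rows
  have hXt : S.Xᵀ = S.Q * Matrix.diagonal S.lam * S.Pᵀ := by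
    rw [S.X_eq]; simp [Matrix.transpose_mul, Matrix.mul_assoc]
  have hXX : S.Xᵀ * S.X = S.Q * Matrix.diagonal (fun j => S.lam j ^ 2) * S.Qᵀ := by
    rw [hXt, S.X_eq]
    calc S.Q * Matrix.diagonal S.lam * S.Pᵀ * (S.P * Matrix.diagonal S.lam * S.Qᵀ)
        = S.Q * Matrix.diagonal S.lam * (S.Pᵀ * S.P) * Matrix.diagonal S.lam * S.Qᵀ := by
          simp only [Matrix.mul_assoc]
      _ = _ := by
          rw [S.P_orthonormal, Matrix.mul_one, Matrix.mul_assoc S.Q, Matrix.diagonal_mul_diagonal]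
          simp [sq]
  have hmid : ∀ f g : Fin S.p → ℝ, S.Q * Matrix.diagonal f * S.Qᵀ * (S.Q * Matrix.diagonal g * S.Qᵀ)
      = S.Q * Matrix.diagonal (fun j => f j * g j) * S.Qᵀ := by
    intro f g
    calc _ = S.Q * Matrix.diagonal f * (S.Qᵀ * S.Q) * Matrix.diagonal g * S.Qᵀ := by
          simp only [Matrix.mul_assoc]
      _ = _ := by rw [hQ, Matrix.mul_one, Matrix.mul_assoc S.Q, Matrix.diagonal_mul_diagonal]
  have hmidP : ∀ f g : Fin S.p → ℝ, S.Q * Matrix.diagonal f * S.Qᵀ * (S.Q * Matrix.diagonal g * S.Pᵀ)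
      = S.Q * Matrix.diagonal (fun j => f j * g j) * S.Pᵀ := by
    intro f g
    calc _ = S.Q * Matrix.diagonal f * (S.Qᵀ * S.Q) * Matrix.diagonal g * S.Pᵀ := by
          simp only [Matrix.mul_assoc]
      _ = _ := by rw [hQ, Matrix.mul_one, Matrix.mul_assoc S.Q, Matrix.diagonal_mul_diagonal]
  have hone : (1 : Matrix (Fin S.p) (Fin S.p) ℝ) = S.Q * Matrix.diagonal (fun _ => 1) * S.Qᵀ := by
    rw [Matrix.diagonal_one, Matrix.mul_one, hQ']
  have hG : S.Xᵀ * S.X + S.ρ • (1 : Matrix (Fin S.p) (Fin S.p) ℝ)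
      = S.Q * Matrix.diagonal d * S.Qᵀ := by
    rw [hXX]
    have : S.ρ • (1 : Matrix (Fin S.p) (Fin S.p) ℝ)
        = S.Q * Matrix.diagonal (fun _ => S.ρ) * S.Qᵀ := by
      have : Matrix.diagonal (fun _ : Fin S.p => S.ρ) = S.ρ • (1 : Matrix (Fin S.p) (Fin S.p) ℝ) := by
        rw [Matrix.smul_one_eq_diagonal]
      rw [this, Matrix.mul_smul, Matrix.smul_mul, Matrix.mul_one, hQ']
    rw [this, ← Matrix.add_mul, ← Matrix.mul_add, Matrix.diagonal_add]
  have hGinv : (S.Xᵀ * S.X + S.ρ • (1 : Matrix (Fin S.p) (Fin S.p) ℝ))⁻¹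
      = S.Q * Matrix.diagonal (fun j => (d j)⁻¹) * S.Qᵀ := by
    apply Matrix.inv_eq_right_inv
    rw [hG, hmid]
    have : (fun j => d j * (d j)⁻¹) = fun _ => 1 := funext fun j => mul_inv_cancel₀ (hd j)
    rw [this, ← hone]
  have hLinv : (Matrix.diagonal S.lam ^ 2 + S.ρ • (1 : Matrix (Fin S.p) (Fin S.p) ℝ))⁻¹
      = Matrix.diagonal (fun j => (d j)⁻¹) := by
    apply Matrix.inv_eq_right_inv
    rw [Matrix.diagonal_pow, Matrix.smul_one_eq_diagonal, Matrix.diagonal_add,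
      Matrix.diagonal_mul_diagonal, ← Matrix.diagonal_one]
    congr 1
    exact funext fun j => mul_inv_cancel₀ (hd j)
  have hdeb : ∀ y, S.debiased y = S.noiseMat *ᵥ y := by
    intro y
    have hr : S.ridge y = (S.Q * Matrix.diagonal (fun j => (d j)⁻¹ * S.lam j) * S.Pᵀ) *ᵥ y := by
      rw [ridge, hGinv, hXt, Matrix.mulVec_mulVec, hmidP]
    rw [debiased, hr, hLinv, Matrix.mulVec_mulVec, hmidP, ← Matrix.smul_mulVec, ← Matrix.add_mulVec,
      ← Matrix.smul_mul, ← Matrix.mul_smul, ← Matrix.add_mul, ← Matrix.mul_add, noiseMat,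
      ← Matrix.diagonal_smul, Matrix.diagonal_add]
    congr 5
    ext j
    have := hd j
    simp only [weight, Pi.smul_apply, smul_eq_mul, hdd]
    field_simp
  rw [hdeb, Matrix.mulVec_add]
  congr 1
  have hNX : S.noiseMat * S.X = 1 - S.Q * Matrix.diagonal S.shrink * S.Qᵀ := by
    have h1 : S.noiseMat * S.X = S.Q * Matrix.diagonal (fun j => S.weight j * S.lam j) * S.Qᵀ := by
      rw [noiseMat]
      conv_lhs => rw [S.X_eq]
      calc _ = S.Q * Matrix.diagonal S.weight * (S.Pᵀ * S.P) * Matrix.diagonal S.lam * S.Qᵀ := by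
            simp only [Matrix.mul_assoc]
        _ = _ := by
          rw [S.P_orthonormal, Matrix.mul_one, Matrix.mul_assoc S.Q, Matrix.diagonal_mul_diagonal]
    rw [h1, hone, ← Matrix.sub_mul, ← Matrix.mul_sub, Matrix.diagonal_sub]
    congr 3
    ext j
    have := hd j
    simp only [weight, shrink]
    field_simp
    ring
  rw [Matrix.mulVec_mulVec, hNX, Matrix.sub_mulVec, Matrix.one_mulVec, bias]

lemma mul_diagonal_mul_transpose_apply {k l m : ℕ} (A : Matrix (Fin k) (Fin m) ℝ) (d : Fin m → ℝ)
    (B : Matrix (Fin l) (Fin m) ℝ) (i : Fin k) (j : Fin l) :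
    (A * Matrix.diagonal d * Bᵀ) i j = ∑ a, A i a * d a * B j a := by
  rw [Matrix.mul_apply]
  exact Finset.sum_congr rfl fun a _ => by rw [Matrix.mul_diagonal, Matrix.transpose_apply]

lemma sum_sum_mul_noiseMat_sq (v : Fin S.p → ℝ) :
    ∑ l, (∑ k, v k * S.noiseMat k l) ^ 2 = ∑ j, (∑ k, v k * S.Q k j) ^ 2 * S.weight j ^ 2 := by
  have h : ∀ l, ∑ k, v k * S.noiseMat k l
      = (S.P *ᵥ fun j => (∑ k, v k * S.Q k j) * S.weight j) l := by
    intro l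
    simp only [noiseMat, mul_diagonal_mul_transpose_apply, Matrix.mulVec, dotProduct,
      Finset.mul_sum, Finset.sum_mul]
    rw [Finset.sum_comm]
    exact Finset.sum_congr rfl fun _ _ => Finset.sum_congr rfl fun _ _ => by ring
  simp_rw [h]
  rw [sum_mulVec_sq_of_orthonormal S.P_orthonormal]
  simp [mul_pow]

lemma sum_sum_mul_Q_sq (v : Fin S.p → ℝ) : ∑ j, (∑ k, v k * S.Q k j) ^ 2 = ∑ k, v k ^ 2 := by
  have hQ : S.Qᵀᵀ * S.Qᵀ = 1 := by rw [Matrix.transpose_transpose]; exact S.Q_orthonormal_rows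
  rw [← sum_mulVec_sq_of_orthonormal hQ v]
  simp only [Matrix.mulVec, dotProduct, Matrix.transpose_apply, mul_comm]

lemma sum_coef_sq (i : Fin S.p₁) : ∑ j, S.c i j ^ 2 = ∑ k ∈ S.N, S.M i k ^ 2 := by
  have := S.sum_sum_mul_Q_sq fun k => if k ∈ S.N then S.M i k else 0
  simpa [c, coef, Finset.sum_ite_mem, ite_mul, ite_pow] using this

/-- A row outside ℳ does not see any strong coordinate, so in the statistic it contributes only
remainders. -/
lemma M_eq_zero {i : Fin S.p₁} (hi : i ∉ S.Mset) {k : Fin S.p} (hk : k ∈ S.N) : S.M i k = 0 := by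
  have h0 : ∑ k ∈ S.N, S.M i k ^ 2 = 0 := by
    rw [← S.sum_coef_sq]
    exact le_antisymm (not_lt.1 hi) (Finset.sum_nonneg fun _ _ => sq_nonneg _)
  have := (Finset.sum_eq_zero_iff_of_nonneg fun _ _ => sq_nonneg _).1 h0 k hk
  exact pow_eq_zero_iff (two_ne_zero) |>.1 this

/-- The standardized coefficients of the errors in the `i`-th linear combination. -/
noncomputable def load (i : Fin S.p₁) (l : Fin n) : ℝ :=
  (∑ j, S.c i j * S.P l j * S.weight j) / S.τ i

lemma τ_pos (hn : 1 ≤ n) (i : Fin S.p₁) : 0 < S.τ i := by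
  rw [τ, scale]
  apply Real.sqrt_pos.2
  have : (0 : ℝ) < n := by exact_mod_cast hn
  have h2 : 0 ≤ ∑ j, S.coef S.N i j ^ 2 * S.weight j ^ 2 :=
    Finset.sum_nonneg fun _ _ => by positivity
  positivity

lemma τ_sq (i : Fin S.p₁) : S.τ i ^ 2 = 1 / n + ∑ j, S.c i j ^ 2 * S.weight j ^ 2 := by
  rw [τ, scale, Real.sq_sqrt]
  · rfl
  · have h2 : 0 ≤ ∑ j, S.coef S.N i j ^ 2 * S.weight j ^ 2 :=
      Finset.sum_nonneg fun _ _ => by positivity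
    positivity

/-- The summand 1/n in the scale ensures that a bias of order o(n^(−1/2)) stays negligible after
standardisation. -/
lemma one_div_sqrt_le_τ (i : Fin S.p₁) : 1 / √(n : ℝ) ≤ S.τ i := by
  rw [τ, scale, ← Real.sqrt_one, ← Real.sqrt_div zero_le_one, Real.sqrt_one]
  apply Real.sqrt_le_sqrt
  have h2 : 0 ≤ ∑ j, S.coef S.N i j ^ 2 * S.weight j ^ 2 :=
    Finset.sum_nonneg fun _ _ => by positivity
  linarith

lemma sum_load_sq (i : Fin S.p₁) :
    ∑ l, S.load i l ^ 2 = (∑ j, S.c i j ^ 2 * S.weight j ^ 2) / S.τ i ^ 2 := by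
  simp only [load, div_pow]
  rw [← Finset.sum_div]
  congr 1
  rw [← Finset.sum_congr rfl fun j _ => mul_pow (S.c i j) (S.weight j) 2,
    ← sum_mulVec_sq_of_orthonormal S.P_orthonormal]
  refine Finset.sum_congr rfl fun l _ => ?_
  simp only [Matrix.mulVec, dotProduct]
  congr 1
  exact Finset.sum_congr rfl fun j _ => by ring

lemma sum_load_sq_le_one (i : Fin S.p₁) : ∑ l, S.load i l ^ 2 ≤ 1 := by
  rw [sum_load_sq]
  apply div_le_one_of_le₀ _ (sq_nonneg _)
  rw [τ_sq]
  have : (0 : ℝ) ≤ 1 / n := by positivity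
  linarith

lemma load_eq_zero {i : Fin S.p₁} (hi : i ∉ S.Mset) (l : Fin n) : S.load i l = 0 := by
  have : ∀ j, S.c i j = 0 := fun j => by
    rw [c, coef]
    exact Finset.sum_eq_zero fun k hk => by rw [S.M_eq_zero hi hk, zero_mul]
  simp [load, this]

lemma abs_load_le (hn : 1 ≤ n) {i : Fin S.p₁} (hi : i ∈ S.Mset) (l : Fin n) :
    |S.load i l| ≤ S.cStar := by
  have h := le_ciSup (f := fun q : S.Mset × Fin n =>
    1 / S.τ q.1 * |∑ j, S.c q.1 j * S.P q.2 j * S.weight j|) (Set.finite_range _).bddAbove (⟨i, hi⟩, l)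
  refine le_trans (le_of_eq ?_) h
  rw [load, abs_div, abs_of_pos (S.τ_pos hn i)]
  simp only; ring

lemma sum_M_mul_noiseMat (hn : 1 ≤ n) (i : Fin S.p₁) (e : Fin n → ℝ) :
    ∑ k ∈ S.N, S.M i k * (S.noiseMat *ᵥ e) k = S.τ i * ∑ l, S.load i l * e l := by
  have hτ := (S.τ_pos hn i).ne'
  have h1 : S.τ i * ∑ l, S.load i l * e l = ∑ l, (∑ j, S.c i j * S.P l j * S.weight j) * e l := by
    rw [Finset.mul_sum]
    refine Finset.sum_congr rfl fun l _ => ?_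
    rw [load]; field_simp
  rw [h1]
  simp only [Matrix.mulVec, dotProduct, noiseMat, mul_diagonal_mul_transpose_apply, c, coef, Finset.mul_sum, Finset.sum_mul]
  rw [Finset.sum_comm]
  refine Finset.sum_congr rfl fun l _ => ?_
  rw [Finset.sum_comm]
  exact Finset.sum_congr rfl fun j _ => Finset.sum_congr rfl fun k _ => by ring

/-- Quantitative conditions on the singular values and the ridge parameter. -/
structure Regular (L : ℝ) : Prop where
  n_pos : 1 ≤ n
  L_pos : 0 < L
  le_lam : ∀ j, L ≤ S.lam j
  abs_ρ_le : |S.ρ| ≤ L ^ 2 / 4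

variable {S} {L : ℝ}

lemma Regular.denom (h : S.Regular L) (j : Fin S.p) :
    3 / 4 * S.lam j ^ 2 ≤ S.lam j ^ 2 + S.ρ ∧ S.lam j ^ 2 + S.ρ ≤ 5 / 4 * S.lam j ^ 2 ∧
      S.lam j ^ 2 / 2 ≤ S.lam j ^ 2 + 2 * S.ρ ∧ S.lam j ^ 2 + 2 * S.ρ ≤ 3 / 2 * S.lam j ^ 2 := by
  have h1 := abs_le.1 h.abs_ρ_le
  have h2 : L ^ 2 ≤ S.lam j ^ 2 := pow_le_pow_left₀ h.L_pos.le (h.le_lam j) 2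
  refine ⟨?_, ?_, ?_, ?_⟩ <;> linarith [h1.1, h1.2]

lemma Regular.lam_pos (h : S.Regular L) (j : Fin S.p) : 0 < S.lam j := h.L_pos.trans_le (h.le_lam j)

lemma Regular.denom_ne (h : S.Regular L) (j : Fin S.p) : S.lam j ^ 2 + S.ρ ≠ 0 := by
  have := h.denom j
  have := h.lam_pos j
  have : 0 < S.lam j ^ 2 := by positivity
  linarith [(h.denom j).1]

lemma Regular.weight_eq (h : S.Regular L) (j : Fin S.p) :
    S.weight j = S.lam j * (S.lam j ^ 2 + 2 * S.ρ) / (S.lam j ^ 2 + S.ρ) ^ 2 := by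
  have := h.denom_ne j
  rw [weight]; field_simp; ring

lemma Regular.weight_bounds (h : S.Regular L) (j : Fin S.p) :
    1 / (4 * S.lam j) ≤ S.weight j ∧ S.weight j ≤ 3 / S.lam j := by
  obtain ⟨h1, h2, h3, h4⟩ := h.denom j
  have hl := h.lam_pos j
  have hl2 : 0 < S.lam j ^ 2 := by positivity
  have hd : 0 < S.lam j ^ 2 + S.ρ := by linarith
  rw [h.weight_eq, div_le_div_iff₀ (by positivity) (by positivity),
    div_le_div_iff₀ (by positivity) hl]
  constructor
  · have : (S.lam j ^ 2 + S.ρ) ^ 2 ≤ (5 / 4 * S.lam j ^ 2) ^ 2 := pow_le_pow_left₀ hd.le h2 2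
    nlinarith
  · have : (3 / 4 * S.lam j ^ 2) ^ 2 ≤ (S.lam j ^ 2 + S.ρ) ^ 2 :=
      pow_le_pow_left₀ (by positivity) h1 2
    nlinarith

lemma Regular.weight_pos (h : S.Regular L) (j : Fin S.p) : 0 < S.weight j := by
  have := h.lam_pos j
  exact lt_of_lt_of_le (by positivity) (h.weight_bounds j).1

lemma Regular.weight_le (h : S.Regular L) (j : Fin S.p) : S.weight j ≤ 3 / L :=
  (h.weight_bounds j).2.trans (div_le_div_of_nonneg_left (by norm_num) h.L_pos (h.le_lam j))

lemma Regular.shrink_le (h : S.Regular L) (j : Fin S.p) : S.shrink j ≤ 2 * S.ρ ^ 2 / L ^ 4 := by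
  obtain ⟨h1, -, -, -⟩ := h.denom j
  have hl2 : L ^ 2 ≤ S.lam j ^ 2 := pow_le_pow_left₀ h.L_pos.le (h.le_lam j) 2
  have hL := h.L_pos
  have h3 : (3 / 4 * L ^ 2) ^ 2 ≤ (S.lam j ^ 2 + S.ρ) ^ 2 :=
    pow_le_pow_left₀ (by positivity) (by linarith) 2
  rw [shrink, div_le_div_iff₀ (by have : 0 < (3 / 4 * L ^ 2) ^ 2 := by positivity
                                  linarith) (by positivity)]
  nlinarith [sq_nonneg S.ρ]

lemma shrink_nonneg (j : Fin S.p) : 0 ≤ S.shrink j := by rw [shrink]; positivity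

/-- The weight is itself of order 1/λ, so relative to it the shrinkage has only L³ in the
denominator. This form is the one compatible with τ. -/
lemma Regular.shrink_le_weight (h : S.Regular L) (j : Fin S.p) :
    S.shrink j ≤ 2 * S.ρ ^ 2 / L ^ 3 * S.weight j := by
  obtain ⟨h1, h2, h3, h4⟩ := h.denom j
  have hl := h.lam_pos j
  have hl2 : 0 < S.lam j ^ 2 := by positivity
  have hd : 0 < (S.lam j ^ 2 + S.ρ) ^ 2 := by
    have : 0 < S.lam j ^ 2 + S.ρ := by linarith
    positivity
  have hL := h.L_pos
  rw [shrink, h.weight_eq, div_mul_div_comm, div_le_div_iff₀ hd (by positivity)]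
  have h5 : L ^ 3 ≤ S.lam j ^ 3 := pow_le_pow_left₀ hL.le (h.le_lam j) 3
  have h6 : L ^ 3 ≤ 2 * (S.lam j * (S.lam j ^ 2 + 2 * S.ρ)) := by
    have : S.lam j * (S.lam j ^ 2 / 2) ≤ S.lam j * (S.lam j ^ 2 + 2 * S.ρ) := by gcongr
    nlinarith
  have h7 : 0 ≤ S.ρ ^ 2 * (S.lam j ^ 2 + S.ρ) ^ 2 := by positivity
  nlinarith

lemma Regular.sum_sum_mul_noiseMat_sq_le (h : S.Regular L) (v : Fin S.p → ℝ) :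
    ∑ l, (∑ k, v k * S.noiseMat k l) ^ 2 ≤ 9 / L ^ 2 * ∑ k, v k ^ 2 := by
  rw [S.sum_sum_mul_noiseMat_sq, ← S.sum_sum_mul_Q_sq, Finset.mul_sum]
  refine Finset.sum_le_sum fun j _ => ?_
  rw [mul_comm]
  gcongr
  calc S.weight j ^ 2 ≤ (3 / L) ^ 2 := pow_le_pow_left₀ (h.weight_pos j).le (h.weight_le j) 2
    _ = 9 / L ^ 2 := by rw [div_pow]; norm_num

lemma Regular.sum_noiseMat_sq_le (h : S.Regular L) (k : Fin S.p) :
    ∑ l, S.noiseMat k l ^ 2 ≤ 9 / L ^ 2 := by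
  have := h.sum_sum_mul_noiseMat_sq_le (Pi.single k 1)
  simpa [Pi.single_apply, ite_mul, ite_pow] using this

lemma bias_eq (v : Fin S.p → ℝ) (k : Fin S.p) :
    S.bias v k = ∑ j, S.Q k j * (S.shrink j * ∑ i, v i * S.Q i j) := by
  simp only [bias, Matrix.mulVec, dotProduct, mul_diagonal_mul_transpose_apply, Finset.mul_sum,
    Finset.sum_mul]
  rw [Finset.sum_comm]
  exact Finset.sum_congr rfl fun j _ => Finset.sum_congr rfl fun i _ => by ring

lemma Regular.sqrt_sum_bias_sq_le (h : S.Regular L) (v : Fin S.p → ℝ) :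
    √(∑ k, S.bias v k ^ 2) ≤ 2 * S.ρ ^ 2 / L ^ 4 * √(∑ k, v k ^ 2) := by
  have hL := h.L_pos
  have h0 : ∑ k, S.bias v k ^ 2 ≤ (2 * S.ρ ^ 2 / L ^ 4) ^ 2 * ∑ k, v k ^ 2 := by
    have h1 := sum_mulVec_sq_of_orthonormal S.Q_orthonormal
      (fun j => S.shrink j * ∑ i, v i * S.Q i j)
    have h2 : ∀ k, S.bias v k = (S.Q *ᵥ fun j => S.shrink j * ∑ i, v i * S.Q i j) k :=
      fun k => bias_eq v k
    rw [Finset.sum_congr rfl fun k _ => by rw [h2 k], h1, ← S.sum_sum_mul_Q_sq v, Finset.mul_sum]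
    refine Finset.sum_le_sum fun j _ => ?_
    rw [mul_pow]
    gcongr
    · exact shrink_nonneg j
    · exact h.shrink_le j
  calc √(∑ k, S.bias v k ^ 2) ≤ √((2 * S.ρ ^ 2 / L ^ 4) ^ 2 * ∑ k, v k ^ 2) := Real.sqrt_le_sqrt h0
    _ = _ := by rw [Real.sqrt_mul (sq_nonneg _), Real.sqrt_sq (by positivity)]

lemma Regular.abs_bias_le (h : S.Regular L) (v : Fin S.p → ℝ) (k : Fin S.p) :
    |S.bias v k| ≤ 2 * S.ρ ^ 2 / L ^ 4 * √(∑ k, v k ^ 2) := by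
  refine le_trans ?_ (h.sqrt_sum_bias_sq_le v)
  apply Real.abs_le_sqrt
  exact Finset.single_le_sum (f := fun k => S.bias v k ^ 2) (fun _ _ => sq_nonneg _)
    (Finset.mem_univ k)

/-- The bias is split as (c·weight)·(shrink/weight) and bounded by Cauchy–Schwarz. The first factor
has length at most τ, so the ridge bias is measured directly against the scale by which it is
divided later. -/
lemma Regular.abs_sum_M_mul_bias_le (h : S.Regular L) (v : Fin S.p → ℝ) (i : Fin S.p₁) :
    |∑ k ∈ S.N, S.M i k * S.bias v k| ≤ S.τ i * (2 * S.ρ ^ 2 / L ^ 3 * √(∑ k, v k ^ 2)) := by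
  have hL := h.L_pos
  have h1 : ∑ k ∈ S.N, S.M i k * S.bias v k
      = ∑ j, (S.c i j * S.weight j) * (S.shrink j / S.weight j * ∑ i, v i * S.Q i j) := by
    rw [Finset.sum_congr rfl fun k _ => by rw [bias_eq, Finset.mul_sum], Finset.sum_comm]
    refine Finset.sum_congr rfl fun j _ => ?_
    have := (h.weight_pos j).ne'
    rw [c, coef, Finset.sum_mul, Finset.sum_mul]
    exact Finset.sum_congr rfl fun k _ => by field_simp
  rw [h1]
  refine (abs_sum_mul_le_sqrt _ _ _).trans ?_
  refine mul_le_mul ?_ ?_ (Real.sqrt_nonneg _) (S.τ_pos h.n_pos i).le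
  · rw [τ, scale]
    apply Real.sqrt_le_sqrt
    simp only [mul_pow]
    have : (0 : ℝ) ≤ 1 / n := by positivity
    exact le_add_of_nonneg_left this
  · calc √(∑ j, (S.shrink j / S.weight j * ∑ i, v i * S.Q i j) ^ 2)
        ≤ √((2 * S.ρ ^ 2 / L ^ 3) ^ 2 * ∑ k, v k ^ 2) := by
          apply Real.sqrt_le_sqrt
          rw [← S.sum_sum_mul_Q_sq v, Finset.mul_sum]
          refine Finset.sum_le_sum fun j _ => ?_
          rw [mul_pow]
          have hw := h.weight_pos j
          have hq : S.shrink j / S.weight j ≤ 2 * S.ρ ^ 2 / L ^ 3 := by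
            rw [div_le_iff₀ hw]; exact h.shrink_le_weight j
          exact mul_le_mul_of_nonneg_right
            (pow_le_pow_left₀ (div_nonneg (shrink_nonneg j) hw.le) hq 2) (sq_nonneg _)
      _ = _ := by rw [Real.sqrt_mul (sq_nonneg _), Real.sqrt_sq (by positivity)]

/-- The weights are at least of order n^(−1/2) because the singular values are O(n^(1/2)). Hence the
summand 1/n does not dominate τ², and the standardised forms do not degenerate. -/
lemma Regular.le_sum_load_sq (h : S.Regular L) {i : Fin S.p₁} {cM C : ℝ} (hcM : 0 < cM)
    (hC : 0 < C) (hM : cM ≤ ∑ k ∈ S.N, S.M i k ^ 2) (hlam : ∀ j, S.lam j ≤ C * √n) :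
    (cM / (16 * C ^ 2)) / (1 + cM / (16 * C ^ 2)) ≤ ∑ l, S.load i l ^ 2 := by
  have hn : (0 : ℝ) < n := by exact_mod_cast h.n_pos
  set κ := cM / (16 * C ^ 2) with hκ
  have hκ0 : 0 < κ := by positivity
  have hs : κ / n ≤ ∑ j, S.c i j ^ 2 * S.weight j ^ 2 := by
    have hw : ∀ j, 1 / (16 * C ^ 2 * n) ≤ S.weight j ^ 2 := by
      intro j
      have h1 := h.lam_pos j
      have h2 : 1 / (4 * (C * √n)) ≤ S.weight j := by
        refine le_trans ?_ (h.weight_bounds j).1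
        have := hlam j
        gcongr
      have h3 := pow_le_pow_left₀ (by positivity) h2 2
      refine le_trans (le_of_eq ?_) h3
      rw [div_pow, mul_pow, mul_pow, Real.sq_sqrt hn.le]
      norm_num
      ring
    calc κ / n = cM * (1 / (16 * C ^ 2 * n)) := by rw [hκ]; field_simp
      _ ≤ (∑ j, S.c i j ^ 2) * (1 / (16 * C ^ 2 * n)) := by
          rw [S.sum_coef_sq]; gcongr
      _ ≤ _ := by
          rw [Finset.sum_mul]
          refine Finset.sum_le_sum fun j _ => ?_
          have := hw j
          gcongr
  rw [S.sum_load_sq, S.τ_sq]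
  have hs0 : 0 < κ / n := by positivity
  rw [div_le_div_iff₀ (by positivity) (by positivity)]
  have : κ * (1 / n) = κ / n := by ring
  nlinarith

/-- If the errors are small relative to the threshold, the selected set is correct. -/
lemma Regular.NHat_eq (h : S.Regular L) {v : Fin S.p → ℝ} {e : Fin n → ℝ} {t : ℝ}
    (hout : ∀ k ∉ S.N, |v k| ≤ S.b - t) (hin : ∀ k ∈ S.N, S.b + t < |v k|)
    (hsmall : ∀ k, |S.bias v k| + |(S.noiseMat *ᵥ e) k| ≤ t) :
    S.NHat (S.X *ᵥ v + e) = S.N := by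
  ext k
  have hdeb : S.debiased (S.X *ᵥ v + e) k = v k - S.bias v k + (S.noiseMat *ᵥ e) k := by
    rw [S.debiased_eq h.denom_ne]; rfl
  have hs := hsmall k
  have h1 : |S.debiased (S.X *ᵥ v + e) k - v k| ≤ t := by
    rw [hdeb]
    have : v k - S.bias v k + (S.noiseMat *ᵥ e) k - v k = (S.noiseMat *ᵥ e) k - S.bias v k := by ring
    rw [this]
    exact (abs_sub _ _).trans (by linarith)
  have h2 := abs_sub_abs_le_abs_sub (S.debiased (S.X *ᵥ v + e) k) (v k)
  have h3 := abs_sub_abs_le_abs_sub (v k) (S.debiased (S.X *ᵥ v + e) k)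
  rw [abs_sub_comm] at h3
  rw [NHat, active, Finset.mem_filter]
  simp only [Finset.mem_univ, true_and]
  constructor
  · intro hk
    by_contra hkN
    linarith [hout k hkN]
  · intro hk
    linarith [hin k hk]

/-- The two remainders come from the centring at g and from the ridge bias. Keeping v and g free
lets the lemma serve the sample, with the true parameter, and the bootstrap, with the estimated one.
-/
lemma Regular.abs_studentized_sub_le (h : S.Regular L) {v : Fin S.p → ℝ} {e : Fin n → ℝ}
    (hN : S.NHat (S.X *ᵥ v + e) = S.N) (g : Fin S.p₁ → ℝ) (i : Fin S.p₁) :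
    |(S.γHat (S.X *ᵥ v + e) i - g i) / S.τHat (S.X *ᵥ v + e) i - ∑ l, S.load i l * e l|
      ≤ |∑ k ∈ S.N, S.M i k * v k - g i| * √n + 2 * S.ρ ^ 2 / L ^ 3 * √(∑ k, v k ^ 2) := by
  have hτ := S.τ_pos h.n_pos i
  have h1 : S.γHat (S.X *ᵥ v + e) i = ∑ k ∈ S.N, S.M i k * v k
      - ∑ k ∈ S.N, S.M i k * S.bias v k + S.τ i * ∑ l, S.load i l * e l := by
    rw [γHat, Matrix.mulVec, dotProduct, ← S.sum_M_mul_noiseMat h.n_pos,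
      ← Finset.sum_sub_distrib, ← Finset.sum_add_distrib]
    simp only [βHat, hN, mul_ite, mul_zero]
    rw [Finset.sum_ite_mem, Finset.univ_inter]
    refine Finset.sum_congr rfl fun k _ => ?_
    rw [S.debiased_eq h.denom_ne]
    simp only [Pi.add_apply, Pi.sub_apply]
    ring
  have h2 : S.τHat (S.X *ᵥ v + e) i = S.τ i := by rw [τHat, hN, τ]
  have h3 : (S.γHat (S.X *ᵥ v + e) i - g i) / S.τHat (S.X *ᵥ v + e) i - ∑ l, S.load i l * e l
      = (∑ k ∈ S.N, S.M i k * v k - g i) / S.τ i - (∑ k ∈ S.N, S.M i k * S.bias v k) / S.τ i := by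
    rw [h1, h2]; field_simp; ring
  rw [h3]
  refine (abs_sub _ _).trans (add_le_add ?_ ?_)
  · rw [abs_div, abs_of_pos hτ, div_le_iff₀ hτ, mul_assoc]
    refine le_mul_of_one_le_right (abs_nonneg _) ?_
    have hn : (0 : ℝ) < √n := Real.sqrt_pos.2 (by exact_mod_cast h.n_pos)
    have := S.one_div_sqrt_le_τ i
    rw [div_le_iff₀ hn] at this
    linarith
  · rw [abs_div, abs_of_pos hτ, div_le_iff₀ hτ, mul_comm]
    exact h.abs_sum_M_mul_bias_le v i

/-- A matrix listing the loadings of the rows in `ℳ`, possibly with repetitions. -/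
noncomputable def loadMat {D : ℕ} (f : Fin D → S.Mset) : Matrix (Fin D) (Fin n) ℝ :=
  Matrix.of fun a l => S.load (f a) l

lemma Regular.mem_cube_of_maxStat_le (h : S.Regular L) {v : Fin S.p → ℝ} {e : Fin n → ℝ}
    (hN : S.NHat (S.X *ᵥ v + e) = S.N) {g : Fin S.p₁ → ℝ} {D : ℕ} (f : Fin D → S.Mset) {r x : ℝ}
    (hr : ∀ i, |∑ k ∈ S.N, S.M i k * v k - g i| * √n + 2 * S.ρ ^ 2 / L ^ 3 * √(∑ k, v k ^ 2) ≤ r)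
    (hx : S.maxStat (S.X *ᵥ v + e) g ≤ x) : linImage (loadMat f) e ∈ cube D (x + r) := by
  rw [linImage_mem_cube]
  intro a
  have h1 := le_ciSup (f := fun i => |S.γHat (S.X *ᵥ v + e) i - g i| / S.τHat (S.X *ᵥ v + e) i)
    (Set.finite_range _).bddAbove (f a)
  have h2 := (h.abs_studentized_sub_le hN g (f a)).trans (hr (f a))
  have hτ : 0 ≤ S.τHat (S.X *ᵥ v + e) (f a) := Real.sqrt_nonneg _
  have h3 : |(S.γHat (S.X *ᵥ v + e) (f a) - g (f a)) / S.τHat (S.X *ᵥ v + e) (f a)| ≤ x := by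
    rw [abs_div, abs_of_nonneg hτ]; exact h1.trans hx
  have h4 := abs_sub_abs_le_abs_sub (∑ l, S.load (f a) l * e l)
    ((S.γHat (S.X *ᵥ v + e) (f a) - g (f a)) / S.τHat (S.X *ᵥ v + e) (f a))
  rw [abs_sub_comm] at h4
  simp only [loadMat, Matrix.of_apply]
  linarith

lemma Regular.maxStat_le_of_mem_cube (h : S.Regular L) {v : Fin S.p → ℝ} {e : Fin n → ℝ}
    (hN : S.NHat (S.X *ᵥ v + e) = S.N) {g : Fin S.p₁ → ℝ} {D : ℕ} [NeZero D] {f : Fin D → S.Mset}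
    (hf : Function.Surjective f) {r x : ℝ}
    (hr : ∀ i, |∑ k ∈ S.N, S.M i k * v k - g i| * √n + 2 * S.ρ ^ 2 / L ^ 3 * √(∑ k, v k ^ 2) ≤ r)
    (hx : linImage (loadMat f) e ∈ cube D (x - r)) : S.maxStat (S.X *ᵥ v + e) g ≤ x := by
  rw [linImage_mem_cube] at hx
  -- A cube that contains a point has nonnegative half-width, which is what the rows with vanishing
  -- loadings require.
  have hxr : 0 ≤ x - r := (abs_nonneg _).trans (hx 0)
  have : Nonempty (Fin S.p₁) := ⟨f 0⟩
  refine ciSup_le fun i => ?_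
  have h2 := (h.abs_studentized_sub_le hN g i).trans (hr i)
  have hτ : 0 ≤ S.τHat (S.X *ᵥ v + e) i := Real.sqrt_nonneg _
  have h3 : |S.γHat (S.X *ᵥ v + e) i - g i| / S.τHat (S.X *ᵥ v + e) i
      = |(S.γHat (S.X *ᵥ v + e) i - g i) / S.τHat (S.X *ᵥ v + e) i| := by
    rw [abs_div, abs_of_nonneg hτ]
  have h4 := abs_sub_abs_le_abs_sub
    ((S.γHat (S.X *ᵥ v + e) i - g i) / S.τHat (S.X *ᵥ v + e) i) (∑ l, S.load i l * e l)
  have h5 : |∑ l, S.load i l * e l| ≤ x - r := by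
    by_cases hi : i ∈ S.Mset
    · obtain ⟨a, ha⟩ := hf ⟨i, hi⟩
      have := hx a
      simpa [loadMat, ha] using this
    · simpa [S.load_eq_zero hi] using hxr
  rw [h3]
  linarith

lemma H_eq {D : ℕ} [NeZero D] {f : Fin D → S.Mset} (hf : Function.Surjective f) (hn : 1 ≤ n)
    {V : Matrix (Fin n) (Fin n) ℝ} (hV : V.PosSemidef) (x : ℝ) :
    S.H V x = (multivariateGaussian 0 (loadMat f * V * (loadMat f)ᵀ)).real (cube D x) := by
  have hm : Measurable fun x : EuclideanSpace ℝ (Fin n) => linImage (loadMat f) x :=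
    (measurable_linImage _).comp (by fun_prop)
  rw [← map_linImage_multivariateGaussian hV, map_measureReal_apply hm (measurableSet_cube _), H]
  congr 1
  ext ξ
  simp only [Set.mem_ofPred_eq, Set.mem_preimage]
  rw [linImage_mem_cube]
  have : Nonempty S.Mset := ⟨f 0⟩
  have he : ∀ i : S.Mset, 1 / S.τ i * |∑ j, ∑ l, S.c i j * S.weight j * S.P l j * ξ l|
      = |∑ l, S.load i l * ξ l| := by
    intro i
    have hτ := S.τ_pos hn i
    have hτ' : 0 < 1 / S.τ i := by positivity
    nth_rewrite 1 [← abs_of_pos hτ']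
    rw [← abs_mul]
    congr 1
    rw [Finset.sum_comm, Finset.mul_sum]
    refine Finset.sum_congr rfl fun l _ => ?_
    rw [load, Finset.sum_div, Finset.sum_mul, Finset.mul_sum]
    exact Finset.sum_congr rfl fun j _ => by ring
  simp_rw [he]
  rw [ciSup_le_iff (Set.finite_range _).bddAbove, hf.forall]
  rfl

/-- Listing the rows of ℳ with repetitions changes no maximum and allows one dimension D for all
sample sizes. The covariance may become singular, but only its diagonal has to be bounded below. -/
lemma exists_surjective_Mset (hne : S.Mset.Nonempty) {D : ℕ} (hD : S.p₁ ≤ D) :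
    ∃ f : Fin D → S.Mset, Function.Surjective f := by
  have : Nonempty S.Mset := hne.to_subtype
  let g : S.Mset ↪ Fin D := (Function.Embedding.subtype _).trans (Fin.castLEEmb hD)
  exact ⟨Function.invFun g, Function.invFun_surjective g.injective⟩

end Setting

end RidgeBootstrap

namespace RidgeBootstrap

set_option linter.unusedSectionVars false

/-! ### Properties of the bootstrap kernel -/

section Kernel

variable {K : ℝ → ℝ} {k : ℕ → ℝ} {η m νb : ℝ}

lemma Assumption7.le_one (h : Assumption7 K k η m νb) (x : ℝ) : K x ≤ 1 := by
  rw [← h.at_zero]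
  rcases le_total 0 x with hx | hx
  · exact h.antitoneOn (Set.mem_Ici.2 le_rfl) hx hx
  · rw [← h.symm x]
    exact h.antitoneOn (Set.mem_Ici.2 le_rfl) (by simpa using hx) (by simpa using hx)

lemma Assumption7.eq_integral (h : Assumption7 K k η m νb) (v : ℝ) :
    (K v : ℂ) = ∫ w : ℝ, Complex.exp (2 * Real.pi * Complex.I * (v * w)) * fourierK K w := by
  have hF : FourierTransform.fourier (fun t : ℝ => (K t : ℂ)) = fourierK K := by
    ext w
    rw [Real.fourier_real_eq_integral_exp_smul, fourierK]
    refine integral_congr_ae (Filter.Eventually.of_forall fun t => ?_)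
    simp only [smul_eq_mul]
    rw [mul_comm]
    congr 2
    push_cast
    ring
  have hint : Integrable (fun t : ℝ => (K t : ℂ)) := h.integrable.ofReal
  have hc : Continuous (fun t : ℝ => (K t : ℂ)) :=
    Complex.continuous_ofReal.comp h.contDiff.continuous
  have := congrFun (hc.fourierInv_fourier_eq hint (by rw [hF]; exact h.fourier_integrable)) v
  rw [← this, hF, Real.fourierInv_eq']
  refine integral_congr_ae (Filter.Eventually.of_forall fun t => ?_)
  simp only [smul_eq_mul]
  congr 2
  simp
  ring

/-- The easy half of Bochner's theorem: Fourier inversion writes the form as the integral of a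
squared modulus against the nonnegative transform. -/
lemma Assumption7.sum_nonneg (h : Assumption7 K k η m νb) {ι : Type*} [Fintype ι] (t x : ι → ℝ) :
    0 ≤ ∑ i, ∑ j, x i * x j * K (t i - t j) := by
  have hI : ∀ v : ℝ, Integrable fun w : ℝ =>
      Complex.exp (2 * Real.pi * Complex.I * (v * w)) * fourierK K w := by
    intro v
    refine h.fourier_integrable.bdd_mul (c := 1) (by fun_prop) (Filter.Eventually.of_forall fun w => ?_)
    have : (2 * Real.pi * Complex.I * (v * w) : ℂ) = ((2 * Real.pi * (v * w) : ℝ) : ℂ) * Complex.I := by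
      push_cast; ring
    rw [this, Complex.norm_exp_ofReal_mul_I]
  have key : ((∑ i, ∑ j, x i * x j * K (t i - t j) : ℝ) : ℂ)
      = ∫ w : ℝ, (((fourierK K w).re * Complex.normSq
        (∑ i, x i * Complex.exp (2 * Real.pi * Complex.I * (t i * w))) : ℝ) : ℂ) := by
    have h1 : ∀ w : ℝ, ∑ i, ∑ j, ((x i : ℂ) * x j) *
        (Complex.exp (2 * Real.pi * Complex.I * ((t i - t j : ℝ) * w)) * fourierK K w)
        = (((fourierK K w).re * Complex.normSq
          (∑ i, x i * Complex.exp (2 * Real.pi * Complex.I * (t i * w))) : ℝ) : ℂ) := by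
      intro w
      have hF : fourierK K w = ((fourierK K w).re : ℂ) :=
        Complex.ext (by simp) (by simp [(h.fourier_nonneg w).1])
      rw [Complex.ofReal_mul, ← hF, ← Complex.mul_conj, map_sum, Finset.sum_mul_sum, Finset.mul_sum]
      refine Finset.sum_congr rfl fun i _ => ?_
      rw [Finset.mul_sum]
      refine Finset.sum_congr rfl fun j _ => ?_
      rw [map_mul, Complex.conj_ofReal, ← Complex.exp_conj]
      have he : Complex.exp (2 * Real.pi * Complex.I * ((t i - t j : ℝ) * w))
          = Complex.exp (2 * Real.pi * Complex.I * (t i * w)) *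
            Complex.exp ((starRingEnd ℂ) (2 * Real.pi * Complex.I * (t j * w))) := by
        rw [← Complex.exp_add]
        congr 1
        have h2 : (starRingEnd ℂ) 2 = 2 := Complex.conj_ofNat 2
        simp [h2]
        ring
      rw [he]
      ring
    rw [← integral_congr_ae (Filter.Eventually.of_forall h1), integral_finsetSum _ fun i _ =>
      integrable_finsetSum _ fun j _ => (hI (t i - t j)).const_mul ((x i : ℂ) * x j)]
    rw [Complex.ofReal_sum]
    refine Finset.sum_congr rfl fun i _ => ?_
    rw [integral_finsetSum _ fun j _ => (hI (t i - t j)).const_mul ((x i : ℂ) * x j),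
      Complex.ofReal_sum]
    refine Finset.sum_congr rfl fun j _ => ?_
    rw [integral_const_mul, ← h.eq_integral]
    push_cast
    ring
  have key' := Complex.ofReal_injective (key.trans integral_complex_ofReal)
  rw [key']
  exact integral_nonneg fun w => mul_nonneg (h.fourier_nonneg w).2 (Complex.normSq_nonneg _)

lemma Assumption7.posSemidef (h : Assumption7 K k η m νb) (n : ℕ) (κ : ℝ) :
    (kernelMatrix n K κ).PosSemidef := by
  refine Matrix.PosSemidef.of_dotProduct_mulVec_nonneg ?_ ?_
  · ext i j
    simp only [kernelMatrix, Matrix.conjTranspose_apply, Matrix.of_apply, star_trivial]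
    rw [← h.symm]
    congr 1
    ring
  · intro x
    have := h.sum_nonneg (fun i : Fin n => (i.val : ℝ) / κ) x
    refine this.trans (le_of_eq ?_)
    simp only [dotProduct, Matrix.mulVec, kernelMatrix, Matrix.of_apply, Pi.star_apply, star_trivial,
      Finset.mul_sum, sub_div]
    exact Finset.sum_congr rfl fun i _ => Finset.sum_congr rfl fun j _ => by ring

/-- Each side of the diagonal is a sum of a nonincreasing function, bounded by κ times the integral
of K. The diagonal contributes 1, which is at most κ. -/
lemma Assumption7.sum_kernel_le (h : Assumption7 K k η m νb) {n : ℕ} {κ : ℝ} (hκ : 1 ≤ κ) (i : Fin n) :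
    ∑ j : Fin n, K (((i.val : ℝ) - j.val) / κ) ≤ (1 + 2 * ∫ t, K t) * κ := by
  have hκ0 : 0 < κ := by linarith
  have hanti : AntitoneOn (fun x => K (x / κ)) (Set.Icc (0 : ℝ) (0 + (n : ℕ))) := by
    intro x hx y hy hxy
    exact h.antitoneOn (Set.mem_Ici.2 (div_nonneg hx.1 hκ0.le))
      (Set.mem_Ici.2 (div_nonneg hy.1 hκ0.le)) (by gcongr)
  have h1 := hanti.sum_le_integral
  simp only [zero_add] at h1
  have h2 : ∫ x in (0 : ℝ)..n, K (x / κ) ≤ κ * ∫ t, K t := by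
    rw [intervalIntegral.integral_comp_div _ hκ0.ne', smul_eq_mul,
      intervalIntegral.integral_of_le (div_le_div_of_nonneg_right (Nat.cast_nonneg n) hκ0.le)]
    exact mul_le_mul_of_nonneg_left
      (setIntegral_le_integral h.integrable (Filter.Eventually.of_forall h.nonneg)) hκ0.le
  have h3 : ∀ j : Fin n, K (((i.val : ℝ) - j.val) / κ) ≤ (if j = i then 1 else 0)
      + ∑ s ∈ Finset.range n, ((if j.val = i.val + (s + 1) then K (((s + 1 : ℕ) : ℝ) / κ) else 0)
        + if i.val = j.val + (s + 1) then K (((s + 1 : ℕ) : ℝ) / κ) else 0) := by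
    intro j
    have hnn : ∀ s ∈ Finset.range n,
        0 ≤ ((if j.val = i.val + (s + 1) then K (((s + 1 : ℕ) : ℝ) / κ) else 0)
        + if i.val = j.val + (s + 1) then K (((s + 1 : ℕ) : ℝ) / κ) else 0) := by
      intro s _
      have := h.nonneg (((s + 1 : ℕ) : ℝ) / κ)
      split_ifs <;> linarith
    have h0 : (0 : ℝ) ≤ if j = i then 1 else 0 := by split_ifs <;> norm_num
    rcases lt_trichotomy i.val j.val with hij | hij | hij
    · obtain ⟨s, hs⟩ := Nat.exists_eq_add_of_lt hij
      have := Finset.single_le_sum hnn (Finset.mem_range.2 (show s < n by lia))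
      rw [if_pos (by lia), if_neg (by lia), add_zero] at this
      refine le_trans (le_of_eq ?_) (le_add_of_nonneg_of_le h0 this)
      rw [← h.symm, hs]
      congr 1
      push_cast
      ring
    · have : j = i := Fin.ext hij.symm
      rw [if_pos this]
      have := Finset.sum_nonneg hnn
      linarith [h.le_one (((i.val : ℝ) - j.val) / κ)]
    · obtain ⟨s, hs⟩ := Nat.exists_eq_add_of_lt hij
      have := Finset.single_le_sum hnn (Finset.mem_range.2 (show s < n by lia))
      rw [if_neg (by lia), if_pos (by lia), zero_add] at this
      refine le_trans (le_of_eq ?_) (le_add_of_nonneg_of_le h0 this)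
      rw [hs]
      congr 1
      push_cast
      ring
  have h4 : ∀ (a : Fin n → Prop) [DecidablePred a] (c : ℝ), 0 ≤ c →
      (∀ j j', a j → a j' → j = j') → ∑ j, (if a j then c else 0) ≤ c := by
    intro a _ c hc ha
    rw [← Finset.sum_filter, Finset.sum_const, nsmul_eq_mul]
    have : (Finset.univ.filter a).card ≤ 1 := by
      rw [Finset.card_le_one]
      intro j hj j' hj'
      exact ha j j' (Finset.mem_filter.1 hj).2 (Finset.mem_filter.1 hj').2
    have h' : ((Finset.univ.filter a).card : ℝ) ≤ 1 := by exact_mod_cast this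
    nlinarith
  calc ∑ j : Fin n, K (((i.val : ℝ) - j.val) / κ)
      ≤ ∑ j : Fin n, ((if j = i then 1 else 0) + ∑ s ∈ Finset.range n,
        ((if j.val = i.val + (s + 1) then K (((s + 1 : ℕ) : ℝ) / κ) else 0)
        + if i.val = j.val + (s + 1) then K (((s + 1 : ℕ) : ℝ) / κ) else 0)) :=
        Finset.sum_le_sum fun j _ => h3 j
    _ ≤ 1 + ∑ s ∈ Finset.range n, (K (((s + 1 : ℕ) : ℝ) / κ) + K (((s + 1 : ℕ) : ℝ) / κ)) := by
        rw [Finset.sum_add_distrib, Finset.sum_comm]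
        refine add_le_add (h4 _ 1 zero_le_one (by rintro j j' rfl rfl; rfl))
          (Finset.sum_le_sum fun s _ => ?_)
        rw [Finset.sum_add_distrib]
        refine add_le_add (h4 _ _ (h.nonneg _) ?_) (h4 _ _ (h.nonneg _) ?_)
        · intro j j' h h'; exact Fin.ext (by lia)
        · intro j j' h h'; exact Fin.ext (by lia)
    _ ≤ (1 + 2 * ∫ t, K t) * κ := by
        rw [Finset.sum_add_distrib]
        nlinarith

lemma Assumption7.eventually_abs_sub_one_le (h : Assumption7 K k η m νb) (S : ℕ) {r : ℝ} (hr : 0 < r) :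
    ∀ᶠ n in atTop, ∀ i j : Fin n, |(i.val : ℤ) - j.val| < S →
      |K (((i.val : ℝ) - j.val) / k n) - 1| ≤ r := by
  have hc : ContinuousAt K 0 := h.contDiff.continuous.continuousAt
  rw [Metric.continuousAt_iff] at hc
  obtain ⟨δ, hδ, hKδ⟩ := hc r hr
  filter_upwards [h.k_tendsto.eventually_gt_atTop (S / δ), h.k_tendsto.eventually_gt_atTop 0]
    with n hn hn0 i j hij
  have h1 : |((i.val : ℝ) - j.val)| < S := by
    have : ((|(i.val : ℤ) - j.val| : ℤ) : ℝ) < ((S : ℤ) : ℝ) := by exact_mod_cast hij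
    simpa using this
  have := hKδ (x := ((i.val : ℝ) - j.val) / k n) (by
    rw [Real.dist_eq, sub_zero, abs_div, abs_of_pos hn0, div_lt_iff₀ hn0]
    rw [div_lt_iff₀ hδ] at hn
    linarith)
  rw [h.at_zero, Real.dist_eq] at this
  exact this.le

end Kernel

/-! ### Measurability and the conditional law of the bootstrap statistic -/

section Conditional

variable {n : ℕ} (S : Setting n)

lemma Setting.measurable_debiased : Measurable S.debiased := by
  unfold Setting.debiased Setting.ridge
  fun_prop

lemma Setting.sum_active (v : Fin S.p → ℝ) (f : Fin S.p → ℝ) :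
    ∑ k ∈ S.active v, f k = ∑ k, if S.b < |v k| then f k else 0 := by
  rw [Setting.active, Finset.sum_filter]

lemma Setting.measurable_sum_NHat (f : Fin S.p → ℝ) :
    Measurable fun y => ∑ k ∈ S.NHat y, f k := by
  simp only [Setting.NHat, S.sum_active]
  refine Finset.measurable_sum _ fun k _ => Measurable.ite ?_ measurable_const measurable_const
  exact measurableSet_lt measurable_const
    (((measurable_pi_apply k).comp S.measurable_debiased).abs)

lemma Setting.measurable_βHat : Measurable S.βHat := by
  refine measurable_pi_iff.2 fun k => ?_
  have : (fun y => S.βHat y k) = fun y => if S.b < |S.debiased y k| then S.debiased y k else 0 := by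
    ext y
    simp [Setting.βHat, Setting.NHat, Setting.active]
  rw [this]
  have hm : Measurable fun y => S.debiased y k := (measurable_pi_apply k).comp S.measurable_debiased
  exact Measurable.ite (measurableSet_lt measurable_const hm.abs) hm measurable_const

lemma Setting.measurable_γHat : Measurable S.γHat := by
  have := S.measurable_βHat
  unfold Setting.γHat
  fun_prop

lemma Setting.measurable_τHat (i : Fin S.p₁) : Measurable fun y => S.τHat y i := by
  unfold Setting.τHat Setting.scale Setting.coef
  have := fun j => S.measurable_sum_NHat (fun k => S.M i k * S.Q k j)
  refine Measurable.sqrt (measurable_const.add (Finset.measurable_sum _ fun j _ => ?_))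
  exact ((this j).pow_const 2).mul_const _

lemma Setting.measurable_maxStat : Measurable fun q : (Fin n → ℝ) × (Fin S.p₁ → ℝ) =>
    S.maxStat q.1 q.2 := by
  unfold Setting.maxStat
  refine Measurable.iSup fun i => Measurable.div ?_ ((S.measurable_τHat i).comp measurable_fst)
  exact ((((measurable_pi_apply i).comp S.measurable_γHat).comp measurable_fst).sub
    ((measurable_pi_apply i).comp measurable_snd)).abs

lemma Setting.measurable_residual : Measurable S.residual := by
  have := S.measurable_βHat
  unfold Setting.residual
  fun_prop

lemma Setting.measurable_bootSample : Measurable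
    fun q : (Fin n → ℝ) × EuclideanSpace ℝ (Fin n) => S.bootSample q.1 q.2 := by
  have h1 := S.measurable_βHat
  have h2 := S.measurable_residual
  unfold Setting.bootSample
  refine Measurable.add ?_ (measurable_pi_iff.2 fun i => ?_)
  · fun_prop
  · exact (((measurable_pi_apply i).comp h2).comp measurable_fst).mul (by fun_prop)

lemma Setting.measurable_bootStat : Measurable
    fun q : (Fin n → ℝ) × EuclideanSpace ℝ (Fin n) => S.bootStat q.1 q.2 := by
  have : (fun q : (Fin n → ℝ) × EuclideanSpace ℝ (Fin n) => S.bootStat q.1 q.2)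
      = (fun r : (Fin n → ℝ) × (Fin S.p₁ → ℝ) => S.maxStat r.1 r.2) ∘
        fun q => (S.bootSample q.1 q.2, S.γHat q.1) := rfl
  rw [this]
  exact Measurable.comp S.measurable_maxStat
    (S.measurable_bootSample.prodMk (S.measurable_γHat.comp measurable_fst))

/-- By independence, conditioning on Y freezes it and leaves the law of W untouched. The exceptional
null set does not depend on s, so all values of a distribution function are covered at once. -/
lemma ae_condDistrib_eq {Ω α β : Type*} [MeasurableSpace Ω] [MeasurableSpace α] [MeasurableSpace β]
    {P : Measure Ω} [IsProbabilityMeasure P] {Y : Ω → α} (hY : Measurable Y) {W : Ω → β}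
    {μ : Measure β} [IsProbabilityMeasure μ] (hW : HasLaw W μ P) (hWY : IndepFun W Y P)
    {ψ : α → β → ℝ} (hψ : Measurable fun q : α × β => ψ q.1 q.2) :
    ∀ᵐ ω ∂P, ∀ s, MeasurableSet s →
      condDistrib (fun ω => ψ (Y ω) (W ω)) Y P (Y ω) s = μ {w | ψ (Y ω) w ∈ s} := by
  let κ : Kernel α ℝ := (Kernel.id ×ₖ Kernel.const _ μ).map (fun q : α × β => ψ q.1 q.2)
  have hκ : ∀ y, ∀ s, MeasurableSet s → κ y s = μ {w | ψ y w ∈ s} := by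
    intro y s hs
    have hs' : MeasurableSet ((fun q : α × β => ψ q.1 q.2) ⁻¹' s) := hψ hs
    simp only [κ]
    rw [Kernel.map_apply' _ hψ _ hs, Kernel.prod_apply, Kernel.id_apply, Kernel.const_apply,
      Measure.dirac_prod, Measure.map_apply (by fun_prop) hs']
    rfl
  have hmk : IsMarkovKernel κ := Kernel.IsMarkovKernel.map _ hψ
  have hZ : AEMeasurable (fun ω => ψ (Y ω) (W ω)) P :=
    hψ.comp_aemeasurable (hY.aemeasurable.prodMk hW.aemeasurable)
  have hprod : P.map (fun ω => (Y ω, W ω)) = (P.map Y).prod μ := by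
    rw [hWY.symm.map_prod_eq_prod_map_map hY.aemeasurable hW.aemeasurable, hW.map_eq]
  have hPY := Measure.isProbabilityMeasure_map (μ := P) hY.aemeasurable
  have h := condDistrib_ae_eq_of_measure_eq_compProd (κ := κ) Y hZ (by
    ext s hs
    have hm : Measurable fun q : α × β => (q.1, ψ q.1 q.2) := measurable_fst.prodMk hψ
    rw [Measure.compProd_apply hs]
    have : (fun ω => (Y ω, ψ (Y ω) (W ω)))
        = (fun q : α × β => (q.1, ψ q.1 q.2)) ∘ fun ω => (Y ω, W ω) := rfl
    rw [this, ← AEMeasurable.map_map_of_aemeasurable hm.aemeasurable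
      (hY.aemeasurable.prodMk hW.aemeasurable), hprod, Measure.map_apply hm hs,
      Measure.prod_apply (hm hs)]
    refine lintegral_congr fun y => ?_
    rw [hκ y _ (measurable_prodMk_left hs)]
    rfl)
  filter_upwards [ae_of_ae_map hY.aemeasurable h] with ω hω s hs
  rw [hω, hκ _ _ hs]

lemma ae_bootCDF_eq {Ω : Type*} [MeasurableSpace Ω] {P : Measure Ω} [IsProbabilityMeasure P]
    {Y : Ω → Fin n → ℝ} (hY : Measurable Y) {W : Ω → EuclideanSpace ℝ (Fin n)}
    {μ : Measure (EuclideanSpace ℝ (Fin n))} [IsProbabilityMeasure μ] (hW : HasLaw W μ P)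
    (hWY : IndepFun W Y P) :
    ∀ᵐ ω ∂P, ∀ x, bootCDF P S Y W ω x = μ.real {w | S.bootStat (Y ω) w ≤ x} := by
  filter_upwards [ae_condDistrib_eq hY hW hWY S.measurable_bootStat] with ω hω x
  rw [bootCDF, Measure.real, hω _ measurableSet_Iic]
  rfl

end Conditional

end RidgeBootstrap

namespace RidgeBootstrap

set_option linter.unusedSectionVars false

/-! ### Gaussian tails and symmetric Schur bounds -/

section Tail

/-- Chernoff's bound for the coordinates of a Gaussian vector. -/
lemma real_abs_gt_le {v v' t : ℝ} (hv0 : 0 ≤ v) (hv : v ≤ v') (hv' : 0 < v') (ht : 0 ≤ t) :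
    (gaussianReal 0 v.toNNReal).real {x | t < |x|} ≤ 2 * Real.exp (-t ^ 2 / (2 * v')) := by
  have hc : ((v.toNNReal : NNReal) : ℝ) = v := Real.coe_toNNReal _ hv0
  have hint : ∀ s, Integrable (fun x => Real.exp (s * x)) (gaussianReal 0 v.toNNReal) :=
    fun s => integrable_exp_mul_gaussianReal s
  have hmgf : ∀ s, mgf (fun x => x) (gaussianReal 0 v.toNNReal) s = Real.exp (v * s ^ 2 / 2) := by
    intro s
    have := congrFun (mgf_fun_id_gaussianReal (μ := 0) (v := v.toNNReal)) s
    rw [this]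
    simp [hc]
  have hexp : ∀ s, s ^ 2 = (t / v') ^ 2 →
      -(t / v') * t + v * s ^ 2 / 2 ≤ -t ^ 2 / (2 * v') := by
    intro s hs
    rw [hs]
    have : v * (t / v') ^ 2 / 2 ≤ v' * (t / v') ^ 2 / 2 := by gcongr
    refine (add_le_add_right this _).trans (le_of_eq ?_)
    field_simp
    ring
  have h1 : (gaussianReal 0 v.toNNReal).real {x | t ≤ id x} ≤ Real.exp (-t ^ 2 / (2 * v')) := by
    refine (measure_ge_le_exp_mul_mgf t (div_nonneg ht hv'.le) (hint _)).trans ?_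
    rw [hmgf, ← Real.exp_add]
    exact Real.exp_le_exp.2 (hexp _ rfl)
  have h2 : (gaussianReal 0 v.toNNReal).real {x | id x ≤ -t} ≤ Real.exp (-t ^ 2 / (2 * v')) := by
    refine (measure_le_le_exp_mul_mgf (-t) (t := -(t / v'))
      (neg_nonpos.2 (div_nonneg ht hv'.le)) (hint _)).trans ?_
    rw [hmgf, ← Real.exp_add]
    refine Real.exp_le_exp.2 (le_trans (le_of_eq ?_) (hexp _ (neg_sq _)))
    ring
  have hsub : {x : ℝ | t < |x|} ⊆ {x | t ≤ id x} ∪ {x | id x ≤ -t} := by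
    intro x hx
    rcases lt_abs.1 (show t < |x| from hx) with h | h
    · exact Or.inl h.le
    · right; simp only [id, Set.mem_ofPred_eq]; linarith
  refine (measureReal_mono hsub).trans ((measureReal_union_le _ _).trans ?_)
  linarith

/-- Schur's test for a symmetric kernel, from |ab| ≤ (a² + b²)/2. -/
lemma sum_sum_mul_le_of_symm {n : ℕ} {c : Fin n → Fin n → ℝ} (hc0 : ∀ i j, 0 ≤ c i j)
    (hsymm : ∀ i j, c i j = c j i) {B : ℝ} (hB : ∀ i, ∑ j, c i j ≤ B) (a b : Fin n → ℝ) :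
    ∑ i, ∑ j, |a i| * |b j| * c i j ≤ B * ((∑ i, a i ^ 2 + ∑ j, b j ^ 2) / 2) := by
  have h1 : ∀ i j, |a i| * |b j| * c i j ≤ (a i ^ 2 * c i j + b j ^ 2 * c j i) / 2 := by
    intro i j
    have := hc0 i j
    have h2 : |a i| * |b j| ≤ (a i ^ 2 + b j ^ 2) / 2 := by
      nlinarith [sq_nonneg (|a i| - |b j|), sq_abs (a i), sq_abs (b j)]
    rw [← hsymm i j]
    nlinarith
  have h3 : ∀ d : Fin n → ℝ, ∑ i, ∑ j, d i ^ 2 * c i j ≤ B * ∑ i, d i ^ 2 := by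
    intro d
    rw [Finset.mul_sum]
    refine Finset.sum_le_sum fun i _ => ?_
    rw [← Finset.mul_sum, mul_comm]
    exact mul_le_mul_of_nonneg_right (hB i) (sq_nonneg _)
  calc ∑ i, ∑ j, |a i| * |b j| * c i j
      ≤ ∑ i, ∑ j, (a i ^ 2 * c i j + b j ^ 2 * c j i) / 2 :=
        Finset.sum_le_sum fun i _ => Finset.sum_le_sum fun j _ => h1 i j
    _ = (∑ i, ∑ j, a i ^ 2 * c i j + ∑ j, ∑ i, b j ^ 2 * c j i) / 2 := by
        simp only [← Finset.sum_div, Finset.sum_add_distrib]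
        congr 2
        exact Finset.sum_comm
    _ ≤ (B * ∑ i, a i ^ 2 + B * ∑ j, b j ^ 2) / 2 := by
        have := h3 a
        have := h3 b
        linarith
    _ = _ := by ring

/-- Tail bound for the weighted sums of a Gaussian vector. -/
lemma multivariateGaussian_real_abs_sum_gt_le {n : ℕ} {V : Matrix (Fin n) (Fin n) ℝ}
    (hV : V.PosSemidef) (a : Fin n → ℝ) {v t : ℝ} (hv : 0 < v) (ht : 0 ≤ t)
    (hav : ∑ i, ∑ j, a i * a j * V i j ≤ v) :
    (multivariateGaussian 0 V).real {w : EuclideanSpace ℝ (Fin n) | t < |∑ i, a i * w i|}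
      ≤ 2 * Real.exp (-t ^ 2 / (2 * v)) := by
  let A : Matrix (Fin 1) (Fin n) ℝ := Matrix.of fun _ i => a i
  have hm : Measurable fun x : EuclideanSpace ℝ (Fin n) => linImage A x :=
    (measurable_linImage A).comp (by fun_prop)
  have hAV : (A * V * Aᵀ).PosSemidef := by simpa using hV.mul_mul_conjTranspose_same A
  have h1 := (measurePreserving_eval_multivariateGaussian (μ := 0) hAV (i := 0)).measureReal_preimage
      (s := {x : ℝ | t < |x|}) (measurableSet_lt measurable_const measurable_id.abs).nullMeasurableSet
  have hent : (A * V * Aᵀ) 0 0 = ∑ i, ∑ j, a i * a j * V i j := by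
    simp only [Matrix.mul_apply, Matrix.transpose_apply, A, Matrix.of_apply, Finset.sum_mul]
    rw [Finset.sum_comm]
    exact Finset.sum_congr rfl fun i _ => Finset.sum_congr rfl fun j _ => by ring
  have hms : MeasurableSet ((fun x : EuclideanSpace ℝ (Fin 1) => x 0) ⁻¹' {x : ℝ | t < |x|}) :=
    (measurableSet_lt measurable_const measurable_id.abs).preimage (by fun_prop)
  rw [← map_linImage_multivariateGaussian hV, map_measureReal_apply hm hms] at h1
  refine le_trans (le_of_eq ?_) (h1.trans_le (real_abs_gt_le hAV.diag_nonneg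
    (hent.trans_le hav) hv ht))
  rfl

end Tail

/-! ### Probabilistic consequences of the bounds for the errors -/

section Noise

variable {n : ℕ} {Ω : Type*} [MeasurableSpace Ω] {P : Measure Ω} [IsProbabilityMeasure P]
  {E : ErrorProcess n P} {r : ℕ} {R W : ℝ} {T : ℕ → ℝ}

lemma NoiseBounds.memLp_linear (h : NoiseBounds E r R W T) (a : Fin n → ℝ) :
    MemLp (fun ω => ∑ i, a i * E.ε i ω) (2 * r : ℕ) P :=
  memLp_finsetSum _ fun i _ => (h.memLp i).const_mul (a i)

lemma NoiseBounds.memLp_two (h : NoiseBounds E r R W T) (hr : 1 ≤ r) (i : Fin n) :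
    MemLp (E.ε i) 2 P :=
  (h.memLp i).mono_exponent (by exact_mod_cast (show 2 ≤ 2 * r by lia))

lemma NoiseBounds.memLp_two_linear (h : NoiseBounds E r R W T) (hr : 1 ≤ r) (a : Fin n → ℝ) :
    MemLp (fun ω => ∑ i, a i * E.ε i ω) 2 P :=
  memLp_finsetSum _ fun i _ => (h.memLp_two hr i).const_mul (a i)

/-- Markov's inequality of order 2r. The high order pays for the union bounds over all coordinates
and over all observations. -/
lemma NoiseBounds.real_abs_linear_gt_le (h : NoiseBounds E r R W T) (a : Fin n → ℝ)
    {t q : ℝ} (ht : 0 < t) (hq : ∑ i, a i ^ 2 ≤ q) :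
    P.real {ω | t < |∑ i, a i * E.ε i ω|} ≤ (4 * 4 ^ r * R ^ 2 * q / t ^ 2) ^ r := by
  have hint : Integrable (fun ω => (∑ i, a i * E.ε i ω) ^ (2 * r)) P := by
    have := (h.memLp_linear a).integrable_norm_pow'
    refine this.congr (Filter.Eventually.of_forall fun ω => ?_)
    simp only [Real.norm_eq_abs]
    exact Even.pow_abs (even_two_mul r) _
  have hm := mul_meas_ge_le_integral_of_nonneg (Filter.Eventually.of_forall fun ω =>
    (Even.pow_nonneg (even_two_mul r) _)) hint (t ^ (2 * r))
  have hsub : {ω | t < |∑ i, a i * E.ε i ω|} ⊆ {ω | t ^ (2 * r) ≤ (∑ i, a i * E.ε i ω) ^ (2 * r)} := by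
    intro ω hω
    simp only [Set.mem_ofPred_eq] at hω ⊢
    rw [← Even.pow_abs (even_two_mul r) (∑ i, a i * E.ε i ω)]
    exact pow_le_pow_left₀ ht.le hω.le _
  have hq0 : 0 ≤ ∑ i, a i ^ 2 := Finset.sum_nonneg fun _ _ => sq_nonneg _
  refine (measureReal_mono hsub).trans ?_
  have ht2 : 0 < t ^ (2 * r) := by positivity
  rw [div_pow, ← pow_mul, le_div_iff₀ ht2, mul_comm]
  refine hm.trans ((h.linear_pow a).trans ?_)
  gcongr

lemma NoiseBounds.real_exists_gt_le (h : NoiseBounds E r R W T) {N : ℕ} (A : Fin N → Fin n → ℝ)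
    {t q : ℝ} (ht : 0 < t) (hq : ∀ k, ∑ i, A k i ^ 2 ≤ q) :
    P.real {ω | ∃ k, t < |∑ i, A k i * E.ε i ω|} ≤ N * (4 * 4 ^ r * R ^ 2 * q / t ^ 2) ^ r := by
  have : {ω | ∃ k, t < |∑ i, A k i * E.ε i ω|} = ⋃ k, {ω | t < |∑ i, A k i * E.ε i ω|} := by
    ext ω; simp
  rw [this]
  refine (measureReal_iUnion_fintype_le _).trans ?_
  refine (Finset.sum_le_sum fun k _ => h.real_abs_linear_gt_le (A k) ht (hq k)).trans ?_
  simp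

/-- The extra factor 1 + |s| is what the residuals need: there the noise is summed over s against
bounded design entries, which costs √|s| by Cauchy–Schwarz. -/
lemma NoiseBounds.real_sum_sq_gt_le (h : NoiseBounds E r R W T) (hr : 1 ≤ r) {ι : Type*} (s : Finset ι)
    (A : ι → Fin n → ℝ) {q : ℝ} (hq : ∀ k, ∑ i, A k i ^ 2 ≤ q) :
    P.real {ω | 1 < (1 + (s.card : ℝ)) * ∑ k ∈ s, (∑ i, A k i * E.ε i ω) ^ 2}
      ≤ (1 + (s.card : ℝ)) * (s.card * (16 * R ^ 2 * q)) := by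
  have hint : ∀ k ∈ s, Integrable (fun ω => (∑ i, A k i * E.ε i ω) ^ 2) P :=
    fun k _ => (h.memLp_two_linear hr (A k)).integrable_sq
  have hI : Integrable (fun ω => (1 + (s.card : ℝ)) * ∑ k ∈ s, (∑ i, A k i * E.ε i ω) ^ 2) P :=
    (integrable_finsetSum _ hint).const_mul _
  have hm := mul_meas_ge_le_integral_of_nonneg (Filter.Eventually.of_forall fun ω =>
    mul_nonneg (by positivity : (0 : ℝ) ≤ 1 + (s.card : ℝ))
      (Finset.sum_nonneg fun k _ => sq_nonneg (∑ i, A k i * E.ε i ω))) hI 1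
  rw [one_mul] at hm
  refine (measureReal_mono fun ω hω => ?_).trans (hm.trans ?_)
  · exact (le_of_lt hω : (1 : ℝ) ≤ _)
  · rw [integral_const_mul, integral_finsetSum _ hint]
    gcongr
    refine (Finset.sum_le_sum fun k _ => (h.linear_sq (A k)).trans
      (mul_le_mul_of_nonneg_left (hq k) (by positivity))).trans ?_
    simp

lemma integral_abs_mul_le {f g : Ω → ℝ} (hf : MemLp f 2 P) (hg : MemLp g 2 P) {a b : ℝ}
    (ha : 0 ≤ a) (hb : 0 ≤ b) (hfa : ∫ ω, f ω ^ 2 ∂P ≤ a ^ 2) (hgb : ∫ ω, g ω ^ 2 ∂P ≤ b ^ 2) :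
    ∫ ω, |f ω * g ω| ∂P ≤ a * b := by
  have h := integral_mul_le_Lp_mul_Lq_of_nonneg (μ := P) Real.HolderConjugate.two_two
    (f := fun ω => |f ω|) (g := fun ω => |g ω|) (Filter.Eventually.of_forall fun _ => abs_nonneg _)
    (Filter.Eventually.of_forall fun _ => abs_nonneg _)
    (by rw [ENNReal.ofReal_ofNat]; exact hf.abs) (by rw [ENNReal.ofReal_ofNat]; exact hg.abs)
  simp only [← abs_mul] at h
  refine h.trans ?_
  simp only [Real.rpow_ofNat, sq_abs]
  have e1 : (∫ ω, f ω ^ 2 ∂P) ^ (1 / 2 : ℝ) ≤ a := by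
    rw [← Real.sqrt_eq_rpow]; exact (Real.sqrt_le_sqrt hfa).trans (Real.sqrt_sq ha).le
  have e2 : (∫ ω, g ω ^ 2 ∂P) ^ (1 / 2 : ℝ) ≤ b := by
    rw [← Real.sqrt_eq_rpow]; exact (Real.sqrt_le_sqrt hgb).trans (Real.sqrt_sq hb).le
  have e3 : 0 ≤ (∫ ω, g ω ^ 2 ∂P) ^ (1 / 2 : ℝ) :=
    Real.rpow_nonneg (integral_nonneg fun _ => sq_nonneg _) _
  exact mul_le_mul e1 e2 e3 ha

lemma integral_abs_le_of_integral_sq_le {f : Ω → ℝ} (hf : MemLp f 2 P) {a : ℝ} (ha : 0 ≤ a)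
    (hfa : ∫ ω, f ω ^ 2 ∂P ≤ a ^ 2) : ∫ ω, |f ω| ∂P ≤ a := by
  have := integral_abs_mul_le (P := P) hf (memLp_const (1 : ℝ)) ha zero_le_one hfa (by simp)
  simpa using this

lemma NoiseBounds.memLp_quadratic (h : NoiseBounds E r R W T) (hr : 2 ≤ r) (i j : Fin n) :
    MemLp (fun ω => E.ε i ω * E.ε j ω) 2 P := by
  have h4 : ∀ i, MemLp (E.ε i) 4 P := fun i =>
    (h.memLp i).mono_exponent (by exact_mod_cast (show 4 ≤ 2 * r by lia))
  exact (h4 j).mul (h4 i)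

lemma NoiseBounds.integral_sq_le (h : NoiseBounds E r R W T) (i : Fin n) :
    ∫ ω, E.ε i ω ^ 2 ∂P ≤ (4 * R) ^ 2 := by
  have := h.linear_sq (Pi.single i 1)
  simp only [Pi.single_apply, ite_mul, one_mul, zero_mul, Finset.sum_ite_eq', Finset.mem_univ,
    if_true, ite_pow, one_pow] at this
  refine this.trans (le_of_eq ?_)
  simp
  ring

/-- The weighted covariance estimator computed from perturbed errors is consistent. -/
lemma NoiseBounds.integral_abs_weighted_cov_sub_le (h : NoiseBounds E r R W T) (hn : 1 ≤ n) (hr : 2 ≤ r)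
    (hR : 0 ≤ R) {c : Fin n → Fin n → ℝ} (hc0 : ∀ i j, 0 ≤ c i j) (hc1 : ∀ i j, c i j ≤ 1)
    (hsymm : ∀ i j, c i j = c j i) {B : ℝ} (hB0 : 0 ≤ B) (hB : ∀ i, ∑ j, c i j ≤ B) {S : ℕ} {κ : ℝ}
    (hκ : 0 ≤ κ)
    (hκc : ∀ i j : Fin n, |(i.val : ℤ) - j.val| < S → 1 - c i j ≤ κ) {u v : Fin n → ℝ} {M : ℝ}
    (hM : ∀ i, |u i| ≤ M) (hM0 : 0 ≤ M) (hu : ∑ i, u i ^ 2 ≤ 1) (hv : ∑ i, v i ^ 2 ≤ 1)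
    {Δ : Fin n → Ω → ℝ} (hΔ : ∀ i, MemLp (Δ i) 2 P) {δ : ℝ} (hδ : 0 ≤ δ)
    (hΔδ : ∀ i, ∫ ω, Δ i ω ^ 2 ∂P ≤ δ ^ 2) :
    Integrable (fun ω => |∑ i, ∑ j, u i * v j * c i j * ((E.ε i ω + Δ i ω) * (E.ε j ω + Δ j ω))
        - ∑ i, ∑ j, u i * v j * E.cov i j|) P ∧
    ∫ ω, |∑ i, ∑ j, u i * v j * c i j * ((E.ε i ω + Δ i ω) * (E.ε j ω + Δ j ω))
        - ∑ i, ∑ j, u i * v j * E.cov i j| ∂P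
      ≤ 128 * R ^ 2 * (M * √B) + (κ * R ^ 2 + 2 * R * T S) + B * (8 * R * δ + δ ^ 2) := by
  set a : Fin n → Fin n → ℝ := fun i j => u i * v j * c i j with ha
  have huv : (∑ i, u i ^ 2 + ∑ i, v i ^ 2) / 2 ≤ 1 := by linarith
  have ha2 : ∑ i, ∑ j, a i j ^ 2 ≤ M ^ 2 * B := by
    calc ∑ i, ∑ j, a i j ^ 2 ≤ ∑ i, ∑ j, M ^ 2 * (v j ^ 2 * c j i) := by
          refine Finset.sum_le_sum fun i _ => Finset.sum_le_sum fun j _ => ?_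
          have h1 : u i ^ 2 ≤ M ^ 2 := by
            rw [← sq_abs (u i)]; exact pow_le_pow_left₀ (abs_nonneg _) (hM i) 2
          have h2 : c i j ^ 2 ≤ c j i := by
            rw [← hsymm i j]; nlinarith [hc0 i j, hc1 i j]
          simp only [ha]
          rw [mul_pow, mul_pow, mul_assoc]
          gcongr
      _ = M ^ 2 * ∑ j, v j ^ 2 * ∑ i, c j i := by
          simp only [← Finset.mul_sum]
          rw [Finset.sum_comm]
          simp only [← Finset.mul_sum]
      _ ≤ M ^ 2 * ∑ j, v j ^ 2 * B := by
          gcongr with j _; exact hB j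
      _ = M ^ 2 * B * ∑ j, v j ^ 2 := by rw [← Finset.sum_mul]; ring
      _ ≤ M ^ 2 * B * 1 := by gcongr
      _ = M ^ 2 * B := mul_one _
  have hQ : MemLp (fun ω => ∑ i, ∑ j, a i j * (E.ε i ω * E.ε j ω) - ∑ i, ∑ j, a i j * E.cov i j) 2 P := by
    refine MemLp.sub ?_ (memLp_const _)
    exact memLp_finsetSum _ fun i _ => memLp_finsetSum _ fun j _ =>
      (h.memLp_quadratic hr i j).const_mul (a i j)
  -- Fluctuation: the variance bound for quadratic forms, with the squared coefficients summing to
  -- at most M²B. Small individual loadings beat the number B of effectively active lags.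
  have h1 : ∫ ω, |∑ i, ∑ j, a i j * (E.ε i ω * E.ε j ω) - ∑ i, ∑ j, a i j * E.cov i j| ∂P
      ≤ 128 * R ^ 2 * (M * √B) := by
    refine integral_abs_le_of_integral_sq_le hQ (by positivity) ((h.quadratic a).trans ?_)
    rw [mul_pow, mul_pow, mul_pow, Real.sq_sqrt hB0]
    have : 0 ≤ 16384 * R ^ 4 := by positivity
    nlinarith
  have hcovs : ∀ i j, E.cov i j = E.cov j i := by
    intro i j
    simp only [ErrorProcess.cov, Matrix.of_apply, mul_comm]
  -- Smoothing bias: near the diagonal the weights are close to one, and far from it the covariances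
  -- are small in sum.
  have h2 : |∑ i, ∑ j, a i j * E.cov i j - ∑ i, ∑ j, u i * v j * E.cov i j|
      ≤ κ * R ^ 2 + 2 * R * T S := by
    have hs := h.cov_sum S κ
    have hB' : ∀ i, ∑ j, (1 - c i j) * |E.cov i j| ≤ κ * R ^ 2 + 2 * R * T S := fun i =>
      hs i (fun j => 1 - c i j) hκ (fun j => sub_nonneg.2 (hc1 i j))
        (fun j => by linarith [hc0 i j]) (hκc i)
    have hs2 := sum_sum_mul_le_of_symm (c := fun i j => (1 - c i j) * |E.cov i j|)
      (fun i j => mul_nonneg (sub_nonneg.2 (hc1 i j)) (abs_nonneg _))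
      (fun i j => by rw [hsymm i j, hcovs i j]) hB' u v
    let i₀ : Fin n := ⟨0, hn⟩
    have hB'' : 0 ≤ κ * R ^ 2 + 2 * R * T S := le_trans (Finset.sum_nonneg fun j _ =>
      mul_nonneg (sub_nonneg.2 (hc1 i₀ j)) (abs_nonneg _)) (hB' i₀)
    calc _ = |∑ i, ∑ j, u i * v j * ((c i j - 1) * E.cov i j)| := by
          congr 1
          simp only [← Finset.sum_sub_distrib, ha]
          exact Finset.sum_congr rfl fun i _ => Finset.sum_congr rfl fun j _ => by ring
      _ ≤ ∑ i, ∑ j, |u i| * |v j| * ((1 - c i j) * |E.cov i j|) := by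
          refine (Finset.abs_sum_le_sum_abs _ _).trans (Finset.sum_le_sum fun i _ =>
            (Finset.abs_sum_le_sum_abs _ _).trans (Finset.sum_le_sum fun j _ => le_of_eq ?_))
          rw [abs_mul, abs_mul, abs_mul, abs_sub_comm, abs_of_nonneg (sub_nonneg.2 (hc1 i j))]
      _ ≤ _ := hs2
      _ ≤ _ := by nlinarith
  set Z : Fin n → Fin n → Ω → ℝ := fun i j ω =>
    |E.ε i ω * Δ j ω| + |Δ i ω * E.ε j ω| + |Δ i ω * Δ j ω| with hZ
  have hε := fun i => h.memLp_two (by lia) i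
  have hZint : ∀ i j, Integrable (Z i j) P := fun i j =>
    (((hε i).integrable_mul (hΔ j)).abs.add ((hΔ i).integrable_mul (hε j)).abs).add
      ((hΔ i).integrable_mul (hΔ j)).abs
  -- Cost of using perturbed errors: the errors have L² norm at most 4R and the perturbations at
  -- most δ, so two cross terms and one square remain.
  have hZb : ∀ i j, ∫ ω, Z i j ω ∂P ≤ 8 * R * δ + δ ^ 2 := by
    intro i j
    have e1 := integral_abs_mul_le (hε i) (hΔ j) (by positivity) hδ (h.integral_sq_le i) (hΔδ j)
    have e2 := integral_abs_mul_le (hΔ i) (hε j) hδ (by positivity) (hΔδ i) (h.integral_sq_le j)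
    have e3 := integral_abs_mul_le (hΔ i) (hΔ j) hδ hδ (hΔδ i) (hΔδ j)
    simp only [hZ]
    have f1 : Integrable (fun ω => |E.ε i ω * Δ j ω|) P := ((hε i).integrable_mul (hΔ j)).abs
    have f2 : Integrable (fun ω => |Δ i ω * E.ε j ω|) P := ((hΔ i).integrable_mul (hε j)).abs
    have f3 : Integrable (fun ω => |Δ i ω * Δ j ω|) P := ((hΔ i).integrable_mul (hΔ j)).abs
    have f4 : Integrable (fun ω => |E.ε i ω * Δ j ω| + |Δ i ω * E.ε j ω|) P := f1.add f2
    rw [integral_add f4 f3, integral_add f1 f2]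
    nlinarith
  have hbound : ∀ ω, |∑ i, ∑ j, u i * v j * c i j * ((E.ε i ω + Δ i ω) * (E.ε j ω + Δ j ω))
        - ∑ i, ∑ j, u i * v j * E.cov i j|
      ≤ |∑ i, ∑ j, a i j * (E.ε i ω * E.ε j ω) - ∑ i, ∑ j, a i j * E.cov i j|
        + (κ * R ^ 2 + 2 * R * T S) + ∑ i, ∑ j, |u i| * |v j| * c i j * Z i j ω := by
    intro ω
    have e1 : ∑ i, ∑ j, u i * v j * c i j * ((E.ε i ω + Δ i ω) * (E.ε j ω + Δ j ω))
        - ∑ i, ∑ j, u i * v j * E.cov i j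
        = (∑ i, ∑ j, a i j * (E.ε i ω * E.ε j ω) - ∑ i, ∑ j, a i j * E.cov i j)
        + (∑ i, ∑ j, a i j * E.cov i j - ∑ i, ∑ j, u i * v j * E.cov i j)
        + ∑ i, ∑ j, a i j * (E.ε i ω * Δ j ω + Δ i ω * E.ε j ω + Δ i ω * Δ j ω) := by
      have : ∑ i, ∑ j, u i * v j * c i j * ((E.ε i ω + Δ i ω) * (E.ε j ω + Δ j ω))
          = ∑ i, ∑ j, a i j * (E.ε i ω * E.ε j ω)
          + ∑ i, ∑ j, a i j * (E.ε i ω * Δ j ω + Δ i ω * E.ε j ω + Δ i ω * Δ j ω) := by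
        simp only [← Finset.sum_add_distrib, ha]
        exact Finset.sum_congr rfl fun i _ => Finset.sum_congr rfl fun j _ => by ring
      rw [this]; ring
    rw [e1]
    refine (abs_add_le _ _).trans (add_le_add ((abs_add_le _ _).trans (add_le_add le_rfl h2)) ?_)
    refine (Finset.abs_sum_le_sum_abs _ _).trans (Finset.sum_le_sum fun i _ =>
      (Finset.abs_sum_le_sum_abs _ _).trans (Finset.sum_le_sum fun j _ => ?_))
    simp only [ha]
    rw [abs_mul, abs_mul, abs_mul, abs_of_nonneg (hc0 i j)]
    have := hc0 i j
    gcongr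
    exact (abs_add_le _ _).trans (add_le_add (abs_add_le _ _) le_rfl)
  have hZsum : Integrable (fun ω => ∑ i, ∑ j, |u i| * |v j| * c i j * Z i j ω) P :=
    integrable_finsetSum _ fun i _ => integrable_finsetSum _ fun j _ => (hZint i j).const_mul _
  have hQi : Integrable (fun ω =>
      |∑ i, ∑ j, a i j * (E.ε i ω * E.ε j ω) - ∑ i, ∑ j, a i j * E.cov i j|) P :=
    (hQ.integrable one_le_two).abs
  have hint : Integrable (fun ω =>
      |∑ i, ∑ j, u i * v j * c i j * ((E.ε i ω + Δ i ω) * (E.ε j ω + Δ j ω))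
        - ∑ i, ∑ j, u i * v j * E.cov i j|) P := by
    refine Integrable.abs (Integrable.sub ?_ (integrable_const _))
    refine integrable_finsetSum _ fun i _ => integrable_finsetSum _ fun j _ => ?_
    exact (((hε i).add (hΔ i)).integrable_mul ((hε j).add (hΔ j))).const_mul _
  refine ⟨hint, ?_⟩
  have hI : Integrable (fun ω =>
      |∑ i, ∑ j, a i j * (E.ε i ω * E.ε j ω) - ∑ i, ∑ j, a i j * E.cov i j|
        + (κ * R ^ 2 + 2 * R * T S)) P := hQi.add (integrable_const _)
  refine (integral_mono hint (hI.add hZsum) hbound).trans ?_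
  simp only [Pi.add_apply]
  rw [integral_add hI hZsum, integral_add hQi (integrable_const _)]
  refine add_le_add (add_le_add h1 (by simp)) ?_
  rw [integral_finsetSum _ fun i _ => integrable_finsetSum _ fun j _ => (hZint i j).const_mul _]
  have hδ2 : 0 ≤ 8 * R * δ + δ ^ 2 := by positivity
  calc ∑ i, ∫ ω, ∑ j, |u i| * |v j| * c i j * Z i j ω ∂P
      = ∑ i, ∑ j, |u i| * |v j| * c i j * ∫ ω, Z i j ω ∂P := by
        refine Finset.sum_congr rfl fun i _ => ?_
        rw [integral_finsetSum _ fun j _ => (hZint i j).const_mul _]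
        exact Finset.sum_congr rfl fun j _ => integral_const_mul _ _
    _ ≤ ∑ i, ∑ j, |u i| * |v j| * c i j * (8 * R * δ + δ ^ 2) := by
        refine Finset.sum_le_sum fun i _ => Finset.sum_le_sum fun j _ => ?_
        have := hc0 i j
        exact mul_le_mul_of_nonneg_left (hZb i j) (by positivity)
    _ = (∑ i, ∑ j, |u i| * |v j| * c i j) * (8 * R * δ + δ ^ 2) := by
        simp only [Finset.sum_mul]
    _ ≤ B * (8 * R * δ + δ ^ 2) := by
        refine mul_le_mul_of_nonneg_right ?_ hδ2
        refine (sum_sum_mul_le_of_symm hc0 hsymm hB u v).trans ?_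
        nlinarith

/-- The characteristic function of standardized linear forms in the errors is nearly Gaussian. -/
lemma NoiseBounds.norm_charFun_sub_le (h : NoiseBounds E r R W T) {D : ℕ}
    (A : Matrix (Fin D) (Fin n) ℝ) {M : ℝ} (hM0 : 0 ≤ M) (hR : 0 ≤ R) (hW : 0 ≤ W)
    (hM : ∀ a l, |A a l| ≤ M)
    (hA : ∀ a, ∑ l, A a l ^ 2 ≤ 1) {τ : ℝ} (hτ : 0 ≤ τ) (t : EuclideanSpace ℝ (Fin D))
    (ht : ∀ a, |t a| ≤ τ) :
    ‖charFun (P.map fun ω => linImage A fun i => E.ε i ω) t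
        - Complex.exp (-((t ⬝ᵥ (A * E.cov * Aᵀ) *ᵥ t : ℝ) : ℂ) / 2)‖
      ≤ 2 * (D * τ * M * (32 * R * W * (D * τ) + R ^ 3 * (D * τ) ^ 2)) := by
  set v : Fin n → ℝ := Aᵀ *ᵥ t with hv
  have hvl : ∀ l, v l = ∑ a, A a l * t a := fun l => rfl
  have hvM : ∀ l, |v l| ≤ D * τ * M := by
    intro l
    rw [hvl]
    refine (Finset.abs_sum_le_sum_abs _ _).trans ?_
    refine (Finset.sum_le_sum fun a _ => ?_).trans (le_of_eq (?_ : ∑ a : Fin D, M * τ = _))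
    · rw [abs_mul]; exact mul_le_mul (hM a l) (ht a) (abs_nonneg _) hM0
    · simp; ring
  have hv2 : ∑ l, v l ^ 2 ≤ (D * τ) ^ 2 := by
    calc ∑ l, v l ^ 2 ≤ ∑ l, (∑ a, A a l ^ 2) * ∑ a, t a ^ 2 := by
          refine Finset.sum_le_sum fun l _ => ?_
          rw [hvl]
          exact Finset.sum_mul_sq_le_sq_mul_sq _ _ _
      _ = (∑ a, ∑ l, A a l ^ 2) * ∑ a, t a ^ 2 := by rw [← Finset.sum_mul, Finset.sum_comm]
      _ ≤ (∑ a : Fin D, (1 : ℝ)) * ∑ a : Fin D, τ ^ 2 := by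
          have e1 : ∑ a, ∑ l, A a l ^ 2 ≤ ∑ a : Fin D, (1 : ℝ) := Finset.sum_le_sum fun a _ => hA a
          have e2 : ∑ a, t a ^ 2 ≤ ∑ a : Fin D, τ ^ 2 := Finset.sum_le_sum fun a _ => by
            rw [← sq_abs (t a)]; exact pow_le_pow_left₀ (abs_nonneg _) (ht a) 2
          have e3 : 0 ≤ ∑ a, t a ^ 2 := Finset.sum_nonneg fun _ _ => sq_nonneg _
          have e4 : (0 : ℝ) ≤ ∑ a : Fin D, (1 : ℝ) := by simp
          exact mul_le_mul e1 e2 e3 e4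
      _ = (D * τ) ^ 2 := by simp; ring
  have hvs : √(∑ l, v l ^ 2) ≤ D * τ := by
    rw [← Real.sqrt_sq (show 0 ≤ D * τ by positivity)]
    exact Real.sqrt_le_sqrt hv2
  obtain ⟨h1, h2⟩ := h.cos_sin v (D * τ * M) (by positivity) hvM
  have hb : D * τ * M * (32 * R * W * √(∑ l, v l ^ 2) + R ^ 3 * ∑ l, v l ^ 2)
      ≤ D * τ * M * (32 * R * W * (D * τ) + R ^ 3 * (D * τ) ^ 2) := by gcongr
  have hmeas : Measurable fun ω => linImage A fun i => E.ε i ω :=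
    (measurable_linImage A).comp (measurable_pi_iff.2 E.measurable_ε)
  have hlin : Measurable fun ω => ∑ l, v l * E.ε l ω :=
    Finset.measurable_sum _ fun l _ => (E.measurable_ε l).const_mul _
  have hq : t ⬝ᵥ (A * E.cov * Aᵀ) *ᵥ t = ∑ i, ∑ j, v i * v j * E.cov i j := by
    rw [← Matrix.mulVec_mulVec, ← Matrix.mulVec_mulVec, Matrix.dotProduct_mulVec,
      ← Matrix.mulVec_transpose, ← hv]
    simp only [dotProduct, Matrix.mulVec, Finset.mul_sum]
    exact Finset.sum_congr rfl fun i _ => Finset.sum_congr rfl fun j _ => by ring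
  have hch : charFun (P.map fun ω => linImage A fun i => E.ε i ω) t
      = ((∫ ω, Real.cos (∑ l, v l * E.ε l ω) ∂P : ℝ) : ℂ)
        + ((∫ ω, Real.sin (∑ l, v l * E.ε l ω) ∂P : ℝ) : ℂ) * Complex.I := by
    rw [charFun_apply, integral_map hmeas.aemeasurable (by fun_prop)]
    simp_rw [inner_linImage, ← hv, Complex.exp_mul_I]
    have i1 : Integrable (fun ω => Real.cos (∑ l, v l * E.ε l ω)) P :=
      Integrable.of_bound (Real.measurable_cos.comp hlin).aestronglyMeasurable 1
        (Filter.Eventually.of_forall fun ω => by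
          rw [Real.norm_eq_abs]; exact Real.abs_cos_le_one _)
    have i2 : Integrable (fun ω => Real.sin (∑ l, v l * E.ε l ω)) P :=
      Integrable.of_bound (Real.measurable_sin.comp hlin).aestronglyMeasurable 1
        (Filter.Eventually.of_forall fun ω => by
          rw [Real.norm_eq_abs]; exact Real.abs_sin_le_one _)
    rw [← integral_complex_ofReal, ← integral_complex_ofReal, ← integral_mul_const,
      ← integral_add i1.ofReal (i2.ofReal.mul_const _)]
    refine integral_congr_ae (Filter.Eventually.of_forall fun ω => ?_)
    simp
  have he : Complex.exp (-((t ⬝ᵥ (A * E.cov * Aᵀ) *ᵥ t : ℝ) : ℂ) / 2)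
      = ((Real.exp (-((∑ i, ∑ j, v i * v j * E.cov i j) / 2)) : ℝ) : ℂ) := by
    rw [hq, Complex.ofReal_exp]
    congr 1
    push_cast
    ring
  rw [hch, he, add_sub_right_comm, ← Complex.ofReal_sub]
  refine (norm_add_le _ _).trans ?_
  rw [norm_mul, Complex.norm_I, mul_one, Complex.norm_real, Complex.norm_real, Real.norm_eq_abs,
    Real.norm_eq_abs]
  linarith

end Noise

end RidgeBootstrap

namespace RidgeBootstrap

set_option linter.unusedSectionVars false

/-! ### Sample and bootstrap statistics under separation of the coordinates -/

lemma sqrt_sum_add_sq_le {ι : Type*} [Fintype ι] (f g : ι → ℝ) :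
    √(∑ i, (f i + g i) ^ 2) ≤ √(∑ i, f i ^ 2) + √(∑ i, g i ^ 2) := by
  have h := norm_add_le (WithLp.toLp 2 f : EuclideanSpace ℝ ι) (WithLp.toLp 2 g)
  simpa [EuclideanSpace.norm_eq] using h

namespace Setting

variable {n : ℕ} {S : Setting n} {L : ℝ}

/-- The strong coordinates are separated from the weak ones, with room `t` on both sides of the
threshold, and the bias of the de-biased estimator is at most `t`. -/
structure Separated (S : Setting n) (L t : ℝ) : Prop extends S.Regular L where
  t_nonneg : 0 ≤ t
  out : ∀ k ∉ S.N, |S.β k| ≤ S.b - 2 * t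
  inn : ∀ k ∈ S.N, S.b + 4 * t < |S.β k|
  bias_le : 2 * S.ρ ^ 2 / L ^ 4 * (2 * √(∑ k, S.β k ^ 2) + 1) ≤ t

variable {t : ℝ}

lemma Separated.bias_le' (h : S.Separated L t) {v : Fin S.p → ℝ}
    (hv : √(∑ k, v k ^ 2) ≤ 2 * √(∑ k, S.β k ^ 2) + 1) (k : Fin S.p) : |S.bias v k| ≤ t := by
  have hL := h.L_pos
  refine (h.abs_bias_le v k).trans (le_trans ?_ h.bias_le)
  gcongr

lemma Separated.abs_bias_β_le (h : S.Separated L t) (k : Fin S.p) : |S.bias S.β k| ≤ t :=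
  h.bias_le' (by linarith [Real.sqrt_nonneg (∑ k, S.β k ^ 2)]) k

lemma Separated.NHat_eq (h : S.Separated L t) {e : Fin n → ℝ}
    (he : ∀ k, |(S.noiseMat *ᵥ e) k| ≤ t) : S.NHat (S.X *ᵥ S.β + e) = S.N := by
  have ht := h.t_nonneg
  refine h.toRegular.NHat_eq (t := 2 * t) (fun k hk => h.out k hk)
    (fun k hk => by linarith [h.inn k hk]) (fun k => ?_)
  linarith [he k, h.abs_bias_β_le k]

lemma Separated.βHat_eq (h : S.Separated L t) {e : Fin n → ℝ}
    (he : ∀ k, |(S.noiseMat *ᵥ e) k| ≤ t) (k : Fin S.p) :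
    S.βHat (S.X *ᵥ S.β + e) k
      = if k ∈ S.N then S.β k - S.bias S.β k + (S.noiseMat *ᵥ e) k else 0 := by
  rw [βHat, h.NHat_eq he, S.debiased_eq h.denom_ne]
  rfl

/-- Signal, bias and noise contribute at most ‖β‖, ‖β‖ and 1. This is why the bias condition of
`Separated` is stated with 2‖β‖ + 1: it then holds for the bootstrap parameter as well. -/
lemma Separated.sqrt_sum_βHat_sq_le (h : S.Separated L t) {e : Fin n → ℝ}
    (he : ∀ k, |(S.noiseMat *ᵥ e) k| ≤ t) (he2 : ∑ k ∈ S.N, (S.noiseMat *ᵥ e) k ^ 2 ≤ 1) :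
    √(∑ k, S.βHat (S.X *ᵥ S.β + e) k ^ 2) ≤ 2 * √(∑ k, S.β k ^ 2) + 1 := by
  have hL := h.L_pos
  have hsub : ∀ v : Fin S.p → ℝ, ∑ k, (if k ∈ S.N then v k else 0) ^ 2 ≤ ∑ k, v k ^ 2 := fun v =>
    Finset.sum_le_sum fun k _ => by
      split_ifs
      · exact le_rfl
      · rw [zero_pow two_ne_zero]; exact sq_nonneg _
  have h1 : ∀ k, S.βHat (S.X *ᵥ S.β + e) k = ((if k ∈ S.N then S.β k else 0)
      + (if k ∈ S.N then -S.bias S.β k else 0)) + if k ∈ S.N then (S.noiseMat *ᵥ e) k else 0 := by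
    intro k
    rw [h.βHat_eq he]
    split_ifs <;> ring
  simp_rw [h1]
  refine (sqrt_sum_add_sq_le _ _).trans (add_le_add ((sqrt_sum_add_sq_le _ _).trans ?_) ?_)
  · rw [two_mul]
    refine add_le_add (Real.sqrt_le_sqrt (hsub _)) ?_
    refine (Real.sqrt_le_sqrt (hsub _)).trans ?_
    simp only [neg_sq]
    refine (h.sqrt_sum_bias_sq_le S.β).trans (mul_le_of_le_one_left (Real.sqrt_nonneg _) ?_)
    rw [div_le_one (by positivity)]
    have : S.ρ ^ 2 ≤ (L ^ 2 / 4) ^ 2 := by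
      rw [← sq_abs S.ρ]; exact pow_le_pow_left₀ (abs_nonneg _) h.abs_ρ_le 2
    nlinarith [pow_pos hL 4]
  · rw [Real.sqrt_le_one]
    simpa [ite_pow, Finset.sum_ite_mem] using he2

/-- The estimation error of the residuals when the selected set is correct. -/
noncomputable def resErr (S : Setting n) (e : Fin n → ℝ) (l : Fin n) : ℝ :=
  (∑ k ∈ S.N, S.X l k * S.bias S.β k + ∑ k ∈ S.Nᶜ, S.X l k * S.β k)
    - ∑ k ∈ S.N, S.X l k * (S.noiseMat *ᵥ e) k

lemma Separated.residual_eq (h : S.Separated L t) {e : Fin n → ℝ}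
    (he : ∀ k, |(S.noiseMat *ᵥ e) k| ≤ t) (l : Fin n) :
    S.residual (S.X *ᵥ S.β + e) l = e l + S.resErr e l := by
  have h1 : ∑ k, S.X l k * S.β k = ∑ k ∈ S.N, S.X l k * S.β k + ∑ k ∈ S.Nᶜ, S.X l k * S.β k :=
    (Finset.sum_add_sum_compl _ _).symm
  have h2 : ∑ k, S.X l k * S.βHat (S.X *ᵥ S.β + e) k
      = ∑ k ∈ S.N, S.X l k * (S.β k - S.bias S.β k + (S.noiseMat *ᵥ e) k) := by
    simp only [h.βHat_eq he, mul_ite, mul_zero]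
    rw [Finset.sum_ite_mem, Finset.univ_inter]
  simp only [residual, Pi.sub_apply, Pi.add_apply, Matrix.mulVec, dotProduct] at h2 ⊢
  rw [h2, h1, resErr]
  simp only [mul_add, mul_sub, Finset.sum_add_distrib, Finset.sum_sub_distrib, Matrix.mulVec, dotProduct]
  ring

/-- The bootstrap distribution function is sandwiched between Gaussian ones. -/
lemma Separated.bootStat_sandwich (h : S.Separated L t) (hb : 0 ≤ S.b - 2 * t) {e : Fin n → ℝ}
    (he : ∀ k, |(S.noiseMat *ᵥ e) k| ≤ t) (he2 : ∑ k ∈ S.N, (S.noiseMat *ᵥ e) k ^ 2 ≤ 1)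
    {M : ℝ} (hM : ∀ l, |e l + S.resErr e l| ≤ M)
    {V : Matrix (Fin n) (Fin n) ℝ} (hV : V.PosSemidef) (hV0 : ∀ i j, 0 ≤ V i j) {B : ℝ}
    (hB : ∀ i, ∑ j, V i j ≤ B) {D : ℕ} [NeZero D] {f : Fin D → S.Mset} (hf : Function.Surjective f)
    {v r : ℝ} (hv : 0 < v) (hvB : B * (9 / L ^ 2 * M ^ 2) ≤ v)
    (hr : 2 * S.ρ ^ 2 / L ^ 3 * (2 * √(∑ k, S.β k ^ 2) + 1) ≤ r) (x : ℝ) :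
    let Γ := multivariateGaussian 0 ((loadMat f * Matrix.diagonal fun l => e l + S.resErr e l) * V *
      (loadMat f * Matrix.diagonal fun l => e l + S.resErr e l)ᵀ)
    (multivariateGaussian 0 V).real {w | S.bootStat (S.X *ᵥ S.β + e) w ≤ x}
        ≤ Γ.real (cube D (x + r)) + S.p * (2 * Real.exp (-t ^ 2 / (2 * v))) ∧
      Γ.real (cube D (x - r)) ≤
        (multivariateGaussian 0 V).real {w | S.bootStat (S.X *ᵥ S.β + e) w ≤ x}
          + S.p * (2 * Real.exp (-t ^ 2 / (2 * v))) := by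
  intro Γ
  have hL := h.L_pos
  have ht := h.t_nonneg
  set y := S.X *ᵥ S.β + e with hy
  set d : Fin n → ℝ := fun l => e l + S.resErr e l with hd
  set μ := multivariateGaussian 0 V with hμ
  have hβ := h.sqrt_sum_βHat_sq_le he he2
  have hres : ∀ l, S.residual y l = d l := h.residual_eq he
  have hβk := h.βHat_eq he
  have hN := h.NHat_eq he
  -- outside a set of small probability, the bootstrap sample selects the correct set
  set bad : Set (EuclideanSpace ℝ (Fin n)) :=
    ⋃ k, {w | t < |∑ l, (S.noiseMat k l * d l) * w l|} with hbad
  have hbadP : μ.real bad ≤ S.p * (2 * Real.exp (-t ^ 2 / (2 * v))) := by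
    refine (measureReal_iUnion_fintype_le _).trans ?_
    refine (Finset.sum_le_sum fun k _ => multivariateGaussian_real_abs_sum_gt_le hV _ hv ht ?_).trans
      (by simp)
    set a : Fin n → ℝ := fun l => S.noiseMat k l * d l with ha
    have hsymm : ∀ i j, V i j = V j i := fun i j => by
      have := congrFun (congrFun hV.1 i) j
      simpa using this.symm
    have ha2 : ∑ l, a l ^ 2 ≤ 9 / L ^ 2 * M ^ 2 := by
      calc ∑ l, a l ^ 2 ≤ ∑ l, S.noiseMat k l ^ 2 * M ^ 2 := by
            refine Finset.sum_le_sum fun l _ => ?_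
            rw [ha, mul_pow]
            have : d l ^ 2 ≤ M ^ 2 := by
              rw [← sq_abs (d l)]; exact pow_le_pow_left₀ (abs_nonneg _) (hM l) 2
            gcongr
        _ ≤ _ := by
            rw [← Finset.sum_mul]
            exact mul_le_mul_of_nonneg_right (h.sum_noiseMat_sq_le k) (sq_nonneg _)
    have hB0 : 0 ≤ B := (Finset.sum_nonneg fun j _ => hV0 ⟨0, h.n_pos⟩ j).trans (hB ⟨0, h.n_pos⟩)
    calc ∑ i, ∑ j, a i * a j * V i j ≤ ∑ i, ∑ j, |a i| * |a j| * V i j :=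
          Finset.sum_le_sum fun i _ => Finset.sum_le_sum fun j _ => by
            rw [← abs_mul]
            exact mul_le_mul_of_nonneg_right (le_abs_self _) (hV0 i j)
      _ ≤ B * ((∑ i, a i ^ 2 + ∑ j, a j ^ 2) / 2) := sum_sum_mul_le_of_symm hV0 hsymm hB a a
      _ = B * ∑ i, a i ^ 2 := by ring
      _ ≤ B * (9 / L ^ 2 * M ^ 2) := by gcongr
      _ ≤ v := hvB
  set es : EuclideanSpace ℝ (Fin n) → Fin n → ℝ := fun w l => d l * w l with hes
  have hbs : ∀ w, S.bootSample y w = S.X *ᵥ S.βHat y + es w := by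
    intro w
    rw [bootSample]
    congr 1
    ext l
    rw [hres l]
  have hgood : ∀ w ∉ bad, S.NHat (S.X *ᵥ S.βHat y + es w) = S.N := by
    intro w hw
    have hw' : ∀ k, |(S.noiseMat *ᵥ es w) k| ≤ t := by
      intro k
      by_contra hcon
      refine hw (Set.mem_iUnion.2 ⟨k, ?_⟩)
      have : (S.noiseMat *ᵥ es w) k = ∑ l, (S.noiseMat k l * d l) * w l := by
        rw [Matrix.mulVec, dotProduct]
        exact Finset.sum_congr rfl fun l _ => (mul_assoc _ _ _).symm
      rw [this] at hcon
      exact not_le.1 hcon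
    -- The bootstrap parameter vanishes off the strong set and differs from β by at most 2t on it.
    -- The margin 4t around the strong coordinates therefore leaves the 2t needed for bootstrap bias
    -- and noise.
    refine h.toRegular.NHat_eq (t := 2 * t) (fun k hk => ?_) (fun k hk => ?_) (fun k => ?_)
    · rw [hβk, if_neg hk, abs_zero]; exact hb
    · rw [hβk, if_pos hk]
      have h1 := h.inn k hk
      have h2 := h.abs_bias_β_le k
      have h3 := he k
      have h4 : |S.β k| ≤ |S.β k - S.bias S.β k + (S.noiseMat *ᵥ e) k| + (|S.bias S.β k|
          + |(S.noiseMat *ᵥ e) k|) := by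
        have : S.β k = (S.β k - S.bias S.β k + (S.noiseMat *ᵥ e) k)
          + (S.bias S.β k - (S.noiseMat *ᵥ e) k) := by ring
        calc |S.β k| = |(S.β k - S.bias S.β k + (S.noiseMat *ᵥ e) k)
          + (S.bias S.β k - (S.noiseMat *ᵥ e) k)| := by rw [← this]
          _ ≤ _ := (abs_add_le _ _).trans (add_le_add le_rfl (abs_sub _ _))
      linarith
    · linarith [hw' k, h.bias_le' hβ k]
  have hr' : ∀ i, |∑ k ∈ S.N, S.M i k * S.βHat y k - S.γHat y i| * √n
      + 2 * S.ρ ^ 2 / L ^ 3 * √(∑ k, S.βHat y k ^ 2) ≤ r := by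
    intro i
    have h0 : ∑ k ∈ S.N, S.M i k * S.βHat y k = S.γHat y i := by
      rw [γHat, Matrix.mulVec, dotProduct, ← Finset.sum_add_sum_compl S.N]
      rw [left_eq_add]
      exact Finset.sum_eq_zero fun k hk => by
        rw [hβk, if_neg (Finset.mem_compl.1 hk), mul_zero]
    rw [h0, sub_self, abs_zero, zero_mul, zero_add]
    refine le_trans ?_ hr
    gcongr
  have hlin : ∀ w : EuclideanSpace ℝ (Fin n), linImage (loadMat f) (es w)
      = linImage (loadMat f * Matrix.diagonal d) w := by
    intro w
    rw [linImage, linImage, ← Matrix.mulVec_mulVec]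
    congr 2
    ext l
    rw [Matrix.mulVec_diagonal]
  have hΓ : ∀ z, Γ.real (cube D z)
      = μ.real {w | linImage (loadMat f) (es w) ∈ cube D z} := by
    intro z
    have hm : Measurable fun x : EuclideanSpace ℝ (Fin n) => linImage (loadMat f * Matrix.diagonal d) x :=
      (measurable_linImage _).comp (by fun_prop)
    simp only [Γ]
    rw [← map_linImage_multivariateGaussian hV, map_measureReal_apply hm (measurableSet_cube _)]
    congr 1
    ext w
    simp only [Set.mem_preimage, Set.mem_ofPred_eq, hlin]
  have hstat : ∀ w, S.bootStat y w = S.maxStat (S.X *ᵥ S.βHat y + es w) (S.γHat y) := by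
    intro w
    rw [bootStat, hbs]
  rw [hΓ, hΓ]
  constructor
  · refine le_trans (measureReal_mono (s₂ := {w | linImage (loadMat f) (es w) ∈ cube D (x + r)} ∪ bad)
      fun w hw => ?_) ((measureReal_union_le _ _).trans (add_le_add le_rfl hbadP))
    by_cases hwb : w ∈ bad
    · exact Or.inr hwb
    · left
      have hw' : S.bootStat y w ≤ x := hw
      rw [hstat] at hw'
      exact h.toRegular.mem_cube_of_maxStat_le (hgood w hwb) f hr' hw'
  · refine le_trans (measureReal_mono (s₂ := {w | S.bootStat y w ≤ x} ∪ bad)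
      fun w hw => ?_) ((measureReal_union_le _ _).trans (add_le_add le_rfl hbadP))
    by_cases hwb : w ∈ bad
    · exact Or.inr hwb
    · left
      change S.bootStat y w ≤ x
      rw [hstat]
      exact h.toRegular.maxStat_le_of_mem_cube (hgood w hwb) hf hr' hw

/-- The distribution function of the sample statistic is sandwiched between those of the linear
statistic. -/
lemma Separated.maxStat_sandwich (h : S.Separated L t) {Ω : Type*} [MeasurableSpace Ω]
    {P : Measure Ω} [IsProbabilityMeasure P] (e : Ω → Fin n → ℝ) {D : ℕ} [NeZero D]
    {f : Fin D → S.Mset} (hf : Function.Surjective f) {r : ℝ}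
    (hr : (⨆ i, |∑ j ∈ S.Nᶜ, S.M i j * S.β j|) * √n
      + 2 * S.ρ ^ 2 / L ^ 3 * (2 * √(∑ k, S.β k ^ 2) + 1) ≤ r) (x : ℝ) :
    P.real {ω | S.maxStat (S.X *ᵥ S.β + e ω) S.γ ≤ x}
        ≤ P.real {ω | linImage (loadMat f) (e ω) ∈ cube D (x + r)}
          + P.real {ω | ∃ k, t < |(S.noiseMat *ᵥ e ω) k|} ∧
      P.real {ω | linImage (loadMat f) (e ω) ∈ cube D (x - r)}
        ≤ P.real {ω | S.maxStat (S.X *ᵥ S.β + e ω) S.γ ≤ x}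
          + P.real {ω | ∃ k, t < |(S.noiseMat *ᵥ e ω) k|} := by
  have hL := h.L_pos
  have hr' : ∀ i, |∑ k ∈ S.N, S.M i k * S.β k - S.γ i| * √n
      + 2 * S.ρ ^ 2 / L ^ 3 * √(∑ k, S.β k ^ 2) ≤ r := by
    intro i
    have h0 : ∑ k ∈ S.N, S.M i k * S.β k - S.γ i = -∑ k ∈ S.Nᶜ, S.M i k * S.β k := by
      rw [γ, Matrix.mulVec, dotProduct, ← Finset.sum_add_sum_compl S.N]
      ring
    rw [h0, abs_neg]
    refine le_trans (add_le_add ?_ ?_) hr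
    · exact mul_le_mul_of_nonneg_right (le_ciSup (f := fun i => |∑ j ∈ S.Nᶜ, S.M i j * S.β j|)
        (Set.finite_range _).bddAbove i) (Real.sqrt_nonneg _)
    · gcongr
      linarith [Real.sqrt_nonneg (∑ k, S.β k ^ 2)]
  have hgood : ∀ ω, ω ∉ {ω | ∃ k, t < |(S.noiseMat *ᵥ e ω) k|} → 
      S.NHat (S.X *ᵥ S.β + e ω) = S.N := by
    intro ω hω
    refine h.NHat_eq fun k => ?_
    by_contra hcon
    exact hω ⟨k, not_le.1 hcon⟩
  constructor
  · refine le_trans (measureReal_mono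
      (s₂ := {ω | linImage (loadMat f) (e ω) ∈ cube D (x + r)} ∪ {ω | ∃ k, t < |(S.noiseMat *ᵥ e ω) k|})
      fun ω hω => ?_) (measureReal_union_le _ _)
    by_cases hwb : ω ∈ {ω | ∃ k, t < |(S.noiseMat *ᵥ e ω) k|}
    · exact Or.inr hwb
    · exact Or.inl (h.toRegular.mem_cube_of_maxStat_le (hgood ω hwb) f hr' hω)
  · refine le_trans (measureReal_mono
      (s₂ := {ω | S.maxStat (S.X *ᵥ S.β + e ω) S.γ ≤ x} ∪ {ω | ∃ k, t < |(S.noiseMat *ᵥ e ω) k|})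
      fun ω hω => ?_) (measureReal_union_le _ _)
    by_cases hwb : ω ∈ {ω | ∃ k, t < |(S.noiseMat *ᵥ e ω) k|}
    · exact Or.inr hwb
    · exact Or.inl (h.toRegular.maxStat_le_of_mem_cube (hgood ω hwb) hf hr' hω)

end Setting

end RidgeBootstrap

namespace RidgeBootstrap

set_option linter.unusedSectionVars false

/-! ### Coverage of approximate quantiles -/

section Quantile

/-- The coverage of the quantiles of random distribution functions that are close to the
distribution function of the statistic. -/
lemma abs_coverage_sub_le {Ω : Type*} [MeasurableSpace Ω] {P : Measure Ω} [IsProbabilityMeasure P]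
    {T : Ω → ℝ} (hT : Measurable T) {F : Ω → ℝ → ℝ} {G : ℝ → ℝ} (hGc : Continuous G)
    (hGm : Monotone G) (hGneg : ∀ x, x < 0 → G x = 0) (hGtop : Tendsto G atTop (𝓝 1))
    {r α : ℝ} (hr : 0 < r) (h1 : r < α) (h2 : 2 * r < 1 - α) {bad : Set Ω} (hbad : P.real bad ≤ r)
    (hF : ∀ ω ∉ bad, ∀ x, |F ω x - G x| ≤ r) (hTG : ∀ x, |P.real {ω | T ω ≤ x} - G x| ≤ r) :
    |P.real {ω | T ω ≤ sInf {x | 1 - α ≤ F ω x}} - (1 - α)| ≤ 4 * r ∧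
      |P.real {ω | sInf {x | 1 - α ≤ F ω x} < T ω} - α| ≤ 4 * r := by
  have hex : ∀ β : ℝ, 0 < β → β < 1 → ∃ x, G x = β := by
    intro β h0 h1
    obtain ⟨y, hy⟩ := (hGtop.eventually (lt_mem_nhds h1)).exists
    exact mem_range_of_exists_le_of_exists_ge hGc ⟨-1, by rw [hGneg _ (by norm_num)]; exact h0.le⟩
      ⟨y, hy.le⟩
  -- A random distribution function within r of G is strictly below 1 − α to the left of x₁, where
  -- the double margin gives strictness, and is at least 1 − α at x₂. The quantile set is then
  -- nonempty and bounded below, so the default value of the infimum plays no role.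
  obtain ⟨x₁, hx₁⟩ := hex (1 - α - 2 * r) (by linarith) (by linarith)
  obtain ⟨x₂, hx₂⟩ := hex (1 - α + r) (by linarith) (by linarith)
  set q : Ω → ℝ := fun ω => sInf {x | 1 - α ≤ F ω x} with hq
  have hq12 : ∀ ω ∉ bad, x₁ ≤ q ω ∧ q ω ≤ x₂ := by
    intro ω hω
    have hlow : ∀ x ∈ {x | 1 - α ≤ F ω x}, x₁ ≤ x := by
      intro x hx
      by_contra hcon
      have e1 := hGm (not_le.1 hcon).le
      have e2 := (abs_le.1 (hF ω hω x)).2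
      have e3 : 1 - α ≤ F ω x := hx
      linarith
    have hmem : x₂ ∈ {x | 1 - α ≤ F ω x} := by
      have e2 := (abs_le.1 (hF ω hω x₂)).1
      change 1 - α ≤ F ω x₂
      linarith
    exact ⟨le_csInf ⟨x₂, hmem⟩ hlow, csInf_le ⟨x₁, hlow⟩ hmem⟩
  have hcompl : ∀ x, P.real {ω | x < T ω} = 1 - P.real {ω | T ω ≤ x} := by
    intro x
    have : {ω | x < T ω} = {ω | T ω ≤ x}ᶜ := by ext ω; simp
    rw [this, probReal_compl_eq_one_sub (measurableSet_le hT measurable_const)]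
  have t1 := abs_le.1 (hTG x₁)
  have t2 := abs_le.1 (hTG x₂)
  have m1 : P.real {ω | T ω ≤ q ω} ≤ P.real {ω | T ω ≤ x₂} + r :=
    (measureReal_mono (s₂ := {ω | T ω ≤ x₂} ∪ bad) fun ω hω => by
      by_cases hb : ω ∈ bad
      · exact Or.inr hb
      · exact Or.inl ((show T ω ≤ q ω from hω).trans (hq12 ω hb).2)).trans
      ((measureReal_union_le _ _).trans (by linarith))
  have m2 : P.real {ω | T ω ≤ x₁} ≤ P.real {ω | T ω ≤ q ω} + r :=
    (measureReal_mono (s₂ := {ω | T ω ≤ q ω} ∪ bad) fun ω hω => by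
      by_cases hb : ω ∈ bad
      · exact Or.inr hb
      · exact Or.inl ((show T ω ≤ x₁ from hω).trans (hq12 ω hb).1)).trans
      ((measureReal_union_le _ _).trans (by linarith))
  have m3 : P.real {ω | q ω < T ω} ≤ P.real {ω | x₁ < T ω} + r :=
    (measureReal_mono (s₂ := {ω | x₁ < T ω} ∪ bad) fun ω hω => by
      by_cases hb : ω ∈ bad
      · exact Or.inr hb
      · exact Or.inl ((hq12 ω hb).1.trans_lt (show q ω < T ω from hω))).trans
      ((measureReal_union_le _ _).trans (by linarith))
  have m4 : P.real {ω | x₂ < T ω} ≤ P.real {ω | q ω < T ω} + r :=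
    (measureReal_mono (s₂ := {ω | q ω < T ω} ∪ bad) fun ω hω => by
      by_cases hb : ω ∈ bad
      · exact Or.inr hb
      · exact Or.inl ((hq12 ω hb).2.trans_lt (show x₂ < T ω from hω))).trans
      ((measureReal_union_le _ _).trans (by linarith))
  rw [hcompl] at m3 m4
  refine ⟨abs_le.2 ⟨?_, ?_⟩, abs_le.2 ⟨?_, ?_⟩⟩ <;> linarith

end Quantile

/-! ### Covariance of linear forms in the errors -/

section Covariance

/-- Subtracting c times the identity shifts the spectrum into the positive half-line, so the shifted
matrix is positive semidefinite. -/
lemma le_quadratic_of_spectrum {n : ℕ} {V : Matrix (Fin n) (Fin n) ℝ} (hV : V.IsHermitian) {c : ℝ}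
    (hc : ∀ μ ∈ spectrum ℝ V, c < μ) (x : Fin n → ℝ) :
    c * ∑ i, x i ^ 2 ≤ ∑ i, ∑ j, x i * x j * V i j := by
  have hH : (V - c • (1 : Matrix (Fin n) (Fin n) ℝ)).IsHermitian := by
    refine hV.sub ?_
    rw [Matrix.IsHermitian, Matrix.conjTranspose_smul, Matrix.conjTranspose_one, star_trivial]
  have hps : (V - c • (1 : Matrix (Fin n) (Fin n) ℝ)).PosSemidef := by
    rw [hH.posSemidef_iff_eigenvalues_nonneg]
    intro i
    have h1 := hH.eigenvalues_mem_spectrum_real i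
    generalize hH.eigenvalues i = z at h1 ⊢
    rw [← Algebra.algebraMap_eq_smul_one, ← spectrum.sub_singleton_eq] at h1
    obtain ⟨μ, hμ, y, hy, h2⟩ := Set.mem_sub.1 h1
    have := hc μ hμ
    rw [Set.mem_singleton_iff.1 hy] at h2
    simp only [Pi.zero_apply]
    linarith
  have h := hps.dotProduct_mulVec_nonneg x
  rw [Matrix.sub_mulVec, dotProduct_sub, Matrix.smul_mulVec, Matrix.one_mulVec] at h
  have e1 : star x ⬝ᵥ (V *ᵥ x) = ∑ i, ∑ j, x i * x j * V i j := by
    simp only [dotProduct, Matrix.mulVec, star_trivial, Finset.mul_sum]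
    exact Finset.sum_congr rfl fun i _ => Finset.sum_congr rfl fun j _ => by ring
  have e2 : star x ⬝ᵥ (c • x) = c * ∑ i, x i ^ 2 := by
    simp only [dotProduct, star_trivial, Pi.smul_apply, smul_eq_mul, Finset.mul_sum]
    exact Finset.sum_congr rfl fun i _ => by ring
  rw [e1, e2] at h
  linarith

lemma mul_mul_transpose_apply {D n : ℕ} (A : Matrix (Fin D) (Fin n) ℝ) (V : Matrix (Fin n) (Fin n) ℝ)
    (a b : Fin D) : (A * V * Aᵀ) a b = ∑ i, ∑ j, A a i * A b j * V i j := by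
  simp only [Matrix.mul_apply, Matrix.transpose_apply, Finset.sum_mul]
  rw [Finset.sum_comm]
  exact Finset.sum_congr rfl fun i _ => Finset.sum_congr rfl fun j _ => by ring

variable {n : ℕ} {Ω : Type*} [MeasurableSpace Ω] {P : Measure Ω} [IsProbabilityMeasure P]
  {E : ErrorProcess n P} {r : ℕ} {R W : ℝ} {T : ℕ → ℝ}

lemma NoiseBounds.cov_quadratic (h : NoiseBounds E r R W T) (hr : 1 ≤ r) (u v : Fin n → ℝ) :
    ∑ i, ∑ j, u i * v j * E.cov i j = ∫ ω, (∑ i, u i * E.ε i ω) * (∑ j, v j * E.ε j ω) ∂P := by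
  have hint : ∀ i j, Integrable (fun ω => E.ε i ω * E.ε j ω) P := fun i j =>
    (h.memLp_two hr i).integrable_mul (h.memLp_two hr j)
  have : ∀ ω, (∑ i, u i * E.ε i ω) * (∑ j, v j * E.ε j ω)
      = ∑ i, ∑ j, u i * v j * (E.ε i ω * E.ε j ω) := by
    intro ω
    rw [Finset.sum_mul_sum]
    exact Finset.sum_congr rfl fun i _ => Finset.sum_congr rfl fun j _ => by ring
  simp_rw [this]
  rw [integral_finsetSum _ fun i _ => integrable_finsetSum _ fun j _ => (hint i j).const_mul _]
  refine Finset.sum_congr rfl fun i _ => ?_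
  rw [integral_finsetSum _ fun j _ => (hint i j).const_mul _]
  exact Finset.sum_congr rfl fun j _ => by rw [integral_const_mul]; rfl

lemma ErrorProcess.isHermitian_cov (E : ErrorProcess n P) : E.cov.IsHermitian := by
  ext i j
  simp only [ErrorProcess.cov, Matrix.conjTranspose_apply, Matrix.of_apply, star_trivial, mul_comm]

lemma NoiseBounds.posSemidef_cov (h : NoiseBounds E r R W T) (hr : 1 ≤ r) : E.cov.PosSemidef := by
  refine Matrix.PosSemidef.of_dotProduct_mulVec_nonneg E.isHermitian_cov fun x => ?_
  have e1 : star x ⬝ᵥ (E.cov *ᵥ x) = ∑ i, ∑ j, x i * x j * E.cov i j := by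
    simp only [dotProduct, Matrix.mulVec, star_trivial, Finset.mul_sum]
    exact Finset.sum_congr rfl fun i _ => Finset.sum_congr rfl fun j _ => by ring
  rw [e1, h.cov_quadratic hr]
  exact integral_nonneg fun ω => mul_self_nonneg _

lemma NoiseBounds.abs_cov_quadratic_le (h : NoiseBounds E r R W T) (hr : 1 ≤ r) (hR : 0 ≤ R)
    {u v : Fin n → ℝ} (hu : ∑ i, u i ^ 2 ≤ 1) (hv : ∑ i, v i ^ 2 ≤ 1) :
    |∑ i, ∑ j, u i * v j * E.cov i j| ≤ 16 * R ^ 2 := by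
  have hb : ∀ w : Fin n → ℝ, ∑ i, w i ^ 2 ≤ 1 → ∫ ω, (∑ i, w i * E.ε i ω) ^ 2 ∂P ≤ (4 * R) ^ 2 := by
    intro w hw
    refine (h.linear_sq w).trans ?_
    nlinarith [sq_nonneg R]
  rw [h.cov_quadratic hr]
  refine (abs_integral_le_integral_abs).trans ((integral_abs_mul_le (h.memLp_two_linear hr u)
    (h.memLp_two_linear hr v) (by positivity) (by positivity) (hb u hu) (hb v hv)).trans ?_)
  nlinarith

end Covariance

/-! ### Estimation error of the residuals -/

section Design

variable {n : ℕ} {S : Setting n} {L t : ℝ}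

lemma abs_sum_mul_le_of_abs_le {ι : Type*} (s : Finset ι) {x v : ι → ℝ} {C : ℝ} (hC : 0 ≤ C)
    (hx : ∀ k, |x k| ≤ C) : |∑ k ∈ s, x k * v k| ≤ C * √s.card * √(∑ k ∈ s, v k ^ 2) := by
  refine (abs_sum_mul_le_sqrt s x v).trans (mul_le_mul_of_nonneg_right ?_ (Real.sqrt_nonneg _))
  rw [← Real.sqrt_sq hC, ← Real.sqrt_mul (sq_nonneg C)]
  apply Real.sqrt_le_sqrt
  calc ∑ k ∈ s, x k ^ 2 ≤ ∑ k ∈ s, C ^ 2 := Finset.sum_le_sum fun k _ => by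
        rw [← sq_abs (x k)]; exact pow_le_pow_left₀ (abs_nonneg _) (hx k) 2
    _ = C ^ 2 * s.card := by simp; ring

/-- The deterministic part of the estimation error of the residuals. -/
noncomputable def Setting.resBias (S : Setting n) (L C : ℝ) : ℝ :=
  C * √S.N.card * (2 * S.ρ ^ 2 / L ^ 4 * √(∑ k, S.β k ^ 2))
    + ⨆ i, |∑ j ∈ S.Nᶜ, S.X i j * S.β j|

lemma Setting.Regular.resBias_nonneg (h : S.Regular L) {C : ℝ} (hC : 0 ≤ C) : 0 ≤ S.resBias L C := by
  have hL := h.L_pos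
  have : 0 ≤ ⨆ i, |∑ j ∈ S.Nᶜ, S.X i j * S.β j| := Real.iSup_nonneg fun _ => abs_nonneg _
  rw [Setting.resBias]
  positivity

lemma Setting.Regular.abs_det_le (h : S.Regular L) {C : ℝ} (hC : 0 ≤ C) (hX : ∀ i j, |S.X i j| ≤ C)
    (l : Fin n) : |∑ k ∈ S.N, S.X l k * S.bias S.β k + ∑ k ∈ S.Nᶜ, S.X l k * S.β k|
      ≤ S.resBias L C := by
  refine (abs_add_le _ _).trans (add_le_add ?_ ?_)
  · refine (abs_sum_mul_le_of_abs_le S.N hC (hX l)).trans ?_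
    refine mul_le_mul_of_nonneg_left ?_ (by positivity)
    refine le_trans (Real.sqrt_le_sqrt ?_) (h.sqrt_sum_bias_sq_le S.β)
    exact Finset.sum_le_sum_of_subset_of_nonneg (Finset.subset_univ _) fun _ _ _ => sq_nonneg _
  · exact le_ciSup (f := fun i => |∑ j ∈ S.Nᶜ, S.X i j * S.β j|) (Set.finite_range _).bddAbove l

lemma Setting.Regular.abs_resErr_le (h : S.Regular L) {C : ℝ} (hC : 0 ≤ C)
    (hX : ∀ i j, |S.X i j| ≤ C) {e : Fin n → ℝ}
    (he : (1 + (S.N.card : ℝ)) * ∑ k ∈ S.N, (S.noiseMat *ᵥ e) k ^ 2 ≤ 1) (l : Fin n) :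
    |S.resErr e l| ≤ S.resBias L C + C := by
  rw [Setting.resErr]
  refine (abs_sub _ _).trans (add_le_add (h.abs_det_le hC hX l) ?_)
  refine (abs_sum_mul_le_of_abs_le S.N hC (hX l)).trans ?_
  rw [mul_assoc, ← Real.sqrt_mul (Nat.cast_nonneg _)]
  refine mul_le_of_le_one_right hC ?_
  rw [Real.sqrt_le_one]
  have : 0 ≤ ∑ k ∈ S.N, (S.noiseMat *ᵥ e) k ^ 2 := Finset.sum_nonneg fun _ _ => sq_nonneg _
  linarith

variable {Ω : Type*} [MeasurableSpace Ω] {P : Measure Ω} [IsProbabilityMeasure P]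
  {E : ErrorProcess n P} {r : ℕ} {R W : ℝ} {T : ℕ → ℝ}

/-- The error is a deterministic bias minus a linear form whose coefficients have squared length at
most 9C²|𝒩|/L². Together with (a+b)² ≤ 2a² + 2b² this gives the constant, as 24² = 4·16·9. -/
lemma NoiseBounds.resErr_bounds (hNB : NoiseBounds E r R W T) (hr : 1 ≤ r) (hR : 0 ≤ R)
    (h : S.Regular L) {C : ℝ} (hC : 0 ≤ C) (hX : ∀ i j, |S.X i j| ≤ C) (l : Fin n) :
    MemLp (fun ω => S.resErr (fun i => E.ε i ω) l) 2 P ∧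
      ∫ ω, S.resErr (fun i => E.ε i ω) l ^ 2 ∂P
        ≤ (2 * S.resBias L C + 24 * R * C * √S.N.card / L) ^ 2 := by
  have hL := h.L_pos
  set a : Fin n → ℝ := fun i => ∑ k, (if k ∈ S.N then S.X l k else 0) * S.noiseMat k i with ha
  set d := ∑ k ∈ S.N, S.X l k * S.bias S.β k + ∑ k ∈ S.Nᶜ, S.X l k * S.β k with hd
  have heq : ∀ ω, S.resErr (fun i => E.ε i ω) l = d - ∑ i, a i * E.ε i ω := by
    intro ω
    rw [Setting.resErr]
    congr 1
    simp only [ha, Matrix.mulVec, dotProduct, Finset.mul_sum, Finset.sum_mul, ite_mul, zero_mul]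
    rw [Finset.sum_comm]
    refine Finset.sum_congr rfl fun i _ => ?_
    rw [Finset.sum_ite_mem, Finset.univ_inter]
    exact Finset.sum_congr rfl fun k _ => by ring
  have ha2 : ∑ i, a i ^ 2 ≤ 9 / L ^ 2 * (C ^ 2 * S.N.card) := by
    refine (h.sum_sum_mul_noiseMat_sq_le _).trans ?_
    gcongr
    calc ∑ k, (if k ∈ S.N then S.X l k else 0) ^ 2 = ∑ k ∈ S.N, S.X l k ^ 2 := by
          simp [ite_pow, Finset.sum_ite_mem]
      _ ≤ ∑ k ∈ S.N, C ^ 2 := Finset.sum_le_sum fun k _ => by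
          rw [← sq_abs (S.X l k)]; exact pow_le_pow_left₀ (abs_nonneg _) (hX l k) 2
      _ = C ^ 2 * S.N.card := by simp; ring
  have hlin := hNB.memLp_two_linear hr a
  have hm : MemLp (fun ω => d - ∑ i, a i * E.ε i ω) 2 P := (memLp_const d).sub hlin
  simp_rw [heq]
  refine ⟨hm, ?_⟩
  have hsq : ∫ ω, (d - ∑ i, a i * E.ε i ω) ^ 2 ∂P ≤ 2 * d ^ 2 + 2 * ∫ ω, (∑ i, a i * E.ε i ω) ^ 2 ∂P := by
    have hI : Integrable (fun ω => 2 * d ^ 2 + 2 * (∑ i, a i * E.ε i ω) ^ 2) P :=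
      (integrable_const _).add (hlin.integrable_sq.const_mul 2)
    refine (integral_mono hm.integrable_sq hI fun ω => ?_).trans (le_of_eq ?_)
    · simp only
      nlinarith [sq_nonneg (d + ∑ i, a i * E.ε i ω)]
    · rw [integral_add (integrable_const _) (hlin.integrable_sq.const_mul 2)]
      simp [integral_const_mul]
  have h0 := h.resBias_nonneg hC
  have hd2 : d ^ 2 ≤ S.resBias L C ^ 2 := by
    rw [← sq_abs d]; exact pow_le_pow_left₀ (abs_nonneg _) (h.abs_det_le hC hX l) 2
  have hl2 : ∫ ω, (∑ i, a i * E.ε i ω) ^ 2 ∂P ≤ 16 * R ^ 2 * (9 / L ^ 2 * (C ^ 2 * S.N.card)) :=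
    (hNB.linear_sq a).trans (mul_le_mul_of_nonneg_left ha2 (by positivity))
  have hq : (24 * R * C * √S.N.card / L) ^ 2 = 4 * (16 * R ^ 2 * (9 / L ^ 2 * (C ^ 2 * S.N.card))) := by
    rw [div_pow, mul_pow, Real.sq_sqrt (Nat.cast_nonneg _)]
    field_simp
    ring
  have hpos : 0 ≤ 24 * R * C * √S.N.card / L := by positivity
  have hx : 0 ≤ 16 * R ^ 2 * (9 / L ^ 2 * (C ^ 2 * S.N.card)) := by positivity
  nlinarith [mul_nonneg h0 hpos]

end Design

end RidgeBootstrap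

namespace RidgeBootstrap

set_option linter.unusedSectionVars false

/-! ### Gaussian approximation at a fixed sample size -/

variable {n : ℕ} {S : Setting n} {L t : ℝ}
  {Ω : Type*} [MeasurableSpace Ω] {P : Measure Ω} [IsProbabilityMeasure P]
  {E : ErrorProcess n P} {r : ℕ} {R W : ℝ} {T : ℕ → ℝ} {D : ℕ} [NeZero D] {f : Fin D → S.Mset}

lemma ErrorProcess.measurable_errors (E : ErrorProcess n P) : Measurable fun ω i => E.ε i ω :=
  measurable_pi_iff.2 E.measurable_ε

lemma ErrorProcess.measurable_y (E : ErrorProcess n P) (S : Setting n) : Measurable (E.y S) :=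
  measurable_const.add E.measurable_errors

lemma Setting.Regular.cStar_nonneg (h : S.Regular L) (f : Fin D → S.Mset) : 0 ≤ S.cStar :=
  (abs_nonneg _).trans (S.abs_load_le h.n_pos (f 0).2 ⟨0, h.n_pos⟩)

lemma NoiseBounds.real_noise_gt_le (hNB : NoiseBounds E r R W T) (h : S.Regular L) (ht : 0 < t) :
    P.real {ω | ∃ k, t < |(S.noiseMat *ᵥ fun i => E.ε i ω) k|}
      ≤ S.p * (4 * 4 ^ r * R ^ 2 * (9 / L ^ 2) / t ^ 2) ^ r :=
  hNB.real_exists_gt_le (fun k i => S.noiseMat k i) ht h.sum_noiseMat_sq_le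

/-- Three errors add up: the probability a lost in the sandwich, the distance b between Γ and G, and
the growth c of G over the shift h. -/
lemma abs_sub_le_of_sandwich {F G Γ : ℝ → ℝ} {a b c h Λ : ℝ} (hh : 0 ≤ h)
    (h1 : ∀ x, F x ≤ Γ (x + h) + a) (h2 : ∀ x, Γ (x - h) ≤ F x + a)
    (hΓ : ∀ x, |Γ x - G x| ≤ b) (hG : ∀ x y, 0 ≤ y → G (x + y) ≤ G x + Λ * y) (hc : Λ * h ≤ c)
    (x : ℝ) : |F x - G x| ≤ a + b + c := by
  have e1 := h1 x
  have e2 := h2 x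
  have e3 := abs_le.1 (hΓ (x + h))
  have e4 := abs_le.1 (hΓ (x - h))
  have e5 := hG x h hh
  have e6 := hG (x - h) h hh
  rw [sub_add_cancel] at e6
  rw [abs_le]
  constructor <;> linarith [e3.1, e3.2, e4.1, e4.2]

lemma posSemidef_loadMat (h : E.cov.PosSemidef) : (Setting.loadMat f * E.cov * (Setting.loadMat f)ᵀ).PosSemidef := by
  simpa using h.mul_mul_conjTranspose_same (Setting.loadMat f)

lemma sum_loadMat_sq_le_one (f : Fin D → S.Mset) (a : Fin D) : ∑ l, Setting.loadMat f a l ^ 2 ≤ 1 :=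
  S.sum_load_sq_le_one _

/-- Gaussian approximation of the sample statistic. -/
lemma Setting.Separated.abs_maxStat_cdf_sub_H_le (h : S.Separated L t) (ht : 0 < t)
    (hNB : NoiseBounds E r R W T) (hr : 1 ≤ r) (hR : 0 ≤ R) (hW : 0 ≤ W)
    (hf : Function.Surjective f) {c κ τ ε₀ h₀ : ℝ} (hτ : 0 ≤ τ) (hc : 0 < c)
    (hclose : ∀ (ν : Measure (EuclideanSpace ℝ (Fin D))) (V : Matrix (Fin D) (Fin D) ℝ),
      IsProbabilityMeasure ν → V.PosSemidef → (∀ i, c ≤ V i i) → (∀ i j, |V i j| ≤ 16 * R ^ 2) →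
      (∀ t : EuclideanSpace ℝ (Fin D), (∀ i, |t i| ≤ τ) →
        ‖charFun ν t - Complex.exp (-((t ⬝ᵥ V *ᵥ t : ℝ) : ℂ) / 2)‖ ≤ κ) →
      ∀ x, |ν.real (cube D x) - (multivariateGaussian 0 V).real (cube D x)| ≤ ε₀)
    (hcV : ∀ a, c ≤ (loadMat f * E.cov * (loadMat f)ᵀ) a a)
    (hch : 2 * (D * τ * S.cStar * (32 * R * W * (D * τ) + R ^ 3 * (D * τ) ^ 2)) ≤ κ)
    (hh : (⨆ i, |∑ j ∈ S.Nᶜ, S.M i j * S.β j|) * √n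
      + 2 * S.ρ ^ 2 / L ^ 3 * (2 * √(∑ k, S.β k ^ 2) + 1) ≤ h₀)
    (hP : S.p * (4 * 4 ^ r * R ^ 2 * (9 / L ^ 2) / t ^ 2) ^ r ≤ ε₀)
    (hΛ : 2 * D / √c * h₀ ≤ ε₀) (x : ℝ) :
    |P.real {ω | S.maxStat (E.y S ω) S.γ ≤ x} - S.H E.cov x| ≤ 3 * ε₀ := by
  have hL := h.L_pos
  have hps := hNB.posSemidef_cov hr
  have hV := posSemidef_loadMat (f := f) hps
  have hm : Measurable fun ω => linImage (loadMat f) fun i => E.ε i ω :=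
    (measurable_linImage _).comp E.measurable_errors
  have hprob := Measure.isProbabilityMeasure_map (μ := P) hm.aemeasurable
  have hbnd : ∀ i j, |(loadMat f * E.cov * (loadMat f)ᵀ) i j| ≤ 16 * R ^ 2 := by
    intro i j
    rw [mul_mul_transpose_apply]
    exact hNB.abs_cov_quadratic_le hr hR (sum_loadMat_sq_le_one f i) (sum_loadMat_sq_le_one f j)
  have hΓ := hclose _ _ hprob hV hcV hbnd (fun s hs =>
    (hNB.norm_charFun_sub_le (loadMat f) (h.cStar_nonneg f) hR hW
      (fun a l => S.abs_load_le h.n_pos (f a).2 l) (sum_loadMat_sq_le_one f) hτ s hs).trans hch)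
  have hsw := h.maxStat_sandwich (P := P) (fun ω i => E.ε i ω) hf hh
  have hh0 : 0 ≤ h₀ := by
    refine le_trans (add_nonneg (mul_nonneg (Real.iSup_nonneg fun _ => abs_nonneg _)
      (Real.sqrt_nonneg _)) ?_) hh
    positivity
  have hmap : ∀ z, P.real {ω | linImage (loadMat f) (fun i => E.ε i ω) ∈ cube D z}
      = (P.map fun ω => linImage (loadMat f) fun i => E.ε i ω).real (cube D z) := fun z =>
    (map_measureReal_apply hm (measurableSet_cube z)).symm
  have hbad := (hNB.real_noise_gt_le (S := S) h.toRegular ht).trans hP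
  have := abs_sub_le_of_sandwich (F := fun x => P.real {ω | S.maxStat (E.y S ω) S.γ ≤ x})
    (G := fun x => S.H E.cov x) (h := h₀) (a := ε₀) (c := ε₀) (b := ε₀) (Λ := 2 * D / √c)
    (Γ := fun z => (P.map fun ω => linImage (loadMat f) fun i => E.ε i ω).real (cube D z))
    hh0
    (fun x => by
      have := (hsw x).1
      rw [hmap] at this
      exact this.trans (add_le_add le_rfl hbad))
    (fun x => by
      have := (hsw x).2
      rw [hmap] at this
      exact this.trans (add_le_add le_rfl hbad))
    (fun x => by rw [Setting.H_eq hf h.n_pos hps]; exact hΓ x)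
    (fun x y hy => by
      simp only [Setting.H_eq hf h.n_pos hps]
      exact real_cube_add_le hV hc hcV x y hy) hΛ x
  linarith

/-- Gaussian approximation of the bootstrap statistic outside a set of small probability. -/
lemma Setting.Separated.exists_abs_bootStat_cdf_sub_H_le (h : S.Separated L t) (ht : 0 < t)
    (hb : 0 ≤ S.b - 2 * t) (hNB : NoiseBounds E r R W T) (hr : 2 ≤ r) (hR : 0 ≤ R)
    (hf : Function.Surjective f) {c κ ε₀ h₀ : ℝ} (hc : 0 < c) (hκ : 0 < κ)
    (hclose : ∀ V V' : Matrix (Fin D) (Fin D) ℝ, V.PosSemidef → V'.PosSemidef →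
      (∀ i, c ≤ V i i) → (∀ i j, |V i j| ≤ 16 * R ^ 2) → (∀ i j, |V' i j - V i j| ≤ κ) →
      ∀ x, |(multivariateGaussian 0 V').real (cube D x)
        - (multivariateGaussian 0 V).real (cube D x)| ≤ ε₀)
    (hcV : ∀ a, c ≤ (loadMat f * E.cov * (loadMat f)ᵀ) a a)
    (hh : 2 * S.ρ ^ 2 / L ^ 3 * (2 * √(∑ k, S.β k ^ 2) + 1) ≤ h₀)
    (hP : S.p * (4 * 4 ^ r * R ^ 2 * (9 / L ^ 2) / t ^ 2) ^ r ≤ ε₀)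
    (hΛ : 2 * D / √c * h₀ ≤ ε₀)
    {V : Matrix (Fin n) (Fin n) ℝ} (hV : V.PosSemidef) (hV0 : ∀ i j, 0 ≤ V i j)
    (hV1 : ∀ i j, V i j ≤ 1) {B : ℝ} (hB0 : 0 < B) (hB : ∀ i, ∑ j, V i j ≤ B) {q : ℕ} {κ' : ℝ}
    (hκ' : 0 ≤ κ') (hVκ : ∀ i j : Fin n, |(i.val : ℤ) - j.val| < q → 1 - V i j ≤ κ')
    {M C : ℝ} (hM : 0 < M) (hC : 0 ≤ C) (hX : ∀ i j, |S.X i j| ≤ C)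
    (hmax : n * (4 * 4 ^ r * R ^ 2 * 1 / M ^ 2) ^ r ≤ ε₀) (hres : S.resBias L C + C ≤ M)
    (hsel : (1 + (S.N.card : ℝ)) * (S.N.card * (16 * R ^ 2 * (9 / L ^ 2))) ≤ ε₀)
    (hgauss : S.p * (2 * Real.exp (-t ^ 2 / (2 * (B * (9 / L ^ 2 * (2 * M) ^ 2))))) ≤ ε₀)
    (hcov : D * (D * ((128 * R ^ 2 * (S.cStar * √B) + (κ' * R ^ 2 + 2 * R * T q)
      + B * (8 * R * (2 * S.resBias L C + 24 * R * C * √S.N.card / L)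
        + (2 * S.resBias L C + 24 * R * C * √S.N.card / L) ^ 2)) / κ)) ≤ ε₀) :
    ∃ bad : Set Ω, P.real bad ≤ 4 * ε₀ ∧ ∀ ω ∉ bad, ∀ x,
      |(multivariateGaussian 0 V).real {w | S.bootStat (E.y S ω) w ≤ x} - S.H E.cov x| ≤ 3 * ε₀ := by
  have hL := h.L_pos
  have hr1 : 1 ≤ r := by lia
  have hps := hNB.posSemidef_cov hr1
  have hVl := posSemidef_loadMat (f := f) hps
  have hbnd : ∀ i j, |(loadMat f * E.cov * (loadMat f)ᵀ) i j| ≤ 16 * R ^ 2 := by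
    intro i j
    rw [mul_mul_transpose_apply]
    exact hNB.abs_cov_quadratic_le hr1 hR (sum_loadMat_sq_le_one f i) (sum_loadMat_sq_le_one f j)
  have hh0 : 0 ≤ h₀ := le_trans (by positivity) hh
  set δ := 2 * S.resBias L C + 24 * R * C * √S.N.card / L with hδ
  have hδ0 : 0 ≤ δ := by
    have := h.resBias_nonneg hC
    positivity
  set e : Ω → Fin n → ℝ := fun ω i => E.ε i ω with he
  set A := loadMat f with hA
  set Vh : Ω → Matrix (Fin D) (Fin D) ℝ := fun ω =>
    (A * Matrix.diagonal fun l => e ω l + S.resErr (e ω) l) * V *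
      (A * Matrix.diagonal fun l => e ω l + S.resErr (e ω) l)ᵀ with hVh
  have hVhps : ∀ ω, (Vh ω).PosSemidef := fun ω => by
    simpa [hVh] using hV.mul_mul_conjTranspose_same
      (A * Matrix.diagonal fun l => e ω l + S.resErr (e ω) l)
  have hVhe : ∀ ω a b, Vh ω a b = ∑ i, ∑ j, A a i * A b j * V i j *
      ((E.ε i ω + S.resErr (e ω) i) * (E.ε j ω + S.resErr (e ω) j)) := by
    intro ω a b
    simp only [hVh]
    rw [mul_mul_transpose_apply]
    refine Finset.sum_congr rfl fun i _ => Finset.sum_congr rfl fun j _ => ?_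
    rw [Matrix.mul_diagonal, Matrix.mul_diagonal]
    simp only [he]
    ring
  have hsymm : ∀ i j, V i j = V j i := fun i j => by
    have := congrFun (congrFun hV.1 i) j
    simpa using this.symm
  -- Markov's inequality for each entry of the conditional covariance. Boundedly many entries make a
  -- union bound affordable.
  have hest : ∀ a b, P.real {ω | κ ≤ |Vh ω a b - (A * E.cov * Aᵀ) a b|}
      ≤ (128 * R ^ 2 * (S.cStar * √B) + (κ' * R ^ 2 + 2 * R * T q)
        + B * (8 * R * δ + δ ^ 2)) / κ := by
    intro a b
    obtain ⟨hint, hle⟩ := hNB.integral_abs_weighted_cov_sub_le h.n_pos hr hR hV0 hV1 hsymm hB0.le hB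
      hκ' hVκ (u := A a) (v := A b) (fun i => S.abs_load_le h.n_pos (f a).2 i) (h.cStar_nonneg f)
      (sum_loadMat_sq_le_one f a) (sum_loadMat_sq_le_one f b)
      (fun i => (hNB.resErr_bounds hr1 hR h.toRegular hC hX i).1) hδ0
      (fun i => (hNB.resErr_bounds hr1 hR h.toRegular hC hX i).2)
    have hm := mul_meas_ge_le_integral_of_nonneg
      (Filter.Eventually.of_forall fun ω => abs_nonneg _) hint κ
    rw [le_div_iff₀ hκ, mul_comm]
    refine le_trans (le_of_eq ?_) (hm.trans hle)
    congr 2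
    ext ω
    simp only [Set.mem_ofPred_eq]
    rw [hVhe, mul_mul_transpose_apply]
  -- The four exceptional events, in order: noise in the estimator exceeds the threshold margin,
  -- noise on the strong set is too large for the residuals, a single error exceeds M, or the
  -- conditional covariance is off by κ. Outside them the residuals are at most 2M, one M from the
  -- errors and one from their estimation.
  let bad1 : Set Ω := {ω | ∃ k, t < |(S.noiseMat *ᵥ e ω) k|}
  let bad2 : Set Ω := {ω | 1 < (1 + (S.N.card : ℝ)) * ∑ k ∈ S.N, (∑ i, S.noiseMat k i * E.ε i ω) ^ 2}
  let bad3 : Set Ω := {ω | ∃ k, M < |∑ i, (1 : Matrix (Fin n) (Fin n) ℝ) k i * E.ε i ω|}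
  let bad4 : Set Ω := ⋃ a : Fin D, ⋃ b : Fin D, {ω | κ ≤ |Vh ω a b - (A * E.cov * Aᵀ) a b|}
  have hb1 : P.real bad1 ≤ ε₀ := (hNB.real_noise_gt_le h.toRegular ht).trans hP
  have hb2 : P.real bad2 ≤ ε₀ :=
    (hNB.real_sum_sq_gt_le hr1 S.N (fun k i => S.noiseMat k i) h.sum_noiseMat_sq_le).trans hsel
  have hb3 : P.real bad3 ≤ ε₀ := by
    refine (hNB.real_exists_gt_le (fun k i => (1 : Matrix (Fin n) (Fin n) ℝ) k i) hM (q := 1)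
      fun k => ?_).trans hmax
    simp [Matrix.one_apply, ite_pow]
  have hb4 : P.real bad4 ≤ ε₀ := by
    refine (measureReal_iUnion_fintype_le _).trans (le_trans (Finset.sum_le_sum fun a _ =>
      (measureReal_iUnion_fintype_le _).trans (Finset.sum_le_sum fun b _ => hest a b)) ?_)
    simpa using hcov
  refine ⟨bad1 ∪ bad2 ∪ bad3 ∪ bad4, ?_, fun ω hω x => ?_⟩
  · have u1 := measureReal_union_le (μ := P) (bad1 ∪ bad2 ∪ bad3) bad4
    have u2 := measureReal_union_le (μ := P) (bad1 ∪ bad2) bad3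
    have u3 := measureReal_union_le (μ := P) bad1 bad2
    linarith
  · simp only [Set.mem_union, not_or] at hω
    obtain ⟨⟨⟨hω1, hω2⟩, hω3⟩, hω4⟩ := hω
    have g1 : ∀ k, |(S.noiseMat *ᵥ e ω) k| ≤ t := fun k => by
      by_contra hcon
      exact hω1 ⟨k, not_le.1 hcon⟩
    have g2 : (1 + (S.N.card : ℝ)) * ∑ k ∈ S.N, (S.noiseMat *ᵥ e ω) k ^ 2 ≤ 1 := not_lt.1 hω2
    have g2' : ∑ k ∈ S.N, (S.noiseMat *ᵥ e ω) k ^ 2 ≤ 1 := by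
      have e1 : 0 ≤ ∑ k ∈ S.N, (S.noiseMat *ᵥ e ω) k ^ 2 := Finset.sum_nonneg fun _ _ => sq_nonneg _
      have e2 : (0 : ℝ) ≤ S.N.card := Nat.cast_nonneg _
      nlinarith
    have g3 : ∀ l, |e ω l + S.resErr (e ω) l| ≤ 2 * M := by
      intro l
      have e1 : |e ω l| ≤ M := by
        by_contra hcon
        refine hω3 ⟨l, ?_⟩
        simpa [Matrix.one_apply] using not_le.1 hcon
      have e2 := (h.abs_resErr_le hC hX g2 l).trans hres
      exact (abs_add_le _ _).trans (by linarith)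
    have g4 : ∀ a b, |Vh ω a b - (A * E.cov * Aᵀ) a b| ≤ κ := by
      intro a b
      by_contra hcon
      exact hω4 (Set.mem_iUnion.2 ⟨a, Set.mem_iUnion.2 ⟨b, (not_le.1 hcon).le⟩⟩)
    have hv : 0 < B * (9 / L ^ 2 * (2 * M) ^ 2) := by positivity
    have hsw := h.bootStat_sandwich hb g1 g2' g3 hV hV0 hB hf hv le_rfl hh
    have := abs_sub_le_of_sandwich
      (F := fun x => (multivariateGaussian 0 V).real {w | S.bootStat (E.y S ω) w ≤ x})
      (G := fun x => S.H E.cov x) (h := h₀) (a := ε₀) (c := ε₀) (b := ε₀) (Λ := 2 * D / √c)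
      (Γ := fun z => (multivariateGaussian 0 (Vh ω)).real (cube D z))
      hh0
      (fun x => (hsw x).1.trans (add_le_add le_rfl hgauss))
      (fun x => (hsw x).2.trans (add_le_add le_rfl hgauss))
      (fun x => by
        rw [Setting.H_eq hf h.n_pos hps]
        exact hclose _ _ hVl (hVhps ω) hcV hbnd g4 x)
      (fun x y hy => by
        simp only [Setting.H_eq hf h.n_pos hps]
        exact real_cube_add_le hVl hc hcV x y hy) hΛ x
    linarith

end RidgeBootstrap

namespace RidgeBootstrap

set_option linter.unusedSectionVars false

/-! ### Orders of magnitude as powers of n -/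

section PowerRates

/-- `f` is of order at most `n ^ a`. -/
def PowO (a : ℝ) (f : ℕ → ℝ) : Prop := f =O[atTop] fun n : ℕ => (n : ℝ) ^ a

variable {a b : ℝ} {f g : ℕ → ℝ}

lemma PowO.mono (h : PowO a f) (hab : a ≤ b) : PowO b f := by
  refine h.trans (IsBigO.of_bound 1 ?_)
  filter_upwards [eventually_ge_atTop 1] with n hn
  have hn' : (1 : ℝ) ≤ n := by exact_mod_cast hn
  rw [one_mul, Real.norm_of_nonneg (by positivity), Real.norm_of_nonneg (by positivity)]
  exact Real.rpow_le_rpow_of_exponent_le hn' hab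

lemma PowO.mul (hf : PowO a f) (hg : PowO b g) : PowO (a + b) fun n => f n * g n := by
  refine (IsBigO.mul hf hg).congr' EventuallyEq.rfl ?_
  filter_upwards [eventually_ge_atTop 1] with n hn
  exact (Real.rpow_add (by exact_mod_cast hn) a b).symm

lemma PowO.add (hf : PowO a f) (hg : PowO a g) : PowO a fun n => f n + g n := IsBigO.add hf hg

lemma PowO.const_mul (hf : PowO a f) (c : ℝ) : PowO a fun n => c * f n := IsBigO.const_mul_left hf c

lemma PowO.pow (hf : PowO a f) (k : ℕ) : PowO (a * k) fun n => f n ^ k := by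
  refine (IsBigO.pow hf k).congr' EventuallyEq.rfl ?_
  filter_upwards with n
  exact (Real.rpow_mul_natCast (Nat.cast_nonneg n) a k).symm

lemma PowO.sqrt (hf : PowO a f) (h0 : ∀ n, 0 ≤ f n) : PowO (a / 2) fun n => √(f n) := by
  obtain ⟨C, hC⟩ := IsBigO.bound hf
  refine IsBigO.of_bound √(max C 0) ?_
  filter_upwards [hC] with n hn
  have hp : 0 ≤ (n : ℝ) ^ a := by positivity
  rw [Real.norm_of_nonneg (h0 n), Real.norm_of_nonneg hp] at hn
  have e : (n : ℝ) ^ (a / 2) = √((n : ℝ) ^ a) := by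
    rw [Real.sqrt_eq_rpow, ← Real.rpow_mul (Nat.cast_nonneg n), mul_one_div]
  rw [e, Real.norm_of_nonneg (Real.sqrt_nonneg _), Real.norm_of_nonneg (Real.sqrt_nonneg _),
    ← Real.sqrt_mul (le_max_right C 0)]
  exact Real.sqrt_le_sqrt (hn.trans (mul_le_mul_of_nonneg_right (le_max_left C 0) hp))

lemma powO_const (c : ℝ) : PowO 0 fun _ => c := by
  refine IsBigO.of_bound ‖c‖ (Eventually.of_forall fun n => ?_)
  simp

lemma powO_rpow (a : ℝ) : PowO a fun n => (n : ℝ) ^ a := isBigO_refl _ _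

lemma PowO.tendsto_zero (h : PowO a f) (ha : a < 0) : Tendsto f atTop (𝓝 0) := by
  refine IsBigO.trans_tendsto h ?_
  have := (tendsto_rpow_neg_atTop (y := -a) (by linarith)).comp (tendsto_natCast_atTop_atTop (R := ℝ))
  simpa [Function.comp_def] using this

lemma PowO.of_abs_le {f g : ℕ → ℝ} (hg : PowO a g) (h : ∀ᶠ n in atTop, |f n| ≤ |g n|) : PowO a f :=
  (IsBigO.of_bound 1 (by filter_upwards [h] with n hn; simpa using hn)).trans hg

lemma eventually_le_of_tendsto_zero (h : Tendsto f atTop (𝓝 0)) {r : ℝ} (hr : 0 < r) :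
    ∀ᶠ n in atTop, f n ≤ r := (h.eventually (gt_mem_nhds hr)).mono fun _ h => h.le

/-- With u = n^(1/m) this is u^m e^(−u) → 0. -/
lemma tendsto_mul_exp_neg_rpow {m : ℝ} (hm : 0 < m) :
    Tendsto (fun n : ℕ => (n : ℝ) * (2 * Real.exp (-(n : ℝ) ^ (1 / m)))) atTop (𝓝 0) := by
  have h1 := tendsto_rpow_mul_exp_neg_mul_atTop_nhds_zero m 1 one_pos
  have h2 : Tendsto (fun n : ℕ => (n : ℝ) ^ (1 / m)) atTop atTop :=
    (tendsto_rpow_atTop (by positivity)).comp tendsto_natCast_atTop_atTop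
  have h3 := (h1.comp h2).const_mul 2
  rw [mul_zero] at h3
  refine h3.congr fun n => ?_
  simp only [Function.comp_apply]
  rw [← Real.rpow_mul (Nat.cast_nonneg n), one_div, inv_mul_cancel₀ hm.ne', Real.rpow_one]
  ring_nf

end PowerRates

/-! ### Verification of the rate conditions -/

section Rates

variable {S : ∀ n, Setting n} {Ω : ℕ → Type*} [∀ n, MeasurableSpace (Ω n)] {P : ∀ n, Measure (Ω n)}
  [∀ n, IsProbabilityMeasure (P n)] {E : ∀ n, ErrorProcess n (P n)} {K : ℝ → ℝ} {k : ℕ → ℝ}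
  {η m αε αβ δ νb : ℝ}

/-- The numerical conditions under which the Gaussian approximations hold with error `ε₀`. -/
lemma eventually_rates (h1 : Assumption1 S η) (hm : 3 / η < m) (h3 : Assumption3 S η m αβ)
    (h4 : Assumption4 S η m αβ δ νb) (h5 : Assumption5 S η m) (h6 : Assumption6 S αε)
    (h7 : Assumption7 K k η m νb) {r : ℕ} (hr : m / 2 - 1 < r) {c C : ℝ} (hc : 0 < c)
    (R B : ℝ) (hB : 0 < B) {s : ℝ} (hs : 0 < s) {ε : ℝ} (hε : 0 < ε) (b : ℝ) :
    ∀ᶠ n : ℕ in atTop, ∀ L, L = c * (n : ℝ) ^ η → ∀ M, M = (n : ℝ) ^ (3 / (2 * m)) / 2 →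
      |(S n).ρ| ≤ L ^ 2 / 4 ∧
      2 * (S n).ρ ^ 2 / L ^ 4 * (2 * √(∑ k, (S n).β k ^ 2) + 1) ≤ s * (S n).b ∧
      (⨆ i, |∑ j ∈ (S n).Nᶜ, (S n).M i j * (S n).β j|) * √n
        + 2 * (S n).ρ ^ 2 / L ^ 3 * (2 * √(∑ k, (S n).β k ^ 2) + 1) ≤ ε ∧
      (S n).p * (4 * 4 ^ r * R ^ 2 * (9 / L ^ 2) / (s * (S n).b) ^ 2) ^ r ≤ ε ∧
      n * (4 * 4 ^ r * R ^ 2 * 1 / M ^ 2) ^ r ≤ ε ∧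
      (S n).resBias L C + C ≤ M ∧
      (1 + ((S n).N.card : ℝ)) * ((S n).N.card * (16 * R ^ 2 * (9 / L ^ 2))) ≤ ε ∧
      (S n).p * (2 * Real.exp (-(s * (S n).b) ^ 2 / (2 * (B * k n * (9 / L ^ 2 * (2 * M) ^ 2))))) ≤ ε ∧
      b * (S n).cStar ≤ ε ∧
      (S n).cStar * √(B * k n) ≤ ε ∧
      B * k n * (8 * R * (2 * (S n).resBias L C + 24 * R * C * √(S n).N.card / L)
        + (2 * (S n).resBias L C + 24 * R * C * √(S n).N.card / L) ^ 2) ≤ ε := by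
  have hη := h1.η_pos
  have hm6 : 6 < m := by
    have : 6 ≤ 3 / η := by rw [le_div_iff₀ hη]; linarith [h1.η_le]
    linarith
  have hm0 : 0 < m := by linarith
  have hmη : 3 / m < η := by rw [div_lt_iff₀ hm0]; rw [div_lt_iff₀ hη] at hm; linarith
  have h1m : 0 < 1 / m := by positivity
  have h3m : 3 / m = 3 * (1 / m) := by ring
  have h3m2 : 3 / (2 * m) = 3 / 2 * (1 / m) := by field_simp
  have hm16 : 1 / m < 1 / 6 := one_div_lt_one_div_of_lt (by norm_num) hm6
  have hαβ := h3.αβ_nonneg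
  have hδ := h4.δ_gt
  have hνb := h4.νb_lt
  have hνb0 := h4.νb_pos
  have hηle := h1.η_le
  -- basic rates
  have hρ : PowO (2 * η - δ) fun n => (S n).ρ := h4.ρ_order
  have hL : PowO (-η) fun n => (c * (n : ℝ) ^ η)⁻¹ := by
    have := (powO_rpow (-η)).const_mul c⁻¹
    refine this.of_abs_le (Eventually.of_forall fun n => le_of_eq ?_)
    rw [mul_inv, Real.rpow_neg (Nat.cast_nonneg n)]
  have hβ : PowO αβ fun n => √(∑ k, (S n).β k ^ 2) := h3.β_norm
  have hβ1 : PowO αβ fun n => 2 * √(∑ k, (S n).β k ^ 2) + 1 :=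
    (hβ.const_mul 2).add ((powO_const 1).mono hαβ)
  have hN : PowO (η - 1 / m) fun n => ((S n).N.card : ℝ) := h3.N_card.isBigO
  have hN1 : PowO (η - 1 / m) fun n => 1 + ((S n).N.card : ℝ) :=
    ((powO_const 1).mono (by linarith)).add hN
  obtain ⟨Cb, hCb, hb⟩ := h4.b_eq
  have hbinv : PowO νb fun n => (s * (S n).b)⁻¹ := by
    have := (powO_rpow νb).const_mul (s * Cb)⁻¹
    refine this.of_abs_le ?_
    filter_upwards [eventually_ge_atTop 1] with n hn
    rw [hb n hn, ← mul_assoc, mul_inv, Real.rpow_neg (Nat.cast_nonneg n), inv_inv]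
  have hbpos : ∀ᶠ n in atTop, 0 < s * (S n).b := by
    filter_upwards [eventually_ge_atTop 1] with n hn
    rw [hb n hn]
    have : (0 : ℝ) < n := by exact_mod_cast hn
    positivity
  have hp : ∀ᶠ n : ℕ in atTop, ((S n).p : ℝ) ≤ n := by
    filter_upwards [eventually_ge_atTop 1] with n hn
    exact_mod_cast h1.p_le n hn
  have hn1 : PowO 1 fun n : ℕ => (n : ℝ) := by simpa [PowO] using powO_rpow 1
  have hk : PowO (η / 2 - 3 / (2 * m)) k := h7.k_bigO
  have hM : PowO (-(3 / (2 * m))) fun n : ℕ => ((n : ℝ) ^ (3 / (2 * m)) / 2)⁻¹ := by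
    have := (powO_rpow (-(3 / (2 * m)))).const_mul 2
    refine this.of_abs_le (Eventually.of_forall fun n => le_of_eq ?_)
    rw [inv_div, Real.rpow_neg (Nat.cast_nonneg n), div_eq_mul_inv]
  have hcS : PowO (-(1 / 4)) fun n => (S n).cStar := by
    refine (IsLittleO.isBigO h6.cStar_order).trans (IsBigO.of_bound 1 ?_)
    filter_upwards [eventually_ge_atTop 3] with n hn
    have hlog : 1 ≤ Real.log n := by
      rw [Real.le_log_iff_exp_le (by positivity)]
      have : (3 : ℝ) ≤ n := by exact_mod_cast hn
      linarith [Real.exp_one_lt_d9]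
    have hζ : -(max (9 / 2) (3 * αε / (2 * αε - 2))) ≤ 0 := by
      have := le_max_left (9 / 2 : ℝ) (3 * αε / (2 * αε - 2))
      linarith
    have h1 := Real.rpow_le_one_of_one_le_of_nonpos hlog hζ
    have h0 : 0 ≤ Real.log n ^ (-(max (9 / 2) (3 * αε / (2 * αε - 2)))) :=
      Real.rpow_nonneg (by linarith) _
    rw [Real.norm_of_nonneg (by positivity), Real.norm_of_nonneg (by positivity), one_mul]
    exact mul_le_of_le_one_right (by positivity) h1
  have hwX : PowO ((1 / m - η) / 2) fun n => ⨆ i, |∑ j ∈ (S n).Nᶜ, (S n).X i j * (S n).β j| :=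
    h5.weak_X.isBigO
  have hdet : PowO ((η - 1 / m) / 2 + (2 * (2 * η - δ) + -η * 4 + αβ)) fun n =>
      C * √(S n).N.card * (2 * (S n).ρ ^ 2 / (c * (n : ℝ) ^ η) ^ 4 * √(∑ k, (S n).β k ^ 2)) := by
    have := ((hN.sqrt fun n => Nat.cast_nonneg _).const_mul C).mul
      (((((hρ.pow 2).const_mul 2).mul (hL.pow 4))).mul hβ)
    refine (this.mono (le_of_eq ?_)).of_abs_le (Eventually.of_forall fun n => le_of_eq ?_)
    · push_cast; ring
    · rw [inv_pow, ← div_eq_mul_inv]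
  -- The ridge part has the exponent (η − 1/m)/2 + αβ − 2δ. Since 2δ > η + αβ, it is below the
  -- exponent of the weak coordinates.
  have hres : PowO ((1 / m - η) / 2) fun n => (S n).resBias (c * (n : ℝ) ^ η) C :=
    (hdet.mono (by linarith)).add hwX
  have hδ' : PowO ((1 / m - η) / 2) fun n => 2 * (S n).resBias (c * (n : ℝ) ^ η) C
      + 24 * R * C * √(S n).N.card / (c * (n : ℝ) ^ η) := by
    refine (hres.const_mul 2).add ?_
    have := (((hN.sqrt fun n => Nat.cast_nonneg _).const_mul (24 * R * C)).mul hL)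
    refine (this.mono (by linarith)).of_abs_le (Eventually.of_forall fun n => le_of_eq ?_)
    rw [← div_eq_mul_inv]
  -- From r > m/2 − 1 and η − νb > 3/m the product exceeds 3/2 − 3/m, which is more than 1 because m
  -- > 6. The bound `hrm` rests on the same computation.
  have hrη : 1 < r * (η - νb) := by
    have e1 : 0 < m / 2 - 1 := by linarith
    have e2 : 3 / m < η - νb := by linarith
    have e3 : (m / 2 - 1) * (3 / m) = 3 / 2 - 3 * (1 / m) := by field_simp
    have e4 : (m / 2 - 1) * (3 / m) ≤ r * (η - νb) := by gcongr
    linarith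
  have hrm : 1 < 3 / m * r := by
    have e3 : 3 / m * (m / 2 - 1) = 3 / 2 - 3 * (1 / m) := by field_simp
    have e4 : 3 / m * (m / 2 - 1) < 3 / m * r := by gcongr
    linarith
  -- the individual conditions
  have c1 : ∀ᶠ n : ℕ in atTop, |(S n).ρ| ≤ (c * (n : ℝ) ^ η) ^ 2 / 4 := by
    have := ((hρ.mul (hL.pow 2)).tendsto_zero (by push_cast; linarith)).abs
    rw [abs_zero] at this
    filter_upwards [eventually_le_of_tendsto_zero this (show (0 : ℝ) < 1 / 4 by norm_num),
      eventually_ge_atTop 1] with n hn hn1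
    have hn0 : (0 : ℝ) < n := by exact_mod_cast hn1
    rw [abs_mul, inv_pow, abs_of_nonneg (by positivity : 0 ≤ ((c * (n : ℝ) ^ η) ^ 2)⁻¹),
      ← div_eq_mul_inv, div_le_iff₀ (by positivity)] at hn
    linarith
  have c2 : ∀ᶠ n : ℕ in atTop, 2 * (S n).ρ ^ 2 / (c * (n : ℝ) ^ η) ^ 4
      * (2 * √(∑ k, (S n).β k ^ 2) + 1) ≤ s * (S n).b := by
    have := (((((hρ.pow 2).const_mul 2).mul (hL.pow 4)).mul hβ1).mul hbinv).tendsto_zero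
      (by push_cast; linarith)
    filter_upwards [eventually_le_of_tendsto_zero this one_pos, hbpos] with n hn hbn
    rw [inv_pow, ← div_eq_mul_inv, ← div_eq_mul_inv, div_le_one hbn] at hn
    exact hn
  have c3 : ∀ᶠ n : ℕ in atTop, (⨆ i, |∑ j ∈ (S n).Nᶜ, (S n).M i j * (S n).β j|) * √n
        + 2 * (S n).ρ ^ 2 / (c * (n : ℝ) ^ η) ^ 3 * (2 * √(∑ k, (S n).β k ^ 2) + 1) ≤ ε := by
    have t1 : Tendsto (fun n : ℕ => (⨆ i, |∑ j ∈ (S n).Nᶜ, (S n).M i j * (S n).β j|) * √n)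
        atTop (𝓝 0) := by
      refine h5.weak_M.tendsto_div_nhds_zero.congr fun n => ?_
      rw [div_div_eq_mul_div, div_one]
    -- The exponent is η + αβ − 2δ, so this is where the lower bound on δ is sharp.
    have t2 := ((((hρ.pow 2).const_mul 2).mul (hL.pow 3)).mul hβ1).tendsto_zero
      (by push_cast; linarith)
    have := t1.add t2
    rw [add_zero] at this
    filter_upwards [eventually_le_of_tendsto_zero this hε] with n hn
    rw [inv_pow, ← div_eq_mul_inv] at hn
    exact hn
  have c4 : ∀ᶠ n : ℕ in atTop, (S n).p * (4 * 4 ^ r * R ^ 2 * (9 / (c * (n : ℝ) ^ η) ^ 2)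
      / (s * (S n).b) ^ 2) ^ r ≤ ε := by
    have := (hn1.mul (((hL.pow 2).mul (hbinv.pow 2)).const_mul (4 * 4 ^ r * R ^ 2 * 9) |>.pow r)).tendsto_zero
      (by push_cast; nlinarith)
    filter_upwards [eventually_le_of_tendsto_zero this hε, hp] with n hn hpn
    refine le_trans ?_ hn
    have e : 4 * 4 ^ r * R ^ 2 * (9 / (c * (n : ℝ) ^ η) ^ 2) / (s * (S n).b) ^ 2
        = 4 * 4 ^ r * R ^ 2 * 9 * ((c * (n : ℝ) ^ η)⁻¹ ^ 2 * (s * (S n).b)⁻¹ ^ 2) := by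
      rw [inv_pow, inv_pow]; ring
    rw [e]
    exact mul_le_mul_of_nonneg_right hpn (by positivity)
  -- The level M is of order n^(3/(2m)), so the union bound over n errors has exponent 1 − 3r/m,
  -- which is negative by `hrm`.
  have c5 : ∀ᶠ n : ℕ in atTop, n * (4 * 4 ^ r * R ^ 2 * 1 / ((n : ℝ) ^ (3 / (2 * m)) / 2) ^ 2) ^ r ≤ ε := by
    have := (hn1.mul ((hM.pow 2).const_mul (4 * 4 ^ r * R ^ 2 * 1) |>.pow r)).tendsto_zero
      (by push_cast; rw [h3m2]; rw [h3m] at hrm; linarith)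
    filter_upwards [eventually_le_of_tendsto_zero this hε] with n hn
    rw [inv_pow, ← div_eq_mul_inv] at hn
    exact hn
  have c6 : ∀ᶠ n : ℕ in atTop, (S n).resBias (c * (n : ℝ) ^ η) C + C ≤ (n : ℝ) ^ (3 / (2 * m)) / 2 := by
    have t1 := hres.tendsto_zero (by linarith)
    have t2 : Tendsto (fun n : ℕ => (n : ℝ) ^ (3 / (2 * m))) atTop atTop :=
      (tendsto_rpow_atTop (by positivity)).comp tendsto_natCast_atTop_atTop
    filter_upwards [eventually_le_of_tendsto_zero t1 one_pos, t2.eventually_ge_atTop (2 * (1 + C))]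
      with n e1 e2
    linarith
  -- The exponent is 2(η − 1/m) − 2η = −2/m: the sparsity assumption is used with its margin
  -- n^(−1/m).
  have c7 : ∀ᶠ n : ℕ in atTop, (1 + ((S n).N.card : ℝ)) * ((S n).N.card *
      (16 * R ^ 2 * (9 / (c * (n : ℝ) ^ η) ^ 2))) ≤ ε := by
    have := (hN1.mul (hN.mul ((hL.pow 2).const_mul (16 * R ^ 2 * 9)))).tendsto_zero
      (by push_cast; linarith)
    filter_upwards [eventually_le_of_tendsto_zero this hε] with n hn
    refine le_trans (le_of_eq ?_) hn
    rw [inv_pow]; ring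
  have c8 : ∀ᶠ n : ℕ in atTop, (S n).p * (2 * Real.exp (-(s * (S n).b) ^ 2 /
      (2 * (B * k n * (9 / (c * (n : ℝ) ^ η) ^ 2 * (2 * ((n : ℝ) ^ (3 / (2 * m)) / 2)) ^ 2))))) ≤ ε := by
    have t1 : Tendsto (fun n => k n / (n : ℝ) ^ (2 * η - 2 * νb - 4 / m)) atTop (𝓝 0) :=
      h7.k_littleO.tendsto_div_nhds_zero
    have t2 : Tendsto (fun n : ℕ => (18 * B * (c⁻¹ ^ 2 * (s * Cb)⁻¹ ^ 2))
        * (k n / (n : ℝ) ^ (2 * η - 2 * νb - 4 / m))) atTop (𝓝 0) := by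
      have := t1.const_mul (18 * B * (c⁻¹ ^ 2 * (s * Cb)⁻¹ ^ 2))
      rw [mul_zero] at this
      exact this
    filter_upwards [eventually_le_of_tendsto_zero t2 one_pos, hp, eventually_ge_atTop 1,
      h7.k_tendsto.eventually_gt_atTop 0, eventually_le_of_tendsto_zero (tendsto_mul_exp_neg_rpow hm0) hε]
      with n hn hpn hn1 hkn hexp
    have hn0 : (0 : ℝ) < n := by exact_mod_cast hn1
    refine le_trans ?_ hexp
    have hnn : (0 : ℝ) ≤ n := hn0.le
    refine mul_le_mul hpn (mul_le_mul_of_nonneg_left (Real.exp_le_exp.2 ?_) (by norm_num))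
      (by positivity) hnn
    rw [neg_div, neg_le_neg_iff, le_div_iff₀ (by positivity), hb n hn1]
    set x : ℝ := (n : ℝ)
    -- Of the exponent 4/m, the share 3/m pays for the squared bound on the residuals. The remaining
    -- 1/m makes the Gaussian exponent at least n^(1/m), which beats the union over p ≤ n
    -- coordinates.
    have e1 : x ^ (2 * η - 2 * νb - 4 / m)
        = (x ^ η) ^ 2 * (x ^ (-νb)) ^ 2 / ((x ^ (3 / (2 * m))) ^ 2 * x ^ (1 / m)) := by
      rw [← Real.rpow_mul_natCast hnn, ← Real.rpow_mul_natCast hnn, ← Real.rpow_mul_natCast hnn,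
        ← Real.rpow_add hn0, ← Real.rpow_add hn0, ← Real.rpow_sub hn0]
      congr 1
      push_cast
      field_simp
      ring
    rw [e1] at hn
    have p1 : 0 < x ^ η := by positivity
    have p2 : 0 < x ^ (-νb) := by positivity
    have p3 : 0 < x ^ (3 / (2 * m)) := by positivity
    have p4 : 0 < x ^ (1 / m) := by positivity
    have e2 : 18 * B * (c⁻¹ ^ 2 * (s * Cb)⁻¹ ^ 2)
        * (k n / ((x ^ η) ^ 2 * (x ^ (-νb)) ^ 2 / ((x ^ (3 / (2 * m))) ^ 2 * x ^ (1 / m))))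
        = (18 * B * k n * (x ^ (3 / (2 * m))) ^ 2 * x ^ (1 / m))
          / ((c * x ^ η) ^ 2 * (s * (Cb * x ^ (-νb))) ^ 2) := by
      field_simp
    rw [e2, div_le_one (by positivity)] at hn
    have e3 : x ^ (1 / m) * (2 * (B * k n * (9 / (c * x ^ η) ^ 2 * (2 * (x ^ (3 / (2 * m)) / 2)) ^ 2)))
        = (18 * B * k n * (x ^ (3 / (2 * m))) ^ 2 * x ^ (1 / m)) / (c * x ^ η) ^ 2 := by
      field_simp
      ring
    rw [e3, div_le_iff₀ (by positivity)]
    linarith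
  have c9 : ∀ᶠ n : ℕ in atTop, b * (S n).cStar ≤ ε :=
    eventually_le_of_tendsto_zero ((hcS.const_mul b).tendsto_zero (by norm_num)) hε
  -- The exponent −1/4 + (η/2 − 3/(2m))/2 is negative since η ≤ 1/2. The logarithmic factor of the
  -- assumption is not required.
  have c10 : ∀ᶠ n : ℕ in atTop, (S n).cStar * √(B * k n) ≤ ε := by
    have hk' : PowO (η / 2 - 3 / (2 * m)) fun n => |B * k n| :=
      (hk.const_mul B).of_abs_le (Eventually.of_forall fun n => (abs_abs _).le)
    have := (hcS.mul (hk'.sqrt fun n => abs_nonneg _)).tendsto_zero (by rw [h3m2]; linarith)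
    filter_upwards [eventually_le_of_tendsto_zero this hε, h7.k_tendsto.eventually_gt_atTop 0] with n hn hkn
    rwa [abs_of_pos (by positivity)] at hn
  -- Bandwidth times residual error has exponent (η/2 − 3/(2m)) + (1/m − η)/2 = −1/m.
  have c11 := eventually_le_of_tendsto_zero ((((hk.const_mul B).mul ((hδ'.const_mul (8 * R)).add
    ((hδ'.pow 2).mono (by push_cast; linarith))))).tendsto_zero (by rw [h3m2]; linarith)) hε
  filter_upwards [c1, c2, c3, c4, c5, c6, c7, c8, c9, c10, c11]
    with n a1 a2 a3 a4 a5 a6 a7 a8 a9 a10 a11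
  rintro L rfl M rfl
  exact ⟨a1, a2, a3, a4, a5, a6, a7, a8, a9, a10, a11⟩

end Rates

end RidgeBootstrap

namespace RidgeBootstrap

set_option linter.unusedSectionVars false

/-! ### Assembly of the estimates -/

lemma Setting.H_regular {n : ℕ} {S : Setting n} {D : ℕ} [NeZero D] {f : Fin D → S.Mset}
    (hf : Function.Surjective f) (hn : 1 ≤ n) {V : Matrix (Fin n) (Fin n) ℝ} (hV : V.PosSemidef)
    {c : ℝ} (hc : 0 < c) (hcV : ∀ a, c ≤ (loadMat f * V * (loadMat f)ᵀ) a a) :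
    Continuous (S.H V) ∧ Monotone (S.H V) ∧ (∀ x, x < 0 → S.H V x = 0) ∧
      Tendsto (S.H V) atTop (𝓝 1) := by
  have hVl : (loadMat f * V * (loadMat f)ᵀ).PosSemidef := by
    simpa using hV.mul_mul_conjTranspose_same (loadMat f)
  have hH : S.H V = fun x => (multivariateGaussian 0 (loadMat f * V * (loadMat f)ᵀ)).real (cube D x) :=
    funext fun x => S.H_eq hf hn hV x
  have hmono : Monotone (S.H V) := by
    rw [hH]
    exact fun x y hxy => measureReal_mono (cube_mono hxy)
  refine ⟨?_, hmono, fun x hx => ?_, ?_⟩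
  · refine (LipschitzWith.of_le_add_mul (Real.toNNReal (2 * D / √c)) fun x y => ?_).continuous
    rw [Real.coe_toNNReal _ (by positivity)]
    have h1 : S.H V x ≤ S.H V (y + dist x y) := hmono (by
      rw [Real.dist_eq]; linarith [le_abs_self (x - y)])
    refine h1.trans ?_
    rw [hH]
    exact real_cube_add_le hVl hc hcV y _ dist_nonneg
  · rw [hH]
    simp only [cube_neg hx, measureReal_empty]
  · rw [hH]
    exact tendsto_real_cube _

section Main

variable {S : ∀ n, Setting n} {Ω : ℕ → Type*} [∀ n, MeasurableSpace (Ω n)] {P : ∀ n, Measure (Ω n)}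
  [∀ n, IsProbabilityMeasure (P n)] {E : ∀ n, ErrorProcess n (P n)} {K : ℝ → ℝ} {k : ℕ → ℝ}
  {η m αε αβ δ νb : ℝ}

lemma le_variance_loadMat {n : ℕ} {S : Setting n} {L : ℝ} (hS : S.Regular L) {D : ℕ}
    (f : Fin D → S.Mset) {V : Matrix (Fin n) (Fin n) ℝ} (hV : V.IsHermitian) {cvar : ℝ} (hvar : 0 ≤ cvar)
    (hspec : ∀ μ ∈ spectrum ℝ V, cvar < μ) {cM C : ℝ} (hcM : 0 < cM) (hC : 0 < C)
    (hM : ∀ i ∈ S.Mset, cM ≤ ∑ k ∈ S.N, S.M i k ^ 2) (hlam : ∀ j, S.lam j ≤ C * √n) (a : Fin D) :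
    cvar * ((cM / (16 * C ^ 2)) / (1 + cM / (16 * C ^ 2)))
      ≤ (Setting.loadMat f * V * (Setting.loadMat f)ᵀ) a a := by
  rw [mul_mul_transpose_apply]
  refine le_trans (mul_le_mul_of_nonneg_left ?_ hvar) (le_quadratic_of_spectrum hV hspec _)
  exact hS.le_sum_load_sq hcM hC (hM _ (f a).2) hlam

/-- The margin t = (1 − cb)b/8 gives b − 2t ≥ cb·b, and b + 4t = b + (1 − cb)b/2 stays below b/cb.
-/
lemma separated_of_separation {n : ℕ} {S : Setting n} {L cb : ℝ} (hS : S.Regular L) (hb : 0 < S.b)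
    (h0 : 0 < cb) (h1 : cb < 1) (hout : ∀ i ∉ S.N, |S.β i| ≤ cb * S.b)
    (hin : ∀ i ∈ S.N, S.b / cb ≤ |S.β i|)
    (hbias : 2 * S.ρ ^ 2 / L ^ 4 * (2 * √(∑ k, S.β k ^ 2) + 1) ≤ (1 - cb) / 8 * S.b) :
    S.Separated L ((1 - cb) / 8 * S.b) where
  toRegular := hS
  t_nonneg := by have : 0 < 1 - cb := by linarith
                 positivity
  out k hk := (hout k hk).trans (by nlinarith)
  inn k hk := by
    refine lt_of_lt_of_le ?_ (hin k hk)
    rw [lt_div_iff₀ h0]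
    nlinarith [mul_pos hb (show 0 < 1 - cb by linarith), mul_pos (mul_pos hb h0) (show 0 < 1 - cb by linarith)]
  bias_le := hbias

set_option maxHeartbeats 1000000 in
/-- Sample and bootstrap statistics have the same Gaussian approximation. -/
lemma eventually_gaussian_approximation (h1 : Assumption1 S η) (h2 : Assumption2 E η m αε)
    (h3 : Assumption3 S η m αβ) (h4 : Assumption4 S η m αβ δ νb) (h5 : Assumption5 S η m)
    (h6 : Assumption6 S αε) (h7 : Assumption7 K k η m νb) {ε₀ : ℝ} (hε₀ : 0 < ε₀) :
    ∀ᶠ n in atTop, (Continuous ((S n).H (E n).cov) ∧ Monotone ((S n).H (E n).cov) ∧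
        (∀ x, x < 0 → (S n).H (E n).cov x = 0) ∧ Tendsto ((S n).H (E n).cov) atTop (𝓝 1)) ∧
      (∀ x, |(P n).real {ω | (S n).maxStat ((E n).y (S n) ω) (S n).γ ≤ x} - (S n).H (E n).cov x|
        ≤ 3 * ε₀) ∧
      ∃ bad : Set (Ω n), (P n).real bad ≤ 4 * ε₀ ∧ ∀ ω ∉ bad, ∀ x,
        |(multivariateGaussian 0 (kernelMatrix n K (k n))).real
          {w | (S n).bootStat ((E n).y (S n) ω) w ≤ x} - (S n).H (E n).cov x| ≤ 3 * ε₀ := by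
  have hη := h1.η_pos
  have hm6 : 6 < m := by
    have e1 : 6 ≤ 3 / η := by rw [le_div_iff₀ hη]; linarith [h1.η_le]
    linarith [h2.m_gt]
  -- The even integer 2r is the largest one not exceeding m. As m > 3/η ≥ 6, it is at least 4, as
  -- quadratic forms require.
  set r := ⌊m / 2⌋₊ with hrdef
  have hr2 : 2 ≤ r := Nat.le_floor (by push_cast; linarith)
  have hrm : ((2 * r : ℕ) : ℝ) ≤ m := by
    have := Nat.floor_le (show 0 ≤ m / 2 by linarith)
    push_cast
    linarith
  have hr : m / 2 - 1 < r := by linarith [Nat.lt_floor_add_one (m / 2)]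
  obtain ⟨R, W, T, hR, hW, hT, hT0, hNB⟩ := h2.exists_noiseBounds hr2 hrm
  obtain ⟨Cl, hCl, hlamU⟩ := h1.lam_upper
  obtain ⟨c, hc, hlamL⟩ := h1.lam_lower
  obtain ⟨Cx, hX⟩ := h1.X_bound
  obtain ⟨D₀, hD₀⟩ := h1.p₁_bound
  obtain ⟨cvar, hvar, hspec⟩ := h2.cov_lower
  obtain ⟨Cb, hCb, hb⟩ := h4.b_eq
  obtain ⟨cb, hcb0, hcb1, hsep⟩ := h4.separation
  obtain ⟨cM, CM, hcM, -, hrow⟩ := h5.row_bounds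
  -- A dimension that serves every sample size. Adding one makes it positive.
  set D := D₀ + 1 with hD
  have hDpos : (0 : ℝ) < D := by positivity
  set c₀ := cvar * ((cM / (16 * Cl ^ 2)) / (1 + cM / (16 * Cl ^ 2))) with hc₀
  have hc₀pos : 0 < c₀ := by positivity
  obtain ⟨κ₁, hκ₁, τ₁, hclose₁⟩ := exists_forall_abs_real_cube_sub_le_of_charFun (D := D)
    (B := 16 * R ^ 2) hc₀pos hε₀
  obtain ⟨κ₂, hκ₂, hclose₂⟩ := exists_forall_abs_real_cube_sub_le (D := D)
    (B := 16 * R ^ 2) hc₀pos hε₀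
  set τ := max τ₁ 0 with hτ
  -- The covariance error passes through Markov's inequality at level κ₂ and a union over D²
  -- entries. θ is a quarter of what each entry may cost in mean, for fluctuation, kernel weights,
  -- distant covariances and residual error.
  set θ := ε₀ * κ₂ / (4 * D ^ 2) with hθ
  have hθpos : 0 < θ := by positivity
  set B := 1 + 2 * ∫ t, K t with hBdef
  have hB : 0 < B := by
    have := integral_nonneg (μ := volume) (f := K) h7.nonneg
    positivity
  obtain ⟨q, hq⟩ : ∃ q, 2 * R * T q ≤ θ := by
    have := hT.const_mul (2 * R)
    rw [mul_zero] at this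
    exact (eventually_le_of_tendsto_zero this hθpos).exists
  set κ' := θ / (R ^ 2 + 1) with hκ'
  have hκ'pos : 0 < κ' := by positivity
  set s := (1 - cb) / 8 with hs
  have hspos : 0 < s := by rw [hs]; linarith
  -- A single tolerance for all rates: it bounds probabilities by ε₀, keeps the Lipschitz shift of H
  -- below ε₀, the characteristic function error below κ₁, and fluctuation plus residual error below
  -- θ.
  set ε₁ := min (min ε₀ (ε₀ * √c₀ / (2 * D))) (min κ₁ (θ / (128 * R ^ 2 + 1))) with hε₁
  have hε₁pos : 0 < ε₁ := by
    have : 0 < √c₀ := Real.sqrt_pos.2 hc₀pos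
    positivity
  have hε₁a : ε₁ ≤ ε₀ := (min_le_left _ _).trans (min_le_left _ _)
  have hε₁b : 2 * D / √c₀ * ε₁ ≤ ε₀ := by
    have e0 : 0 < √c₀ := Real.sqrt_pos.2 hc₀pos
    have e1 : ε₁ ≤ ε₀ * √c₀ / (2 * D) := (min_le_left _ _).trans (min_le_right _ _)
    calc 2 * D / √c₀ * ε₁ ≤ 2 * D / √c₀ * (ε₀ * √c₀ / (2 * D)) := by gcongr
      _ = ε₀ := by field_simp
  have hε₁c : ε₁ ≤ κ₁ := (min_le_right _ _).trans (min_le_left _ _)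
  have hε₁d : (128 * R ^ 2 + 1) * ε₁ ≤ θ := by
    have e1 : ε₁ ≤ θ / (128 * R ^ 2 + 1) := (min_le_right _ _).trans (min_le_right _ _)
    rw [le_div_iff₀ (by positivity)] at e1
    linarith
  filter_upwards [eventually_rates h1 h2.m_gt h3 h4 h5 h6 h7 hr hc (C := max Cx 0)
    R B hB hspos hε₁pos
    (2 * (D * τ * (32 * R * W * (D * τ) + R ^ 3 * (D * τ) ^ 2))), eventually_ge_atTop 1,
    h7.k_tendsto.eventually_ge_atTop 1, h7.eventually_abs_sub_one_le q hκ'pos]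
    with n hrates hn hkn hKn
  set L := c * (n : ℝ) ^ η with hL
  set M := (n : ℝ) ^ (3 / (2 * m)) / 2 with hM
  have hn0 : (0 : ℝ) < n := by exact_mod_cast hn
  obtain ⟨a1, a2, a3, a4, a5, a6, a7, a8, a9, a10, a11⟩ := hrates L rfl M rfl
  have hreg : (S n).Regular L := ⟨hn, by positivity, fun j => hlamL n hn j, a1⟩
  have hbpos : 0 < (S n).b := by
    rw [hb n hn]
    positivity
  have hSep := separated_of_separation hreg hbpos hcb0 hcb1 (hsep n hn).1 (hsep n hn).2 a2
  obtain ⟨f, hf⟩ := (S n).exists_surjective_Mset (h5.Mset_nonempty n hn)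
    (show (S n).p₁ ≤ D from (hD₀ n hn).trans (Nat.le_succ _))
  have hcV := le_variance_loadMat hreg f (E n).isHermitian_cov hvar.le (hspec n hn) hcM hCl
    (fun i hi => (hrow n hn i hi).1)
    (fun j => by rw [Real.sqrt_eq_rpow]; exact hlamU n hn j)
  have htpos : 0 < s * (S n).b := by positivity
  have hNBn := hNB n hn
  have hps := hNBn.posSemidef_cov (by lia)
  have hCS := hreg.cStar_nonneg f
  have hbiasnn : 0 ≤ 2 * (S n).ρ ^ 2 / L ^ 3 * (2 * √(∑ k, (S n).β k ^ 2) + 1) := by positivity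
  have hweak : 0 ≤ (⨆ i, |∑ j ∈ (S n).Nᶜ, (S n).M i j * (S n).β j|) * √n :=
    mul_nonneg (Real.iSup_nonneg fun _ => abs_nonneg _) (Real.sqrt_nonneg _)
  refine ⟨Setting.H_regular hf hn hps hc₀pos hcV, ?_, ?_⟩
  · refine hSep.abs_maxStat_cdf_sub_H_le htpos hNBn (by lia) hR hW hf (le_max_right τ₁ 0) hc₀pos
      (fun ν V h h' h'' h''' hch => hclose₁ ν V h h' h'' h''' fun t ht =>
        hch t fun i => (ht i).trans (le_max_left _ _)) hcV ?_ a3 (a4.trans hε₁a) hε₁b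
    refine le_trans (le_of_eq ?_) (a9.trans hε₁c)
    ring
  · have hX' : ∀ i j, |(S n).X i j| ≤ max Cx 0 := fun i j => (hX n hn i j).trans (le_max_left _ _)
    refine hSep.exists_abs_bootStat_cdf_sub_H_le htpos ?_ hNBn hr2 hR hf hc₀pos hκ₂ hclose₂ hcV
      (h₀ := ε₁) (by linarith) (a4.trans hε₁a) hε₁b (h7.posSemidef n (k n)) (fun i j => h7.nonneg _)
      (fun i j => h7.le_one _) (B := B * k n) (by positivity) (fun i => h7.sum_kernel_le hkn i)
      (q := q) hκ'pos.le (fun i j hij => ?_) (M := M) (by positivity) (le_max_right Cx 0) hX'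
      (a5.trans hε₁a) a6 (a7.trans hε₁a) (a8.trans hε₁a) ?_
    · linarith [mul_pos hcb0 hbpos]
    · have := (abs_le.1 (hKn i j hij)).1
      simp only [kernelMatrix, Matrix.of_apply]
      linarith
    · have e1 : 128 * R ^ 2 * ((S n).cStar * √(B * k n)) ≤ 128 * R ^ 2 * ε₁ := by gcongr
      have e2 : κ' * R ^ 2 ≤ θ := by
        rw [hκ', div_mul_eq_mul_div, div_le_iff₀ (by positivity)]
        exact mul_le_mul_of_nonneg_left (by linarith only) hθpos.le
      have e3 : 0 ≤ 128 * R ^ 2 * ε₁ := by positivity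
      rw [← mul_assoc, ← mul_div_assoc, div_le_iff₀ hκ₂]
      have e4 : ε₀ * κ₂ = D * D * (4 * θ) := by rw [hθ]; field_simp
      rw [e4]
      refine mul_le_mul_of_nonneg_left ?_ (by positivity)
      linarith only [e1, e2, hq, a11, hε₁d, e3, hε₁pos]

/-- The bootstrap distribution function inherits the Gaussian approximation. -/
lemma eventually_bootCDF_approximation {W : ∀ n, Ω n → EuclideanSpace ℝ (Fin n)}
    (hW : ∀ n, HasLaw (W n) (multivariateGaussian 0 (kernelMatrix n K (k n))) (P n))
    (hWy : ∀ n, IndepFun (W n) ((E n).y (S n)) (P n))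
    (h1 : Assumption1 S η) (h2 : Assumption2 E η m αε)
    (h3 : Assumption3 S η m αβ) (h4 : Assumption4 S η m αβ δ νb) (h5 : Assumption5 S η m)
    (h6 : Assumption6 S αε) (h7 : Assumption7 K k η m νb) {r : ℝ} (hr : 0 < r) :
    ∀ᶠ n in atTop, (Continuous ((S n).H (E n).cov) ∧ Monotone ((S n).H (E n).cov) ∧
        (∀ x, x < 0 → (S n).H (E n).cov x = 0) ∧ Tendsto ((S n).H (E n).cov) atTop (𝓝 1)) ∧
      (∀ x, |(P n).real {ω | (S n).maxStat ((E n).y (S n) ω) (S n).γ ≤ x} - (S n).H (E n).cov x|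
        ≤ r) ∧
      ∃ bad : Set (Ω n), (P n).real bad ≤ r ∧ ∀ ω ∉ bad, ∀ x,
        |bootCDF (P n) (S n) ((E n).y (S n)) (W n) ω x - (S n).H (E n).cov x| ≤ r := by
  filter_upwards [eventually_gaussian_approximation h1 h2 h3 h4 h5 h6 h7
    (show 0 < r / 4 by positivity)] with n hn
  obtain ⟨hH, hT, bad, hbad, hF⟩ := hn
  refine ⟨hH, fun x => (hT x).trans (by linarith), ?_⟩
  have hae := ae_bootCDF_eq (S := S n) ((E n).measurable_y (S n)) (hW n) (hWy n)
  -- The conditional distribution is determined only almost surely, so its exceptional null set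
  -- joins the bad event.
  set null : Set (Ω n) := {ω | ¬∀ x, bootCDF (P n) (S n) ((E n).y (S n)) (W n) ω x
    = (multivariateGaussian 0 (kernelMatrix n K (k n))).real
      {w | (S n).bootStat ((E n).y (S n) ω) w ≤ x}} with hnull
  have hnull0 : (P n).real null = 0 := by
    rw [Measure.real, show P n null = 0 from hae, ENNReal.toReal_zero]
  refine ⟨bad ∪ null, ?_, fun ω hω x => ?_⟩
  · have := measureReal_union_le (μ := P n) bad null
    linarith
  · rw [Set.mem_union, not_or] at hω
    have e : ∀ x, bootCDF (P n) (S n) ((E n).y (S n)) (W n) ω x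
        = (multivariateGaussian 0 (kernelMatrix n K (k n))).real
          {w | (S n).bootStat ((E n).y (S n) ω) w ≤ x} := not_not.1 hω.2
    rw [e x]
    exact (hF ω hω.1 x).trans (by linarith)

end Main

end RidgeBootstrap

open RidgeBootstrap in
theorem theorem3 {Ω : ℕ → Type*} [∀ n, MeasurableSpace (Ω n)]
    (P : ∀ n, Measure (Ω n)) [∀ n, IsProbabilityMeasure (P n)]
    (S : ∀ n, Setting n) (E : ∀ n, ErrorProcess n (P n))
    (K : ℝ → ℝ) (k : ℕ → ℝ)
    (W : ∀ n, Ω n → EuclideanSpace ℝ (Fin n))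
    (hW : ∀ n, HasLaw (W n) (multivariateGaussian 0 (kernelMatrix n K (k n))) (P n))
    (hWy : ∀ n, IndepFun (W n) ((E n).y (S n)) (P n))
    (η m αε αβ δ νb : ℝ)
    (h1 : Assumption1 S η) (h2 : Assumption2 E η m αε) (h3 : Assumption3 S η m αβ)
    (h4 : Assumption4 S η m αβ δ νb) (h5 : Assumption5 S η m) (h6 : Assumption6 S αε)
    (h7 : Assumption7 K k η m νb) :
    (∀ r > 0, Tendsto (fun n => (P n).real {ω | r ≤
        ⨆ x : ℝ, |bootCDF (P n) (S n) ((E n).y (S n)) (W n) ω x - (S n).H (E n).cov x|})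
      atTop (𝓝 0)) ∧
    ∀ α : ℝ, 0 < α → α < 1 →
      Tendsto (fun n => (P n).real {ω | (S n).maxStat ((E n).y (S n) ω) (S n).γ ≤
          bootQuantile (P n) (S n) ((E n).y (S n)) (W n) α ω}) atTop (𝓝 (1 - α)) ∧
      ∀ z : ∀ n, Fin (S n).p₁ → ℝ, (∀ n ≥ 1, (S n).M *ᵥ (S n).β = z n) →
        Tendsto (fun n => (P n).real {ω |
          bootQuantile (P n) (S n) ((E n).y (S n)) (W n) α ω <
            (S n).maxStat ((E n).y (S n) ω) (z n)}) atTop (𝓝 α) := by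
  have key := fun {r : ℝ} (hr : 0 < r) =>
    eventually_bootCDF_approximation hW hWy h1 h2 h3 h4 h5 h6 h7 hr
  refine ⟨fun r hr => ?_, fun α hα0 hα1 => ?_⟩
  · rw [Metric.tendsto_atTop']
    intro θ hθ
    obtain ⟨N, hN⟩ := eventually_atTop.1 (key (show 0 < min (r / 2) (θ / 2) by positivity))
    refine ⟨N, fun n hn => ?_⟩
    obtain ⟨-, -, bad, hbad, hF⟩ := hN n hn.le
    rw [Real.dist_0_eq_abs, abs_of_nonneg measureReal_nonneg]
    refine lt_of_le_of_lt (measureReal_mono (s₂ := bad) fun ω hω => ?_)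
      (lt_of_le_of_lt (hbad.trans (min_le_right _ _)) (by linarith))
    by_contra hcon
    have e1 : ⨆ x : ℝ, |bootCDF (P n) (S n) ((E n).y (S n)) (W n) ω x - (S n).H (E n).cov x|
        ≤ r / 2 := ciSup_le fun x => (hF ω hcon x).trans (min_le_left _ _)
    have e2 : r ≤ ⨆ x : ℝ, |bootCDF (P n) (S n) ((E n).y (S n)) (W n) ω x - (S n).H (E n).cov x| := hω
    linarith
  · have hcov : ∀ θ : ℝ, 0 < θ → ∀ᶠ n in atTop,
        |(P n).real {ω | (S n).maxStat ((E n).y (S n) ω) (S n).γ ≤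
          bootQuantile (P n) (S n) ((E n).y (S n)) (W n) α ω} - (1 - α)| < θ ∧
        |(P n).real {ω | bootQuantile (P n) (S n) ((E n).y (S n)) (W n) α ω <
          (S n).maxStat ((E n).y (S n) ω) (S n).γ} - α| < θ := by
      intro θ hθ
      -- The coverage error is at most 4r ≤ θ/2, and the other two bounds keep the shifted levels 1
      -- − α − 2r and 1 − α + r inside (0, 1).
      set r := min (θ / 8) (min (α / 2) ((1 - α) / 4)) with hr
      have hα1' : 0 < 1 - α := by linarith
      have hr0 : 0 < r := by positivity
      have hr1 : r ≤ θ / 8 := min_le_left _ _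
      have hr2 : r ≤ α / 2 := (min_le_right _ _).trans (min_le_left _ _)
      have hr3 : r ≤ (1 - α) / 4 := (min_le_right _ _).trans (min_le_right _ _)
      filter_upwards [key hr0] with n hn
      obtain ⟨⟨hGc, hGm, hGneg, hGtop⟩, hT, bad, hbad, hF⟩ := hn
      have hm : Measurable fun ω => (S n).maxStat ((E n).y (S n) ω) (S n).γ :=
        Measurable.comp (g := fun q : (Fin n → ℝ) × (Fin (S n).p₁ → ℝ) => (S n).maxStat q.1 q.2)
          (f := fun ω => ((E n).y (S n) ω, (S n).γ)) (S n).measurable_maxStat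
          (((E n).measurable_y (S n)).prodMk measurable_const)
      obtain ⟨e1, e2⟩ := abs_coverage_sub_le (α := α)
        (F := fun ω x => bootCDF (P n) (S n) ((E n).y (S n)) (W n) ω x) hm hGc hGm hGneg hGtop
        hr0 (by linarith) (by linarith) hbad hF hT
      exact ⟨lt_of_le_of_lt e1 (by linarith), lt_of_le_of_lt e2 (by linarith)⟩
    refine ⟨Metric.tendsto_nhds.2 fun θ hθ => (hcov θ hθ).mono fun n hn => ?_, fun z hz =>
      Metric.tendsto_nhds.2 fun θ hθ => ?_⟩
    · rw [Real.dist_eq]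
      exact hn.1
    · filter_upwards [hcov θ hθ, eventually_ge_atTop 1] with n hn hn1
      rw [Real.dist_eq, ← hz n hn1]
      exact hn.2
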